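/- **Setting.** Let $d\ge 1$, let $\mathcal V=B(0,V_0)\subset\mathbb R^d$ be the centered open ball with $|\mathcal V|=1$, let $\chi\in(0,1)$ and $K(x,v)=1+\chi\,\mathrm{sign}(x\cdot v)$. Fix a radially symmetric $\phi\in C_c^\infty(\mathbb R^d)$ with $\mathbf 1_{B(0,1)}\le\phi\le\mathbf 1_{B(0,2)}$, put $\phi_r(x)=\phi(x/r)$ (and $\phi_r(s)=\phi_r(x)$ with $|x|=|s|$ for scalars $s$), and for $\delta\in(0,1)$ fix an odd nondecreasing $\zeta_\delta\in C^\infty(\mathbb R)$ with $\zeta_\delta(s)=1$ for $s\ge\delta$. For $R>1$ and $\delta_1,\delta_2,\delta_3\in(0,1)$ define $$K_{R,\delta_i}(x,v)=\bigl(\phi_R(x)-\phi_{\delta_2}(x)\bigr)\bigl(1-\phi_{\delta_1}(V_0-|v|)-\phi_{\delta_1}(v)\bigr)\bigl(1+\chi\,\zeta_{\delta_3}(x\cdot v)\bigr),$$ $$\mathcal A f(x,v)=\int_{\mathcal V}K_{R,\delta_i}(x,v')f(x,v')\,dv',\qquad \mathcal B f=-v\cdot\nabla_xf-Kf+\int_{\mathcal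 V}\bigl(K-K_{R,\delta_i}\bigr)(x,v')f(x,v')\,dv',$$ $$\mathcal B_1 f=-v\cdot\nabla_xf-Kf+(1-\phi_R(x))\int_{\mathcal V}K(x,v')f(x,v')\,dv'.$$ For $\gamma>0$ let $m(x)=e^{\gamma\langle x\rangle}$, $\langle x\rangle=(1+|x|^2)^{1/2}$, $\|f\|_{L^p(m)}=\|mf\|_{L^p(\mathbb R^d\times\mathcal V)}$, and let $X=L^1(m)\cap L^2(m)$ with $\|f\|_X^2=\|f\|_{L^1(m)}^2+\|f\|_{L^2(m)}^2$. For $\mathcal G\in\{\mathcal B,\mathcal B_1\}$, $S_{\mathcal G}(t)f$ denotes the weak (distributional) solution $u$ of $\partial_tu=\mathcal G u$, $u(0)=f$, with $u\in C([0,\infty);L^1_{loc})$ and $u$ bounded on every $[0,T]$ with values in $X$ (for $\mathcal B$), respectively in $L^1(m)$ (for $\mathcal B_1$). Let $$Y=\{g\in L^2(\mathbb R^d\times\mathcal V):\ \mathrm{supp}\,g\subset \overline{B(0,2R)}\times\mathcal V,\ g\in H^{1/2}(\mathbb R^d\times\mathcal V)\},$$ with the Sobolev–Slobodeckij norm $$\|g\|_Y^2=\|g\|_{L^2}^2+\iint\frac{|g(z)-g(z')|^2}{|z-z'|^{2d+1}}\,dz\,dz'.$$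 **Proposition.** There is $\gamma^*>0$ such that for every $\gamma\in(0,\gamma^*)$ there are $a^*<0$, $C\ge1$ and $R_0>1$ with the following properties for every $R\ge R_0$. 1. $S_{\mathcal B_1}$ is well defined on $L^1(m)$ (each initial datum has exactly one solution) and $\|S_{\mathcal B_1}(t)f\|_{L^1(m)}\le C e^{a^*t}\|f\|_{L^1(m)}$ for all $t\ge0$, $f\in L^1(m)$. 2. For the same $a^*$: for all sufficiently small $\delta_1\in(0,1)$, then all sufficiently small $\delta_2\in(0,1)$ (depending on $\delta_1$), then all sufficiently small $\delta_3\in(0,1)$ (depending on $\delta_1,\delta_2$), $S_{\mathcal B}$ is well defined on $X$ (each initial datum has exactly one solution), and for every $a>a^*$ there is $C_a\in(0,\infty)$ such that $$\int_0^\infty\|\mathcal A S_{\mathcal B}(t)f\|_Y^2\,e^{-2at}\,dt\le C_a\,\|f\|_X^2\qquad\forall f\in X;$$ in particular $\mathcal A S_{\mathcal B}(t)f\in Y$ for almost every $t>0$. -/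

import Mathlib

open MeasureTheory Set Filter Topology
open scoped ENNReal NNReal ContDiff

noncomputable section

namespace RunTumble

/-- The Euclidean space `ℝ^d`, used both for positions and for velocities. -/
abbrev E (d : ℕ) : Type := EuclideanSpace ℝ (Fin d)

/-- The velocity set `𝒱 = B(0, V₀)`. -/
def velocitySet (d : ℕ) (V₀ : ℝ) : Set (E d) := Metric.ball 0 V₀

/-- Lebesgue measure on `ℝ^d × 𝒱`, seen as a measure on `ℝ^d × ℝ^d` carried by `ℝ^d × 𝒱`.
Functions on `ℝ^d × 𝒱` are functions on `ℝ^d × ℝ^d`, considered up to this measure. -/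
def phaseMeasure (d : ℕ) (V₀ : ℝ) : Measure (E d × E d) :=
  (volume : Measure (E d)).prod (volume.restrict (velocitySet d V₀))

/-! ### Weights and function spaces -/

/-- `⟨x⟩ = (1 + |x|²)^{1/2}`. -/
def bracket {d : ℕ} (x : E d) : ℝ := Real.sqrt (1 + ‖x‖ ^ 2)

/-- The exponential weight `m(x) = exp (γ ⟨x⟩)`. -/
def weight {d : ℕ} (γ : ℝ) (x : E d) : ℝ := Real.exp (γ * bracket x)

/-- The (extended) norm `‖f‖_{L^p(m)} = ‖m f‖_{L^p}`. -/
def eNormLpWeight {d : ℕ} (V₀ γ : ℝ) (p : ℝ≥0∞) (f : E d × E d → ℝ) : ℝ≥0∞ :=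
  eLpNorm (fun z => weight γ z.1 * f z) p (phaseMeasure d V₀)

/-- The (extended) norm of `L¹(m)`. -/
def eNormL1 {d : ℕ} (V₀ γ : ℝ) (f : E d × E d → ℝ) : ℝ≥0∞ := eNormLpWeight V₀ γ 1 f

/-- The square of the (extended) norm of `X = L¹(m) ∩ L²(m)`,
`‖f‖_X² = ‖f‖_{L¹(m)}² + ‖f‖_{L²(m)}²`. -/
def eNormXSq {d : ℕ} (V₀ γ : ℝ) (f : E d × E d → ℝ) : ℝ≥0∞ :=
  eNormLpWeight V₀ γ 1 f ^ 2 + eNormLpWeight V₀ γ 2 f ^ 2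

/-- Membership in the space of measurable functions on `ℝ^d × 𝒱` on which the extended norm
(or squared norm) `N` is finite. -/
def Mem {d : ℕ} (V₀ : ℝ) (N : (E d × E d → ℝ) → ℝ≥0∞) (f : E d × E d → ℝ) : Prop :=
  AEStronglyMeasurable f (phaseMeasure d V₀) ∧ N f < ⊤

/-- The square of the Sobolev–Slobodeckij norm of `H^{1/2}(ℝ^d × 𝒱)`:
`‖g‖_{L²}² + ∬ |g(z) - g(z')|² / |z - z'|^{2d + 1} dz dz'`, where `z, z'` range over the
`2d`-dimensional set `ℝ^d × 𝒱` and `|z - z'|` is the Euclidean distance. -/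
def eNormHHalfSq {d : ℕ} (V₀ : ℝ) (g : E d × E d → ℝ) : ℝ≥0∞ :=
  eLpNorm g 2 (phaseMeasure d V₀) ^ 2 +
    ∫⁻ z, ∫⁻ z', ENNReal.ofReal ((g z - g z') ^ 2) /
        ENNReal.ofReal (Real.sqrt (‖z.1 - z'.1‖ ^ 2 + ‖z.2 - z'.2‖ ^ 2) ^ (2 * d + 1))
      ∂(phaseMeasure d V₀) ∂(phaseMeasure d V₀)

open Classical in
/-- The square of the norm of the space `Y` of the functions of `H^{1/2}(ℝ^d × 𝒱)` supported in
`B(0, r) × 𝒱`, extended by `∞` to the functions that do not belong to `Y`. -/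
def eNormYSq {d : ℕ} (V₀ r : ℝ) (g : E d × E d → ℝ) : ℝ≥0∞ :=
  if AEStronglyMeasurable g (phaseMeasure d V₀) ∧
      ∀ᵐ z ∂(phaseMeasure d V₀), z.1 ∉ Metric.ball (0 : E d) r → g z = 0
  then eNormHHalfSq V₀ g else ⊤

/-! ### Kernels -/

/-- The turning kernel `K(x, v) = 1 + χ sign (x · v)`. -/
def turningKernel {d : ℕ} (χ : ℝ) (x v : E d) : ℝ := 1 + χ * Real.sign (inner ℝ x v)

/-- `φ ∈ 𝒟(ℝ^d)` is radially symmetric and `1_{B(0,1)} ≤ φ ≤ 1_{B(0,2)}`. -/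
structure IsCutoff {d : ℕ} (φ : E d → ℝ) : Prop where
  smooth : ContDiff ℝ ∞ φ
  radial : ∀ x y : E d, ‖x‖ = ‖y‖ → φ x = φ y
  lower : ∀ x, (Metric.ball (0 : E d) 1).indicator (fun _ => (1 : ℝ)) x ≤ φ x
  upper : ∀ x, φ x ≤ (Metric.ball (0 : E d) 2).indicator (fun _ => (1 : ℝ)) x

/-- `φ_r(x) = φ(x / r)`. -/
def scaled {d : ℕ} (φ : E d → ℝ) (r : ℝ) (x : E d) : ℝ := φ (r⁻¹ • x)

/-- `φ_r(s)` for a scalar `s`: the value of the radial function `φ_r` at the points of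
norm `|s|`. -/
def scaledRadial {d : ℕ} [NeZero d] (φ : E d → ℝ) (r s : ℝ) : ℝ :=
  scaled φ r (EuclideanSpace.single 0 s)

/-- `ζ_δ`: a smooth, odd, increasing regularization of the sign function, equal to `1` on
`[δ, ∞)`. -/
structure IsRegularizedSign (δ : ℝ) (ζ : ℝ → ℝ) : Prop where
  smooth : ContDiff ℝ ∞ ζ
  odd : ∀ s, ζ (-s) = -ζ s
  mono : Monotone ζ
  eq_one : ∀ s, δ ≤ s → ζ s = 1

/-- `φ_{δ,R}(x) = φ_R(x) - φ_δ(x)`. -/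
def positionTruncation {d : ℕ} (φ : E d → ℝ) (δ R : ℝ) (x : E d) : ℝ :=
  scaled φ R x - scaled φ δ x

/-- `ψ_δ(v) = 1 - φ_δ(V₀ - |v|) - φ_δ(v)`. -/
def velocityTruncation {d : ℕ} [NeZero d] (V₀ : ℝ) (φ : E d → ℝ) (δ : ℝ) (v : E d) : ℝ :=
  1 - scaledRadial φ δ (V₀ - ‖v‖) - scaled φ δ v

/-- The truncated and regularized kernel
`K_{R,δᵢ}(x, v) = φ_{δ₂,R}(x) ψ_{δ₁}(v) (1 + χ ζ_{δ₃}(x · v))`. -/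
def regularKernel {d : ℕ} [NeZero d] (χ V₀ : ℝ) (φ : E d → ℝ) (ζ : ℝ → ℝ → ℝ)
    (R δ₁ δ₂ δ₃ : ℝ) (x v : E d) : ℝ :=
  positionTruncation φ δ₂ R x * velocityTruncation V₀ φ δ₁ v *
    (1 + χ * ζ δ₃ (inner ℝ x v))

/-! ### Operators and semigroups -/

/-- The integral operator `f ↦ ∫_𝒱 k(x, v') f(x, v') dv'`; its values do not depend on `v`. -/
def gain {d : ℕ} (V₀ : ℝ) (k : E d → E d → ℝ) (f : E d × E d → ℝ) (z : E d × E d) : ℝ :=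
  ∫ v' in velocitySet d V₀, k z.1 v' * f (z.1, v')

/-- The operator `𝒜 f = ∫_𝒱 K_{R,δᵢ}(x, v') f(x, v') dv'`. -/
def opA {d : ℕ} [NeZero d] (χ V₀ : ℝ) (φ : E d → ℝ) (ζ : ℝ → ℝ → ℝ) (R δ₁ δ₂ δ₃ : ℝ)
    (f : E d × E d → ℝ) : E d × E d → ℝ :=
  gain V₀ (regularKernel χ V₀ φ ζ R δ₁ δ₂ δ₃) f

/-- The kernel of the gain part of `ℬ₁ f = - v·∇ₓf - K f + (1 - φ_R) ∫_𝒱 K' f' dv'`. -/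
def kernelB1 {d : ℕ} (χ : ℝ) (φ : E d → ℝ) (R : ℝ) (x v : E d) : ℝ :=
  (1 - scaled φ R x) * turningKernel χ x v

/-- The kernel of the gain part of `ℬ = ℒ - 𝒜`, that is of
`ℬ f = - v·∇ₓf - K f + ∫_𝒱 (K' - K'_{R,δᵢ}) f' dv'`. -/
def kernelB {d : ℕ} [NeZero d] (χ V₀ : ℝ) (φ : E d → ℝ) (ζ : ℝ → ℝ → ℝ) (R δ₁ δ₂ δ₃ : ℝ)
    (x v : E d) : ℝ :=
  turningKernel χ x v - regularKernel χ V₀ φ ζ R δ₁ δ₂ δ₃ x v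

/-- Test functions: `φ ∈ C¹_c(ℝ^d × 𝒱)`. -/
structure IsTestFunction {d : ℕ} (V₀ : ℝ) (φ : E d × E d → ℝ) : Prop where
  smooth : ContDiff ℝ 1 φ
  compact : HasCompactSupport φ
  support : tsupport φ ⊆ univ ×ˢ velocitySet d V₀

/-- `u` is a weak (distributional) solution, in the class
`C([0,∞); L¹_loc) ∩ L^∞_loc([0,∞); 𝒳)` with `𝒳` the space of finite extended norm `N`, of
`∂ₜ u = - v·∇ₓ u - K u + ∫_𝒱 k(x, v') u(t, x, v') dv'`, with initial datum `f`.
(The loss term is `∫_𝒱 K u dv' = K u` because `|𝒱| = 1`.)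
In other words `u(t) = S(t) f` for the semigroup `S` on `𝒳` associated with this equation. -/
structure IsTrajectory {d : ℕ} (χ V₀ : ℝ) (k : E d → E d → ℝ) (N : (E d × E d → ℝ) → ℝ≥0∞)
    (f : E d × E d → ℝ) (u : ℝ → E d × E d → ℝ) : Prop where
  measurable : ∀ t, 0 ≤ t → AEStronglyMeasurable (u t) (phaseMeasure d V₀)
  bounded : ∀ T, ∃ M : ℝ≥0, ∀ t ∈ Icc 0 T, N (u t) ≤ M
  continuous : ∀ ρ t : ℝ, 0 ≤ t →
    Tendsto (fun s => ∫⁻ z in Metric.ball 0 ρ ×ˢ univ, ‖u s z - u t z‖ₑ ∂(phaseMeasure d V₀))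
      (𝓝[Ici 0] t) (𝓝 0)
  initial : u 0 =ᵐ[phaseMeasure d V₀] f
  weak : ∀ φ, IsTestFunction V₀ φ → ∀ t, 0 ≤ t →
    ∫ z, u t z * φ z ∂(phaseMeasure d V₀) = ∫ z, f z * φ z ∂(phaseMeasure d V₀) +
      ∫ s in (0 : ℝ)..t,
        ((∫ z, u s z * fderiv ℝ φ z (z.2, 0) ∂(phaseMeasure d V₀)) +
          ∫ z, (- turningKernel χ z.1 z.2 * u s z + gain V₀ k (u s) z) * φ z
            ∂(phaseMeasure d V₀))

/-- The equation `∂ₜ u = - v·∇ₓ u - K u + ∫_𝒱 k(x, v') u(t, x, v') dv'` is well posed in the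
space of finite extended norm `N`: every initial datum has exactly one trajectory, so that
`S(t) f := u(t)` is well defined. -/
def IsWellPosed {d : ℕ} (χ V₀ : ℝ) (k : E d → E d → ℝ) (N : (E d × E d → ℝ) → ℝ≥0∞) : Prop :=
  ∀ f, Mem V₀ N f → ∃ u, IsTrajectory χ V₀ k N f u ∧
    ∀ w, IsTrajectory χ V₀ k N f w → ∀ t, 0 ≤ t → w t =ᵐ[phaseMeasure d V₀] u t

end RunTumble

end

noncomputable section

namespace RunTumble

variable {d : ℕ}

/-! ### Cauchy–Schwarz inequalities for the Lebesgue integral -/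

/-! Both equations are solved by the same Duhamel series along the free transport flow. Every
estimate is made on the majorant series, built with `|k|` and `|f|` and valued in `[0, ∞]`: it needs
no convergence and satisfies an exact Duhamel identity (`majorant_eq`). Volterra bounds in weighted
`L¹` and `L²` make it finite almost everywhere, which turns the signed series into a weak solution
(`mildSol_isTrajectory`). Weak solutions are unique already in `L¹`, by duality with transported
test functions and an iterated Gronwall argument (`IsL1Trajectory.ae_eq`). Hence any trajectory is
the mild solution, and only the majorant has to be estimated.

Decay of `ℬ₁` in `L¹(m)`. With `s = x · v` and `β = χ / 2`, the weight is `ψ = m (1 + γ (s - β √(1 +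
s²)) / ⟨x⟩)`. To first order in `γ`, transport of `m` produces `γ m s / ⟨x⟩`, and the loss term
acting on the correction `s` produces `-K γ m s / ⟨x⟩`; since `K = 1 + χ sign s`, the sum is `-χ γ m
|s| / ⟨x⟩`. This pays for the other correction, because `(1 + χ) β ≤ χ`. In the gain term only the
velocity average of `ψ` matters: there `s` averages to zero and `-β √(1 + s²)` leaves a strictly
negative multiple of `γ m`, uniform for large `|x|`. For `|x| < R` the gain of `ℬ₁` vanishes and the
loss, at least `1 - χ`, suffices. So `v · ∇ψ - K ψ + κ ≤ b ψ` with `b < 0`, where `κ` is exactly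
what the gain of `ℬ₁` needs (`exists_isLyapunov`, `IsLyapunov.lintegral_majorant_le`).

Decay for `ℬ`. Its kernel agrees with that of `ℬ₁` outside a set of small finite measure, so the
gain is absorbed up to `∫ ρ P`, with `P` the majorant and `ρ` small in `L²`. The `L²` norm of `P` is
in turn controlled by its `L¹` norm through dispersion: averaging `h (x + τ v)` over `v` maps `L¹`
to `L^∞` with norm `|τ|^{-d}`, while the sources of a short recent past are absorbed. The loop
closes for `ρ` small (`exists_decay`). The squared norms decay like `e^{bt}`, hence `a* = b / 2`.

Regularity. `𝒜 u` is a velocity average of `u` against `ψ(v) F(x, v)` with `F` smooth. Multiplied by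
`e^{-at}`, the truncated solution is freely transported with a source that is square integrable in
time, with room to spare since `a > a*`. Free transport averages gain half a derivative: after
Fourier transform in `x`, the average is an oscillatory integral whose `L²` norm in time gains `1 /
√|ξ|` (`lintegral_oscIntegral_le`), and Plancherel's identity concludes
(`lintegral_halfSemi_velAvg_le`). Duhamel's formula superposes these gains, and for a function of
`x` alone the seminorm on `ℝ^d × 𝒱` is controlled by the one on `ℝ^d`. -/

theorem lintegral_mul_sq_le {α : Type*} [MeasurableSpace α] {μ : Measure α} {f g : α → ℝ≥0∞}
    (hf : AEMeasurable f μ) (hg : AEMeasurable g μ) :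
    (∫⁻ a, f a * g a ∂μ) ^ 2 ≤ (∫⁻ a, f a ^ 2 ∂μ) * ∫⁻ a, g a ^ 2 ∂μ := by
  have h := ENNReal.lintegral_mul_le_Lp_mul_Lq μ Real.HolderConjugate.two_two hf hg
  have h2 := pow_le_pow_left' h 2
  refine h2.trans_eq ?_
  rw [mul_pow, ← ENNReal.rpow_natCast, ← ENNReal.rpow_natCast, ← ENNReal.rpow_mul,
    ← ENNReal.rpow_mul]
  norm_num

/-- Cauchy–Schwarz for the splitting `w h = √w · (√w h)`. It serves as a convexity inequality for
kernels `w` of finite mass: exponential kernels in time and geometric weights on `ℕ`. -/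
theorem lintegral_weight_mul_sq_le {α : Type*} [MeasurableSpace α] {μ : Measure α}
    {w h : α → ℝ≥0∞} (hw : AEMeasurable w μ) (hh : AEMeasurable h μ) :
    (∫⁻ a, w a * h a ∂μ) ^ 2 ≤ (∫⁻ a, w a ∂μ) * ∫⁻ a, w a * h a ^ 2 ∂μ := by
  have key : ∀ x : ℝ≥0∞, (x ^ (1 / 2 : ℝ)) * (x ^ (1 / 2 : ℝ)) = x := fun x => by
    rw [← ENNReal.rpow_add_of_nonneg _ _ (by norm_num) (by norm_num)]; norm_num
  have h1 := lintegral_mul_sq_le (μ := μ) (hw.pow_const (1 / 2 : ℝ))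
    ((hw.pow_const (1 / 2 : ℝ)).mul hh)
  have key2 : ∀ x y : ℝ≥0∞, (x ^ (1 / 2 : ℝ) * y) * (x ^ (1 / 2 : ℝ) * y) = x * (y * y) :=
    fun x y => by rw [mul_mul_mul_comm, key]
  simpa only [Pi.mul_apply, ← mul_assoc (_ ^ (1 / 2 : ℝ)) (_ ^ (1 / 2 : ℝ)), key, key2, sq] using h1

theorem lintegral_sq_le_measure_mul {α : Type*} [MeasurableSpace α] {μ : Measure α}
    {h : α → ℝ≥0∞} (hh : AEMeasurable h μ) :
    (∫⁻ a, h a ∂μ) ^ 2 ≤ μ univ * ∫⁻ a, h a ^ 2 ∂μ := by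
  simpa using lintegral_weight_mul_sq_le (μ := μ) (w := fun _ => 1) aemeasurable_const hh

/-! ### Free transport -/

/-- The free transport flow `(x, v) ↦ (x + t v, v)`. -/
def shift (t : ℝ) (z : E d × E d) : E d × E d := (z.1 + t • z.2, z.2)

@[simp] theorem shift_fst (t : ℝ) (z : E d × E d) : (shift t z).1 = z.1 + t • z.2 := rfl

@[simp] theorem shift_snd (t : ℝ) (z : E d × E d) : (shift t z).2 = z.2 := rfl

theorem shift_shift (s t : ℝ) (z : E d × E d) : shift s (shift t z) = shift (t + s) z := by
  ext1
  · simp [add_smul, add_assoc]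
  · rfl

@[simp] theorem shift_zero (z : E d × E d) : shift 0 z = z := by
  ext1 <;> simp

theorem measurable_shift_uncurry : Measurable fun p : ℝ × (E d × E d) => shift p.1 p.2 := by
  unfold shift; fun_prop

theorem continuous_shift_uncurry : Continuous fun p : ℝ × (E d × E d) => shift p.1 p.2 := by
  unfold shift; fun_prop

theorem measurable_shift (t : ℝ) : Measurable (shift t : E d × E d → E d × E d) := by
  unfold shift; fun_prop

theorem measurable_comp_shift {α β : Type*} [MeasurableSpace α] [MeasurableSpace β]
    {g : E d × E d → β} (hg : Measurable g) {a : α → ℝ} {b : α → E d × E d}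
    (ha : Measurable a) (hb : Measurable b) : Measurable fun p => g (shift (a p) (b p)) :=
  hg.comp (measurable_shift_uncurry.comp (ha.prodMk hb))

instance phaseMeasure.instSFinite (V₀ : ℝ) : SFinite (phaseMeasure d V₀) := by
  unfold phaseMeasure; infer_instance

instance phaseMeasure.instSigmaFinite (V₀ : ℝ) : SigmaFinite (phaseMeasure d V₀) := by
  unfold phaseMeasure; infer_instance

/-- After exchange of the two factors the flow is a skew product over the velocity, whose fibre maps
are translations of the position. -/
theorem measurePreserving_shift (V₀ t : ℝ) :
    MeasurePreserving (shift t) (phaseMeasure d V₀) (phaseMeasure d V₀) := by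
  unfold phaseMeasure
  set ν := (volume : Measure (E d)).restrict (velocitySet d V₀)
  have h1 : MeasurePreserving (fun p : E d × E d => (p.1, p.2 + t • p.1)) (ν.prod volume)
      (ν.prod volume) := by
    refine (MeasurePreserving.id ν).skew_product (g := fun v x => x + t • v) (by fun_prop)
      (Eventually.of_forall fun v => ?_)
    exact (measurePreserving_add_right (volume : Measure (E d)) (t • v)).map_eq
  have h2 : MeasurePreserving Prod.swap ((volume : Measure (E d)).prod ν) (ν.prod volume) :=
    Measure.measurePreserving_swap
  have h3 : MeasurePreserving Prod.swap (ν.prod volume) ((volume : Measure (E d)).prod ν) :=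
    Measure.measurePreserving_swap
  exact (h3.comp (h1.comp h2))

theorem lintegral_shift (V₀ t : ℝ) (F : E d × E d → ℝ≥0∞) (hF : Measurable F) :
    ∫⁻ z, F (shift t z) ∂(phaseMeasure d V₀) = ∫⁻ z, F z ∂(phaseMeasure d V₀) :=
  (measurePreserving_shift V₀ t).lintegral_comp hF

theorem shift_neg_shift (t : ℝ) (z : E d × E d) : shift (-t) (shift t z) = z := by
  rw [shift_shift]; simp

theorem shift_shift_neg (t : ℝ) (z : E d × E d) : shift t (shift (-t) z) = z := by
  rw [shift_shift]; simp

theorem measurableEmbedding_shift (t : ℝ) :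
    MeasurableEmbedding (shift t : E d × E d → E d × E d) :=
  (MeasurableEquiv.mk ⟨shift t, shift (-t), shift_neg_shift t, shift_shift_neg t⟩
    (measurable_shift t) (measurable_shift (-t))).measurableEmbedding

theorem integral_shift (V₀ t : ℝ) (F : E d × E d → ℝ) :
    ∫ z, F (shift t z) ∂(phaseMeasure d V₀) = ∫ z, F z ∂(phaseMeasure d V₀) :=
  (measurePreserving_shift V₀ t).integral_comp (measurableEmbedding_shift t) F

theorem measurableSet_velocitySet (V₀ : ℝ) : MeasurableSet (velocitySet d V₀) :=
  measurableSet_ball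

theorem ae_velocity_mem (V₀ : ℝ) : ∀ᵐ z ∂(phaseMeasure d V₀), z.2 ∈ velocitySet d V₀ := by
  unfold phaseMeasure
  refine Measure.ae_prod_mem_iff_ae_ae_mem (s := {z : E d × E d | z.2 ∈ velocitySet d V₀}) ?_ |>.2 ?_
  · exact measurable_snd (measurableSet_velocitySet V₀)
  · exact Eventually.of_forall fun x => ae_restrict_mem (measurableSet_velocitySet V₀)

/-! ### The damping factor -/

/-- The signed crossing time `|x · v| / |v|²`, a primitive of `sign (x · v)` along the free
transport flow. -/
def crossing (z : E d × E d) : ℝ := |inner ℝ z.1 z.2| / ‖z.2‖ ^ 2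

/-- The factor `exp (- ∫₀ᵗ K(x - s v, v) ds)` lost by a particle sitting at `z` at time `t`. -/
def damping (χ t : ℝ) (z : E d × E d) : ℝ :=
  Real.exp (-t - χ * (crossing z - crossing (shift (-t) z)))

theorem measurable_crossing : Measurable (crossing : E d × E d → ℝ) := by
  unfold crossing; fun_prop

theorem measurable_damping {α : Type*} [MeasurableSpace α] (χ : ℝ) {a : α → ℝ}
    {b : α → E d × E d} (ha : Measurable a) (hb : Measurable b) :
    Measurable fun p => damping χ (a p) (b p) := by
  unfold damping
  have h1 := measurable_crossing.comp hb
  have h2 := measurable_comp_shift measurable_crossing ha.neg hb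
  exact Real.measurable_exp.comp (ha.neg.sub ((h1.sub h2).const_mul χ))

theorem damping_pos (χ t : ℝ) (z : E d × E d) : 0 < damping χ t z := Real.exp_pos _

theorem damping_zero (χ : ℝ) (z : E d × E d) : damping χ 0 z = 1 := by simp [damping]

/-- Along the flow `x · v` moves at the constant speed `|v|²`, so the quotient is 1-Lipschitz by the
reverse triangle inequality. This bounds the damping by `e^{-(1 - χ) t}` without integrating the
discontinuous `K`. -/
theorem abs_crossing_sub_le (t : ℝ) (z : E d × E d) :
    |crossing (shift t z) - crossing z| ≤ |t| := by
  obtain ⟨x, v⟩ := z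
  by_cases hv : v = 0
  · simp [crossing, shift, hv]
  have hv2 : 0 < ‖v‖ ^ 2 := by positivity
  have hinner : inner ℝ (x + t • v) v = inner ℝ x v + t * ‖v‖ ^ 2 := by
    rw [inner_add_left, real_inner_smul_left, real_inner_self_eq_norm_sq]
  simp only [crossing, shift, hinner]
  rw [← sub_div, abs_div, abs_of_pos hv2, div_le_iff₀ hv2]
  refine (abs_abs_sub_abs_le_abs_sub _ _).trans ?_
  rw [add_sub_cancel_left, abs_mul, abs_of_pos hv2]

theorem damping_le {χ t : ℝ} (hχ : 0 ≤ χ) (ht : 0 ≤ t) (z : E d × E d) :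
    damping χ t z ≤ Real.exp (-(1 - χ) * t) := by
  unfold damping
  rw [Real.exp_le_exp]
  have h := abs_crossing_sub_le (-t) z
  rw [abs_neg, abs_of_nonneg ht] at h
  nlinarith [(abs_le.1 h).2]

/-! ### The Duhamel series -/

/-- The gain term with absolute values, computed with lower Lebesgue integrals. -/
def absGain (V₀ : ℝ) (k : E d → E d → ℝ) (P : E d × E d → ℝ≥0∞) (x : E d) : ℝ≥0∞ :=
  ∫⁻ v in velocitySet d V₀, ‖k x v‖ₑ * P (x, v)

/-- The terms of the Duhamel series. -/
def duhamelTerm (χ V₀ : ℝ) (k : E d → E d → ℝ) (f : E d × E d → ℝ) :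
    ℕ → ℝ → E d × E d → ℝ
  | 0 => fun t z => damping χ t z * f (shift (-t) z)
  | n + 1 => fun t z => ∫ s in Ioc 0 t,
      damping χ (t - s) z * gain V₀ k (duhamelTerm χ V₀ k f n s) (shift (-(t - s)) z)

/-- The terms of the majorant series. -/
def majorantTerm (χ V₀ : ℝ) (k : E d → E d → ℝ) (f : E d × E d → ℝ) :
    ℕ → ℝ → E d × E d → ℝ≥0∞
  | 0 => fun t z => ‖damping χ t z‖ₑ * ‖f (shift (-t) z)‖ₑ
  | n + 1 => fun t z => ∫⁻ s in Ioc 0 t,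
      ‖damping χ (t - s) z‖ₑ *
        absGain V₀ k (majorantTerm χ V₀ k f n s) (shift (-(t - s)) z).1

/-- The mild solution. -/
def mildSol (χ V₀ : ℝ) (k : E d → E d → ℝ) (f : E d × E d → ℝ) (t : ℝ) (z : E d × E d) : ℝ :=
  ∑' n, duhamelTerm χ V₀ k f n t z

/-- The majorant of the mild solution. -/
def majorant (χ V₀ : ℝ) (k : E d → E d → ℝ) (f : E d × E d → ℝ) (t : ℝ) (z : E d × E d) :
    ℝ≥0∞ :=
  ∑' n, majorantTerm χ V₀ k f n t z

theorem measurable_absGain {α : Type*} [MeasurableSpace α] (V₀ : ℝ) {k : E d → E d → ℝ}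
    (hk : Measurable (Function.uncurry k)) {P : α → E d × E d → ℝ≥0∞}
    (hP : Measurable (Function.uncurry P)) {x : α → E d} (hx : Measurable x) :
    Measurable fun p => absGain V₀ k (P p) (x p) := by
  unfold absGain
  refine Measurable.lintegral_prod_right' (f := fun q : α × E d =>
    ‖k (x q.1) q.2‖ₑ * P q.1 (x q.1, q.2)) ?_
  have h1 : Measurable fun q : α × E d => k (x q.1) q.2 :=
    hk.comp ((hx.comp measurable_fst).prodMk measurable_snd)
  have h2 : Measurable fun q : α × E d => P q.1 (x q.1, q.2) :=
    hP.comp (measurable_fst.prodMk ((hx.comp measurable_fst).prodMk measurable_snd))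
  exact h1.enorm.mul h2

theorem measurable_gain {α : Type*} [MeasurableSpace α] (V₀ : ℝ) {k : E d → E d → ℝ}
    (hk : Measurable (Function.uncurry k)) {P : α → E d × E d → ℝ}
    (hP : Measurable (Function.uncurry P)) {x : α → E d × E d} (hx : Measurable x) :
    Measurable fun p => gain V₀ k (P p) (x p) := by
  unfold gain
  refine (StronglyMeasurable.integral_prod_right' (f := fun q : α × E d =>
    k (x q.1).1 q.2 * P q.1 ((x q.1).1, q.2)) ?_).measurable
  have h0 : Measurable fun q : α × E d => (x q.1).1 := by fun_prop
  have h1 : Measurable fun q : α × E d => k (x q.1).1 q.2 :=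
    hk.comp (h0.prodMk measurable_snd)
  have h2 : Measurable fun q : α × E d => P q.1 ((x q.1).1, q.2) :=
    hP.comp (measurable_fst.prodMk (h0.prodMk measurable_snd))
  exact (h1.mul h2).stronglyMeasurable

/-- The moving domain `Ioc 0 t` is absorbed into an indicator function, so that joint measurability
in time and phase is that of a parameter integral over a fixed space. -/
theorem measurable_majorantTerm (χ V₀ : ℝ) {k : E d → E d → ℝ}
    (hk : Measurable (Function.uncurry k)) {f : E d × E d → ℝ} (hf : Measurable f) (n : ℕ) :
    Measurable (Function.uncurry (majorantTerm χ V₀ k f n)) := by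
  induction n with
  | zero =>
    exact (measurable_damping χ measurable_fst measurable_snd).enorm.mul
      (measurable_comp_shift hf measurable_fst.neg measurable_snd).enorm
  | succ n ih =>
    have h : Function.uncurry (majorantTerm χ V₀ k f (n + 1)) = fun p : ℝ × (E d × E d) =>
        ∫⁻ s, (Ioc 0 p.1).indicator (fun s => ‖damping χ (p.1 - s) p.2‖ₑ *
        absGain V₀ k (majorantTerm χ V₀ k f n s) (shift (-(p.1 - s)) p.2).1) s := by
      ext p
      rw [lintegral_indicator measurableSet_Ioc]; rfl
    rw [h]
    have hm : Measurable fun q : (ℝ × (E d × E d)) × ℝ => ‖damping χ (q.1.1 - q.2) q.1.2‖ₑ *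
        absGain V₀ k (majorantTerm χ V₀ k f n q.2) (shift (-(q.1.1 - q.2)) q.1.2).1 := by
      have ha : Measurable fun q : (ℝ × (E d × E d)) × ℝ => q.1.1 - q.2 := by fun_prop
      have hb : Measurable fun q : (ℝ × (E d × E d)) × ℝ => q.1.2 := by fun_prop
      refine (measurable_damping χ ha hb).enorm.mul ?_
      refine measurable_absGain V₀ hk (P := fun q : (ℝ × (E d × E d)) × ℝ =>
        majorantTerm χ V₀ k f n q.2) ?_ (measurable_comp_shift measurable_fst ha.neg hb)
      exact ih.comp ((measurable_snd.comp measurable_fst).prodMk measurable_snd)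
    have hs : MeasurableSet {q : (ℝ × (E d × E d)) × ℝ | q.2 ∈ Ioc 0 q.1.1} :=
      (measurableSet_lt measurable_const measurable_snd).inter
        (measurableSet_le measurable_snd (measurable_fst.comp measurable_fst))
    exact Measurable.lintegral_prod_right' (hm.indicator hs)

theorem measurable_duhamelTerm (χ V₀ : ℝ) {k : E d → E d → ℝ}
    (hk : Measurable (Function.uncurry k)) {f : E d × E d → ℝ} (hf : Measurable f) (n : ℕ) :
    Measurable (Function.uncurry (duhamelTerm χ V₀ k f n)) := by
  induction n with
  | zero =>
    exact (measurable_damping χ measurable_fst measurable_snd).mul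
      (measurable_comp_shift hf measurable_fst.neg measurable_snd)
  | succ n ih =>
    have h : Function.uncurry (duhamelTerm χ V₀ k f (n + 1)) = fun p : ℝ × (E d × E d) =>
        ∫ s, (Ioc 0 p.1).indicator (fun s => damping χ (p.1 - s) p.2 *
        gain V₀ k (duhamelTerm χ V₀ k f n s) (shift (-(p.1 - s)) p.2)) s := by
      ext p
      rw [integral_indicator measurableSet_Ioc]; rfl
    rw [h]
    have hm : Measurable fun q : (ℝ × (E d × E d)) × ℝ => damping χ (q.1.1 - q.2) q.1.2 *
        gain V₀ k (duhamelTerm χ V₀ k f n q.2) (shift (-(q.1.1 - q.2)) q.1.2) := by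
      have ha : Measurable fun q : (ℝ × (E d × E d)) × ℝ => q.1.1 - q.2 := by fun_prop
      have hb : Measurable fun q : (ℝ × (E d × E d)) × ℝ => q.1.2 := by fun_prop
      refine (measurable_damping χ ha hb).mul ?_
      refine measurable_gain V₀ hk (P := fun q : (ℝ × (E d × E d)) × ℝ =>
        duhamelTerm χ V₀ k f n q.2) ?_ (measurable_comp_shift measurable_id ha.neg hb)
      exact ih.comp ((measurable_snd.comp measurable_fst).prodMk measurable_snd)
    have hs : MeasurableSet {q : (ℝ × (E d × E d)) × ℝ | q.2 ∈ Ioc 0 q.1.1} :=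
      (measurableSet_lt measurable_const measurable_snd).inter
        (measurableSet_le measurable_snd (measurable_fst.comp measurable_fst))
    exact (StronglyMeasurable.integral_prod_right'
      (hm.indicator hs).stronglyMeasurable).measurable

theorem measurable_majorant (χ V₀ : ℝ) {k : E d → E d → ℝ}
    (hk : Measurable (Function.uncurry k)) {f : E d × E d → ℝ} (hf : Measurable f) :
    Measurable (Function.uncurry (majorant χ V₀ k f)) := by
  have : Function.uncurry (majorant χ V₀ k f) =
      fun p => ∑' n, Function.uncurry (majorantTerm χ V₀ k f n) p := rfl
  rw [this]
  exact Measurable.tsum fun n => measurable_majorantTerm χ V₀ hk hf n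

theorem measurable_mildSol (χ V₀ : ℝ) {k : E d → E d → ℝ}
    (hk : Measurable (Function.uncurry k)) {f : E d × E d → ℝ} (hf : Measurable f) :
    Measurable (Function.uncurry (mildSol χ V₀ k f)) := by
  have : Function.uncurry (mildSol χ V₀ k f) =
      fun p => ∑' n, Function.uncurry (duhamelTerm χ V₀ k f n) p := rfl
  rw [this]
  exact Measurable.tsum fun n => measurable_duhamelTerm χ V₀ hk hf n

theorem enorm_gain_le (V₀ : ℝ) (k : E d → E d → ℝ) {f : E d × E d → ℝ} {P : E d × E d → ℝ≥0∞}
    (h : ∀ z, ‖f z‖ₑ ≤ P z) (z : E d × E d) : ‖gain V₀ k f z‖ₑ ≤ absGain V₀ k P z.1 := by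
  refine (enorm_integral_le_lintegral_enorm _).trans (lintegral_mono fun v => ?_)
  rw [enorm_mul]
  exact mul_le_mul_right (h _) _

theorem enorm_duhamelTerm_le (χ V₀ : ℝ) (k : E d → E d → ℝ) (f : E d × E d → ℝ) (n : ℕ)
    (t : ℝ) (z : E d × E d) :
    ‖duhamelTerm χ V₀ k f n t z‖ₑ ≤ majorantTerm χ V₀ k f n t z := by
  induction n generalizing t z with
  | zero => simp [duhamelTerm, majorantTerm, enorm_mul]
  | succ n ih =>
    refine (enorm_integral_le_lintegral_enorm _).trans (lintegral_mono fun s => ?_)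
    rw [enorm_mul]
    exact mul_le_mul_right (enorm_gain_le V₀ k (fun z => ih s z) _) _

theorem enorm_mildSol_le (χ V₀ : ℝ) (k : E d → E d → ℝ) (f : E d × E d → ℝ)
    (t : ℝ) (z : E d × E d) :
    ‖mildSol χ V₀ k f t z‖ₑ ≤ majorant χ V₀ k f t z :=
  enorm_tsum_le_tsum_enorm.trans
    (ENNReal.tsum_le_tsum fun n => enorm_duhamelTerm_le χ V₀ k f n t z)

theorem absGain_tsum (V₀ : ℝ) {k : E d → E d → ℝ}
    (hk : Measurable (Function.uncurry k)) {P : ℕ → E d × E d → ℝ≥0∞}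
    (hP : ∀ n, Measurable (P n)) (x : E d) :
    absGain V₀ k (fun z => ∑' n, P n z) x = ∑' n, absGain V₀ k (P n) x := by
  unfold absGain
  rw [← lintegral_tsum]
  · simp_rw [ENNReal.tsum_mul_left]
  · intro n
    have h1 : Measurable fun v => k x v := hk.comp (measurable_const.prodMk measurable_id)
    have h2 : Measurable fun v => P n (x, v) := (hP n).comp (measurable_const.prodMk measurable_id)
    exact (h1.enorm.mul h2).aemeasurable

/-- The majorant solves the Duhamel equation with the kernel `|k|` and the datum `|f|`. -/
theorem majorant_eq (χ V₀ : ℝ) {k : E d → E d → ℝ}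
    (hk : Measurable (Function.uncurry k)) {f : E d × E d → ℝ} (hf : Measurable f)
    (t : ℝ) (z : E d × E d) :
    majorant χ V₀ k f t z = ‖damping χ t z‖ₑ * ‖f (shift (-t) z)‖ₑ +
      ∫⁻ s in Ioc 0 t, ‖damping χ (t - s) z‖ₑ *
        absGain V₀ k (majorant χ V₀ k f s) (shift (-(t - s)) z).1 := by
  have hm := fun n => measurable_majorantTerm χ V₀ hk hf n
  have hslice : ∀ n s, Measurable (majorantTerm χ V₀ k f n s) := fun n s =>
    (hm n).comp (measurable_const.prodMk measurable_id)
  rw [majorant, tsum_eq_zero_add' ENNReal.summable]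
  congr 1
  change ∑' n, (∫⁻ s in Ioc 0 t, ‖damping χ (t - s) z‖ₑ *
        absGain V₀ k (majorantTerm χ V₀ k f n s) (shift (-(t - s)) z).1) = _
  rw [← lintegral_tsum]
  · refine lintegral_congr fun s => ?_
    rw [ENNReal.tsum_mul_left]
    congr 1
    exact (absGain_tsum V₀ hk (fun n => hslice n s) _).symm
  · intro n
    have ha : Measurable fun s : ℝ => t - s := by fun_prop
    refine ((measurable_damping χ ha measurable_const).enorm.mul ?_).aemeasurable
    exact measurable_absGain V₀ hk (hm n) (measurable_comp_shift measurable_fst ha.neg measurable_const)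

/-! ### Bounds on the majorant -/

/-- Measurable kernels that are bounded by `C` on the velocity set. -/
structure IsBoundedKernel (V₀ : ℝ) (C : ℝ≥0) (k : E d → E d → ℝ) : Prop where
  measurable : Measurable (Function.uncurry k)
  bound : ∀ x, ∀ v ∈ velocitySet d V₀, ‖k x v‖ₑ ≤ C

theorem lintegral_phaseMeasure (V₀ : ℝ) {F : E d × E d → ℝ≥0∞} (hF : Measurable F) :
    ∫⁻ z, F z ∂(phaseMeasure d V₀) = ∫⁻ x, ∫⁻ v in velocitySet d V₀, F (x, v) := by
  unfold phaseMeasure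
  exact lintegral_prod _ hF.aemeasurable

theorem lintegral_phaseMeasure_fst {V₀ : ℝ} (hV : volume (velocitySet d V₀) = 1)
    {F : E d → ℝ≥0∞} (hF : Measurable F) :
    ∫⁻ z, F z.1 ∂(phaseMeasure d V₀) = ∫⁻ x, F x := by
  have h : Measurable fun z : E d × E d => F z.1 := hF.comp measurable_fst
  rw [lintegral_phaseMeasure V₀ h]
  simp [hV]

theorem lintegral_pow_le {α : Type*} [MeasurableSpace α] {μ : Measure α} {p : ℕ}
    (hp : p = 1 ∨ p = 2) {h : α → ℝ≥0∞} (hh : AEMeasurable h μ) :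
    (∫⁻ a, h a ∂μ) ^ p ≤ μ univ ^ (p - 1) * ∫⁻ a, h a ^ p ∂μ := by
  rcases hp with rfl | rfl
  · simp
  · simpa using lintegral_sq_le_measure_mul hh

/-- For `p = 2`, Cauchy–Schwarz against the weights `2^{-n}`, of total mass 2. It reduces the `L^p`
bound of the whole series to term bounds that decay faster than `2^{-n}`, with no Minkowski
inequality. -/
theorem tsum_pow_le {p : ℕ} (hp : p = 1 ∨ p = 2) (x : ℕ → ℝ≥0∞) :
    (∑' n, x n) ^ p ≤ 2 * ∑' n, 2 ^ n * x n ^ p := by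
  rcases hp with rfl | rfl
  · simp only [pow_one]
    calc ∑' n, x n ≤ ∑' n, 2 ^ n * x n := ENNReal.tsum_le_tsum fun n => by
          nth_rewrite 1 [← one_mul (x n)]
          exact mul_le_mul_left (one_le_pow₀ one_le_two) _
      _ ≤ _ := by
          nth_rewrite 1 [← one_mul (∑' n, _)]
          exact mul_le_mul_left one_le_two _
  · have h := lintegral_weight_mul_sq_le (μ := Measure.count (α := ℕ))
      (w := fun n => (2⁻¹ : ℝ≥0∞) ^ n) (h := fun n => 2 ^ n * x n)
      (measurable_of_countable _).aemeasurable (measurable_of_countable _).aemeasurable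
    simp only [lintegral_count] at h
    have h1 : ∀ n : ℕ, (2⁻¹ : ℝ≥0∞) ^ n * 2 ^ n = 1 := fun n => by
      rw [← mul_pow, ENNReal.inv_mul_cancel (by norm_num) (by norm_num), one_pow]
    have h2 : ∀ n : ℕ, (2⁻¹ : ℝ≥0∞) ^ n * (2 ^ n * x n) = x n := fun n => by
      rw [← mul_assoc, h1, one_mul]
    have h3 : ∀ n : ℕ, (2⁻¹ : ℝ≥0∞) ^ n * (2 ^ n * x n) ^ 2 = 2 ^ n * x n ^ 2 := fun n => by
      rw [sq, ← mul_assoc, h2, sq]; ring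
    simp only [h2, h3] at h
    refine h.trans (mul_le_mul_left ?_ _)
    rw [ENNReal.tsum_geometric]
    simp

theorem lintegral_exp_Ioc_le {μ t : ℝ} (hμ : 0 < μ) (ht : 0 ≤ t) :
    ∫⁻ s in Ioc 0 t, ENNReal.ofReal (Real.exp (μ * s)) ≤ ENNReal.ofReal (Real.exp (μ * t) / μ) := by
  have hc : Continuous fun s : ℝ => Real.exp (μ * s) := by fun_prop
  rw [← ofReal_integral_eq_lintegral_ofReal
    (hc.integrableOn_Icc.mono_set Ioc_subset_Icc_self)
    (Eventually.of_forall fun s => (Real.exp_pos _).le)]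
  refine ENNReal.ofReal_le_ofReal ?_
  rw [← intervalIntegral.integral_of_le ht, intervalIntegral.integral_comp_mul_left _ hμ.ne']
  simp only [mul_zero, integral_exp, Real.exp_zero, smul_eq_mul]
  rw [div_eq_inv_mul]
  gcongr
  linarith

section Bounds

variable {χ V₀ : ℝ} {C : ℝ≥0} {k : E d → E d → ℝ} {f : E d × E d → ℝ}

theorem enorm_damping_le_one (hχ : χ ∈ Ioo (0 : ℝ) 1) {t : ℝ} (ht : 0 ≤ t) (z : E d × E d) :
    ‖damping χ t z‖ₑ ≤ 1 := by
  rw [Real.enorm_of_nonneg (damping_pos χ t z).le]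
  refine ENNReal.ofReal_le_one.2 ((damping_le hχ.1.le ht z).trans ?_)
  rw [Real.exp_le_one_iff]
  nlinarith [hχ.2]

/-- Jensen's inequality in the velocity, with constant one because `|𝒱| = 1`. -/
theorem absGain_pow_le (hV : volume (velocitySet d V₀) = 1) (hk : IsBoundedKernel V₀ C k)
    {p : ℕ} (hp : p = 1 ∨ p = 2) {P : E d × E d → ℝ≥0∞} (hP : Measurable P) (x : E d) :
    absGain V₀ k P x ^ p ≤ C ^ p * ∫⁻ v in velocitySet d V₀, P (x, v) ^ p := by
  have hPx : Measurable fun v => P (x, v) := hP.comp (measurable_const.prodMk measurable_id)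
  have h1 : absGain V₀ k P x ≤ C * ∫⁻ v in velocitySet d V₀, P (x, v) := by
    unfold absGain
    rw [← lintegral_const_mul _ hPx]
    refine setLIntegral_mono' (measurableSet_velocitySet V₀) fun v hv => ?_
    exact mul_le_mul_left (hk.bound x v hv) _
  refine (pow_le_pow_left' h1 p).trans ?_
  rw [mul_pow]
  refine mul_le_mul_right ?_ _
  simpa [hV] using lintegral_pow_le (μ := volume.restrict (velocitySet d V₀)) hp hPx.aemeasurable

/-- Weights with at most exponential growth along the free transport flow. -/
structure IsFlowWeight (V₀ c : ℝ) (W : E d → ℝ≥0∞) : Prop where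
  measurable : Measurable W
  nonneg : 0 ≤ c
  growth : ∀ x, ∀ v ∈ velocitySet d V₀, ∀ t, 0 ≤ t →
    W (x + t • v) ≤ ENNReal.ofReal (Real.exp (c * t)) * W x

/-- The flow preserves the measure, so the shift can be moved onto the weight, where it costs at
most the exponential growth factor. -/
theorem IsFlowWeight.lintegral_shift_le {c : ℝ} {W : E d → ℝ≥0∞} (hW : IsFlowWeight V₀ c W)
    {t T : ℝ} (ht : 0 ≤ t) (htT : t ≤ T) {F : E d × E d → ℝ≥0∞} (hF : Measurable F) :
    ∫⁻ z, W z.1 * F (shift (-t) z) ∂(phaseMeasure d V₀) ≤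
      ENNReal.ofReal (Real.exp (c * T)) * ∫⁻ z, W z.1 * F z ∂(phaseMeasure d V₀) := by
  have hm : Measurable fun z : E d × E d => W z.1 * F (shift (-t) z) :=
    (hW.measurable.comp measurable_fst).mul (hF.comp (measurable_shift _))
  have hm' : Measurable fun z : E d × E d => W z.1 * F z :=
    (hW.measurable.comp measurable_fst).mul hF
  rw [← lintegral_shift V₀ t _ hm, ← lintegral_const_mul _ hm']
  refine lintegral_mono_ae ?_
  filter_upwards [ae_velocity_mem V₀] with z hz
  rw [shift_neg_shift, ← mul_assoc]
  refine mul_le_mul_left ((hW.growth z.1 z.2 hz t ht).trans ?_) _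
  refine mul_le_mul_left (ENNReal.ofReal_le_ofReal ?_) _
  rw [Real.exp_le_exp]
  exact mul_le_mul_of_nonneg_left htT hW.nonneg

/-- One Volterra step. The damping is at most one, Cauchy–Schwarz in time costs `T^{p-1}`, undoing
the flow costs `e^{cT}`, and the velocity integral costs `C^p`. -/
theorem lintegral_majorantTerm_succ_le (hV : volume (velocitySet d V₀) = 1)
    (hχ : χ ∈ Ioo (0 : ℝ) 1) (hk : IsBoundedKernel V₀ C k) (hf : Measurable f)
    {p : ℕ} (hp : p = 1 ∨ p = 2) {c : ℝ} {W : E d → ℝ≥0∞} (hW : IsFlowWeight V₀ c W)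
    (n : ℕ) {t T : ℝ} (htT : t ≤ T) :
    ∫⁻ z, W z.1 * majorantTerm χ V₀ k f (n + 1) t z ^ p ∂(phaseMeasure d V₀) ≤
      ENNReal.ofReal T ^ (p - 1) * (ENNReal.ofReal (Real.exp (c * T)) * C ^ p) *
      ∫⁻ s in Ioc 0 t, ∫⁻ z, W z.1 * majorantTerm χ V₀ k f n s z ^ p ∂(phaseMeasure d V₀) := by
  have hm := measurable_majorantTerm χ V₀ hk.measurable hf n
  have hWm : Measurable fun z : E d × E d => W z.1 := hW.measurable.comp measurable_fst
  have hslice : ∀ s, Measurable (majorantTerm χ V₀ k f n s) := fun s =>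
    hm.comp (measurable_const.prodMk measurable_id)
  obtain ⟨G, hG⟩ : ∃ G : ℝ → E d → ℝ≥0∞, ∀ s x,
    G s x = absGain V₀ k (majorantTerm χ V₀ k f n s) x := ⟨_, fun _ _ => rfl⟩
  have hGm : Measurable fun q : ℝ × E d => G q.1 q.2 := by
    simp only [hG]
    exact measurable_absGain V₀ hk.measurable
      (P := fun q : ℝ × E d => majorantTerm χ V₀ k f n q.1)
      (hm.comp ((measurable_fst.comp measurable_fst).prodMk measurable_snd)) measurable_snd
  have hxm : Measurable fun q : (E d × E d) × ℝ => (shift (-(t - q.2)) q.1).1 :=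
    measurable_comp_shift measurable_fst (by fun_prop) measurable_fst
  have hjoint : Measurable fun q : (E d × E d) × ℝ => G q.2 (shift (-(t - q.2)) q.1).1 :=
    hGm.comp (measurable_snd.prodMk hxm)
  have hjz : ∀ z, Measurable fun s => G s (shift (-(t - s)) z).1 := fun z =>
    hjoint.comp (measurable_const.prodMk measurable_id)
  have hdef : ∀ z, majorantTerm χ V₀ k f (n + 1) t z =
      ∫⁻ s in Ioc 0 t, ‖damping χ (t - s) z‖ₑ * G s (shift (-(t - s)) z).1 := fun z => by
    simp only [hG]; rfl
  have h1 : ∀ z, majorantTerm χ V₀ k f (n + 1) t z ^ p ≤ ENNReal.ofReal T ^ (p - 1) *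
      ∫⁻ s in Ioc 0 t, G s (shift (-(t - s)) z).1 ^ p := by
    intro z
    have : majorantTerm χ V₀ k f (n + 1) t z ≤ ∫⁻ s in Ioc 0 t, G s (shift (-(t - s)) z).1 := by
      rw [hdef]
      refine setLIntegral_mono' measurableSet_Ioc fun s hs => ?_
      nth_rewrite 2 [← one_mul (G s _)]
      exact mul_le_mul_left (enorm_damping_le_one hχ (by linarith [hs.2]) z) _
    refine (pow_le_pow_left' this p).trans ((lintegral_pow_le hp (hjz z).aemeasurable).trans ?_)
    refine mul_le_mul_left (pow_le_pow_left' ?_ _) _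
    simp only [Measure.restrict_apply_univ, Real.volume_Ioc, sub_zero]
    exact ENNReal.ofReal_le_ofReal htT
  have h2 : ∫⁻ z, W z.1 * majorantTerm χ V₀ k f (n + 1) t z ^ p ∂(phaseMeasure d V₀) ≤
      ENNReal.ofReal T ^ (p - 1) * ∫⁻ s in Ioc 0 t, ∫⁻ z, W z.1 * G s (shift (-(t - s)) z).1 ^ p
        ∂(phaseMeasure d V₀) := by
    have hjp : Measurable fun q : (E d × E d) × ℝ =>
        W q.1.1 * G q.2 (shift (-(t - q.2)) q.1).1 ^ p :=
      (hWm.comp measurable_fst).mul (hjoint.pow_const p)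
    rw [← lintegral_lintegral_swap hjp.aemeasurable,
      ← lintegral_const_mul _ hjp.lintegral_prod_right']
    refine lintegral_mono fun z => ?_
    dsimp only
    rw [lintegral_const_mul _ ((hjz z).pow_const p), mul_left_comm]
    exact mul_le_mul_right (h1 z) _
  refine h2.trans ?_
  rw [mul_assoc]
  refine mul_le_mul_right ?_ _
  rw [← lintegral_const_mul]
  swap
  · exact Measurable.lintegral_prod_right'
      (f := fun q : ℝ × (E d × E d) => W q.2.1 * majorantTerm χ V₀ k f n q.1 q.2 ^ p)
      ((hWm.comp measurable_snd).mul (hm.pow_const p))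
  refine setLIntegral_mono' measurableSet_Ioc fun s hs => ?_
  have hGs : Measurable (G s) := hGm.comp (measurable_const.prodMk measurable_id)
  refine (hW.lintegral_shift_le (F := fun z => G s z.1 ^ p) (by linarith [hs.2])
    (by linarith [hs.1] : t - s ≤ T) ((hGs.comp measurable_fst).pow_const p)).trans ?_
  rw [mul_assoc]
  refine mul_le_mul_right ?_ _
  have hPm : Measurable fun q : E d × E d => majorantTerm χ V₀ k f n s q ^ p :=
    (hslice s).pow_const p
  have hA : Measurable fun x : E d =>
      ∫⁻ v in velocitySet d V₀, majorantTerm χ V₀ k f n s (x, v) ^ p :=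
    hPm.lintegral_prod_right'
  calc ∫⁻ z, W z.1 * G s z.1 ^ p ∂(phaseMeasure d V₀)
      = ∫⁻ x, W x * G s x ^ p :=
        lintegral_phaseMeasure_fst hV (F := fun x => W x * G s x ^ p)
          (hW.measurable.mul (hGs.pow_const p))
    _ ≤ ∫⁻ x, C ^ p * (W x * ∫⁻ v in velocitySet d V₀, majorantTerm χ V₀ k f n s (x, v) ^ p) := by
        refine lintegral_mono fun x => ?_
        rw [mul_left_comm]
        rw [hG]
        exact mul_le_mul_right (absGain_pow_le hV hk hp (hslice s) x) _
    _ = C ^ p * ∫⁻ z, W z.1 * majorantTerm χ V₀ k f n s z ^ p ∂(phaseMeasure d V₀) := by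
        have hWA : Measurable fun x : E d => W x *
            ∫⁻ v in velocitySet d V₀, majorantTerm χ V₀ k f n s (x, v) ^ p :=
          hW.measurable.mul hA
        have hWP : Measurable fun z : E d × E d => W z.1 * majorantTerm χ V₀ k f n s z ^ p :=
          hWm.mul hPm
        rw [lintegral_const_mul _ hWA, lintegral_phaseMeasure V₀ hWP]
        congr 1
        refine lintegral_congr fun x => ?_
        exact (lintegral_const_mul _ (hPm.comp (measurable_const.prodMk measurable_id))).symm

theorem lintegral_majorantTerm_zero_le (hχ : χ ∈ Ioo (0 : ℝ) 1) (hf : Measurable f)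
    (p : ℕ) {c : ℝ} {W : E d → ℝ≥0∞} (hW : IsFlowWeight V₀ c W) {t T : ℝ} (ht : 0 ≤ t)
    (htT : t ≤ T) :
    ∫⁻ z, W z.1 * majorantTerm χ V₀ k f 0 t z ^ p ∂(phaseMeasure d V₀) ≤
      ENNReal.ofReal (Real.exp (c * T)) * ∫⁻ z, W z.1 * ‖f z‖ₑ ^ p ∂(phaseMeasure d V₀) := by
  refine le_trans (lintegral_mono fun z => mul_le_mul_right (pow_le_pow_left' ?_ p) _)
    (hW.lintegral_shift_le (F := fun z => ‖f z‖ₑ ^ p) ht htT (hf.enorm.pow_const p))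
  change ‖damping χ t z‖ₑ * ‖f (shift (-t) z)‖ₑ ≤ ‖f (shift (-t) z)‖ₑ
  nth_rewrite 2 [← one_mul ‖f _‖ₑ]
  exact mul_le_mul_left (enorm_damping_le_one hχ ht z) _

/-- The majorant is locally bounded in time in the weighted Lebesgue spaces. -/
theorem exists_lintegral_majorant_le (hV : volume (velocitySet d V₀) = 1)
    (hχ : χ ∈ Ioo (0 : ℝ) 1) (hk : IsBoundedKernel V₀ C k) (hf : Measurable f)
    {p : ℕ} (hp : p = 1 ∨ p = 2) {c : ℝ} {W : E d → ℝ≥0∞} (hW : IsFlowWeight V₀ c W) (T : ℝ) :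
    ∃ M : ℝ≥0, ∀ t ∈ Icc 0 T, ∫⁻ z, W z.1 * majorant χ V₀ k f t z ^ p ∂(phaseMeasure d V₀) ≤
      M * ∫⁻ z, W z.1 * ‖f z‖ₑ ^ p ∂(phaseMeasure d V₀) := by
  set J := ∫⁻ z, W z.1 * ‖f z‖ₑ ^ p ∂(phaseMeasure d V₀) with hJ
  set A : ℝ := Real.exp (c * T) with hA
  set B : ℝ := T ^ (p - 1) * (A * C ^ p) with hB
  -- Measured against `e^{μt}`, a Volterra step contracts by `B / μ ≤ 1/8`. The decay `8^{-n}` beats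
  -- the factor `2^n` of `tsum_pow_le` and leaves a geometric series of ratio `1/4`.
  set μ : ℝ := 8 * (|B| + 1) with hμ
  have hμ0 : 0 < μ := by positivity
  have hind : ∀ n, ∀ t ∈ Icc 0 T,
      ∫⁻ z, W z.1 * majorantTerm χ V₀ k f n t z ^ p ∂(phaseMeasure d V₀) ≤
        ENNReal.ofReal (A * (8⁻¹ ^ n * Real.exp (μ * t))) * J := by
    intro n
    induction n with
    | zero =>
      intro t ht
      refine (lintegral_majorantTerm_zero_le hχ hf p hW ht.1 ht.2).trans
        (mul_le_mul_left (ENNReal.ofReal_le_ofReal ?_) _)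
      rw [pow_zero, one_mul]
      nth_rewrite 1 [← mul_one (Real.exp _)]
      gcongr
      exact Real.one_le_exp (mul_nonneg hμ0.le ht.1)
    | succ n ih =>
      intro t ht
      have hT : 0 ≤ T := ht.1.trans ht.2
      have hB0 : 0 ≤ B := by positivity
      refine (lintegral_majorantTerm_succ_le hV hχ hk hf hp hW n ht.2).trans ?_
      have e1 : ENNReal.ofReal T ^ (p - 1) * (ENNReal.ofReal (Real.exp (c * T)) * (C : ℝ≥0∞) ^ p) =
          ENNReal.ofReal B := by
        rw [hB, ENNReal.ofReal_mul (by positivity), ENNReal.ofReal_mul (by positivity),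
          ENNReal.ofReal_pow hT, ENNReal.ofReal_pow (by positivity), ENNReal.ofReal_coe_nnreal]
      rw [e1]
      calc _ ≤ ENNReal.ofReal B * ∫⁻ s in Ioc 0 t,
            ENNReal.ofReal (A * 8⁻¹ ^ n) * J * ENNReal.ofReal (Real.exp (μ * s)) := by
            refine mul_le_mul_right (setLIntegral_mono' measurableSet_Ioc fun s hs => ?_) _
            refine (ih s ⟨hs.1.le, hs.2.trans ht.2⟩).trans_eq ?_
            rw [← mul_assoc A, ENNReal.ofReal_mul (by positivity)]
            ring
        _ ≤ ENNReal.ofReal B * (ENNReal.ofReal (A * 8⁻¹ ^ n) * J *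
              ENNReal.ofReal (Real.exp (μ * t) / μ)) := by
            rw [lintegral_const_mul _ (by fun_prop)]
            exact mul_le_mul_right (mul_le_mul_right (lintegral_exp_Ioc_le hμ0 ht.1) _) _
        _ = ENNReal.ofReal (B * (A * 8⁻¹ ^ n) * (Real.exp (μ * t) / μ)) * J := by
            rw [mul_assoc B, ENNReal.ofReal_mul hB0,
              ENNReal.ofReal_mul (p := A * 8⁻¹ ^ n) (by positivity)]
            ring
        _ ≤ _ := by
            refine mul_le_mul_left (ENNReal.ofReal_le_ofReal ?_) _
            have h8 : B / μ ≤ 8⁻¹ := by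
              rw [div_le_iff₀ hμ0, hμ, abs_of_nonneg hB0]; linarith
            calc B * (A * 8⁻¹ ^ n) * (Real.exp (μ * t) / μ)
                = B / μ * (A * 8⁻¹ ^ n * Real.exp (μ * t)) := by ring
              _ ≤ 8⁻¹ * (A * 8⁻¹ ^ n * Real.exp (μ * t)) := by gcongr
              _ = _ := by ring
  have hWm : Measurable fun z : E d × E d => W z.1 := hW.measurable.comp measurable_fst
  refine ⟨(4 * (A * Real.exp (μ * T))).toNNReal, fun t ht => ?_⟩
  calc ∫⁻ z, W z.1 * majorant χ V₀ k f t z ^ p ∂(phaseMeasure d V₀)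
      ≤ ∫⁻ z, ∑' n, 2 * 2 ^ n * (W z.1 * majorantTerm χ V₀ k f n t z ^ p)
          ∂(phaseMeasure d V₀) := by
        refine lintegral_mono fun z => ?_
        refine (mul_le_mul_right (tsum_pow_le hp _) _).trans_eq ?_
        rw [← ENNReal.tsum_mul_left, ← ENNReal.tsum_mul_left]
        congr 1; ext n; ring
    _ = ∑' n, 2 * 2 ^ n * ∫⁻ z, W z.1 * majorantTerm χ V₀ k f n t z ^ p ∂(phaseMeasure d V₀) := by
        have hms : ∀ n, Measurable fun z : E d × E d =>
            W z.1 * majorantTerm χ V₀ k f n t z ^ p := fun n =>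
          hWm.mul (((measurable_majorantTerm χ V₀ hk.measurable hf n).comp
            (measurable_const.prodMk measurable_id)).pow_const p)
        rw [lintegral_tsum fun n => ((hms n).const_mul _).aemeasurable]
        congr 1; ext n
        rw [lintegral_const_mul _ (hms n)]
    _ ≤ ∑' n : ℕ, ENNReal.ofReal (2 * (A * Real.exp (μ * T))) * J * ENNReal.ofReal (4⁻¹ ^ n) := by
        refine ENNReal.tsum_le_tsum fun n => ?_
        refine (mul_le_mul_right (hind n t ht) _).trans ?_
        have : (2 * 2 ^ n : ℝ≥0∞) = ENNReal.ofReal (2 * 2 ^ n) := by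
          rw [ENNReal.ofReal_mul (by norm_num), ENNReal.ofReal_pow (by norm_num)]; norm_num
        rw [this, ← mul_assoc, ← ENNReal.ofReal_mul (by positivity), mul_right_comm _ J,
          ← ENNReal.ofReal_mul (by positivity)]
        refine mul_le_mul_left (ENNReal.ofReal_le_ofReal ?_) _
        have : (4⁻¹ : ℝ) ^ n = 2 ^ n * 8⁻¹ ^ n := by rw [← mul_pow]; norm_num
        rw [this]
        calc 2 * 2 ^ n * (A * (8⁻¹ ^ n * Real.exp (μ * t)))
            = 2 * (A * Real.exp (μ * t)) * (2 ^ n * 8⁻¹ ^ n) := by ring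
          _ ≤ 2 * (A * Real.exp (μ * T)) * (2 ^ n * 8⁻¹ ^ n) := by
            gcongr
            exact ht.2
    _ ≤ _ := by
        rw [ENNReal.tsum_mul_left, ← ENNReal.ofReal_tsum_of_nonneg (fun n => by positivity)
          (summable_geometric_of_lt_one (by norm_num) (by norm_num)),
          tsum_geometric_of_lt_one (by norm_num) (by norm_num), mul_right_comm,
          ← ENNReal.ofReal_mul (by positivity)]
        refine mul_le_mul_left ?_ _
        rw [← ENNReal.ofReal]
        refine ENNReal.ofReal_le_ofReal ?_
        have : 0 < A * Real.exp (μ * T) := by positivity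
        norm_num
        linarith

end Bounds

/-! ### The Duhamel equation -/

section Duhamel

variable {χ V₀ : ℝ} {k : E d → E d → ℝ} {f : E d × E d → ℝ}

/-- The sum of the integrals of absolute values is bounded by the gain of the majorant at this
position, so its finiteness licenses the exchange of sum and integral. -/
theorem gain_mildSol (hk : Measurable (Function.uncurry k)) (hf : Measurable f)
    {s : ℝ} {z : E d × E d} (h : absGain V₀ k (majorant χ V₀ k f s) z.1 ≠ ⊤) :
    gain V₀ k (mildSol χ V₀ k f s) z = ∑' n, gain V₀ k (duhamelTerm χ V₀ k f n s) z := by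
  have hkz : Measurable fun v => k z.1 v := hk.comp (measurable_const.prodMk measurable_id)
  have hm : ∀ n, Measurable fun v => duhamelTerm χ V₀ k f n s (z.1, v) := fun n =>
    (measurable_duhamelTerm χ V₀ hk hf n).comp
      (measurable_const.prodMk (measurable_const.prodMk measurable_id))
  unfold gain mildSol
  simp_rw [← tsum_mul_left]
  refine integral_tsum (fun n => (hkz.mul (hm n)).aestronglyMeasurable) (ne_top_of_le_ne_top h ?_)
  have hPm : ∀ n, Measurable (majorantTerm χ V₀ k f n s) := fun n =>
    (measurable_majorantTerm χ V₀ hk hf n).comp (measurable_const.prodMk measurable_id)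
  unfold majorant
  rw [absGain_tsum V₀ hk hPm]
  refine ENNReal.tsum_le_tsum fun n => lintegral_mono fun v => ?_
  rw [enorm_mul]
  exact mul_le_mul_right (enorm_duhamelTerm_le χ V₀ k f n s _) _

/-- Finiteness of the majorant at the single point `(t, z)` is enough: by `majorant_eq` it dominates
every sum and integral met in the exchange. -/
theorem mildSol_eq (hk : Measurable (Function.uncurry k)) (hf : Measurable f)
    {t : ℝ} {z : E d × E d} (h : majorant χ V₀ k f t z ≠ ⊤) :
    IntegrableOn (fun s => damping χ (t - s) z *
        gain V₀ k (mildSol χ V₀ k f s) (shift (-(t - s)) z)) (Ioc 0 t) ∧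
      mildSol χ V₀ k f t z = damping χ t z * f (shift (-t) z) +
        ∫ s in Ioc 0 t, damping χ (t - s) z *
          gain V₀ k (mildSol χ V₀ k f s) (shift (-(t - s)) z) := by
  have ha : Measurable fun s : ℝ => t - s := by fun_prop
  have hb : Measurable fun s : ℝ => shift (-(t - s)) z :=
    measurable_comp_shift measurable_id ha.neg measurable_const
  have hd : Measurable fun s : ℝ => damping χ (t - s) z := measurable_damping χ ha measurable_const
  have hP := majorant_eq χ V₀ hk hf t z
  have hfin : ∫⁻ s in Ioc 0 t, ‖damping χ (t - s) z‖ₑ *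
      absGain V₀ k (majorant χ V₀ k f s) (shift (-(t - s)) z).1 ≠ ⊤ :=
    ne_top_of_le_ne_top h (hP ▸ le_add_self)
  have hgm : Measurable fun s => absGain V₀ k (majorant χ V₀ k f s) (shift (-(t - s)) z).1 :=
    measurable_absGain V₀ hk (measurable_majorant χ V₀ hk hf) (measurable_fst.comp hb)
  -- The damping never vanishes, so the product can be finite only if the gain itself is.
  have hae : ∀ᵐ s ∂(volume.restrict (Ioc 0 t)),
      absGain V₀ k (majorant χ V₀ k f s) (shift (-(t - s)) z).1 ≠ ⊤ := by
    filter_upwards [ae_lt_top (hd.enorm.mul hgm) hfin] with s hs htop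
    rw [Pi.mul_apply, htop, ENNReal.mul_top] at hs
    · exact lt_irrefl _ hs
    · exact enorm_ne_zero.2 (damping_pos _ _ _).ne'
  have hnorm : ∀ s, ‖gain V₀ k (mildSol χ V₀ k f s) (shift (-(t - s)) z)‖ₑ ≤
      absGain V₀ k (majorant χ V₀ k f s) (shift (-(t - s)) z).1 := fun s =>
    enorm_gain_le V₀ k (fun z => enorm_mildSol_le χ V₀ k f s z) _
  constructor
  · refine ⟨(hd.mul (measurable_gain V₀ hk (measurable_mildSol χ V₀ hk hf)
      hb)).aestronglyMeasurable, ?_⟩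
    refine lt_of_le_of_lt (lintegral_mono fun s => ?_) (lt_top_iff_ne_top.2 hfin)
    rw [enorm_mul]
    exact mul_le_mul_right (hnorm s) _
  · have hsum : Summable fun n => duhamelTerm χ V₀ k f n t z := by
      have : Summable fun n => ‖duhamelTerm χ V₀ k f n t z‖ := by
        refine (ENNReal.summable_toReal (f := fun n => ‖duhamelTerm χ V₀ k f n t z‖ₑ)
          (ne_top_of_le_ne_top h (ENNReal.tsum_le_tsum fun n =>
          enorm_duhamelTerm_le χ V₀ k f n t z))).congr fun n => by simp
      exact this.of_norm
    rw [mildSol, hsum.tsum_eq_zero_add]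
    congr 1
    change ∑' n, (∫ s in Ioc 0 t, damping χ (t - s) z *
      gain V₀ k (duhamelTerm χ V₀ k f n s) (shift (-(t - s)) z)) = _
    rw [← integral_tsum]
    · refine integral_congr_ae ?_
      filter_upwards [hae] with s hs
      rw [gain_mildSol hk hf hs, tsum_mul_left]
    · exact fun n => (hd.mul (measurable_gain V₀ hk (measurable_duhamelTerm χ V₀ hk hf n)
        hb)).aestronglyMeasurable
    · refine ne_top_of_le_ne_top h ?_
      rw [majorant, tsum_eq_zero_add' (f := fun n => majorantTerm χ V₀ k f n t z)
        ENNReal.summable]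
      refine le_trans (ENNReal.tsum_le_tsum fun n => ?_)
        (le_add_self (a := ∑' n, majorantTerm χ V₀ k f (n + 1) t z))
      refine lintegral_mono fun s => ?_
      rw [enorm_mul]
      exact mul_le_mul_right (enorm_gain_le V₀ k
        (fun z => enorm_duhamelTerm_le χ V₀ k f n s z) _) _

end Duhamel

/-! ### Primitives of integrable functions -/

/-- On `[0, T]`, `a` is the primitive of the integrable function `a'`. -/
structure IsPrimitiveOn (T : ℝ) (a a' : ℝ → ℝ) : Prop where
  integrable : IntervalIntegrable a' volume 0 T
  eq : ∀ t ∈ Icc 0 T, a t = a 0 + ∫ s in (0 : ℝ)..t, a' s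

theorem IsPrimitiveOn.mono {T t : ℝ} {a a' : ℝ → ℝ} (h : IsPrimitiveOn T a a') (ht : t ∈ Icc 0 T) :
    IsPrimitiveOn t a a' :=
  ⟨h.integrable.mono_set (by
    rw [uIcc_of_le ht.1, uIcc_of_le (ht.1.trans ht.2)]; exact Icc_subset_Icc_right ht.2),
    fun s hs => h.eq s ⟨hs.1, hs.2.trans ht.2⟩⟩

theorem IsPrimitiveOn.congr {T : ℝ} {a a' b' : ℝ → ℝ} (h : IsPrimitiveOn T a a')
    (hT : 0 ≤ T) (hab : ∀ᵐ s ∂(volume.restrict (Ioc 0 T)), a' s = b' s) :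
    IsPrimitiveOn T a b' := by
  refine ⟨h.integrable.congr_ae (by rwa [uIoc_of_le hT]), fun t ht => ?_⟩
  rw [h.eq t ht, intervalIntegral.integral_of_le ht.1, intervalIntegral.integral_of_le ht.1]
  congr 1
  exact integral_congr_ae (ae_restrict_of_ae_restrict_of_subset (Ioc_subset_Ioc_right ht.2) hab)

/-- A countable exceptional set is allowed because `K` jumps when a characteristic crosses `x · v =
0`. -/
theorem IsPrimitiveOn.of_hasDerivAt {T : ℝ} {a a' : ℝ → ℝ} {s : Set ℝ} (hs : s.Countable)
    (hc : Continuous a) (hd : ∀ t, t ∉ s → HasDerivAt a (a' t) t)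
    (hi : IntervalIntegrable a' volume 0 T) : IsPrimitiveOn T a a' := by
  refine ⟨hi, fun t ht => ?_⟩
  have hi' : IntervalIntegrable a' volume 0 t := hi.mono_set (by
    rw [uIcc_of_le ht.1, uIcc_of_le (ht.1.trans ht.2)]; exact Icc_subset_Icc_right ht.2)
  rw [integral_eq_of_hasDerivAt_off_countable a a' hs hc.continuousOn
    (fun x hx => hd x hx.2) hi']
  ring

theorem absolutelyContinuousOnInterval_const_add_integral {T c : ℝ} {a' : ℝ → ℝ}
    (h : IntervalIntegrable a' volume 0 T) :
    AbsolutelyContinuousOnInterval (fun t => c + ∫ s in (0 : ℝ)..t, a' s) 0 T :=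
  AbsolutelyContinuousOnInterval.add (f := fun _ => c)
    (ContDiffOn.absolutelyContinuousOnInterval contDiffOn_const)
    (h.absolutelyContinuousOnInterval_intervalIntegral (by simp))

theorem ae_deriv_const_add_integral {T c : ℝ} {a' : ℝ → ℝ} (hT : 0 ≤ T)
    (h : IntervalIntegrable a' volume 0 T) :
    ∀ᵐ x ∂(volume.restrict (Ioc 0 T)), deriv (fun t => c + ∫ s in (0 : ℝ)..t, a' s) x = a' x := by
  rw [ae_restrict_iff' measurableSet_Ioc]
  filter_upwards [h.ae_hasDerivAt_integral] with x hx hxT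
  have hx' : x ∈ uIcc 0 T := by rw [uIcc_of_le hT]; exact Ioc_subset_Icc_self hxT
  exact ((hx hx' 0 (by simp)).const_add c).deriv

/-- Integration by parts for absolutely continuous functions. It is applied to `a 0 + ∫ a'`, since
`a` is only known to coincide with it on `[0, T]`. -/
theorem IsPrimitiveOn.mul {T : ℝ} {a a' b b' : ℝ → ℝ} (hT : 0 ≤ T)
    (ha : IsPrimitiveOn T a a') (hb : IsPrimitiveOn T b b') :
    IsPrimitiveOn T (fun t => a t * b t) (fun t => a' t * b t + a t * b' t) := by
  have hA := absolutelyContinuousOnInterval_const_add_integral (c := a 0) ha.integrable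
  have hB := absolutelyContinuousOnInterval_const_add_integral (c := b 0) hb.integrable
  have hcong : ∀ x ∈ Ioc 0 T, a' x * (b 0 + ∫ s in (0 : ℝ)..x, b' s) +
      (a 0 + ∫ s in (0 : ℝ)..x, a' s) * b' x = a' x * b x + a x * b' x := fun x hx => by
    rw [← ha.eq x (Ioc_subset_Icc_self hx), ← hb.eq x (Ioc_subset_Icc_self hx)]
  constructor
  · have h1 := (ha.integrable.mul_continuousOn hB.continuousOn).add
      (hb.integrable.continuousOn_mul hA.continuousOn)
    refine h1.congr_ae ?_
    rw [uIoc_of_le hT, EventuallyEq, ae_restrict_iff' measurableSet_Ioc]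
    exact Eventually.of_forall hcong
  · intro t ht
    have ha' := ha.mono ht
    have hb' := hb.mono ht
    have hA' := absolutelyContinuousOnInterval_const_add_integral (c := a 0) ha'.integrable
    have hB' := absolutelyContinuousOnInterval_const_add_integral (c := b 0) hb'.integrable
    have h := AbsolutelyContinuousOnInterval.integral_deriv_mul_eq_sub hA' hB'
    simp only [intervalIntegral.integral_same, add_zero] at h
    rw [← ha.eq t ht, ← hb.eq t ht] at h
    rw [← sub_eq_iff_eq_add', ← h, intervalIntegral.integral_of_le ht.1,
      intervalIntegral.integral_of_le ht.1]
    refine integral_congr_ae ?_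
    filter_upwards [ae_deriv_const_add_integral (c := a 0) ht.1 ha'.integrable,
      ae_deriv_const_add_integral (c := b 0) ht.1 hb'.integrable,
      ae_restrict_mem measurableSet_Ioc] with x h1 h2 hx
    rw [h1, h2]
    exact hcong x ⟨hx.1, hx.2.trans ht.2⟩

/-! ### The equation along the characteristics -/

/-- The integrating factor `exp (c ∫₀ᵗ K(x + s v, v) ds)`. -/
def gauge (χ c : ℝ) (z : E d × E d) (t : ℝ) : ℝ :=
  Real.exp (c * (t + χ * (crossing (shift t z) - crossing z)))

/-- Along a characteristic, the damping between the times `s` and `t` splits into a function of `t`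
times a function of `s`. This converts Duhamel's formula into a linear equation with an integrating
factor. -/
theorem damping_shift (χ s t : ℝ) (z : E d × E d) :
    damping χ (t - s) (shift t z) = gauge χ (-1) z t * gauge χ 1 z s := by
  unfold damping gauge
  rw [← Real.exp_add, shift_shift]
  congr 1
  have : t + -(t - s) = s := by ring
  rw [this]; ring

theorem gauge_zero (χ c : ℝ) (z : E d × E d) : gauge χ c z 0 = 1 := by simp [gauge]

theorem gauge_mul_gauge_neg (χ : ℝ) (z : E d × E d) (t : ℝ) :
    gauge χ (-1) z t * gauge χ 1 z t = 1 := by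
  rw [← damping_shift, sub_self, damping_zero]

theorem inner_shift (z : E d × E d) (t : ℝ) :
    inner ℝ (shift t z).1 z.2 = inner ℝ z.1 z.2 + t * ‖z.2‖ ^ 2 := by
  simp only [shift, inner_add_left, real_inner_smul_left, real_inner_self_eq_norm_sq]

theorem continuous_crossing_shift (z : E d × E d) : Continuous fun t => crossing (shift t z) := by
  simp only [crossing, shift_snd, inner_shift]
  fun_prop

theorem continuous_gauge (χ c : ℝ) (z : E d × E d) : Continuous (gauge χ c z) := by
  have := continuous_crossing_shift z
  unfold gauge
  fun_prop

theorem measurable_turningKernel (χ : ℝ) :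
    Measurable (Function.uncurry (turningKernel χ : E d → E d → ℝ)) := by
  have hs : Measurable Real.sign := by
    unfold Real.sign
    exact Measurable.ite measurableSet_Iio measurable_const
      (Measurable.ite measurableSet_Ioi measurable_const measurable_const)
  have hi : Measurable fun p : E d × E d => inner ℝ p.1 p.2 := by fun_prop
  unfold turningKernel
  exact measurable_const.add ((hs.comp hi).const_mul χ)

theorem abs_sign_le (r : ℝ) : |Real.sign r| ≤ 1 := by
  rcases Real.sign_apply_eq r with h | h | h <;> simp [h]

theorem turningKernel_mem {χ : ℝ} (hχ : 0 ≤ χ) (x v : E d) :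
    turningKernel χ x v ∈ Icc (1 - χ) (1 + χ) := by
  have := abs_le.1 (abs_sign_le (inner ℝ x v))
  unfold turningKernel
  constructor <;> nlinarith [this.1, this.2]

theorem gauge_isPrimitiveOn {χ : ℝ} (hχ : 0 ≤ χ) (c : ℝ) (z : E d × E d) (T : ℝ) :
    IsPrimitiveOn T (gauge χ c z)
      (fun s => c * turningKernel χ (shift s z).1 (shift s z).2 * gauge χ c z s) := by
  have hKm : Measurable fun s : ℝ => turningKernel χ (shift s z).1 (shift s z).2 :=
    measurable_comp_shift (measurable_turningKernel χ) measurable_id measurable_const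
  -- A moving particle crosses `x · v = 0` at one time at most. For `v = 0`, division by zero makes
  -- the crossing time constantly `0`, in agreement with `sign 0 = 0`.
  refine IsPrimitiveOn.of_hasDerivAt (s := {t | z.2 ≠ 0 ∧ inner ℝ z.1 z.2 + t * ‖z.2‖ ^ 2 = 0})
    ?_ (continuous_gauge χ c z) ?_ ?_
  · refine Set.Subsingleton.countable ?_
    rintro s ⟨hv, hs⟩ t ⟨-, ht⟩
    have hv2 : ‖z.2‖ ^ 2 ≠ 0 := by positivity
    exact mul_right_cancel₀ hv2 (by linarith)
  · intro t ht
    have key : HasDerivAt (fun t => crossing (shift t z))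
        (Real.sign (inner ℝ (shift t z).1 (shift t z).2)) t := by
      by_cases hv : z.2 = 0
      · simp only [crossing, shift, hv, inner_zero_right, Real.sign_zero]
        simpa using hasDerivAt_const t (0 : ℝ)
      have hv2 : ‖z.2‖ ^ 2 ≠ 0 := by positivity
      have hne : inner ℝ z.1 z.2 + t * ‖z.2‖ ^ 2 ≠ 0 := fun h => ht ⟨hv, h⟩
      simp only [crossing, shift_snd, inner_shift]
      have h1 : HasDerivAt (fun t : ℝ => inner ℝ z.1 z.2 + t * ‖z.2‖ ^ 2) (‖z.2‖ ^ 2) t := by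
        simpa using ((hasDerivAt_id t).mul_const (‖z.2‖ ^ 2)).const_add (inner ℝ z.1 z.2)
      rcases hne.lt_or_gt with h | h
      · have h2 := ((hasDerivAt_abs_neg h).comp t h1).div_const (‖z.2‖ ^ 2)
        exact h2.congr_deriv (by rw [Real.sign_of_neg h, mul_div_cancel_right₀ _ hv2])
      · have h2 := ((hasDerivAt_abs_pos h).comp t h1).div_const (‖z.2‖ ^ 2)
        exact h2.congr_deriv (by rw [Real.sign_of_pos h, mul_div_cancel_right₀ _ hv2])
    have h3 := (((hasDerivAt_id t).add
      ((key.sub_const (crossing z)).const_mul χ)).const_mul c).exp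
    refine h3.congr_deriv ?_
    simp only [turningKernel, gauge, id, Pi.add_apply]
    ring
  · refine (intervalIntegrable_const (c := |c| * (1 + χ))).mul_continuousOn
      (continuous_gauge χ c z).continuousOn |>.mono_fun ?_ ?_
    · exact ((hKm.const_mul c).mul (continuous_gauge χ c z).measurable).aestronglyMeasurable
    · refine Eventually.of_forall fun s => ?_
      have hK := turningKernel_mem hχ (shift s z).1 (shift s z).2
      simp only [norm_mul, Real.norm_eq_abs, abs_abs]
      have hK' : |turningKernel χ (shift s z).1 (shift s z).2| ≤ |1 + χ| := by
        rw [abs_of_nonneg (by linarith : (0 : ℝ) ≤ 1 + χ), abs_le]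
        constructor <;> linarith [hK.1, hK.2]
      gcongr

section Characteristics

variable {χ V₀ : ℝ} {k : E d → E d → ℝ} {f : E d × E d → ℝ}

theorem mildSol_zero (χ V₀ : ℝ) (k : E d → E d → ℝ) (f : E d × E d → ℝ) (z : E d × E d) :
    mildSol χ V₀ k f 0 z = f z := by
  unfold mildSol
  rw [tsum_eq_single 0]
  · simp [duhamelTerm, damping_zero]
  · intro n hn
    obtain ⟨n, rfl⟩ := Nat.exists_eq_succ_of_ne_zero hn
    simp [duhamelTerm]

/-- The Duhamel equation for the majorant, along the characteristics. -/
theorem majorant_shift (hk : Measurable (Function.uncurry k)) (hf : Measurable f) (t : ℝ)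
    (z : E d × E d) :
    majorant χ V₀ k f t (shift t z) = ‖gauge χ (-1) z t‖ₑ * (‖f z‖ₑ +
      ∫⁻ s in Ioc 0 t, ‖gauge χ 1 z s‖ₑ * absGain V₀ k (majorant χ V₀ k f s) (shift s z).1) := by
  have h0 : damping χ t (shift t z) = gauge χ (-1) z t := by
    have := damping_shift χ 0 t z
    rwa [sub_zero, gauge_zero, mul_one] at this
  rw [majorant_eq χ V₀ hk hf, shift_neg_shift, h0, mul_add]
  congr 1
  rw [← lintegral_const_mul']
  · refine lintegral_congr fun s => ?_
    rw [damping_shift, enorm_mul, shift_shift, mul_assoc]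
    congr 4
    ring_nf
  · exact enorm_ne_top

/-- In `majorant_shift` the second factor increases with time and the first is finite and nonzero.
Hence finiteness at the final time propagates to all earlier times of the same characteristic. -/
theorem majorant_shift_ne_top (hk : Measurable (Function.uncurry k)) (hf : Measurable f) {t T : ℝ}
    (htT : t ≤ T) {z : E d × E d} (h : majorant χ V₀ k f T (shift T z) ≠ ⊤) :
    majorant χ V₀ k f t (shift t z) ≠ ⊤ := by
  rw [majorant_shift hk hf] at h ⊢
  have hg : ‖gauge χ (-1) z T‖ₑ ≠ 0 := enorm_ne_zero.2 (Real.exp_pos _).ne'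
  have h1 : ‖f z‖ₑ + ∫⁻ s in Ioc 0 T, ‖gauge χ 1 z s‖ₑ *
      absGain V₀ k (majorant χ V₀ k f s) (shift s z).1 ≠ ⊤ := fun htop => by
    rw [htop, ENNReal.mul_top hg] at h
    exact h rfl
  refine ENNReal.mul_ne_top enorm_ne_top (ne_top_of_le_ne_top h1 ?_)
  exact add_le_add_right (lintegral_mono_set (Ioc_subset_Ioc_right htT)) _

/-- Along almost every characteristic, the mild solution is a primitive of the right-hand side of
the equation. -/
theorem mildSol_isPrimitiveOn (hχ : 0 ≤ χ) (hk : Measurable (Function.uncurry k))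
    (hf : Measurable f) {T : ℝ} (hT : 0 ≤ T) {z : E d × E d}
    (h : majorant χ V₀ k f T (shift T z) ≠ ⊤) :
    IsPrimitiveOn T (fun t => mildSol χ V₀ k f t (shift t z)) (fun s =>
      -turningKernel χ (shift s z).1 (shift s z).2 * mildSol χ V₀ k f s (shift s z) +
        gain V₀ k (mildSol χ V₀ k f s) (shift s z)) := by
  set g : ℝ → ℝ := fun s => gain V₀ k (mildSol χ V₀ k f s) (shift s z) with hg
  have heq : ∀ t ≤ T, IntegrableOn (fun s => gauge χ (-1) z t * (gauge χ 1 z s * g s)) (Ioc 0 t) ∧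
      mildSol χ V₀ k f t (shift t z) = gauge χ (-1) z t * (f z +
        ∫ s in Ioc 0 t, gauge χ 1 z s * g s) := by
    intro t ht
    have hcong : ∀ s, damping χ (t - s) (shift t z) *
        gain V₀ k (mildSol χ V₀ k f s) (shift (-(t - s)) (shift t z)) =
        gauge χ (-1) z t * (gauge χ 1 z s * g s) := fun s => by
      rw [damping_shift, shift_shift, mul_assoc, hg]
      congr 4
      ring_nf
    have h0 : damping χ t (shift t z) = gauge χ (-1) z t := by
      have := damping_shift χ 0 t z
      rwa [sub_zero, gauge_zero, mul_one] at this
    obtain ⟨h1, h2⟩ := mildSol_eq hk hf (majorant_shift_ne_top hk hf ht h)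
    simp only [hcong] at h1 h2
    refine ⟨h1, ?_⟩
    rw [h2, shift_neg_shift, h0, integral_const_mul, mul_add]
  have hint : IntervalIntegrable (fun s => gauge χ 1 z s * g s) volume 0 T := by
    rw [intervalIntegrable_iff_integrableOn_Ioc_of_le hT]
    have h1 := (heq T le_rfl).1.const_mul (gauge χ 1 z T)
    refine h1.congr (Eventually.of_forall fun s => ?_)
    simp only
    rw [← mul_assoc, mul_comm (gauge χ 1 z T), gauge_mul_gauge_neg, one_mul]
  have hY : IsPrimitiveOn T (fun t => f z + ∫ s in (0 : ℝ)..t, gauge χ 1 z s * g s)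
      (fun s => gauge χ 1 z s * g s) := ⟨hint, fun t _ => by simp⟩
  -- By `damping_shift`, the solution along the characteristic is the integrating factor times a
  -- primitive. The product rule yields the loss term from the first factor and the gain from the
  -- second.
  have hprod := (gauge_isPrimitiveOn hχ (-1) z T).mul hT hY
  have hval : ∀ t ∈ Icc 0 T, mildSol χ V₀ k f t (shift t z) = gauge χ (-1) z t *
      (f z + ∫ s in (0 : ℝ)..t, gauge χ 1 z s * g s) := fun t ht => by
    rw [(heq t ht.2).2, intervalIntegral.integral_of_le ht.1]
  have hp2 := hprod.congr hT (b' := fun s =>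
      -turningKernel χ (shift s z).1 (shift s z).2 * mildSol χ V₀ k f s (shift s z) + g s) (by
    filter_upwards [ae_restrict_mem measurableSet_Ioc] with s hs
    rw [hval s (Ioc_subset_Icc_self hs), ← mul_assoc, gauge_mul_gauge_neg]
    ring)
  refine ⟨hp2.integrable, fun t ht => ?_⟩
  rw [hval t ht, hp2.eq t ht]
  simp [mildSol_zero, gauge_zero, hg]

end Characteristics

/-! ### The mild solution is a trajectory -/

/-- The right-hand side of the equation without the transport term. -/
def collision (χ V₀ : ℝ) (k : E d → E d → ℝ) (u : E d × E d → ℝ) (z : E d × E d) : ℝ :=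
  -turningKernel χ z.1 z.2 * u z + gain V₀ k u z

theorem lintegral_absGain_le {V₀ : ℝ} {C : ℝ≥0} {k : E d → E d → ℝ}
    (hV : volume (velocitySet d V₀) = 1) (hk : IsBoundedKernel V₀ C k)
    {P : E d × E d → ℝ≥0∞} (hP : Measurable P) :
    ∫⁻ z, absGain V₀ k P z.1 ∂(phaseMeasure d V₀) ≤ C * ∫⁻ z, P z ∂(phaseMeasure d V₀) := by
  have hm : Measurable (absGain V₀ k P) :=
    measurable_absGain V₀ hk.measurable (P := fun _ : E d => P) (hP.comp measurable_snd)
      measurable_id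
  rw [lintegral_phaseMeasure_fst hV hm, lintegral_phaseMeasure V₀ hP,
    ← lintegral_const_mul _ hP.lintegral_prod_right']
  refine lintegral_mono fun x => ?_
  simpa using absGain_pow_le hV hk (Or.inl rfl) hP x

theorem enorm_turningKernel_le {χ : ℝ} (hχ : χ ∈ Ioo (0 : ℝ) 1) (x v : E d) :
    ‖turningKernel χ x v‖ₑ ≤ 2 := by
  have h := turningKernel_mem hχ.1.le x v
  rw [Real.enorm_of_nonneg (by linarith [h.1, hχ.2])]
  have : (2 : ℝ≥0∞) = ENNReal.ofReal 2 := by norm_num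
  rw [this]
  exact ENNReal.ofReal_le_ofReal (by linarith [h.2, hχ.2])

theorem measurable_collision (χ V₀ : ℝ) {α : Type*} [MeasurableSpace α] {k : E d → E d → ℝ}
    (hk : Measurable (Function.uncurry k)) {u : α → E d × E d → ℝ}
    (hu : Measurable (Function.uncurry u)) {x : α → E d × E d} (hx : Measurable x) :
    Measurable fun p => collision χ V₀ k (u p) (x p) := by
  have h1 : Measurable fun p => turningKernel χ (x p).1 (x p).2 :=
    (measurable_turningKernel χ).comp hx
  have h2 : Measurable fun p => u p (x p) := hu.comp (measurable_id.prodMk hx)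
  exact (h1.neg.mul h2).add (measurable_gain V₀ hk hu hx)

theorem enorm_collision_le {χ : ℝ} (hχ : χ ∈ Ioo (0 : ℝ) 1) (V₀ : ℝ) (k : E d → E d → ℝ)
    {u : E d × E d → ℝ} {P : E d × E d → ℝ≥0∞} (h : ∀ z, ‖u z‖ₑ ≤ P z) (z : E d × E d) :
    ‖collision χ V₀ k u z‖ₑ ≤ 2 * P z + absGain V₀ k P z.1 := by
  unfold collision
  refine (enorm_add_le _ _).trans (add_le_add ?_ (enorm_gain_le V₀ k h z))
  rw [enorm_mul, enorm_neg]
  exact mul_le_mul' (enorm_turningKernel_le hχ _ _) (h z)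

theorem IsFlowWeight.one (V₀ : ℝ) : IsFlowWeight (d := d) V₀ 0 (fun _ => 1) :=
  ⟨measurable_const, le_rfl, by simp⟩

theorem hasDerivAt_comp_shift {φ : E d × E d → ℝ} (hφ : Differentiable ℝ φ) (z : E d × E d)
    (t : ℝ) : HasDerivAt (fun t => φ (shift t z)) (fderiv ℝ φ (shift t z) (z.2, 0)) t := by
  have h1 : HasDerivAt (fun t => shift t z) ((z.2, 0) : E d × E d) t := by
    have : HasDerivAt (fun t : ℝ => z.1 + t • z.2) z.2 t := by
      simpa using ((hasDerivAt_id t).smul_const z.2).const_add z.1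
    exact this.prodMk (hasDerivAt_const t z.2)
  exact (hφ _).hasFDerivAt.comp_hasDerivAt t h1

section Trajectory

variable {χ V₀ : ℝ} {C : ℝ≥0} {k : E d → E d → ℝ} {f : E d × E d → ℝ}

theorem exists_lintegral_majorant_one_le (hV : volume (velocitySet d V₀) = 1)
    (hχ : χ ∈ Ioo (0 : ℝ) 1) (hk : IsBoundedKernel V₀ C k) (hf : Measurable f)
    (hf1 : ∫⁻ z, ‖f z‖ₑ ∂(phaseMeasure d V₀) ≠ ⊤) (T : ℝ) :
    ∃ M : ℝ≥0, ∀ t ∈ Icc 0 T, ∫⁻ z, majorant χ V₀ k f t z ∂(phaseMeasure d V₀) ≤ M := by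
  obtain ⟨M, hM⟩ := exists_lintegral_majorant_le hV hχ hk hf (Or.inl rfl)
    (IsFlowWeight.one V₀) T
  refine ⟨M * (∫⁻ z, ‖f z‖ₑ ∂(phaseMeasure d V₀)).toNNReal, fun t ht => ?_⟩
  have := hM t ht
  simp only [one_mul, pow_one] at this
  refine this.trans_eq ?_
  rw [ENNReal.coe_mul, ENNReal.coe_toNNReal hf1]

theorem ae_majorant_shift_ne_top (hk : Measurable (Function.uncurry k)) (hf : Measurable f)
    {T : ℝ} (hP : ∫⁻ z, majorant χ V₀ k f T z ∂(phaseMeasure d V₀) ≠ ⊤) :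
    ∀ᵐ z ∂(phaseMeasure d V₀), majorant χ V₀ k f T (shift T z) ≠ ⊤ := by
  have hm : Measurable (majorant χ V₀ k f T) :=
    (measurable_majorant χ V₀ hk hf).comp (measurable_const.prodMk measurable_id)
  filter_upwards [ae_lt_top (f := fun z => majorant χ V₀ k f T (shift T z))
    (hm.comp (measurable_shift T)) (by rwa [lintegral_shift V₀ T _ hm])] with z hz
  exact hz.ne

theorem measurable_collision_mildSol_shift (hk : Measurable (Function.uncurry k))
    (hf : Measurable f) :
    Measurable fun q : (E d × E d) × ℝ =>
      collision χ V₀ k (mildSol χ V₀ k f q.2) (shift q.2 q.1) :=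
  measurable_collision χ V₀ hk (u := fun q : (E d × E d) × ℝ => mildSol χ V₀ k f q.2)
    ((measurable_mildSol χ V₀ hk hf).comp
      ((measurable_snd.comp measurable_fst).prodMk measurable_snd))
    (measurable_comp_shift measurable_id measurable_snd measurable_fst)

theorem lintegral_collision_mildSol_le (hV : volume (velocitySet d V₀) = 1)
    (hχ : χ ∈ Ioo (0 : ℝ) 1) (hk : IsBoundedKernel V₀ C k) (hf : Measurable f) {t : ℝ} {M : ℝ≥0}
    (hM : ∫⁻ z, majorant χ V₀ k f t z ∂(phaseMeasure d V₀) ≤ M) :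
    ∫⁻ z, ‖collision χ V₀ k (mildSol χ V₀ k f t) z‖ₑ ∂(phaseMeasure d V₀) ≤
      (2 + C) * M := by
  have hm : Measurable (majorant χ V₀ k f t) :=
    (measurable_majorant χ V₀ hk.measurable hf).comp (measurable_const.prodMk measurable_id)
  calc _ ≤ ∫⁻ z, (2 * majorant χ V₀ k f t z + absGain V₀ k (majorant χ V₀ k f t) z.1)
        ∂(phaseMeasure d V₀) := lintegral_mono fun z =>
          enorm_collision_le hχ V₀ k (fun z => enorm_mildSol_le χ V₀ k f t z) z
    _ = 2 * (∫⁻ z, majorant χ V₀ k f t z ∂(phaseMeasure d V₀)) +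
        ∫⁻ z, absGain V₀ k (majorant χ V₀ k f t) z.1 ∂(phaseMeasure d V₀) := by
        rw [lintegral_add_left (hm.const_mul 2), lintegral_const_mul _ hm]
    _ ≤ 2 * M + C * M := add_le_add (mul_le_mul_right hM _)
        ((lintegral_absGain_le hV hk hm).trans (mul_le_mul_right hM _))
    _ = _ := by ring

/-- Once transport is undone, the solution is a primitive in time of the collision term, which is
bounded in `L¹` uniformly on `[0, T]`. -/
theorem lintegral_mildSol_shift_sub_le (hV : volume (velocitySet d V₀) = 1)
    (hχ : χ ∈ Ioo (0 : ℝ) 1) (hk : IsBoundedKernel V₀ C k) (hf : Measurable f) {T : ℝ} {M : ℝ≥0}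
    (hM : ∀ t ∈ Icc 0 T, ∫⁻ z, majorant χ V₀ k f t z ∂(phaseMeasure d V₀) ≤ M)
    {s t : ℝ} (hs : s ∈ Icc 0 T) (ht : t ∈ Icc 0 T) :
    ∫⁻ z, ‖mildSol χ V₀ k f s (shift s z) - mildSol χ V₀ k f t (shift t z)‖ₑ
      ∂(phaseMeasure d V₀) ≤ (2 + C) * M * ENNReal.ofReal |s - t| := by
  have hT : 0 ≤ T := hs.1.trans hs.2
  have hFm := measurable_collision_mildSol_shift (χ := χ) (V₀ := V₀) hk.measurable hf
  have hae := ae_majorant_shift_ne_top hk.measurable hf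
    (ne_top_of_le_ne_top ENNReal.coe_ne_top (hM T ⟨hT, le_rfl⟩))
  calc _ ≤ ∫⁻ z, (∫⁻ r in uIoc t s, ‖collision χ V₀ k (mildSol χ V₀ k f r) (shift r z)‖ₑ)
        ∂(phaseMeasure d V₀) := by
        refine lintegral_mono_ae ?_
        filter_upwards [hae] with z hz
        have hp := mildSol_isPrimitiveOn hχ.1.le hk.measurable hf hT hz
        have hsub : ∀ r ∈ Icc 0 T, uIcc 0 r ⊆ uIcc 0 T := fun r hr => by
          rw [uIcc_of_le hr.1, uIcc_of_le hT]; exact Icc_subset_Icc_right hr.2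
        have h1 := hp.eq s hs
        have h2 := hp.eq t ht
        rw [h1, h2, add_sub_add_left_eq_sub, intervalIntegral.integral_interval_sub_left
          (hp.integrable.mono_set (hsub s hs)) (hp.integrable.mono_set (hsub t ht))]
        rw [← ofReal_norm, intervalIntegral.norm_integral_eq_norm_integral_uIoc, ofReal_norm]
        exact enorm_integral_le_lintegral_enorm _
    _ = ∫⁻ r in uIoc t s, ∫⁻ z, ‖collision χ V₀ k (mildSol χ V₀ k f r) (shift r z)‖ₑ
        ∂(phaseMeasure d V₀) := lintegral_lintegral_swap hFm.enorm.aemeasurable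
    _ ≤ ∫⁻ _ in uIoc t s, (2 + C) * M := by
        refine setLIntegral_mono' measurableSet_uIoc fun r hr => ?_
        have hr' : r ∈ Icc 0 T := by
          rcases mem_uIoc.1 hr with h | h
          · exact ⟨ht.1.trans h.1.le, h.2.trans hs.2⟩
          · exact ⟨hs.1.trans h.1.le, h.2.trans ht.2⟩
        have hm : Measurable (collision χ V₀ k (mildSol χ V₀ k f r)) :=
          measurable_collision χ V₀ hk.measurable (u := fun _ : E d × E d => mildSol χ V₀ k f r)
            ((measurable_mildSol χ V₀ hk.measurable hf).comp
              (measurable_const.prodMk measurable_snd)) measurable_id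
        rw [lintegral_shift V₀ r _ hm.enorm]
        exact lintegral_collision_mildSol_le hV hχ hk hf (hM r hr')
    _ = _ := by
        rw [setLIntegral_const, Real.volume_uIoc]

/-- Strong continuity in `L¹` of composition with measure-preserving maps that depend continuously
on a parameter. -/
theorem tendsto_lintegral_comp_shift_sub {g : E d × E d → ℝ} (hg : Measurable g)
    (hg1 : ∫⁻ z, ‖g z‖ₑ ∂(phaseMeasure d V₀) ≠ ⊤) (t : ℝ) :
    Tendsto (fun s => ∫⁻ z, ‖g (shift s z) - g (shift t z)‖ₑ ∂(phaseMeasure d V₀)) (𝓝 t)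
      (𝓝 0) := by
  have hgL : MemLp g 1 (phaseMeasure d V₀) :=
    memLp_one_iff_integrable.2 ⟨hg.aestronglyMeasurable, lt_top_iff_ne_top.2 hg1⟩
  have : IsLocallyFiniteMeasure (phaseMeasure d V₀) := by unfold phaseMeasure; infer_instance
  have hcont : Continuous fun s : ℝ =>
      (⟨shift s, by unfold shift; fun_prop⟩ : C(E d × E d, E d × E d)) :=
    ContinuousMap.continuous_of_continuous_uncurry _ continuous_shift_uncurry
  have h := ContinuousAt.compMeasurePreservingLp (f := fun _ : ℝ => hgL.toLp g) (z := t)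
    continuousAt_const hcont.continuousAt (fun s => measurePreserving_shift V₀ s) ENNReal.one_ne_top
  have h2 := tendsto_iff_edist_tendsto_0.1 h
  refine h2.congr fun s => ?_
  simp only
  rw [Lp.toLp_compMeasurePreserving, Lp.toLp_compMeasurePreserving, Lp.edist_toLp_toLp,
    eLpNorm_one_eq_lintegral_enorm]
  rfl

theorem exists_bound_of_continuous_hasCompactSupport {g : E d × E d → ℝ} (hg : Continuous g)
    (hc : HasCompactSupport g) : ∃ B : ℝ≥0, ∀ z, ‖g z‖ₑ ≤ B := by
  obtain ⟨B, hB⟩ := hc.exists_bound_of_continuous hg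
  refine ⟨B.toNNReal, fun z => ?_⟩
  rw [← ofReal_norm]
  exact ENNReal.ofReal_le_ofReal (hB z)

/-- The derivative of a test function along the free transport flow. -/
def transportDeriv (φ : E d × E d → ℝ) (z : E d × E d) : ℝ := fderiv ℝ φ z (z.2, 0)

theorem IsTestFunction.continuous_transportDeriv {φ : E d × E d → ℝ} (hφ : IsTestFunction V₀ φ) :
    Continuous (transportDeriv φ) := by
  have h := hφ.smooth.continuous_fderiv one_ne_zero
  unfold transportDeriv
  exact h.clm_apply (continuous_snd.prodMk continuous_const)

theorem IsTestFunction.hasCompactSupport_transportDeriv {φ : E d × E d → ℝ}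
    (hφ : IsTestFunction V₀ φ) : HasCompactSupport (transportDeriv φ) := by
  refine (hφ.compact.fderiv ℝ).mono' (subset_trans ?_ subset_closure)
  intro z hz h0
  refine hz ?_
  simp only [transportDeriv]
  rw [h0]; simp

/-- Time continuity combines the Lipschitz bound along the flow with the continuity of the flow in
`L¹`. For the weak formulation, the product of solution and test function is differentiated along
each characteristic, integrated over phase space, and the flow is undone by invariance of the
measure. -/
theorem mildSol_isTrajectory (hV : volume (velocitySet d V₀) = 1)
    (hχ : χ ∈ Ioo (0 : ℝ) 1) (hk : IsBoundedKernel V₀ C k) (hf : Measurable f)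
    (hf1 : ∫⁻ z, ‖f z‖ₑ ∂(phaseMeasure d V₀) ≠ ⊤) {N : (E d × E d → ℝ) → ℝ≥0∞}
    (hN : ∀ T, ∃ M : ℝ≥0, ∀ t ∈ Icc 0 T, N (mildSol χ V₀ k f t) ≤ M) :
    IsTrajectory χ V₀ k N f (mildSol χ V₀ k f) := by
  have hum := measurable_mildSol χ V₀ hk.measurable hf
  have hut : ∀ t, Measurable (mildSol χ V₀ k f t) := fun t =>
    hum.comp (measurable_const.prodMk measurable_id)
  have hbd := exists_lintegral_majorant_one_le hV hχ hk hf hf1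
  refine ⟨fun t _ => (hut t).aestronglyMeasurable, hN, fun ρ t ht => ?_,
    Eventually.of_forall fun z => mildSol_zero χ V₀ k f z, fun φ hφ t ht => ?_⟩
  · obtain ⟨M, hM⟩ := hbd (t + 1)
    have ht' : t ∈ Icc 0 (t + 1) := ⟨ht, by linarith⟩
    have hu1 : ∫⁻ z, ‖mildSol χ V₀ k f t z‖ₑ ∂(phaseMeasure d V₀) ≠ ⊤ :=
      ne_top_of_le_ne_top ENNReal.coe_ne_top ((lintegral_mono fun z =>
        enorm_mildSol_le χ V₀ k f t z).trans (hM t ht'))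
    have hlim : Tendsto (fun s => (2 + C) * M * ENNReal.ofReal |s - t| +
        ∫⁻ z, ‖mildSol χ V₀ k f t (shift s z) - mildSol χ V₀ k f t (shift t z)‖ₑ
          ∂(phaseMeasure d V₀)) (𝓝[Ici 0] t) (𝓝 0) := by
      have h1 : Tendsto (fun s => ((2 + C) * M : ℝ≥0∞) * ENNReal.ofReal |s - t|) (𝓝 t) (𝓝 0) := by
        have : Tendsto (fun s => ENNReal.ofReal |s - t|) (𝓝 t) (𝓝 0) := by
          have hc : Continuous fun s : ℝ => ENNReal.ofReal |s - t| :=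
            ENNReal.continuous_ofReal.comp (by fun_prop)
          simpa using hc.tendsto t
        simpa using ENNReal.Tendsto.const_mul (a := ((2 + C) * M : ℝ≥0∞)) this
          (Or.inr (by finiteness))
      have h2 := h1.add (tendsto_lintegral_comp_shift_sub (V₀ := V₀) (hut t) hu1 t)
      rw [add_zero] at h2
      exact h2.mono_left nhdsWithin_le_nhds
    refine tendsto_of_tendsto_of_tendsto_of_le_of_le' tendsto_const_nhds hlim
      (Eventually.of_forall fun _ => zero_le) ?_
    have hev : ∀ᶠ s in 𝓝[Ici 0] t, s ∈ Icc 0 (t + 1) := by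
      filter_upwards [self_mem_nhdsWithin,
        mem_nhdsWithin_of_mem_nhds (Iio_mem_nhds (by linarith : t < t + 1))] with s h1 h2
      exact ⟨h1, h2.le⟩
    filter_upwards [hev] with s hs
    refine (setLIntegral_le_lintegral _ _).trans ?_
    have hm1 : Measurable fun z => ‖mildSol χ V₀ k f s z - mildSol χ V₀ k f t z‖ₑ :=
      ((hut s).sub (hut t)).enorm
    have hm2 : Measurable fun z =>
        ‖mildSol χ V₀ k f s (shift s z) - mildSol χ V₀ k f t (shift t z)‖ₑ :=
      (((hut s).comp (measurable_shift s)).sub ((hut t).comp (measurable_shift t))).enorm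
    rw [← lintegral_shift V₀ s _ hm1]
    refine le_trans (lintegral_mono fun z => ?_) ((lintegral_add_left hm2 fun z =>
      ‖mildSol χ V₀ k f t (shift s z) - mildSol χ V₀ k f t (shift t z)‖ₑ).trans_le
      (add_le_add_left (lintegral_mildSol_shift_sub_le hV hχ hk hf hM hs ht') _))
    rw [enorm_sub_rev (mildSol χ V₀ k f t (shift s z))]
    refine le_trans (le_of_eq ?_) (enorm_add_le _ _)
    congr 1; ring
  · obtain ⟨M, hM⟩ := hbd t
    obtain ⟨B, hB⟩ := exists_bound_of_continuous_hasCompactSupport hφ.smooth.continuous hφ.compact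
    obtain ⟨B', hB'⟩ := exists_bound_of_continuous_hasCompactSupport hφ.continuous_transportDeriv
      hφ.hasCompactSupport_transportDeriv
    have hφm := hφ.smooth.continuous.measurable
    have hφm' := hφ.continuous_transportDeriv.measurable
    have hu : ∀ s ∈ Icc 0 t, ∫⁻ z, ‖mildSol χ V₀ k f s z‖ₑ ∂(phaseMeasure d V₀) ≤ M :=
      fun s hs => (lintegral_mono fun z => enorm_mildSol_le χ V₀ k f s z).trans (hM s hs)
    have hFm : ∀ s, Measurable (collision χ V₀ k (mildSol χ V₀ k f s)) := fun s =>
      measurable_collision χ V₀ hk.measurable (u := fun _ : E d × E d => mildSol χ V₀ k f s)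
        (hum.comp (measurable_const.prodMk measurable_snd)) measurable_id
    have hF : ∀ s ∈ Icc 0 t, ∫⁻ z, ‖collision χ V₀ k (mildSol χ V₀ k f s) z‖ₑ
        ∂(phaseMeasure d V₀) ≤ (2 + C) * M := fun s hs =>
      lintegral_collision_mildSol_le hV hχ hk hf (hM s hs)
    have hi1 : ∀ s ∈ Icc 0 t, Integrable
        (fun z => mildSol χ V₀ k f s z * transportDeriv φ z) (phaseMeasure d V₀) := fun s hs => by
      refine ⟨((hut s).mul hφm').aestronglyMeasurable, ?_⟩
      refine lt_of_le_of_lt (lintegral_mono fun z => ?_) (lt_of_le_of_lt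
        ((lintegral_mul_const B' (hut s).enorm).trans_le (mul_le_mul_left (hu s hs) _))
        (by finiteness))
      rw [enorm_mul]; exact mul_le_mul_right (hB' z) _
    have hi2 : ∀ s ∈ Icc 0 t, Integrable
        (fun z => collision χ V₀ k (mildSol χ V₀ k f s) z * φ z) (phaseMeasure d V₀) :=
      fun s hs => by
      refine ⟨((hFm s).mul hφm).aestronglyMeasurable, ?_⟩
      refine lt_of_le_of_lt (lintegral_mono fun z => ?_) (lt_of_le_of_lt
        ((lintegral_mul_const B (hFm s).enorm).trans_le (mul_le_mul_left (hF s hs) _))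
        (by finiteness))
      rw [enorm_mul]; exact mul_le_mul_right (hB z) _
    have hif : Integrable (fun z => f z * φ z) (phaseMeasure d V₀) := by
      refine ⟨(hf.mul hφm).aestronglyMeasurable, ?_⟩
      refine lt_of_le_of_lt (lintegral_mono fun z => ?_) (lt_of_le_of_lt
        (lintegral_mul_const B hf.enorm).le (ENNReal.mul_lt_top (lt_top_iff_ne_top.2 hf1)
        ENNReal.coe_lt_top))
      rw [enorm_mul]; exact mul_le_mul_right (hB z) _
    set G : E d × E d → ℝ → ℝ := fun z s =>
      collision χ V₀ k (mildSol χ V₀ k f s) (shift s z) * φ (shift s z) +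
        mildSol χ V₀ k f s (shift s z) * transportDeriv φ (shift s z) with hG
    have hshm : Measurable fun q : (E d × E d) × ℝ => shift q.2 q.1 :=
      measurable_comp_shift measurable_id measurable_snd measurable_fst
    have hGm : Measurable (Function.uncurry G) :=
      ((measurable_collision_mildSol_shift hk.measurable hf).mul (hφm.comp hshm)).add
        ((hum.comp (measurable_snd.prodMk hshm)).mul (hφm'.comp hshm))
    have hGi : Integrable (Function.uncurry G)
        ((phaseMeasure d V₀).prod (volume.restrict (Ioc 0 t))) := by
      refine ⟨hGm.aestronglyMeasurable, ?_⟩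
      rw [HasFiniteIntegral, lintegral_prod_symm _ hGm.enorm.aemeasurable]
      refine lt_of_le_of_lt (setLIntegral_mono' (g := fun _ => (2 + C) * M * B + M * B')
        measurableSet_Ioc fun s hs => ?_) ?_
      · have hs' := Ioc_subset_Icc_self hs
        have e1 : ∫⁻ z, ‖collision χ V₀ k (mildSol χ V₀ k f s) z * φ z‖ₑ ∂(phaseMeasure d V₀) ≤
            (2 + C) * M * B := by
          refine (lintegral_mono fun z => ?_).trans
            ((lintegral_mul_const (B : ℝ≥0∞) (hFm s).enorm).trans_le (mul_le_mul_left (hF s hs') _))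
          rw [enorm_mul]; exact mul_le_mul_right (hB z) _
        have e2 : ∫⁻ z, ‖mildSol χ V₀ k f s z * transportDeriv φ z‖ₑ ∂(phaseMeasure d V₀) ≤
            M * B' := by
          refine (lintegral_mono fun z => ?_).trans
            ((lintegral_mul_const (B' : ℝ≥0∞) (hut s).enorm).trans_le (mul_le_mul_left (hu s hs') _))
          rw [enorm_mul]; exact mul_le_mul_right (hB' z) _
        have hms : Measurable fun z => ‖collision χ V₀ k (mildSol χ V₀ k f s) z * φ z +
            mildSol χ V₀ k f s z * transportDeriv φ z‖ₑ :=
          (((hFm s).mul hφm).add ((hut s).mul hφm')).enorm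
        calc ∫⁻ z, ‖G z s‖ₑ ∂(phaseMeasure d V₀) = ∫⁻ z, ‖collision χ V₀ k (mildSol χ V₀ k f s) z
            * φ z + mildSol χ V₀ k f s z * transportDeriv φ z‖ₑ ∂(phaseMeasure d V₀) :=
              lintegral_shift V₀ s _ hms
          _ ≤ _ := (lintegral_mono fun z => enorm_add_le _ _).trans
              ((lintegral_add_left ((hFm s).mul hφm).enorm _).trans_le (add_le_add e1 e2))
      · rw [setLIntegral_const]
        simp only [Real.volume_Ioc]
        finiteness
    have hae := ae_majorant_shift_ne_top (V₀ := V₀) (χ := χ) hk.measurable hf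
      (ne_top_of_le_ne_top ENNReal.coe_ne_top (hM t ⟨ht, le_rfl⟩))
    have hchar : ∀ᵐ z ∂(phaseMeasure d V₀), mildSol χ V₀ k f t (shift t z) * φ (shift t z) =
        f z * φ z + ∫ s in Ioc 0 t, G z s := by
      filter_upwards [hae] with z hz
      have hp := mildSol_isPrimitiveOn hχ.1.le hk.measurable hf ht hz
      have hcd : Continuous fun s => transportDeriv φ (shift s z) :=
        hφ.continuous_transportDeriv.comp
          (continuous_shift_uncurry.comp (continuous_id.prodMk continuous_const))
      have hq : IsPrimitiveOn t (fun s => φ (shift s z)) (fun s => transportDeriv φ (shift s z)) :=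
        IsPrimitiveOn.of_hasDerivAt countable_empty
          (hφ.smooth.continuous.comp
            (continuous_shift_uncurry.comp (continuous_id.prodMk continuous_const)))
          (fun s _ => hasDerivAt_comp_shift (hφ.smooth.differentiable one_ne_zero) z s)
          (hcd.intervalIntegrable _ _)
      have := (hp.mul ht hq).eq t ⟨ht, le_rfl⟩
      simp only [mildSol_zero, shift_zero] at this
      rw [this, intervalIntegral.integral_of_le ht]
      rfl
    calc ∫ z, mildSol χ V₀ k f t z * φ z ∂(phaseMeasure d V₀)
        = ∫ z, mildSol χ V₀ k f t (shift t z) * φ (shift t z) ∂(phaseMeasure d V₀) :=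
          (integral_shift V₀ t fun z => mildSol χ V₀ k f t z * φ z).symm
      _ = ∫ z, (f z * φ z + ∫ s in Ioc 0 t, G z s) ∂(phaseMeasure d V₀) := integral_congr_ae hchar
      _ = ∫ z, f z * φ z ∂(phaseMeasure d V₀) +
          ∫ z, (∫ s in Ioc 0 t, G z s) ∂(phaseMeasure d V₀) :=
          integral_add hif hGi.integral_prod_left
      _ = ∫ z, f z * φ z ∂(phaseMeasure d V₀) +
          ∫ s in Ioc 0 t, ∫ z, G z s ∂(phaseMeasure d V₀) := by
          rw [integral_integral_swap hGi]
      _ = _ := by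
          rw [intervalIntegral.integral_of_le ht]
          congr 1
          refine setIntegral_congr_fun measurableSet_Ioc fun s hs => ?_
          have hs' := Ioc_subset_Icc_self hs
          simp only [hG]
          rw [integral_shift V₀ s fun z => collision χ V₀ k (mildSol χ V₀ k f s) z * φ z +
            mildSol χ V₀ k f s z * transportDeriv φ z, integral_add (hi2 s hs') (hi1 s hs'),
            add_comm]
          rfl

end Trajectory

/-! ### The `L¹` norm by duality with test functions -/

theorem exists_smooth_cutoff {K O : Set (E d × E d)} (hK : IsCompact K) (hO : IsOpen O)
    (hKO : K ⊆ O) : ∃ g : E d × E d → ℝ, ContDiff ℝ 1 g ∧ HasCompactSupport g ∧ tsupport g ⊆ O ∧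
      (∀ z, g z ∈ Icc (0 : ℝ) 1) ∧ ∀ z ∈ K, g z = 1 := by
  obtain ⟨W, hW, hKW, hWO, hWc⟩ := exists_open_between_and_isCompact_closure hK hO hKO
  obtain ⟨g, hg, hr, hs, h1⟩ := exists_contMDiff_support_eq_eq_one_iff
    (modelWithCornersSelf ℝ (E d × E d)) (n := (⊤ : ℕ∞)) hW hK.isClosed hKW
  have ht : tsupport g ⊆ closure W := by rw [tsupport, hs]
  refine ⟨g, (contMDiff_iff_contDiff.1 hg).of_le (by exact_mod_cast le_top), ?_, ht.trans hWO,
    fun z => hr (mem_range_self z), fun z hz => (h1 z).1 hz⟩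
  exact hWc.of_isClosed_subset (isClosed_tsupport g) ht

/-- The sign of `w` is approximated by test functions. Inner regularity of the finite measure `|w|
μ` gives compact sets nearly filling `{w > 0}` and `{w < 0}`; smooth cutoffs with disjoint supports
around them differ from the sign only on a set of small mass. Everything stays inside the open set
`ℝ^d × 𝒱`, so the functions are admissible. -/
theorem lintegral_le_of_forall_test {V₀ : ℝ} {w : E d × E d → ℝ} (hw : Measurable w)
    (hi : Integrable w (phaseMeasure d V₀)) {B : ℝ}
    (h : ∀ φ, IsTestFunction V₀ φ → (∀ z, |φ z| ≤ 1) → ∫ z, w z * φ z ∂(phaseMeasure d V₀) ≤ B) :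
    ∫ z, |w z| ∂(phaseMeasure d V₀) ≤ B := by
  refine le_of_forall_pos_le_add fun ε hε => ?_
  set μ := phaseMeasure d V₀ with hμ
  set ν := μ.withDensity fun z => ‖w z‖ₑ with hν
  have : IsFiniteMeasure ν := isFiniteMeasure_withDensity hi.2.ne
  set U : Set (E d × E d) := univ ×ˢ velocitySet d V₀ with hU
  have hUo : IsOpen U := isOpen_univ.prod Metric.isOpen_ball
  have hUae : ∀ᵐ z ∂μ, z ∈ U := by
    filter_upwards [ae_velocity_mem V₀] with z hz using ⟨mem_univ _, hz⟩
  have hP : MeasurableSet ({z | 0 < w z} ∩ U) :=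
    (measurableSet_lt measurable_const hw).inter hUo.measurableSet
  have hQ : MeasurableSet ({z | w z < 0} ∩ U) :=
    (measurableSet_lt hw measurable_const).inter hUo.measurableSet
  have hε4 : ENNReal.ofReal (ε / 4) ≠ 0 := by simpa using hε
  obtain ⟨K₁, hK₁P, hK₁, hd₁⟩ := hP.exists_isCompact_sdiff_lt (measure_ne_top ν _) hε4
  obtain ⟨K₂, hK₂Q, hK₂, hd₂⟩ := hQ.exists_isCompact_sdiff_lt (measure_ne_top ν _) hε4
  have hdisj : Disjoint K₁ K₂ := by
    refine Set.disjoint_left.2 fun z h1 h2 => ?_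
    exact lt_asymm (show 0 < w z from (hK₁P h1).1) (show w z < 0 from (hK₂Q h2).1)
  obtain ⟨O₁, O₂, hO₁, hO₂, hKO₁, hKO₂, hO⟩ := SeparatedNhds.of_isCompact_isCompact hK₁ hK₂ hdisj
  obtain ⟨g₁, hg₁, hc₁, hs₁, hr₁, ho₁⟩ := exists_smooth_cutoff hK₁ (hO₁.inter hUo)
    (subset_inter hKO₁ fun z hz => (hK₁P hz).2)
  obtain ⟨g₂, hg₂, hc₂, hs₂, hr₂, ho₂⟩ := exists_smooth_cutoff hK₂ (hO₂.inter hUo)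
    (subset_inter hKO₂ fun z hz => (hK₂Q hz).2)
  set φ : E d × E d → ℝ := fun z => g₁ z - g₂ z with hφ
  have hφ1 : ∀ z, |φ z| ≤ 1 := fun z => by
    rw [abs_le]
    constructor <;> simp only [hφ] <;> linarith [(hr₁ z).1, (hr₁ z).2, (hr₂ z).1, (hr₂ z).2]
  have hφt : IsTestFunction V₀ φ := by
    refine ⟨hg₁.sub hg₂, hc₁.sub hc₂, ?_⟩
    exact (tsupport_sub g₁ g₂).trans (union_subset (hs₁.trans inter_subset_right)
      (hs₂.trans inter_subset_right))
  have hz₂ : ∀ z ∈ K₁, g₂ z = 0 := fun z hz => by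
    refine image_eq_zero_of_notMem_tsupport fun hzt => ?_
    exact Set.disjoint_left.1 hO (hKO₁ hz) (hs₂ hzt).1
  have hz₁ : ∀ z ∈ K₂, g₁ z = 0 := fun z hz => by
    refine image_eq_zero_of_notMem_tsupport fun hzt => ?_
    exact Set.disjoint_left.1 hO (hs₁ hzt).1 (hKO₂ hz)
  have hφm : Measurable φ := hφt.smooth.continuous.measurable
  have hiφ : Integrable (fun z => w z * φ z) μ := by
    refine hi.norm.mono' (hw.mul hφm).aestronglyMeasurable (Eventually.of_forall fun z => ?_)
    rw [norm_mul, Real.norm_eq_abs (φ z)]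
    exact mul_le_of_le_one_right (norm_nonneg _) (hφ1 z)
  set D : Set (E d × E d) := ({z | 0 < w z} ∩ U) \ K₁ ∪ ({z | w z < 0} ∩ U) \ K₂ with hD
  have hDm : MeasurableSet D :=
    (hP.diff hK₁.isClosed.measurableSet).union (hQ.diff hK₂.isClosed.measurableSet)
  have hpt : ∀ᵐ z ∂μ, |w z| - w z * φ z ≤ D.indicator (fun z => 2 * |w z|) z := by
    filter_upwards [hUae] with z hzU
    by_cases hzD : z ∈ D
    · rw [indicator_of_mem hzD]
      have := abs_mul (w z) (φ z)
      nlinarith [neg_abs_le (w z * φ z), hφ1 z, abs_nonneg (w z)]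
    · rw [indicator_of_notMem hzD]
      simp only [hD, mem_union, Set.mem_sdiff, mem_inter_iff, not_or, not_and, not_not] at hzD
      rcases lt_trichotomy (w z) 0 with hlt | heq | hgt
      · have hk := hzD.2 ⟨hlt, hzU⟩
        simp only [hφ, ho₂ z hk, hz₁ z hk, abs_of_neg hlt]
        linarith
      · simp [heq]
      · have hk := hzD.1 ⟨hgt, hzU⟩
        simp only [hφ, ho₁ z hk, hz₂ z hk, abs_of_pos hgt]
        linarith
  have hDν : ν D ≤ ENNReal.ofReal (ε / 2) := by
    refine (measure_union_le _ _).trans ((add_le_add hd₁.le hd₂.le).trans_eq ?_)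
    rw [← ENNReal.ofReal_add (by positivity) (by positivity)]
    congr 1; ring
  have hDint : ∫ z, D.indicator (fun z => 2 * |w z|) z ∂μ ≤ ε := by
    rw [integral_indicator hDm, integral_const_mul]
    have h2 : ∫ z in D, |w z| ∂μ ≤ ε / 2 := by
      have e : ∫ z in D, |w z| ∂μ = (ν D).toReal := by
        rw [hν, withDensity_apply _ hDm, ← integral_norm_eq_lintegral_enorm
          hw.aestronglyMeasurable]
        rfl
      rw [e]
      exact ENNReal.toReal_le_of_le_ofReal (by positivity) hDν
    linarith
  have hfin : ∫ z, |w z| ∂μ - ∫ z, w z * φ z ∂μ ≤ ε := by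
    rw [← integral_sub hi.abs hiφ]
    refine le_trans (integral_mono_ae (hi.abs.sub hiφ) ?_ hpt) hDint
    exact (hi.abs.const_mul 2).indicator hDm
  linarith [h φ hφt hφ1]

/-! ### Weak solutions with values in `L¹` -/

theorem gain_congr_ae {V₀ : ℝ} (k : E d → E d → ℝ) {u w : E d × E d → ℝ}
    (h : u =ᵐ[phaseMeasure d V₀] w) : gain V₀ k u =ᵐ[phaseMeasure d V₀] gain V₀ k w := by
  have h1 : ∀ᵐ x : E d, ∀ᵐ v ∂(volume.restrict (velocitySet d V₀)), u (x, v) = w (x, v) :=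
    Measure.ae_ae_of_ae_prod h
  have h2 : ∀ᵐ x : E d, ∀ v, gain V₀ k u (x, v) = gain V₀ k w (x, v) := by
    filter_upwards [h1] with x hx v
    refine integral_congr_ae ?_
    filter_upwards [hx] with v' hv'
    simp only [hv']
  exact Measure.quasiMeasurePreserving_fst.ae (p := fun x => ∀ v, gain V₀ k u (x, v) =
    gain V₀ k w (x, v)) h2 |>.mono fun z hz => hz z.2

theorem collision_congr_ae {χ V₀ : ℝ} (k : E d → E d → ℝ) {u w : E d × E d → ℝ}
    (h : u =ᵐ[phaseMeasure d V₀] w) :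
    collision χ V₀ k u =ᵐ[phaseMeasure d V₀] collision χ V₀ k w := by
  filter_upwards [h, gain_congr_ae k h] with z h1 h2
  simp only [collision, h1, h2]

/-- Weak solutions that are measurable in the phase variable and locally bounded in `L¹`. -/
structure IsL1Trajectory (χ V₀ : ℝ) (k : E d → E d → ℝ) (f : E d × E d → ℝ)
    (u : ℝ → E d × E d → ℝ) : Prop where
  measurable : ∀ t, Measurable (u t)
  bounded : ∀ T, ∃ M : ℝ≥0, ∀ t ∈ Icc 0 T, ∫⁻ z, ‖u t z‖ₑ ∂(phaseMeasure d V₀) ≤ M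
  continuous : ∀ ρ t : ℝ, 0 ≤ t →
    Tendsto (fun s => ∫⁻ z in Metric.ball 0 ρ ×ˢ univ, ‖u s z - u t z‖ₑ ∂(phaseMeasure d V₀))
      (𝓝[Ici 0] t) (𝓝 0)
  weak : ∀ φ, IsTestFunction V₀ φ → ∀ t, 0 ≤ t →
    ∫ z, u t z * φ z ∂(phaseMeasure d V₀) = ∫ z, f z * φ z ∂(phaseMeasure d V₀) +
      ∫ s in (0 : ℝ)..t, ((∫ z, u s z * transportDeriv φ z ∂(phaseMeasure d V₀)) +
          ∫ z, collision χ V₀ k (u s) z * φ z ∂(phaseMeasure d V₀))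

/-- All conditions on a trajectory see it only up to null sets at each time, so measurable
representatives can be chosen time by time. -/
theorem IsTrajectory.exists_isL1Trajectory {χ V₀ : ℝ} {k : E d → E d → ℝ}
    {N : (E d × E d → ℝ) → ℝ≥0∞} {f : E d × E d → ℝ} {u : ℝ → E d × E d → ℝ}
    (hu : IsTrajectory χ V₀ k N f u)
    (hN : ∀ M : ℝ≥0, ∃ M' : ℝ≥0, ∀ g, AEStronglyMeasurable g (phaseMeasure d V₀) → N g ≤ M →
      ∫⁻ z, ‖g z‖ₑ ∂(phaseMeasure d V₀) ≤ M') :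
    ∃ w, IsL1Trajectory χ V₀ k f w ∧ ∀ t, 0 ≤ t → u t =ᵐ[phaseMeasure d V₀] w t := by
  classical
  -- The value `0` at negative times only secures measurability at every time; every other condition
  -- concerns `t ≥ 0`.
  set w : ℝ → E d × E d → ℝ := fun t => if h : 0 ≤ t then (hu.measurable t h).mk (u t) else 0
    with hw
  have hae : ∀ t, 0 ≤ t → u t =ᵐ[phaseMeasure d V₀] w t := fun t ht => by
    simp only [hw, dif_pos ht]
    exact (hu.measurable t ht).ae_eq_mk
  refine ⟨w, ⟨fun t => ?_, fun T => ?_, fun ρ t ht => ?_, fun φ hφ t ht => ?_⟩, hae⟩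
  · simp only [hw]
    split_ifs with h
    · exact (hu.measurable t h).stronglyMeasurable_mk.measurable
    · exact measurable_const
  · obtain ⟨M, hM⟩ := hu.bounded T
    obtain ⟨M', hM'⟩ := hN M
    refine ⟨M', fun t ht => ?_⟩
    refine le_of_eq_of_le (lintegral_congr_ae ?_) (hM' (u t) (hu.measurable t ht.1) (hM t ht))
    filter_upwards [hae t ht.1] with z hz
    rw [hz]
  · refine (hu.continuous ρ t ht).congr' ?_
    filter_upwards [self_mem_nhdsWithin] with s hs
    refine lintegral_congr_ae (ae_restrict_of_ae ?_)
    filter_upwards [hae t ht, hae s hs] with z h1 h2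
    rw [h1, h2]
  · have h := hu.weak φ hφ t ht
    have e1 : ∫ z, u t z * φ z ∂(phaseMeasure d V₀) = ∫ z, w t z * φ z ∂(phaseMeasure d V₀) :=
      integral_congr_ae (by filter_upwards [hae t ht] with z hz; rw [hz])
    rw [← e1, h]
    congr 1
    rw [intervalIntegral.integral_of_le ht, intervalIntegral.integral_of_le ht]
    refine setIntegral_congr_fun measurableSet_Ioc fun s hs => ?_
    have hs := hae s hs.1.le
    congr 1
    · exact integral_congr_ae (by filter_upwards [hs] with z hz; rw [hz]; rfl)
    · refine integral_congr_ae ?_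
      filter_upwards [collision_congr_ae (χ := χ) k hs] with z hz
      rw [← hz]; rfl

/-! ### Uniqueness -/

section Uniqueness

variable {χ V₀ : ℝ} {C : ℝ≥0} {k : E d → E d → ℝ} {f : E d × E d → ℝ}

theorem setLIntegral_absGain_le (hV : volume (velocitySet d V₀) = 1)
    (hk : IsBoundedKernel V₀ C k) {P : E d × E d → ℝ≥0∞} (hP : Measurable P) {S : Set (E d)}
    (hS : MeasurableSet S) :
    ∫⁻ z in S ×ˢ univ, absGain V₀ k P z.1 ∂(phaseMeasure d V₀) ≤
      C * ∫⁻ z in S ×ˢ univ, P z ∂(phaseMeasure d V₀) := by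
  have hS' : MeasurableSet (S ×ˢ (univ : Set (E d))) := hS.prod MeasurableSet.univ
  rw [← lintegral_indicator hS', ← lintegral_indicator hS']
  refine le_trans (lintegral_mono fun z => ?_) (lintegral_absGain_le hV hk (hP.indicator hS'))
  by_cases hz : z.1 ∈ S
  · rw [indicator_of_mem (show z ∈ S ×ˢ univ from ⟨hz, mem_univ _⟩)]
    refine lintegral_mono fun v => ?_
    rw [indicator_of_mem (show (z.1, v) ∈ S ×ˢ univ from ⟨hz, mem_univ _⟩)]
  · rw [indicator_of_notMem (fun h => hz h.1)]
    exact zero_le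

theorem measurable_collision_slice (χ V₀ : ℝ) (hk : Measurable (Function.uncurry k))
    {u : E d × E d → ℝ} (hu : Measurable u) : Measurable (collision χ V₀ k u) :=
  measurable_collision χ V₀ hk (u := fun _ : E d × E d => u) (hu.comp measurable_snd) measurable_id

/-- Linearity of the gain holds only almost everywhere, at the positions where both velocity
sections are integrable. -/
theorem collision_sub_ae (hk : IsBoundedKernel V₀ C k) {u w : E d × E d → ℝ}
    (hu : Integrable u (phaseMeasure d V₀)) (hw : Integrable w (phaseMeasure d V₀)) :
    ∀ᵐ z ∂(phaseMeasure d V₀), collision χ V₀ k u z - collision χ V₀ k w z =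
      collision χ V₀ k (fun z => u z - w z) z := by
  have hkv : ∀ (g : E d × E d → ℝ) (x : E d), Integrable (fun v => g (x, v))
      (volume.restrict (velocitySet d V₀)) → Integrable (fun v => k x v * g (x, v))
      (volume.restrict (velocitySet d V₀)) := fun g x hg => by
    refine hg.bdd_mul (c := C) (hk.measurable.comp
      (measurable_const.prodMk measurable_id)).aestronglyMeasurable ?_
    filter_upwards [ae_restrict_mem (measurableSet_velocitySet V₀)] with v hv
    have := hk.bound x v hv
    rw [← ofReal_norm] at this
    simpa using ENNReal.toReal_mono ENNReal.coe_ne_top this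
  have h : ∀ᵐ x : E d, ∀ v, gain V₀ k u (x, v) - gain V₀ k w (x, v) =
      gain V₀ k (fun z => u z - w z) (x, v) := by
    filter_upwards [hu.prod_right_ae, hw.prod_right_ae] with x h1 h2 v
    simp only [gain]
    rw [← integral_sub (hkv u x h1) (hkv w x h2)]
    simp only [mul_sub]
  have h' := Measure.quasiMeasurePreserving_fst (μ := (volume : Measure (E d)))
    (ν := (volume : Measure (E d)).restrict (velocitySet d V₀)) |>.ae h
  filter_upwards [h'] with z hz
  have := hz z.2
  simp only [collision]
  rw [← this]
  ring

theorem setLIntegral_collision_sub_le (hV : volume (velocitySet d V₀) = 1)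
    (hχ : χ ∈ Ioo (0 : ℝ) 1) (hk : IsBoundedKernel V₀ C k) {u w : E d × E d → ℝ}
    (hum : Measurable u) (hwm : Measurable w)
    (hu : Integrable u (phaseMeasure d V₀)) (hw : Integrable w (phaseMeasure d V₀))
    {S : Set (E d)} (hS : MeasurableSet S) :
    ∫⁻ z in S ×ˢ univ, ‖collision χ V₀ k u z - collision χ V₀ k w z‖ₑ ∂(phaseMeasure d V₀) ≤
      (2 + C) * ∫⁻ z in S ×ˢ univ, ‖u z - w z‖ₑ ∂(phaseMeasure d V₀) := by
  have hP : Measurable fun z => ‖u z - w z‖ₑ := (hum.sub hwm).enorm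
  calc _ ≤ ∫⁻ z in S ×ˢ univ, (2 * ‖u z - w z‖ₑ + absGain V₀ k (fun z => ‖u z - w z‖ₑ) z.1)
        ∂(phaseMeasure d V₀) := by
        refine lintegral_mono_ae (ae_restrict_of_ae ?_)
        filter_upwards [collision_sub_ae (χ := χ) hk hu hw] with z hz
        rw [hz]
        exact enorm_collision_le hχ V₀ k (fun z => le_rfl) z
    _ ≤ _ := by
        rw [lintegral_add_left (hP.const_mul 2), lintegral_const_mul _ hP, add_mul]
        exact add_le_add le_rfl (setLIntegral_absGain_le hV hk hP hS)

/-- For flow times near `σ` the transported supports stay over one fixed ball of positions, so local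
`L¹` continuity handles the first variable. Dominated convergence handles the second. -/
theorem integral_mul_comp_shift_tendsto {U : ℝ → E d × E d → ℝ} (hUm : ∀ r, Measurable (U r))
    (hUi : ∀ r, 0 ≤ r → Integrable (U r) (phaseMeasure d V₀))
    (hUc : ∀ ρ t : ℝ, 0 ≤ t →
      Tendsto (fun s => ∫⁻ z in Metric.ball 0 ρ ×ˢ univ, ‖U s z - U t z‖ₑ ∂(phaseMeasure d V₀))
        (𝓝[Ici 0] t) (𝓝 0))
    {ψ : E d × E d → ℝ} (hψ : Continuous ψ) (hc : HasCompactSupport ψ) {s : ℝ} (hs : 0 ≤ s)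
    (σ : ℝ) :
    Tendsto (fun q : ℝ × ℝ => ∫ z, U q.1 z * ψ (shift q.2 z) ∂(phaseMeasure d V₀))
      (𝓝[Ici 0] s ×ˢ 𝓝 σ) (𝓝 (∫ z, U s z * ψ (shift σ z) ∂(phaseMeasure d V₀))) := by
  obtain ⟨B, hB⟩ := exists_bound_of_continuous_hasCompactSupport hψ hc
  have hB' : ∀ z, ‖ψ z‖ ≤ B := fun z => by
    have := hB z
    rw [← ofReal_norm] at this
    simpa using ENNReal.toReal_mono ENNReal.coe_ne_top this
  have hψs : ∀ τ, Measurable fun z : E d × E d => ψ (shift τ z) := fun τ =>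
    hψ.measurable.comp (measurable_shift τ)
  have hint : ∀ r, 0 ≤ r → ∀ τ, Integrable (fun z => U r z * ψ (shift τ z)) (phaseMeasure d V₀) :=
    fun r hr τ => (hUi r hr).mul_bdd (c := B) (hψs τ).aestronglyMeasurable
      (Eventually.of_forall fun z => hB' _)
  obtain ⟨ρ, hρ⟩ : ∃ ρ : ℝ, ∀ τ ∈ Icc (σ - 1) (σ + 1), ∀ z : E d × E d,
      z.1 ∉ Metric.ball (0 : E d) ρ → ψ (shift τ z) = 0 := by
    have hKc : IsCompact ((fun p : ℝ × (E d × E d) => (shift (-p.1) p.2).1) ''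
        (Icc (σ - 1) (σ + 1) ×ˢ tsupport ψ)) := by
      refine (isCompact_Icc.prod hc).image ?_
      unfold shift; fun_prop
    obtain ⟨ρ, hρ⟩ := hKc.isBounded.subset_ball (0 : E d)
    refine ⟨ρ, fun τ hτ z hz => ?_⟩
    refine image_eq_zero_of_notMem_tsupport fun hzt => hz (hρ ?_)
    refine ⟨(τ, shift τ z), ⟨hτ, hzt⟩, ?_⟩
    simp only [shift_neg_shift]
  have hcont : Tendsto (fun τ => ∫ z, U s z * ψ (shift τ z) ∂(phaseMeasure d V₀)) (𝓝 σ)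
      (𝓝 (∫ z, U s z * ψ (shift σ z) ∂(phaseMeasure d V₀))) := by
    refine tendsto_integral_filter_of_dominated_convergence (fun z => ‖U s z‖ * B)
      (Eventually.of_forall fun τ => (hint s hs τ).aestronglyMeasurable)
      (Eventually.of_forall fun τ => Eventually.of_forall fun z => ?_)
      ((hUi s hs).norm.mul_const _) (Eventually.of_forall fun z => ?_)
    · rw [norm_mul]; exact mul_le_mul_of_nonneg_left (hB' _) (norm_nonneg _)
    · have : Continuous fun τ => ψ (shift τ z) :=
        hψ.comp (continuous_shift_uncurry.comp (continuous_id.prodMk continuous_const))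
      exact (this.tendsto σ).const_mul _
  rw [tendsto_iff_edist_tendsto_0] at hcont ⊢
  have h1 : Tendsto (fun q : ℝ × ℝ => B * (∫⁻ z in Metric.ball 0 ρ ×ˢ univ,
      ‖U q.1 z - U s z‖ₑ ∂(phaseMeasure d V₀)) +
      edist (∫ z, U s z * ψ (shift q.2 z) ∂(phaseMeasure d V₀))
        (∫ z, U s z * ψ (shift σ z) ∂(phaseMeasure d V₀))) (𝓝[Ici 0] s ×ˢ 𝓝 σ) (𝓝 0) := by
    have h2 := (ENNReal.Tendsto.const_mul (a := (B : ℝ≥0∞)) (hUc ρ s hs)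
      (Or.inr ENNReal.coe_ne_top)).comp (tendsto_fst (g := 𝓝 σ))
    have h3 := h2.add (hcont.comp (tendsto_snd (f := 𝓝[Ici 0] s)))
    simpa using h3
  refine tendsto_of_tendsto_of_tendsto_of_le_of_le' tendsto_const_nhds h1
    (Eventually.of_forall fun _ => zero_le) ?_
  have hev : ∀ᶠ q : ℝ × ℝ in 𝓝[Ici 0] s ×ˢ 𝓝 σ, 0 ≤ q.1 ∧ q.2 ∈ Icc (σ - 1) (σ + 1) :=
    (eventually_mem_nhdsWithin (s := Ici (0 : ℝ)) (a := s)).prod_mk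
      (Icc_mem_nhds (by linarith) (by linarith))
  filter_upwards [hev] with q hq
  refine (edist_triangle _ (∫ z, U s z * ψ (shift q.2 z) ∂(phaseMeasure d V₀)) _).trans
    (add_le_add_left ?_ _)
  rw [edist_eq_enorm_sub, ← integral_sub (hint q.1 hq.1 q.2) (hint s hs q.2)]
  refine (enorm_integral_le_lintegral_enorm _).trans ?_
  have hSm : MeasurableSet (Metric.ball (0 : E d) ρ ×ˢ (univ : Set (E d))) :=
    measurableSet_ball.prod MeasurableSet.univ
  have hdm : Measurable fun z => ‖U q.1 z - U s z‖ₑ := ((hUm q.1).sub (hUm s)).enorm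
  rw [← lintegral_const_mul _ hdm, ← lintegral_indicator hSm]
  refine lintegral_mono fun z => ?_
  simp only
  by_cases hz : z.1 ∈ Metric.ball (0 : E d) ρ
  · rw [indicator_of_mem (show z ∈ Metric.ball (0 : E d) ρ ×ˢ univ from ⟨hz, mem_univ _⟩),
      ← sub_mul, enorm_mul, mul_comm]
    exact mul_le_mul_left (hB _) _
  · rw [hρ q.2 hq.2 z hz]; simp

theorem IsTestFunction.comp_shift {φ : E d × E d → ℝ} (hφ : IsTestFunction V₀ φ) (τ : ℝ) :
    IsTestFunction V₀ (fun z => φ (shift τ z)) := by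
  have hsh : ContDiff ℝ 1 (shift τ : E d × E d → E d × E d) := by unfold shift; fun_prop
  set e : (E d × E d) ≃ₜ (E d × E d) := ⟨⟨shift τ, shift (-τ), shift_neg_shift τ,
    shift_shift_neg τ⟩, hsh.continuous, by unfold shift; fun_prop⟩ with he
  refine ⟨hφ.smooth.comp hsh, hφ.compact.comp_homeomorph e, ?_⟩
  intro z hz
  have : shift τ z ∈ tsupport φ := by
    have h := tsupport_comp_subset_preimage φ hsh.continuous
    exact h hz
  exact ⟨mem_univ _, (hφ.support this).2⟩

theorem transportDeriv_comp_shift {φ : E d × E d → ℝ} (hφ : IsTestFunction V₀ φ) (τ : ℝ)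
    (z : E d × E d) : transportDeriv (fun z => φ (shift τ z)) z = transportDeriv φ (shift τ z) := by
  have h1 := hasDerivAt_comp_shift ((hφ.comp_shift τ).smooth.differentiable one_ne_zero) z 0
  have h2 := hasDerivAt_comp_shift (hφ.smooth.differentiable one_ne_zero) z (0 + τ)
  have h3 := HasDerivAt.comp_add_const 0 τ h2
  simp only [shift_shift] at h1
  simp only [zero_add, shift_zero] at h1 h3
  exact h1.unique h3

theorem IsL1Trajectory.integrable {u : ℝ → E d × E d → ℝ} (hu : IsL1Trajectory χ V₀ k f u) {t : ℝ}
    (ht : 0 ≤ t) : Integrable (u t) (phaseMeasure d V₀) := by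
  obtain ⟨M, hM⟩ := hu.bounded t
  exact ⟨(hu.measurable t).aestronglyMeasurable,
    lt_of_le_of_lt (hM t ⟨ht, le_rfl⟩) ENNReal.coe_lt_top⟩

theorem integrable_collision (hV : volume (velocitySet d V₀) = 1)
    (hχ : χ ∈ Ioo (0 : ℝ) 1) (hk : IsBoundedKernel V₀ C k) {u : E d × E d → ℝ}
    (hum : Measurable u) (hu : Integrable u (phaseMeasure d V₀)) :
    Integrable (collision χ V₀ k u) (phaseMeasure d V₀) := by
  refine ⟨(measurable_collision_slice χ V₀ hk.measurable hum).aestronglyMeasurable, ?_⟩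
  refine lt_of_le_of_lt (lintegral_mono fun z => enorm_collision_le hχ V₀ k
    (P := fun z => ‖u z‖ₑ) (fun z => le_rfl) z) ?_
  rw [lintegral_add_left (hum.enorm.const_mul 2), lintegral_const_mul _ hum.enorm]
  refine ENNReal.add_lt_top.2 ⟨ENNReal.mul_lt_top (by simp) hu.2, ?_⟩
  exact lt_of_le_of_lt (lintegral_absGain_le hV hk hum.enorm)
    (ENNReal.mul_lt_top ENNReal.coe_lt_top hu.2)

/-- Along the backward flow, the duality product with a test function is differentiable from the
right. -/
theorem IsL1Trajectory.hasDerivWithinAt (hV : volume (velocitySet d V₀) = 1)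
    (hχ : χ ∈ Ioo (0 : ℝ) 1) (hk : IsBoundedKernel V₀ C k) {u : ℝ → E d × E d → ℝ}
    (hu : IsL1Trajectory χ V₀ k f u) {φ : E d × E d → ℝ} (hφ : IsTestFunction V₀ φ) (t : ℝ) {s : ℝ}
    (hs : 0 ≤ s) :
    HasDerivWithinAt (fun s => ∫ z, u s z * φ (shift (t - s) z) ∂(phaseMeasure d V₀))
      (∫ z, collision χ V₀ k (u s) z * φ (shift (t - s) z) ∂(phaseMeasure d V₀)) (Ici s) s := by
  set μ := phaseMeasure d V₀ with hμ
  have hcm : ∀ r, Measurable (collision χ V₀ k (u r)) := fun r =>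
    measurable_collision_slice χ V₀ hk.measurable (hu.measurable r)
  have hci : ∀ r, 0 ≤ r → Integrable (collision χ V₀ k (u r)) μ := fun r hr =>
    integrable_collision hV hχ hk (hu.measurable r) (hu.integrable hr)
  have hcc : ∀ ρ t : ℝ, 0 ≤ t → Tendsto (fun s => ∫⁻ z in Metric.ball 0 ρ ×ˢ univ,
      ‖collision χ V₀ k (u s) z - collision χ V₀ k (u t) z‖ₑ ∂μ) (𝓝[Ici 0] t) (𝓝 0) := by
    intro ρ t ht
    have h1 := ENNReal.Tendsto.const_mul (a := (2 + C : ℝ≥0∞)) (hu.continuous ρ t ht)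
      (Or.inr (by finiteness))
    rw [mul_zero] at h1
    refine tendsto_of_tendsto_of_tendsto_of_le_of_le' tendsto_const_nhds h1
      (Eventually.of_forall fun _ => zero_le) ?_
    filter_upwards [self_mem_nhdsWithin] with r hr
    exact setLIntegral_collision_sub_le hV hχ hk (hu.measurable r) (hu.measurable t)
      (hu.integrable hr) (hu.integrable ht) measurableSet_ball
  set A : ℝ → ℝ → ℝ := fun r σ => (∫ z, u r z * transportDeriv φ (shift σ z) ∂μ) +
    ∫ z, collision χ V₀ k (u r) z * φ (shift σ z) ∂μ with hA
  have hAt : ∀ r, 0 ≤ r → ∀ σ, Tendsto (fun q : ℝ × ℝ => A q.1 q.2) (𝓝[Ici 0] r ×ˢ 𝓝 σ)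
      (𝓝 (A r σ)) := fun r hr σ =>
    (integral_mul_comp_shift_tendsto hu.measurable (fun r hr => hu.integrable hr) hu.continuous
      hφ.continuous_transportDeriv hφ.hasCompactSupport_transportDeriv hr σ).add
    (integral_mul_comp_shift_tendsto hcm hci hcc hφ.smooth.continuous hφ.compact hr σ)
  have hAc : ∀ σ, ContinuousOn (fun r => A r σ) (Ici 0) := fun σ r hr =>
    (hAt r hr σ).comp (tendsto_id.prodMk tendsto_const_nhds)
  have hAi : ∀ σ a b, 0 ≤ a → 0 ≤ b → IntervalIntegrable (fun r => A r σ) volume a b :=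
    fun σ a b ha hb => ((hAc σ).mono fun x hx => (le_inf ha hb).trans hx.1).intervalIntegrable
  obtain ⟨B, hB⟩ := exists_bound_of_continuous_hasCompactSupport hφ.smooth.continuous hφ.compact
  obtain ⟨B', hB'⟩ := exists_bound_of_continuous_hasCompactSupport hφ.continuous_transportDeriv
    hφ.hasCompactSupport_transportDeriv
  have tobd : ∀ {x : ℝ} {b : ℝ≥0}, ‖x‖ₑ ≤ b → ‖x‖ ≤ b := fun {x b} h => by
    rw [← ofReal_norm] at h
    simpa using ENNReal.toReal_mono ENNReal.coe_ne_top h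
  have hφs : ∀ σ, Measurable fun z : E d × E d => φ (shift σ z) := fun σ =>
    hφ.smooth.continuous.measurable.comp (measurable_shift σ)
  have hint : ∀ r, 0 ≤ r → ∀ σ, Integrable (fun z => u r z * φ (shift σ z)) μ :=
    fun r hr σ => (hu.integrable hr).mul_bdd (c := B) (hφs σ).aestronglyMeasurable
      (Eventually.of_forall fun z => tobd (hB _))
  have hweak : ∀ s', s ≤ s' → ∀ σ, ∫ z, u s' z * φ (shift σ z) ∂μ =
      (∫ z, u s z * φ (shift σ z) ∂μ) + ∫ r in s..s', A r σ := by
    intro s' hs' σ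
    have h1 := hu.weak _ (hφ.comp_shift σ) s' (hs.trans hs')
    have h2 := hu.weak _ (hφ.comp_shift σ) s hs
    simp only [transportDeriv_comp_shift hφ] at h1 h2
    rw [h1, h2, add_assoc]
    congr 1
    exact (intervalIntegral.integral_add_adjacent_intervals (hAi σ 0 s le_rfl hs)
      (hAi σ s s' hs (hs.trans hs'))).symm
  -- The integrand also depends on the endpoint. Joint continuity of `A` at `(s, t - s)` shows that
  -- this dependence does not contribute to the derivative.
  have hX : HasDerivWithinAt (fun s' => ∫ r in s..s', A r (t - s')) (A s (t - s)) (Ici s) s := by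
    rw [hasDerivWithinAt_iff_isLittleO, Asymptotics.isLittleO_iff]
    intro ε hε
    have h1 := (hAt s hs (t - s)).eventually (Metric.ball_mem_nhds _ hε)
    obtain ⟨p, hp, q, hq, hpq⟩ := Filter.eventually_prod_iff.1 h1
    rw [eventually_nhdsWithin_iff, Metric.eventually_nhds_iff] at hp
    rw [Metric.eventually_nhds_iff] at hq
    obtain ⟨δ₁, hδ₁, hp⟩ := hp
    obtain ⟨δ₂, hδ₂, hq⟩ := hq
    filter_upwards [self_mem_nhdsWithin, mem_nhdsWithin_of_mem_nhds
      (Metric.ball_mem_nhds s hδ₁), mem_nhdsWithin_of_mem_nhds (Metric.ball_mem_nhds s hδ₂)]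
      with s' hs' h1 h2
    have hs' : s ≤ s' := hs'
    have e : ∫ r in s..s', (A r (t - s') - A s (t - s)) =
        (∫ r in s..s', A r (t - s')) - (s' - s) • A s (t - s) := by
      rw [intervalIntegral.integral_sub (hAi _ _ _ hs (hs.trans hs')) intervalIntegrable_const,
        intervalIntegral.integral_const]
    rw [intervalIntegral.integral_same, sub_zero, ← e]
    refine intervalIntegral.norm_integral_le_of_norm_le_const fun r hr => ?_
    rw [uIoc_of_le hs'] at hr
    have h3 : A r (t - s') ∈ Metric.ball (A s (t - s)) ε := hpq (hp (y := r) (by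
      rw [Metric.mem_ball, Real.dist_eq, abs_of_nonneg (by linarith)] at h1
      rw [Real.dist_eq, abs_of_nonneg (by linarith [hr.1])]
      linarith [hr.2]) (hs.trans hr.1.le)) (hq (y := t - s') (by
      rw [Metric.mem_ball, Real.dist_eq] at h2
      rw [Real.dist_eq, ← abs_neg]
      convert h2 using 2
      ring))
    rw [Metric.mem_ball, Real.dist_eq] at h3
    exact h3.le
  -- The derivative that falls on the transported test function cancels the transport term of the
  -- weak formulation, so only the collision term survives.
  have hY : HasDerivAt (fun s' => ∫ z, u s z * φ (shift (t - s') z) ∂μ)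
      (∫ z, u s z * (-transportDeriv φ (shift (t - s) z)) ∂μ) s := by
    refine (hasDerivAt_integral_of_dominated_loc_of_deriv_le (bound := fun z => ‖u s z‖ * B')
      (F' := fun s' z => u s z * (-transportDeriv φ (shift (t - s') z))) univ_mem
      (Eventually.of_forall fun s' => (hint s hs _).aestronglyMeasurable) (hint s hs _) ?_
      (Eventually.of_forall fun z s' _ => ?_) ((hu.integrable hs).norm.mul_const _)
      (Eventually.of_forall fun z s' _ => ?_)).2
    · exact ((hu.measurable s).mul (hφ.continuous_transportDeriv.measurable.comp
        (measurable_shift _)).neg).aestronglyMeasurable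
    · rw [norm_mul, norm_neg]
      exact mul_le_mul_of_nonneg_left (tobd (hB' _)) (norm_nonneg _)
    · have h1 := (hasDerivAt_comp_shift (hφ.smooth.differentiable one_ne_zero) z
        (t - s')).comp_const_sub t s'
      exact h1.const_mul _
  have hXY := hX.add hY.hasDerivWithinAt
  refine (hXY.congr (fun s' hs' => ?_) ?_).congr_deriv ?_
  · rw [hweak s' hs']; simp only [Pi.add_apply]; ring
  · simp
  · simp only [hA, mul_neg, integral_neg]
    ring

/-- Weak solutions in `L¹` are unique. -/
theorem IsL1Trajectory.ae_eq (hV : volume (velocitySet d V₀) = 1)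
    (hχ : χ ∈ Ioo (0 : ℝ) 1) (hk : IsBoundedKernel V₀ C k) {u w : ℝ → E d × E d → ℝ}
    (hu : IsL1Trajectory χ V₀ k f u) (hw : IsL1Trajectory χ V₀ k f w) {T : ℝ} (hT : 0 ≤ T) :
    u T =ᵐ[phaseMeasure d V₀] w T := by
  set μ := phaseMeasure d V₀ with hμ
  obtain ⟨M₁, hM₁⟩ := hu.bounded T
  obtain ⟨M₂, hM₂⟩ := hw.bounded T
  have hdm : ∀ s, Measurable fun z => u s z - w s z := fun s =>
    (hu.measurable s).sub (hw.measurable s)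
  have hdi : ∀ s, 0 ≤ s → Integrable (fun z => u s z - w s z) μ := fun s hs =>
    (hu.integrable hs).sub (hw.integrable hs)
  have hL1 : ∀ s, 0 ≤ s → ∫⁻ z, ‖u s z - w s z‖ₑ ∂μ =
      ENNReal.ofReal (∫ z, |u s z - w s z| ∂μ) := fun s hs =>
    (ofReal_integral_norm_eq_lintegral_enorm (hdi s hs)).symm
  set c : ℝ := 2 + C with hc
  -- Gronwall by iteration. Each pass inserts the previous bound into the collision term, of `L¹`
  -- operator norm at most `c = 2 + C`, and integrates once more in time; the factorial sends the
  -- bound to zero.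
  have key : ∀ j : ℕ, ∀ t ∈ Icc 0 T, ∫ z, |u t z - w t z| ∂μ ≤
      (M₁ + M₂) * ((c * t) ^ j / j.factorial) := by
    intro j
    induction j with
    | zero =>
      intro t ht
      have h1 : ∫⁻ z, ‖u t z - w t z‖ₑ ∂μ ≤ ENNReal.ofReal (M₁ + M₂) := by
        refine (lintegral_mono fun z => enorm_sub_le).trans ?_
        rw [lintegral_add_left (hu.measurable t).enorm, ENNReal.ofReal_add (by positivity)
          (by positivity), ENNReal.ofReal_coe_nnreal, ENNReal.ofReal_coe_nnreal]
        exact add_le_add (hM₁ t ht) (hM₂ t ht)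
      rw [hL1 t ht.1, ENNReal.ofReal_le_ofReal_iff (by positivity)] at h1
      simpa using h1
    | succ j ih =>
      intro t ht
      -- By duality the difference at time `t` is tested with `φ`, carried backward along the flow.
      -- This keeps the supremum of `|φ|` at most one and removes the transport term.
      refine lintegral_le_of_forall_test (hdm t) (hdi t ht.1) fun φ hφ hφ1 => ?_
      have hφs : ∀ σ, Measurable fun z : E d × E d => φ (shift σ z) := fun σ =>
        hφ.smooth.continuous.measurable.comp (measurable_shift σ)
      have hint : ∀ g : E d × E d → ℝ, Integrable g μ → ∀ σ,
          Integrable (fun z => g z * φ (shift σ z)) μ := fun g hg σ =>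
        hg.mul_bdd (c := 1) (hφs σ).aestronglyMeasurable (Eventually.of_forall fun z => hφ1 _)
      set H : ℝ → ℝ := fun s => (∫ z, u s z * φ (shift (t - s) z) ∂μ) -
        ∫ z, w s z * φ (shift (t - s) z) ∂μ with hH
      set H' : ℝ → ℝ := fun s => (∫ z, collision χ V₀ k (u s) z * φ (shift (t - s) z) ∂μ) -
        ∫ z, collision χ V₀ k (w s) z * φ (shift (t - s) z) ∂μ with hH'
      have hHd : ∀ s ∈ Ico 0 t, HasDerivWithinAt H (H' s) (Ici s) s := fun s hs =>
        (hu.hasDerivWithinAt hV hχ hk hφ t hs.1).sub (hw.hasDerivWithinAt hV hχ hk hφ t hs.1)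
      have hHc : ContinuousOn H (Icc 0 t) := fun s hs => by
        have hq : Tendsto (fun s' : ℝ => (s', t - s')) (𝓝[Icc 0 t] s)
            (𝓝[Ici 0] s ×ˢ 𝓝 (t - s)) :=
          (tendsto_id.mono_left (nhdsWithin_mono _ Icc_subset_Ici_self)).prodMk
            (((continuous_const.sub continuous_id).tendsto s).mono_left nhdsWithin_le_nhds)
        exact ((integral_mul_comp_shift_tendsto hu.measurable (fun r hr => hu.integrable hr)
          hu.continuous hφ.smooth.continuous hφ.compact hs.1 (t - s)).comp hq).sub
          ((integral_mul_comp_shift_tendsto hw.measurable (fun r hr => hw.integrable hr)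
          hw.continuous hφ.smooth.continuous hφ.compact hs.1 (t - s)).comp hq)
      have hH0 : H 0 = 0 := by
        have h1 := hu.weak _ (hφ.comp_shift t) 0 le_rfl
        have h2 := hw.weak _ (hφ.comp_shift t) 0 le_rfl
        simp only [intervalIntegral.integral_same, add_zero] at h1 h2
        simp only [hH, sub_zero]
        exact sub_eq_zero.2 (h1.trans h2.symm)
      have hbd : ∀ s ∈ Ico 0 t, ‖H' s‖ ≤ (M₁ + M₂) * (c * ((c * s) ^ j / j.factorial)) := by
        intro s hs
        have hs' : s ∈ Icc 0 T := ⟨hs.1, hs.2.le.trans ht.2⟩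
        have hiu := integrable_collision hV hχ hk (hu.measurable s) (hu.integrable hs.1)
        have hiw := integrable_collision hV hχ hk (hw.measurable s) (hw.integrable hs.1)
        have h1 : H' s = ∫ z, (collision χ V₀ k (u s) z - collision χ V₀ k (w s) z) *
            φ (shift (t - s) z) ∂μ := by
          simp only [hH', sub_mul]
          rw [integral_sub (hint _ hiu _) (hint _ hiw _)]
        have h2 : ‖H' s‖ₑ ≤ ENNReal.ofReal (c * ∫ z, |u s z - w s z| ∂μ) := by
          rw [h1]
          refine (enorm_integral_le_lintegral_enorm _).trans ?_
          have e2 : ∫⁻ z, ‖collision χ V₀ k (u s) z - collision χ V₀ k (w s) z‖ₑ ∂μ ≤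
              (2 + C) * ∫⁻ z, ‖u s z - w s z‖ₑ ∂μ := by
            simpa using setLIntegral_collision_sub_le hV hχ hk (hu.measurable s) (hw.measurable s)
              (hu.integrable hs.1) (hw.integrable hs.1) (MeasurableSet.univ (α := E d))
          rw [ENNReal.ofReal_mul (by positivity), ← hL1 s hs.1]
          have ec : ENNReal.ofReal c = 2 + C := by
            rw [hc, ENNReal.ofReal_add (by norm_num) (by positivity), ENNReal.ofReal_coe_nnreal]
            norm_num
          rw [ec]
          refine le_trans (lintegral_mono fun z => ?_) e2
          rw [enorm_mul]
          refine mul_le_of_le_one_right zero_le ?_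
          rw [← ofReal_norm]
          exact ENNReal.ofReal_le_one.2 (hφ1 _)
        rw [← ofReal_norm, ENNReal.ofReal_le_ofReal_iff (mul_nonneg (by positivity)
          (integral_nonneg fun z => abs_nonneg _))] at h2
        calc ‖H' s‖ ≤ c * ∫ z, |u s z - w s z| ∂μ := h2
          _ ≤ c * ((M₁ + M₂) * ((c * s) ^ j / j.factorial)) :=
            mul_le_mul_of_nonneg_left (ih s hs') (by positivity)
          _ = _ := by ring
      have hfin := image_norm_le_of_norm_deriv_right_le_deriv_boundary hHc hHd
        (B := fun s => (M₁ + M₂) * ((c * s) ^ (j + 1) / (j + 1).factorial))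
        (B' := fun s => (M₁ + M₂) * (c * ((c * s) ^ j / j.factorial)))
        (by simp [hH0]) (fun s => by
          have h1 := ((((hasDerivAt_id s).const_mul c).pow (j + 1)).div_const
            ((j + 1).factorial : ℝ)).const_mul ((M₁ : ℝ) + M₂)
          refine h1.congr_deriv ?_
          rw [Nat.factorial_succ]
          push_cast
          simp only [id]
          have : (j.factorial : ℝ) ≠ 0 := by positivity
          have : (j : ℝ) + 1 ≠ 0 := by positivity
          field_simp) hbd (right_mem_Icc.2 ht.1)
      have hHt : H t = ∫ z, (u t z - w t z) * φ z ∂μ := by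
        have h1 := hint _ (hu.integrable ht.1) 0
        have h2 := hint _ (hw.integrable ht.1) 0
        simp only [shift_zero] at h1 h2
        simp only [hH, sub_self, shift_zero, sub_mul]
        rw [integral_sub h1 h2]
      rw [← hHt]
      exact (le_abs_self _).trans hfin
  have hlim : Tendsto (fun j : ℕ => ((M₁ : ℝ) + M₂) * ((c * T) ^ j / j.factorial)) atTop (𝓝 0) := by
    simpa using (FloorSemiring.tendsto_pow_div_factorial_atTop (c * T)).const_mul ((M₁ : ℝ) + M₂)
  have hle : ∫ z, |u T z - w T z| ∂μ ≤ 0 :=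
    ge_of_tendsto' hlim fun j => key j T ⟨hT, le_rfl⟩
  have h0 : ∫ z, |u T z - w T z| ∂μ = 0 :=
    le_antisymm hle (integral_nonneg fun z => abs_nonneg _)
  rw [integral_eq_zero_iff_of_nonneg (fun z => abs_nonneg _) (hdi T hT).abs] at h0
  filter_upwards [h0] with z hz
  have : |u T z - w T z| = 0 := hz
  linarith [abs_eq_zero.1 this]

end Uniqueness

/-! ### Exponential factors -/

/-- The exponential, as an extended nonnegative number. -/
def expE (x : ℝ) : ℝ≥0∞ := ENNReal.ofReal (Real.exp x)

theorem expE_add (x y : ℝ) : expE (x + y) = expE x * expE y := by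
  unfold expE
  rw [Real.exp_add, ENNReal.ofReal_mul (Real.exp_pos x).le]

@[simp] theorem expE_zero : expE 0 = 1 := by simp [expE]

theorem expE_mono {x y : ℝ} (h : x ≤ y) : expE x ≤ expE y :=
  ENNReal.ofReal_le_ofReal (Real.exp_le_exp.2 h)

theorem expE_le_one {x : ℝ} (h : x ≤ 0) : expE x ≤ 1 := (expE_mono h).trans_eq expE_zero

theorem expE_ne_top (x : ℝ) : expE x ≠ ⊤ := ENNReal.ofReal_ne_top

theorem expE_pow_two (x : ℝ) : expE x ^ 2 = expE (2 * x) := by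
  rw [sq, ← expE_add]; congr 1; ring

theorem continuous_expE : Continuous expE := ENNReal.continuous_ofReal.comp Real.continuous_exp

@[fun_prop] theorem measurable_expE : Measurable expE := continuous_expE.measurable

theorem lintegral_expE_le {c t : ℝ} (hc : 0 < c) :
    ∫⁻ s in Ioc 0 t, expE (-c * (t - s)) ≤ ENNReal.ofReal (1 / c) := by
  rcases lt_or_ge t 0 with ht | ht
  · simp [Ioc_eq_empty (not_lt.2 ht.le)]
  have h1 : ∀ s, expE (-c * (t - s)) = expE (-(c * t)) * expE (c * s) := fun s => by
    rw [← expE_add]; congr 1; ring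
  simp only [h1]
  rw [lintegral_const_mul _ (by fun_prop)]
  refine (mul_le_mul_right (lintegral_exp_Ioc_le hc ht) _).trans_eq ?_
  rw [expE, ← ENNReal.ofReal_mul (Real.exp_pos _).le, ← mul_div_assoc, ← Real.exp_add]
  simp

theorem lintegral_triangle {t : ℝ} {F : ℝ → ℝ → ℝ≥0∞} (hF : Measurable (Function.uncurry F)) :
    ∫⁻ r in Ioc 0 t, ∫⁻ s in Ioc 0 r, F r s = ∫⁻ s in Ioc 0 t, ∫⁻ r in Ioc s t, F r s := by
  have hm : Measurable (Function.uncurry fun r s : ℝ =>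
      {p : ℝ × ℝ | 0 < p.2 ∧ p.2 ≤ p.1 ∧ p.1 ≤ t}.indicator (Function.uncurry F) (r, s)) := by
    refine hF.indicator ?_
    exact (measurableSet_lt measurable_const measurable_snd).inter
      ((measurableSet_le measurable_snd measurable_fst).inter
        (measurableSet_le measurable_fst measurable_const))
  have h1 : ∀ r, (Ioc 0 t).indicator (fun r => ∫⁻ s in Ioc 0 r, F r s) r =
      ∫⁻ s, {p : ℝ × ℝ | 0 < p.2 ∧ p.2 ≤ p.1 ∧ p.1 ≤ t}.indicator (Function.uncurry F) (r, s) := by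
    intro r
    by_cases hr : r ∈ Ioc 0 t
    · rw [indicator_of_mem hr, ← lintegral_indicator measurableSet_Ioc]
      refine lintegral_congr fun s => ?_
      refine indicator_eq_indicator ?_ rfl
      exact ⟨fun h => ⟨h.1, h.2, hr.2⟩, fun h => ⟨h.1, h.2.1⟩⟩
    · rw [indicator_of_notMem hr]
      symm
      refine (lintegral_congr fun s => indicator_of_notMem (fun h => hr ?_) _).trans lintegral_zero
      exact ⟨h.1.trans_le h.2.1, h.2.2⟩
  have h2 : ∀ s, (Ioc 0 t).indicator (fun s => ∫⁻ r in Ioc s t, F r s) s =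
      ∫⁻ r, {p : ℝ × ℝ | 0 < p.2 ∧ p.2 ≤ p.1 ∧ p.1 ≤ t}.indicator (Function.uncurry F) (r, s) := by
    intro s
    by_cases hs : s ∈ Ioc 0 t
    -- The triangle contains the diagonal `r = s`, which `Ioc s t` omits; it is negligible for each
    -- `s`.
    · rw [indicator_of_mem hs, setLIntegral_congr Ioc_ae_eq_Icc,
        ← lintegral_indicator measurableSet_Icc]
      refine lintegral_congr fun r => ?_
      refine indicator_eq_indicator ?_ rfl
      exact ⟨fun h => ⟨hs.1, h.1, h.2⟩, fun h => h.2⟩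
    · rw [indicator_of_notMem hs]
      symm
      refine (lintegral_congr fun r => indicator_of_notMem (fun h => hs ?_) _).trans lintegral_zero
      exact ⟨h.1, h.2.1.trans h.2.2⟩
  rw [← lintegral_indicator measurableSet_Ioc, ← lintegral_indicator measurableSet_Ioc]
  simp only [h1, h2]
  exact lintegral_lintegral_swap hm.aemeasurable

/-! ### Weighted `L¹` decay of the majorant -/

/-- A weight `ψ` with derivative `ψ'` along the free transport flow, such that
`v · ∇ψ - K ψ + κ ≤ b ψ`. -/
structure IsLyapunov (χ V₀ b : ℝ) (ψ ψ' κ : E d × E d → ℝ) : Prop where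
  cont : Continuous ψ
  cont' : Continuous ψ'
  measurable : Measurable κ
  nonneg : ∀ z, z.2 ∈ velocitySet d V₀ → 0 ≤ ψ z
  nonneg' : ∀ z, z.2 ∈ velocitySet d V₀ → 0 ≤ κ z
  hasDerivAt : ∀ z t, HasDerivAt (fun t => ψ (shift t z)) (ψ' (shift t z)) t
  ineq : ∀ z, z.2 ∈ velocitySet d V₀ → ψ' z - turningKernel χ z.1 z.2 * ψ z + κ z ≤ b * ψ z

section Decay

variable {χ V₀ b : ℝ} {ψ ψ' κ : E d × E d → ℝ} {k : E d → E d → ℝ} {f : E d × E d → ℝ}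

/-- The derivative along the characteristic of integrating factor times `e^{-br} ψ` is at most minus
the same factor times `e^{-br} κ`, by the Lyapunov inequality. Integration from `s` to `t` keeps the
`κ` term as a dissipation. -/
theorem IsLyapunov.gauge_ineq (h : IsLyapunov χ V₀ b ψ ψ' κ) (hχ : 0 ≤ χ) {z : E d × E d}
    (hz : z.2 ∈ velocitySet d V₀) {s t : ℝ} (hs : 0 ≤ s) (hst : s ≤ t) :
    ENNReal.ofReal (gauge χ (-1) z t * Real.exp (-b * t) * ψ (shift t z)) +
      ∫⁻ r in Ioc s t, ENNReal.ofReal (gauge χ (-1) z r * Real.exp (-b * r) * κ (shift r z)) ≤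
    ENNReal.ofReal (gauge χ (-1) z s * Real.exp (-b * s) * ψ (shift s z)) := by
  have ht : 0 ≤ t := hs.trans hst
  have hsh : Continuous fun t => shift t z :=
    continuous_shift_uncurry.comp (continuous_id.prodMk continuous_const)
  have hexp : IsPrimitiveOn t (fun r => Real.exp (-b * r)) (fun r => -b * Real.exp (-b * r)) :=
    IsPrimitiveOn.of_hasDerivAt countable_empty (by fun_prop)
      (fun r _ => by
        have := ((hasDerivAt_id r).const_mul (-b)).exp
        refine this.congr_deriv ?_
        simp only [id, mul_one]; ring) (Continuous.intervalIntegrable (by fun_prop) _ _)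
  have hψ : IsPrimitiveOn t (fun r => ψ (shift r z)) (fun r => ψ' (shift r z)) :=
    IsPrimitiveOn.of_hasDerivAt countable_empty (h.cont.comp hsh)
      (fun r _ => h.hasDerivAt z r) ((h.cont'.comp hsh).intervalIntegrable _ _)
  have hE := ((gauge_isPrimitiveOn hχ (-1) z t).mul ht hexp).mul ht hψ
  set Ef : ℝ → ℝ := fun r => gauge χ (-1) z r * Real.exp (-b * r) * ψ (shift r z) with hEf
  set E' : ℝ → ℝ := fun r => (-1 * turningKernel χ (shift r z).1 (shift r z).2 * gauge χ (-1) z r *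
    Real.exp (-b * r) + gauge χ (-1) z r * (-b * Real.exp (-b * r))) * ψ (shift r z) +
    gauge χ (-1) z r * Real.exp (-b * r) * ψ' (shift r z) with hE'
  have hgpos : ∀ r, 0 < gauge χ (-1) z r * Real.exp (-b * r) := fun r =>
    mul_pos (Real.exp_pos _) (Real.exp_pos _)
  have hle : ∀ r, gauge χ (-1) z r * Real.exp (-b * r) * κ (shift r z) ≤ -E' r := fun r => by
    have := mul_le_mul_of_nonneg_left (h.ineq (shift r z) hz) (hgpos r).le
    simp only [hE']
    linarith
  have hnn : ∀ r, 0 ≤ gauge χ (-1) z r * Real.exp (-b * r) * κ (shift r z) := fun r =>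
    mul_nonneg (hgpos r).le (h.nonneg' _ hz)
  have hint : IntervalIntegrable E' volume s t := hE.integrable.mono_set (by
    rw [uIcc_of_le hst, uIcc_of_le ht]; exact Icc_subset_Icc_left hs)
  have hEst : Ef t - Ef s = ∫ r in s..t, E' r := by
    have h1 := hE.eq t ⟨ht, le_rfl⟩
    have h2 := hE.eq s ⟨hs, hst⟩
    have h3 := intervalIntegral.integral_interval_sub_left (hE.integrable)
      (hE.mono ⟨hs, hst⟩).integrable
    have h1' : Ef t = Ef 0 + ∫ r in (0 : ℝ)..t, E' r := h1
    have h2' : Ef s = Ef 0 + ∫ r in (0 : ℝ)..s, E' r := h2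
    have h3' : (∫ r in (0 : ℝ)..t, E' r) - ∫ r in (0 : ℝ)..s, E' r = ∫ r in s..t, E' r := h3
    linarith
  have hlint : ∫⁻ r in Ioc s t,
      ENNReal.ofReal (gauge χ (-1) z r * Real.exp (-b * r) * κ (shift r z)) ≤
      ENNReal.ofReal (Ef s - Ef t) := by
    have h1 : Ef s - Ef t = ∫ r in Ioc s t, -E' r := by
      rw [integral_neg, ← intervalIntegral.integral_of_le hst, ← hEst]; ring
    rw [h1, ofReal_integral_eq_lintegral_ofReal]
    · exact lintegral_mono fun r => ENNReal.ofReal_le_ofReal (hle r)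
    · exact ((intervalIntegrable_iff_integrableOn_Ioc_of_le hst).1 hint).neg
    · exact Eventually.of_forall fun r => (hnn r).trans (hle r)
  have hEt : 0 ≤ Ef t := mul_nonneg (hgpos t).le (h.nonneg _ hz)
  by_cases hneg : 0 ≤ Ef s - Ef t
  · calc _ ≤ ENNReal.ofReal (Ef t) + ENNReal.ofReal (Ef s - Ef t) := add_le_add_right hlint _
      _ = _ := by rw [← ENNReal.ofReal_add hEt hneg]; congr 1; ring
  · exfalso
    apply hneg
    have : Ef t - Ef s ≤ 0 := by
      rw [hEst, intervalIntegral.integral_of_le hst]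
      refine integral_nonpos fun r => ?_
      have h0 : E' r ≤ 0 := by linarith [(hnn r).trans (hle r)]
      exact h0
    linarith

theorem measurable_absGain_majorant (χ V₀ : ℝ) (hk : Measurable (Function.uncurry k))
    (hf : Measurable f) : Measurable fun q : ℝ × E d =>
      absGain V₀ k (majorant χ V₀ k f q.1) q.2 :=
  measurable_absGain V₀ hk (P := fun q : ℝ × E d => majorant χ V₀ k f q.1)
    ((measurable_majorant χ V₀ hk hf).comp
      ((measurable_fst.comp measurable_fst).prodMk measurable_snd)) measurable_snd

/-- By `majorant_shift`, the majorant superposes the initial datum and the sources emitted at times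
`s`. `gauge_ineq` applies to each contribution from its own starting time, and Tonelli on the
triangle `s ≤ r ≤ t` reassembles the dissipation. -/
theorem IsLyapunov.majorant_char (h : IsLyapunov χ V₀ b ψ ψ' κ) (hχ : 0 ≤ χ)
    (hk : Measurable (Function.uncurry k)) (hf : Measurable f) {z : E d × E d}
    (hz : z.2 ∈ velocitySet d V₀) {t : ℝ} (ht : 0 ≤ t) :
    expE (-b * t) * ENNReal.ofReal (ψ (shift t z)) * majorant χ V₀ k f t (shift t z) +
      ∫⁻ r in Ioc 0 t, expE (-b * r) * ENNReal.ofReal (κ (shift r z)) *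
        majorant χ V₀ k f r (shift r z) ≤
    ENNReal.ofReal (ψ z) * ‖f z‖ₑ + ∫⁻ s in Ioc 0 t, expE (-b * s) *
      ENNReal.ofReal (ψ (shift s z)) * absGain V₀ k (majorant χ V₀ k f s) (shift s z).1 := by
  set g : ℝ → ℝ≥0∞ := fun s => ‖gauge χ 1 z s‖ₑ * absGain V₀ k (majorant χ V₀ k f s) (shift s z).1
    with hg
  have hshm : Measurable fun s => shift s z := measurable_comp_shift measurable_id measurable_id
    measurable_const
  have hgm : Measurable g := (continuous_gauge χ 1 z).measurable.enorm.mul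
    ((measurable_absGain_majorant χ V₀ hk hf).comp
      (measurable_id.prodMk (measurable_fst.comp hshm)))
  have hgg : ∀ c r, ‖gauge χ c z r‖ₑ = ENNReal.ofReal (gauge χ c z r) := fun c r =>
    Real.enorm_of_nonneg (Real.exp_pos _).le
  set Eψ : ℝ → ℝ≥0∞ := fun r =>
    ENNReal.ofReal (gauge χ (-1) z r * Real.exp (-b * r) * ψ (shift r z)) with hEψ
  set Eκ : ℝ → ℝ≥0∞ := fun r =>
    ENNReal.ofReal (gauge χ (-1) z r * Real.exp (-b * r) * κ (shift r z)) with hEκ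
  have hfac : ∀ (w : ℝ) (r : ℝ), ENNReal.ofReal (gauge χ (-1) z r * Real.exp (-b * r) * w) =
      expE (-b * r) * ENNReal.ofReal w * ‖gauge χ (-1) z r‖ₑ := fun w r => by
    have h0 : 0 ≤ gauge χ (-1) z r := (Real.exp_pos _).le
    rw [mul_assoc, ENNReal.ofReal_mul h0, ENNReal.ofReal_mul (Real.exp_pos _).le, hgg, expE]
    ring
  have hEκm : Measurable Eκ := ENNReal.measurable_ofReal.comp
    (((continuous_gauge χ (-1) z).measurable.mul (by fun_prop)).mul (h.measurable.comp hshm))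
  have hP : ∀ r, majorant χ V₀ k f r (shift r z) = ‖gauge χ (-1) z r‖ₑ *
      (‖f z‖ₑ + ∫⁻ s in Ioc 0 r, g s) := fun r => majorant_shift hk hf r z
  have e1 : expE (-b * t) * ENNReal.ofReal (ψ (shift t z)) * majorant χ V₀ k f t (shift t z) =
      Eψ t * ‖f z‖ₑ + ∫⁻ s in Ioc 0 t, Eψ t * g s := by
    rw [hP, lintegral_const_mul _ hgm, ← mul_add, hEψ, ← mul_assoc]
    simp only [hfac]
  have e2 : ∫⁻ r in Ioc 0 t, expE (-b * r) * ENNReal.ofReal (κ (shift r z)) *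
        majorant χ V₀ k f r (shift r z) = (∫⁻ r in Ioc 0 t, Eκ r) * ‖f z‖ₑ +
        ∫⁻ s in Ioc 0 t, (∫⁻ r in Ioc s t, Eκ r) * g s := by
    have h1 : ∀ r, expE (-b * r) * ENNReal.ofReal (κ (shift r z)) *
        majorant χ V₀ k f r (shift r z) = Eκ r * ‖f z‖ₑ + ∫⁻ s in Ioc 0 r, Eκ r * g s := fun r => by
      rw [hP, lintegral_const_mul _ hgm, ← mul_add, hEκ, ← mul_assoc]
      simp only [hfac]
    simp only [h1]
    rw [lintegral_add_left (hEκm.mul_const _), lintegral_mul_const _ hEκm,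
      lintegral_triangle (F := fun r s => Eκ r * g s)
        ((hEκm.comp measurable_fst).mul (hgm.comp measurable_snd))]
    simp only [lintegral_mul_const _ hEκm]
  rw [e1, e2, add_add_add_comm, ← add_mul, ← lintegral_add_left (hgm.const_mul _)]
  simp only [← add_mul]
  refine add_le_add (mul_le_mul_left ?_ _) (setLIntegral_mono' measurableSet_Ioc fun s hs => ?_)
  · refine (h.gauge_ineq hχ hz le_rfl ht).trans_eq ?_
    simp [gauge_zero]
  · refine (mul_le_mul_left (h.gauge_ineq hχ hz hs.1.le hs.2) _).trans_eq ?_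
    rw [hfac, hg]
    simp only
    rw [mul_assoc, ← mul_assoc ‖gauge χ (-1) z s‖ₑ, ← enorm_mul, gauge_mul_gauge_neg, enorm_one,
      one_mul]

/-- The `L¹` norm of the majorant with the weight `ψ` decays like `e^{bt}`, up to the part of the
gain term that is not absorbed by `κ`. -/
theorem IsLyapunov.lintegral_majorant_le (h : IsLyapunov χ V₀ b ψ ψ' κ) (hχ : 0 ≤ χ)
    (hk : Measurable (Function.uncurry k)) (hf : Measurable f) {ρ : E d × E d → ℝ≥0∞}
    (hρ : Measurable ρ)
    (hgain : ∀ x, ∀ v ∈ velocitySet d V₀, ‖k x v‖ₑ * ∫⁻ v' in velocitySet d V₀,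
      ENNReal.ofReal (ψ (x, v')) ≤ ENNReal.ofReal (κ (x, v)) + ρ (x, v))
    {t : ℝ} (ht : 0 ≤ t)
    (hfin : ∫⁻ r in Ioc 0 t, expE (-b * r) * ∫⁻ z, ENNReal.ofReal (κ z) *
      majorant χ V₀ k f r z ∂(phaseMeasure d V₀) ≠ ⊤) :
    expE (-b * t) * ∫⁻ z, ENNReal.ofReal (ψ z) * majorant χ V₀ k f t z ∂(phaseMeasure d V₀) ≤
      ∫⁻ z, ENNReal.ofReal (ψ z) * ‖f z‖ₑ ∂(phaseMeasure d V₀) +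
      ∫⁻ s in Ioc 0 t, expE (-b * s) * ∫⁻ z, ρ z * majorant χ V₀ k f s z ∂(phaseMeasure d V₀) := by
  set μ := phaseMeasure d V₀ with hμ
  have hPm := measurable_majorant χ V₀ hk hf
  have hPt : ∀ r, Measurable (majorant χ V₀ k f r) := fun r =>
    hPm.comp (measurable_const.prodMk measurable_id)
  have hψm : Measurable fun z => ENNReal.ofReal (ψ z) := h.cont.measurable.ennreal_ofReal
  have hκm : Measurable fun z => ENNReal.ofReal (κ z) := h.measurable.ennreal_ofReal
  have hhm := measurable_absGain_majorant χ V₀ hk hf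
  have hht : ∀ s, Measurable fun z : E d × E d => absGain V₀ k (majorant χ V₀ k f s) z.1 :=
    fun s => hhm.comp (measurable_const.prodMk measurable_fst)
  have swap : ∀ (w : E d × E d → ℝ≥0∞) (p : ℝ → E d × E d → ℝ≥0∞), Measurable w →
      Measurable (Function.uncurry p) →
      ∫⁻ z, (∫⁻ r in Ioc 0 t, expE (-b * r) * w (shift r z) * p r (shift r z)) ∂μ =
      ∫⁻ r in Ioc 0 t, expE (-b * r) * ∫⁻ z, w z * p r z ∂μ := by
    intro w p hw hp
    have hsm : Measurable fun q : (E d × E d) × ℝ => shift q.2 q.1 :=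
      measurable_comp_shift measurable_id measurable_snd measurable_fst
    have hexm : Measurable fun q : (E d × E d) × ℝ => expE (-b * q.2) :=
      measurable_expE.comp (measurable_snd.const_mul _)
    have hm : Measurable fun q : (E d × E d) × ℝ =>
        expE (-b * q.2) * w (shift q.2 q.1) * p q.2 (shift q.2 q.1) :=
      (hexm.mul (hw.comp hsm)).mul (hp.comp (measurable_snd.prodMk hsm))
    rw [lintegral_lintegral_swap hm.aemeasurable]
    refine lintegral_congr fun r => ?_
    have hpr : Measurable (p r) := hp.comp (measurable_const.prodMk measurable_id)
    have hwp : Measurable fun z => w z * p r z := hw.mul hpr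
    have hwps : Measurable fun z => w (shift r z) * p r (shift r z) := hwp.comp (measurable_shift r)
    simp only [mul_assoc]
    rw [lintegral_const_mul _ hwps, hμ, lintegral_shift V₀ r (fun z => w z * p r z) hwp]
  -- The gain does not depend on the outgoing velocity, so `ψ` enters only through its velocity
  -- average, which the hypothesis bounds by `κ + ρ`.
  have hgain' : ∀ s, ∫⁻ z, ENNReal.ofReal (ψ z) * absGain V₀ k (majorant χ V₀ k f s) z.1 ∂μ ≤
      ∫⁻ z, ENNReal.ofReal (κ z) * majorant χ V₀ k f s z ∂μ +
      ∫⁻ z, ρ z * majorant χ V₀ k f s z ∂μ := by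
    intro s
    have m1 : Measurable fun z : E d × E d =>
      ENNReal.ofReal (ψ z) * absGain V₀ k (majorant χ V₀ k f s) z.1 := hψm.mul (hht s)
    have m2 : Measurable fun z : E d × E d =>
      ENNReal.ofReal (κ z) * majorant χ V₀ k f s z := hκm.mul (hPt s)
    have m3 : Measurable fun z : E d × E d => ρ z * majorant χ V₀ k f s z := hρ.mul (hPt s)
    rw [← lintegral_add_left m2, hμ, lintegral_phaseMeasure V₀ m1, lintegral_phaseMeasure V₀
      (F := fun z => ENNReal.ofReal (κ z) * majorant χ V₀ k f s z + ρ z * majorant χ V₀ k f s z)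
      (m2.add m3)]
    refine lintegral_mono fun x => ?_
    have mkx : Measurable fun v => ‖k x v‖ₑ * majorant χ V₀ k f s (x, v) :=
      (hk.comp (measurable_const.prodMk measurable_id)).enorm.mul
        ((hPt s).comp (measurable_const.prodMk measurable_id))
    have mψx : Measurable fun v => ENNReal.ofReal (ψ (x, v)) :=
      hψm.comp (measurable_const.prodMk measurable_id)
    simp only
    rw [lintegral_mul_const _ mψx]
    unfold absGain
    rw [← lintegral_const_mul _ mkx]
    refine setLIntegral_mono' (measurableSet_velocitySet V₀) fun v hv => ?_
    rw [← add_mul, ← mul_assoc, mul_comm (∫⁻ v in velocitySet d V₀, ENNReal.ofReal (ψ (x, v)))]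
    exact mul_le_mul_left (hgain x v hv) _
  have hchar : ∫⁻ z, (expE (-b * t) * ENNReal.ofReal (ψ (shift t z)) *
        majorant χ V₀ k f t (shift t z) +
      ∫⁻ r in Ioc 0 t, expE (-b * r) * ENNReal.ofReal (κ (shift r z)) *
        majorant χ V₀ k f r (shift r z)) ∂μ ≤
      ∫⁻ z, (ENNReal.ofReal (ψ z) * ‖f z‖ₑ + ∫⁻ s in Ioc 0 t, expE (-b * s) *
      ENNReal.ofReal (ψ (shift s z)) * absGain V₀ k (majorant χ V₀ k f s) (shift s z).1) ∂μ := by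
    refine lintegral_mono_ae ?_
    filter_upwards [ae_velocity_mem V₀] with z hz
    exact h.majorant_char hχ hk hf hz ht
  have mψP : Measurable fun z => ENNReal.ofReal (ψ z) * majorant χ V₀ k f t z := hψm.mul (hPt t)
  have mψPs : Measurable fun z => expE (-b * t) * ENNReal.ofReal (ψ (shift t z)) *
        majorant χ V₀ k f t (shift t z) :=
    ((hψm.comp (measurable_shift t)).const_mul _).mul ((hPt t).comp (measurable_shift t))
  have mψf : Measurable fun z => ENNReal.ofReal (ψ z) * ‖f z‖ₑ := hψm.mul hf.enorm
  rw [lintegral_add_left mψPs, lintegral_add_left mψf,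
    swap _ _ hκm hPm, swap _ (fun s z => absGain V₀ k (majorant χ V₀ k f s) z.1) hψm
      (hhm.comp (measurable_fst.prodMk (measurable_fst.comp measurable_snd)))] at hchar
  have e1 : ∫⁻ z, expE (-b * t) * ENNReal.ofReal (ψ (shift t z)) *
        majorant χ V₀ k f t (shift t z) ∂μ = expE (-b * t) * ∫⁻ z, ENNReal.ofReal (ψ z) *
        majorant χ V₀ k f t z ∂μ := by
    have mψPt : Measurable fun z => ENNReal.ofReal (ψ (shift t z)) *
        majorant χ V₀ k f t (shift t z) := mψP.comp (measurable_shift t)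
    simp only [mul_assoc]
    rw [lintegral_const_mul _ mψPt, hμ, lintegral_shift V₀ t (fun z => ENNReal.ofReal (ψ z) *
      majorant χ V₀ k f t z) mψP]
  rw [e1] at hchar
  have hρm : Measurable fun r => expE (-b * r) * ∫⁻ z, ENNReal.ofReal (κ z) *
      majorant χ V₀ k f r z ∂μ := by
    refine (measurable_expE.comp (measurable_id.const_mul _)).mul ?_
    exact Measurable.lintegral_prod_right' (f := fun q : ℝ × (E d × E d) =>
      ENNReal.ofReal (κ q.2) * majorant χ V₀ k f q.1 q.2) ((hκm.comp measurable_snd).mul hPm)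
  have hsplit : ∫⁻ s in Ioc 0 t, expE (-b * s) * ∫⁻ z, ENNReal.ofReal (ψ z) *
      absGain V₀ k (majorant χ V₀ k f s) z.1 ∂μ ≤
      (∫⁻ r in Ioc 0 t, expE (-b * r) * ∫⁻ z, ENNReal.ofReal (κ z) *
        majorant χ V₀ k f r z ∂μ) +
      ∫⁻ s in Ioc 0 t, expE (-b * s) * ∫⁻ z, ρ z * majorant χ V₀ k f s z ∂μ := by
    rw [← lintegral_add_left hρm]
    refine lintegral_mono fun s => ?_
    rw [← mul_add]
    exact mul_le_mul_right (hgain' s) _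
  have hfinal := hchar.trans (add_le_add_right hsplit _)
  rw [add_left_comm, add_comm] at hfinal
  -- The dissipation in `κ` is on both sides; it may be cancelled because it is finite.
  exact (ENNReal.add_le_add_iff_left hfin).1 hfinal

end Decay

/-! ### `L²` estimates -/

theorem add_sq_le_two_mul (a b : ℝ≥0∞) : (a + b) ^ 2 ≤ 2 * (a ^ 2 + b ^ 2) := by
  by_cases ha : a = ⊤
  · simp [ha]
  by_cases hb : b = ⊤
  · simp [hb]
  lift a to ℝ≥0 using ha
  lift b to ℝ≥0 using hb
  have := add_pow_le (zero_le : 0 ≤ a) (zero_le : 0 ≤ b) 2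
  norm_num at this
  exact_mod_cast this

theorem add_add_sq_le (a b c : ℝ≥0∞) : (a + b + c) ^ 2 ≤ 4 * (a ^ 2 + b ^ 2 + c ^ 2) := by
  calc (a + b + c) ^ 2 ≤ 2 * ((a + b) ^ 2 + c ^ 2) := add_sq_le_two_mul _ _
    _ ≤ 2 * (2 * (a ^ 2 + b ^ 2) + 2 * c ^ 2) := by
        gcongr
        · exact add_sq_le_two_mul _ _
        · nth_rewrite 1 [← one_mul (c ^ 2)]
          exact mul_le_mul_left one_le_two _
    _ = _ := by ring

/-- Absorption of a half. Finiteness is essential, since `x = ⊤` satisfies the inequality trivially.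
-/
theorem le_two_mul_of_le_add_half {x a : ℝ≥0∞} (hx : x ≠ ⊤) (h : x ≤ a + 2⁻¹ * x) :
    x ≤ 2 * a := by
  have h2 : 2⁻¹ * x ≠ ⊤ := ENNReal.mul_ne_top (by simp) hx
  have h1 : 2⁻¹ * x + 2⁻¹ * x = x := by rw [← add_mul, ENNReal.inv_two_add_inv_two, one_mul]
  have h3 : 2⁻¹ * x ≤ a := by
    exact (ENNReal.add_le_add_iff_right h2).1 (h1.trans_le h)
  calc x = 2 * (2⁻¹ * x) := by
        rw [← mul_assoc, ENNReal.mul_inv_cancel (by simp) (by simp), one_mul]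
    _ ≤ _ := mul_le_mul_right h3 _

/-- A substitute for Minkowski's inequality: weighted Cauchy–Schwarz in `s` at fixed `x`, then
Tonelli. -/
theorem lintegral_sq_lintegral_le {α β : Type*} [MeasurableSpace α] [MeasurableSpace β]
    {μ : Measure α} {ν : Measure β} [SFinite μ] [SFinite ν] {w : α → ℝ≥0∞} (hw : Measurable w)
    {G : α → β → ℝ≥0∞} (hG : Measurable (Function.uncurry G)) :
    ∫⁻ x, (∫⁻ s, w s * G s x ∂μ) ^ 2 ∂ν ≤
      (∫⁻ s, w s ∂μ) * ∫⁻ s, w s * (∫⁻ x, G s x ^ 2 ∂ν) ∂μ := by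
  have hGs : ∀ s, Measurable fun x => G s x ^ 2 := fun s =>
    (hG.comp (measurable_const.prodMk measurable_id)).pow_const 2
  have hGx : ∀ x, Measurable fun s => G s x := fun x =>
    hG.comp (measurable_id.prodMk measurable_const)
  have hm : Measurable (Function.uncurry fun s x => w s * G s x ^ 2) :=
    (hw.comp measurable_fst).mul (hG.pow_const 2)
  calc ∫⁻ x, (∫⁻ s, w s * G s x ∂μ) ^ 2 ∂ν
      ≤ ∫⁻ x, (∫⁻ s, w s ∂μ) * ∫⁻ s, w s * G s x ^ 2 ∂μ ∂ν :=
        lintegral_mono fun x => lintegral_weight_mul_sq_le hw.aemeasurable (hGx x).aemeasurable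
    _ = (∫⁻ s, w s ∂μ) * ∫⁻ x, (∫⁻ s, w s * G s x ^ 2 ∂μ) ∂ν := by
        rw [lintegral_const_mul]
        exact Measurable.lintegral_prod_left' hm
    _ = _ := by
        rw [← lintegral_lintegral_swap hm.aemeasurable]
        simp only [lintegral_const_mul _ (hGs _)]

/-! ### Dispersion of the velocity averages. -/

section Dispersion

variable {V₀ : ℝ} {h : E d → ℝ≥0∞}

/-- An average of translations over a probability measure is a contraction of `L²`. No lower bound
on `τ` is needed, so this serves short times. -/
theorem lintegral_average_sq_le (hV : volume (velocitySet d V₀) = 1) (hh : Measurable h) (τ : ℝ) :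
    ∫⁻ x, (∫⁻ v in velocitySet d V₀, h (x + τ • v)) ^ 2 ≤ ∫⁻ x, h x ^ 2 := by
  have hm : Measurable (Function.uncurry fun (v x : E d) => h (x + τ • v)) :=
    hh.comp (by fun_prop)
  refine (le_of_eq ?_).trans ((lintegral_sq_lintegral_le
    (μ := volume.restrict (velocitySet d V₀)) (ν := (volume : Measure (E d)))
    (w := fun _ => 1) measurable_const hm).trans_eq ?_)
  · simp
  · simp only [one_mul, lintegral_const, Measure.restrict_apply_univ, hV]
    have : ∀ v : E d, ∫⁻ x, h (x + τ • v) ^ 2 = ∫⁻ x, h x ^ 2 := fun v =>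
      lintegral_add_right_eq_self (fun x => h x ^ 2) (τ • v)
    simp [this, hV]

theorem lintegral_average (hV : volume (velocitySet d V₀) = 1) (hh : Measurable h) (τ : ℝ) :
    ∫⁻ x, (∫⁻ v in velocitySet d V₀, h (x + τ • v)) = ∫⁻ x, h x := by
  have hm : Measurable (Function.uncurry fun (x v : E d) => h (x + τ • v)) :=
    hh.comp (by fun_prop)
  rw [lintegral_lintegral_swap hm.aemeasurable]
  have : ∀ v : E d, ∫⁻ x, h (x + τ • v) = ∫⁻ x, h x := fun v =>
    lintegral_add_right_eq_self h (τ • v)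
  simp [this, hV]

/-- The substitution `y = x + τ v` has Jacobian `|τ|^{-d}`: after a positive time the velocity
average sends `L¹` to `L^∞`. -/
theorem average_le (hh : Measurable h) {η τ : ℝ} (hη : 0 < η) (hτ : η ≤ |τ|) (x : E d) :
    ∫⁻ v in velocitySet d V₀, h (x + τ • v) ≤ ENNReal.ofReal ((η ^ d)⁻¹) * ∫⁻ y, h y := by
  have hτ0 : τ ≠ 0 := fun h0 => by simp [h0] at hτ; linarith
  refine (setLIntegral_le_lintegral _ _).trans ?_
  have h1 : ∫⁻ v : E d, h (x + τ • v) = ∫⁻ y, h (x + y) ∂(Measure.map (fun v : E d => τ • v) volume) :=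
    (lintegral_map (hh.comp (by fun_prop)) (by fun_prop)).symm
  rw [h1, Measure.map_addHaar_smul _ hτ0, lintegral_smul_measure, lintegral_add_left_eq_self]
  refine mul_le_mul_left (ENNReal.ofReal_le_ofReal ?_) _
  rw [abs_inv, abs_pow, finrank_euclideanSpace_fin]
  exact inv_anti₀ (by positivity) (pow_le_pow_left₀ hη.le hτ d)

/-- Interpolation of the `L^∞` bound with the conservation of the integral. -/
theorem lintegral_average_sq_le_sq (hV : volume (velocitySet d V₀) = 1) (hh : Measurable h)
    {η τ : ℝ} (hη : 0 < η) (hτ : η ≤ |τ|) :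
    ∫⁻ x, (∫⁻ v in velocitySet d V₀, h (x + τ • v)) ^ 2 ≤
      ENNReal.ofReal ((η ^ d)⁻¹) * (∫⁻ x, h x) ^ 2 := by
  have hm : Measurable (Function.uncurry fun (x v : E d) => h (x + τ • v)) :=
    hh.comp (by fun_prop)
  have hS : Measurable fun x => ∫⁻ v in velocitySet d V₀, h (x + τ • v) :=
    Measurable.lintegral_prod_right' hm
  calc ∫⁻ x, (∫⁻ v in velocitySet d V₀, h (x + τ • v)) ^ 2
      ≤ ∫⁻ x, (ENNReal.ofReal ((η ^ d)⁻¹) * ∫⁻ y, h y) *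
          (∫⁻ v in velocitySet d V₀, h (x + τ • v)) := lintegral_mono fun x => by
        rw [sq]
        exact mul_le_mul_left (average_le hh hη hτ x) _
    _ = _ := by
        rw [lintegral_const_mul _ hS, lintegral_average hV hh, sq, mul_assoc]

end Dispersion

/-! ### The spatial density of the majorant in `L²`. -/

section Density

variable {χ V₀ : ℝ} {C : ℝ≥0} {k : E d → E d → ℝ} {f : E d × E d → ℝ}

theorem enorm_damping_le (hχ : 0 ≤ χ) {t : ℝ} (ht : 0 ≤ t) (z : E d × E d) :
    ‖damping χ t z‖ₑ ≤ expE (-(1 - χ) * t) := by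
  rw [Real.enorm_of_nonneg (damping_pos χ t z).le]
  exact ENNReal.ofReal_le_ofReal (damping_le hχ ht z)

theorem majorant_le (hχ : 0 ≤ χ) (hk : Measurable (Function.uncurry k)) (hf : Measurable f)
    {t : ℝ} (ht : 0 ≤ t) (z : E d × E d) :
    majorant χ V₀ k f t z ≤ expE (-(1 - χ) * t) * ‖f (shift (-t) z)‖ₑ +
      ∫⁻ s in Ioc 0 t, expE (-(1 - χ) * (t - s)) *
        absGain V₀ k (majorant χ V₀ k f s) (shift (-(t - s)) z).1 := by
  rw [majorant_eq χ V₀ hk hf]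
  refine add_le_add (mul_le_mul_left (enorm_damping_le hχ ht z) _) ?_
  refine setLIntegral_mono' measurableSet_Ioc fun s hs => ?_
  exact mul_le_mul_left (enorm_damping_le hχ (sub_nonneg.2 hs.2) z) _

/-- The spatial density of the majorant. -/
def density (χ V₀ : ℝ) (k : E d → E d → ℝ) (f : E d × E d → ℝ) (t : ℝ) (x : E d) : ℝ≥0∞ :=
  ∫⁻ v in velocitySet d V₀, majorant χ V₀ k f t (x, v)

theorem measurable_density (χ V₀ : ℝ) (hk : Measurable (Function.uncurry k)) (hf : Measurable f) :
    Measurable (Function.uncurry (density χ V₀ k f)) := by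
  refine Measurable.lintegral_prod_right' (f := fun q : (ℝ × E d) × E d =>
    majorant χ V₀ k f q.1.1 (q.1.2, q.2)) ?_
  exact (measurable_majorant χ V₀ hk hf).comp ((measurable_fst.comp measurable_fst).prodMk
    ((measurable_snd.comp measurable_fst).prodMk measurable_snd))

theorem absGain_majorant_le (hk : IsBoundedKernel V₀ C k) (hf : Measurable f) (s : ℝ) (x : E d) :
    absGain V₀ k (majorant χ V₀ k f s) x ≤ C * density χ V₀ k f s x := by
  have hm : Measurable fun v => majorant χ V₀ k f s (x, v) :=
    (measurable_majorant χ V₀ hk.measurable hf).comp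
      (measurable_const.prodMk (measurable_const.prodMk measurable_id))
  unfold absGain density
  rw [← lintegral_const_mul _ hm]
  exact setLIntegral_mono' (measurableSet_velocitySet V₀) fun v hv =>
    mul_le_mul_left (hk.bound x v hv) _

theorem lintegral_density (hk : Measurable (Function.uncurry k)) (hf : Measurable f) (t : ℝ) :
    ∫⁻ x, density χ V₀ k f t x = ∫⁻ z, majorant χ V₀ k f t z ∂(phaseMeasure d V₀) := by
  have hm : Measurable (majorant χ V₀ k f t) :=
    (measurable_majorant χ V₀ hk hf).comp (measurable_const.prodMk measurable_id)
  rw [lintegral_phaseMeasure V₀ hm]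
  rfl

theorem lintegral_density_sq_le (hV : volume (velocitySet d V₀) = 1)
    (hk : Measurable (Function.uncurry k)) (hf : Measurable f) (t : ℝ) :
    ∫⁻ x, density χ V₀ k f t x ^ 2 ≤
      ∫⁻ z, majorant χ V₀ k f t z ^ 2 ∂(phaseMeasure d V₀) := by
  have hm : Measurable (majorant χ V₀ k f t) :=
    (measurable_majorant χ V₀ hk hf).comp (measurable_const.prodMk measurable_id)
  rw [lintegral_phaseMeasure V₀ (hm.pow_const 2)]
  refine lintegral_mono fun x => ?_
  have hmx : Measurable fun v => majorant χ V₀ k f t (x, v) :=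
    hm.comp (measurable_const.prodMk measurable_id)
  have := lintegral_sq_le_measure_mul (μ := volume.restrict (velocitySet d V₀)) hmx.aemeasurable
  rwa [Measure.restrict_apply_univ, hV, one_mul] at this

theorem measurable_absGain_average (χ V₀ : ℝ) (hk : Measurable (Function.uncurry k))
    (hf : Measurable f) (t : ℝ) : Measurable (Function.uncurry fun (s : ℝ) (x : E d) =>
      ∫⁻ v in velocitySet d V₀, absGain V₀ k (majorant χ V₀ k f s) (x + (-(t - s)) • v)) := by
  refine Measurable.lintegral_prod_right' (f := fun q : (ℝ × E d) × E d =>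
    absGain V₀ k (majorant χ V₀ k f q.1.1) (q.1.2 + (-(t - q.1.1)) • q.2)) ?_
  exact (measurable_absGain_majorant χ V₀ hk hf).comp
    ((measurable_fst.comp measurable_fst).prodMk (by fun_prop))

theorem density_le (hχ : 0 ≤ χ) (hk : Measurable (Function.uncurry k)) (hf : Measurable f)
    {t : ℝ} (ht : 0 ≤ t) (x : E d) :
    density χ V₀ k f t x ≤ expE (-(1 - χ) * t) *
        (∫⁻ v in velocitySet d V₀, ‖f (shift (-t) (x, v))‖ₑ) +
      ∫⁻ s in Ioc 0 t, expE (-(1 - χ) * (t - s)) *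
        ∫⁻ v in velocitySet d V₀, absGain V₀ k (majorant χ V₀ k f s) (x + (-(t - s)) • v) := by
  have h1 : Measurable fun v => ‖f (shift (-t) (x, v))‖ₑ :=
    (hf.comp ((measurable_shift (-t)).comp (measurable_const.prodMk measurable_id))).enorm
  have h2 : ∀ s, Measurable fun v => absGain V₀ k (majorant χ V₀ k f s) (x + (-(t - s)) • v) :=
    fun s => (measurable_absGain_majorant χ V₀ hk hf).comp (measurable_const.prodMk (by fun_prop))
  have h3 : Measurable (Function.uncurry fun (v : E d) (s : ℝ) => expE (-(1 - χ) * (t - s)) *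
      absGain V₀ k (majorant χ V₀ k f s) (x + (-(t - s)) • v)) := by
    have he : Measurable fun q : E d × ℝ => expE (-(1 - χ) * (t - q.2)) :=
      measurable_expE.comp (by fun_prop)
    exact he.mul ((measurable_absGain_majorant χ V₀ hk hf).comp
      (measurable_snd.prodMk (by fun_prop)))
  have h1' : Measurable fun v => expE (-(1 - χ) * t) * ‖f (shift (-t) (x, v))‖ₑ := h1.const_mul _
  refine (lintegral_mono fun v => majorant_le hχ hk hf ht (x, v)).trans_eq ?_
  rw [lintegral_add_left h1', lintegral_const_mul _ h1]
  congr 1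
  simp only [shift_fst]
  rw [lintegral_lintegral_swap h3.aemeasurable]
  simp only [lintegral_const_mul _ (h2 _)]

/-- The `L²` norm of the density is controlled by its recent past and by its `L¹` norm. -/
theorem lintegral_density_sq_le_add (hV : volume (velocitySet d V₀) = 1)
    (hχ : χ ∈ Ioo (0 : ℝ) 1) (hk : IsBoundedKernel V₀ C k) (hf : Measurable f) {t η : ℝ}
    (ht : 0 ≤ t) (hη : 0 < η) :
    ∫⁻ x, density χ V₀ k f t x ^ 2 ≤ 4 *
      (expE (-(1 - χ) * t) ^ 2 * ∫⁻ z, ‖f z‖ₑ ^ 2 ∂(phaseMeasure d V₀) +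
      ENNReal.ofReal η * (∫⁻ s in Ioc 0 t ∩ Ioc (t - η) t,
        C ^ 2 * ∫⁻ x, density χ V₀ k f s x ^ 2) +
      ENNReal.ofReal (1 / (1 - χ)) * ∫⁻ s in Ioc 0 t, expE (-(1 - χ) * (t - s)) *
        (ENNReal.ofReal ((η ^ d)⁻¹) *
          (C * ∫⁻ z, majorant χ V₀ k f s z ∂(phaseMeasure d V₀)) ^ 2)) := by
  have hl : 0 < 1 - χ := by linarith [hχ.2]
  set G : ℝ → E d → ℝ≥0∞ := fun s x =>
    ∫⁻ v in velocitySet d V₀, absGain V₀ k (majorant χ V₀ k f s) (x + (-(t - s)) • v) with hG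
  have hGm : Measurable (Function.uncurry G) := measurable_absGain_average χ V₀ hk.measurable hf t
  have hGx : ∀ x, Measurable fun s => G s x := fun x =>
    hGm.comp (measurable_id.prodMk measurable_const)
  have hem : Measurable fun s => expE (-(1 - χ) * (t - s)) := measurable_expE.comp (by fun_prop)
  have hgs : ∀ s, Measurable fun x => absGain V₀ k (majorant χ V₀ k f s) x := fun s =>
    (measurable_absGain_majorant χ V₀ hk.measurable hf).comp
      (measurable_const.prodMk measurable_id)
  have hDs : ∀ s, Measurable (density χ V₀ k f s) := fun s =>
    (measurable_density χ V₀ hk.measurable hf).comp (measurable_const.prodMk measurable_id)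
  set F : E d → ℝ≥0∞ := fun x => ∫⁻ v in velocitySet d V₀, ‖f (shift (-t) (x, v))‖ₑ with hF
  have hfsh : Measurable fun z => ‖f (shift (-t) z)‖ₑ := (hf.comp (measurable_shift (-t))).enorm
  have hFm : Measurable F := Measurable.lintegral_prod_right' hfsh
  -- Three contributions: the datum, damped in `L²`; the sources emitted after `t - η`, estimated in
  -- `L²` and small with `η`; the older ones, which have dispersed and are controlled by the `L¹`
  -- norm alone.
  have hpt : ∀ x, density χ V₀ k f t x ≤ expE (-(1 - χ) * t) * F x +
      (∫⁻ s in Ioc 0 t ∩ Ioc (t - η) t, G s x) +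
      ∫⁻ s in Ioc 0 t ∩ Iic (t - η), expE (-(1 - χ) * (t - s)) * G s x := by
    intro x
    refine (density_le hχ.1.le hk.measurable hf ht x).trans ?_
    rw [add_assoc]
    refine add_le_add_right ?_ _
    have hsub : Ioc 0 t ⊆ (Ioc 0 t ∩ Ioc (t - η) t) ∪ (Ioc 0 t ∩ Iic (t - η)) := fun s hs => by
      rcases lt_or_ge (t - η) s with h | h
      · exact Or.inl ⟨hs, h, hs.2⟩
      · exact Or.inr ⟨hs, h⟩
    refine (lintegral_mono_set hsub).trans ((lintegral_union_le _ _ _).trans ?_)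
    refine add_le_add_left (setLIntegral_mono' (measurableSet_Ioc.inter measurableSet_Ioc)
      fun s hs => ?_) _
    refine (mul_le_mul_left (expE_le_one ?_) _).trans_eq (one_mul _)
    have := hs.1.2
    nlinarith
  have hm1 : Measurable fun x => (expE (-(1 - χ) * t) * F x) ^ 2 := (hFm.const_mul _).pow_const 2
  have hm2 : Measurable fun x => (∫⁻ s in Ioc 0 t ∩ Ioc (t - η) t, G s x) ^ 2 :=
    (Measurable.lintegral_prod_left' hGm).pow_const 2
  have hm3 : Measurable fun x =>
      (∫⁻ s in Ioc 0 t ∩ Iic (t - η), expE (-(1 - χ) * (t - s)) * G s x) ^ 2 :=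
    (Measurable.lintegral_prod_left' (f := fun q : ℝ × E d =>
      expE (-(1 - χ) * (t - q.1)) * G q.1 q.2)
      ((hem.comp measurable_fst).mul hGm)).pow_const 2
  calc ∫⁻ x, density χ V₀ k f t x ^ 2
      ≤ ∫⁻ x, 4 * ((expE (-(1 - χ) * t) * F x) ^ 2 +
        (∫⁻ s in Ioc 0 t ∩ Ioc (t - η) t, G s x) ^ 2 +
        (∫⁻ s in Ioc 0 t ∩ Iic (t - η), expE (-(1 - χ) * (t - s)) * G s x) ^ 2) :=
        lintegral_mono fun x => (pow_le_pow_left' (hpt x) 2).trans (add_add_sq_le _ _ _)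
    _ = 4 * ((∫⁻ x, (expE (-(1 - χ) * t) * F x) ^ 2) +
        (∫⁻ x, (∫⁻ s in Ioc 0 t ∩ Ioc (t - η) t, G s x) ^ 2) +
        ∫⁻ x, (∫⁻ s in Ioc 0 t ∩ Iic (t - η), expE (-(1 - χ) * (t - s)) * G s x) ^ 2) := by
        have hm12 : Measurable fun x => (expE (-(1 - χ) * t) * F x) ^ 2 +
          (∫⁻ s in Ioc 0 t ∩ Ioc (t - η) t, G s x) ^ 2 := hm1.add hm2
        rw [lintegral_const_mul', lintegral_add_left hm12, lintegral_add_left hm1]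
        simp
    _ ≤ _ := by
        refine mul_le_mul_right (add_le_add (add_le_add ?_ ?_) ?_) _
        · simp only [mul_pow]
          rw [lintegral_const_mul _ (hFm.pow_const 2)]
          refine mul_le_mul_right ?_ _
          rw [← lintegral_shift V₀ (-t) _ (hf.enorm.pow_const 2),
            lintegral_phaseMeasure V₀ (hfsh.pow_const 2)]
          refine lintegral_mono fun x => ?_
          have hmx : Measurable fun v => ‖f (shift (-t) (x, v))‖ₑ :=
            hfsh.comp (measurable_const.prodMk measurable_id)
          have := lintegral_sq_le_measure_mul (μ := volume.restrict (velocitySet d V₀))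
            hmx.aemeasurable
          rwa [Measure.restrict_apply_univ, hV, one_mul] at this
        · have h1 := lintegral_sq_lintegral_le (μ := volume.restrict (Ioc 0 t ∩ Ioc (t - η) t))
            (ν := (volume : Measure (E d))) (w := fun _ => 1) measurable_const hGm
          simp only [one_mul, lintegral_const, Measure.restrict_apply_univ] at h1
          refine h1.trans (mul_le_mul' ?_ (lintegral_mono fun s => ?_))
          · refine (measure_mono inter_subset_right).trans_eq ?_
            rw [Real.volume_Ioc]; congr 1; ring
          · refine (lintegral_average_sq_le hV (hgs s) _).trans ?_
            rw [← lintegral_const_mul _ ((hDs s).pow_const 2)]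
            refine lintegral_mono fun x => ?_
            rw [← mul_pow]
            exact pow_le_pow_left' (absGain_majorant_le hk hf s x) 2
        · refine (lintegral_sq_lintegral_le
            (μ := volume.restrict (Ioc 0 t ∩ Iic (t - η))) (ν := (volume : Measure (E d)))
            hem hGm).trans (mul_le_mul' ?_ ?_)
          · exact (lintegral_mono_set inter_subset_left).trans (lintegral_expE_le hl)
          · refine le_trans (setLIntegral_mono' (measurableSet_Ioc.inter measurableSet_Iic)
              fun s hs => mul_le_mul_right ?_ _) (lintegral_mono_set inter_subset_left)
            have hs2 : s ≤ t - η := hs.2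
            refine (lintegral_average_sq_le_sq hV (hgs s) hη ?_).trans (mul_le_mul_right
              (pow_le_pow_left' ?_ 2) _)
            · rw [abs_neg]
              exact le_trans (by linarith) (le_abs_self _)
            · rw [← lintegral_density hk.measurable hf, ← lintegral_const_mul _ (hDs s)]
              exact lintegral_mono fun x => absGain_majorant_le hk hf s x

end Density

/-! ### From decay in `L¹` to decay in `L²`, and the coupled bootstrap. -/

section SquareDecay

variable {χ V₀ : ℝ} {C : ℝ≥0} {k : E d → E d → ℝ} {f : E d × E d → ℝ}

/-- The window is chosen so that the recent past can be absorbed with coefficient one half. One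
factor `η` is the Cauchy–Schwarz mass and the other the length of the window; `expE 1` bounds `e^{β
(t - s)}` there, as `β < 1` and `η ≤ 1`. -/
theorem exists_small_time (C : ℝ≥0) : ∃ η : ℝ, 0 < η ∧ η ≤ 1 ∧
    4 * (ENNReal.ofReal η * (ENNReal.ofReal η * (expE 1 * (C : ℝ≥0∞) ^ 2))) ≤ 2⁻¹ := by
  have hq : (0 : ℝ) < 8 * (Real.exp 1 * (C : ℝ) ^ 2) + 1 := by positivity
  refine ⟨(8 * (Real.exp 1 * (C : ℝ) ^ 2) + 1)⁻¹, by positivity,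
    inv_le_one_of_one_le₀ (by have : (0 : ℝ) ≤ 8 * (Real.exp 1 * (C : ℝ) ^ 2) := by positivity
                              linarith), ?_⟩
  set q := 8 * (Real.exp 1 * (C : ℝ) ^ 2) + 1 with hqd
  have hC : (C : ℝ≥0∞) ^ 2 = ENNReal.ofReal ((C : ℝ) ^ 2) := by
    rw [ENNReal.ofReal_pow C.coe_nonneg, ENNReal.ofReal_coe_nnreal]
  have h4 : (4 : ℝ≥0∞) = ENNReal.ofReal 4 := by simp
  have h2 : (2⁻¹ : ℝ≥0∞) = ENNReal.ofReal 2⁻¹ := by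
    rw [ENNReal.ofReal_inv_of_pos two_pos]; simp
  rw [hC, expE, ← ENNReal.ofReal_mul (Real.exp_pos _).le, ← ENNReal.ofReal_mul (by positivity),
    ← ENNReal.ofReal_mul (by positivity), h4, ← ENNReal.ofReal_mul (by positivity), h2]
  refine ENNReal.ofReal_le_ofReal ?_
  have h1 : Real.exp 1 * (C : ℝ) ^ 2 ≤ q / 8 := by rw [hqd]; linarith
  calc 4 * (q⁻¹ * (q⁻¹ * (Real.exp 1 * (C : ℝ) ^ 2))) ≤ 4 * (q⁻¹ * (q⁻¹ * (q / 8))) := by gcongr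
    _ = q⁻¹ / 2 := by field_simp; norm_num
    _ ≤ 1 / 2 := by
        have : q⁻¹ ≤ 1 := inv_le_one_of_one_le₀ (by
          have : (0 : ℝ) ≤ 8 * (Real.exp 1 * (C : ℝ) ^ 2) := by positivity
          linarith)
        linarith
    _ = 2⁻¹ := by norm_num

/-- Convolution with `e^{-ct}` preserves decay at any rate `β < c`: the weight `e^{βt}` is shared
between kernel and source. -/
theorem lintegral_expE_shift_le {c β t : ℝ} (hc : β < c) {g : ℝ → ℝ≥0∞} {A : ℝ≥0∞}
    (hg : ∀ s ∈ Ioc 0 t, expE (β * s) * g s ≤ A) :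
    expE (β * t) * ∫⁻ s in Ioc 0 t, expE (-c * (t - s)) * g s ≤
      ENNReal.ofReal (1 / (c - β)) * A := by
  have hem : Measurable fun s => expE (-(c - β) * (t - s)) := measurable_expE.comp (by fun_prop)
  rw [← lintegral_const_mul' _ _ (expE_ne_top _)]
  calc ∫⁻ s in Ioc 0 t, expE (β * t) * (expE (-c * (t - s)) * g s)
      ≤ ∫⁻ s in Ioc 0 t, expE (-(c - β) * (t - s)) * A := by
        refine setLIntegral_mono' measurableSet_Ioc fun s hs => ?_
        have : expE (β * t) * (expE (-c * (t - s)) * g s) =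
            expE (-(c - β) * (t - s)) * (expE (β * s) * g s) := by
          rw [← mul_assoc, ← mul_assoc, ← expE_add, ← expE_add]
          congr 2; ring
        rw [this]
        exact mul_le_mul_right (hg s hs) _
    _ = (∫⁻ s in Ioc 0 t, expE (-(c - β) * (t - s))) * A := lintegral_mul_const _ hem
    _ ≤ _ := mul_le_mul_left (lintegral_expE_le (sub_pos.2 hc)) _

/-- The `L²` norm of the density decays as soon as the `L¹` norm of the majorant does. -/
theorem exists_density_sq_le (hV : volume (velocitySet d V₀) = 1) (hχ : χ ∈ Ioo (0 : ℝ) 1)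
    (C : ℝ≥0) {β : ℝ} (hβ0 : 0 ≤ β) (hβ : β < 1 - χ) :
    ∃ M : ℝ≥0, ∀ (k : E d → E d → ℝ) (f : E d × E d → ℝ), IsBoundedKernel V₀ C k → Measurable f →
      ∫⁻ z, ‖f z‖ₑ ^ 2 ∂(phaseMeasure d V₀) ≠ ⊤ → ∀ (T : ℝ) (A : ℝ≥0∞),
      (∀ t ∈ Icc 0 T, expE (β * t) *
        (∫⁻ z, majorant χ V₀ k f t z ∂(phaseMeasure d V₀)) ^ 2 ≤ A) →
      ∀ t ∈ Icc 0 T, expE (β * t) * ∫⁻ x, density χ V₀ k f t x ^ 2 ≤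
        M * (∫⁻ z, ‖f z‖ₑ ^ 2 ∂(phaseMeasure d V₀) + A) := by
  obtain ⟨η, hη, hη1, hsmall⟩ := exists_small_time C
  have hl : 0 < 1 - χ := by linarith [hχ.2]
  set D : ℝ≥0 := (Real.toNNReal (1 / (1 - χ))) * (Real.toNNReal (1 / (1 - χ - β))) *
    ((Real.toNNReal ((η ^ d)⁻¹)) * C ^ 2) with hD
  refine ⟨2 * (4 * (1 + D)), fun k f hk hf hf2 T A hA => ?_⟩
  set J := ∫⁻ z, ‖f z‖ₑ ^ 2 ∂(phaseMeasure d V₀) with hJ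
  set q : ℝ → ℝ≥0∞ := fun s => ∫⁻ x, density χ V₀ k f s x ^ 2 with hq
  set n : ℝ → ℝ≥0∞ := fun s => ∫⁻ z, majorant χ V₀ k f s z ∂(phaseMeasure d V₀) with hn
  set S : ℝ≥0∞ := ⨆ t ∈ Icc 0 T, expE (β * t) * q t with hS
  have hqS : ∀ t ∈ Icc 0 T, expE (β * t) * q t ≤ S := fun t ht =>
    le_iSup₂ (f := fun t (_ : t ∈ Icc 0 T) => expE (β * t) * q t) t ht
  -- The local bound on `[0, T]` makes the supremum finite, so the share of the recent past can be
  -- absorbed. The resulting constant does not depend on `T`.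
  have hfinite : S ≠ ⊤ := by
    obtain ⟨M, hM⟩ := exists_lintegral_majorant_le hV hχ hk hf (p := 2) (Or.inr rfl)
      (IsFlowWeight.one V₀) T
    refine ne_top_of_le_ne_top (b := expE (β * T) * (M * J))
      (ENNReal.mul_ne_top (expE_ne_top _) (ENNReal.mul_ne_top ENNReal.coe_ne_top hf2))
      (iSup₂_le fun t ht => mul_le_mul' (expE_mono (by nlinarith [ht.2])) ?_)
    have h := hM t ht
    simp only [one_mul] at h
    exact (lintegral_density_sq_le hV hk.measurable hf t).trans h
  have hstep : ∀ t ∈ Icc 0 T, expE (β * t) * q t ≤ 4 * (1 + D) * (J + A) + 2⁻¹ * S := by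
    intro t ht
    have h1 : expE (β * t) * (expE (-(1 - χ) * t) ^ 2 * J) ≤ J := by
      rw [← mul_assoc, expE_pow_two, ← expE_add]
      refine (mul_le_mul_left (expE_le_one ?_) _).trans_eq (one_mul _)
      nlinarith [ht.1]
    have h2 : expE (β * t) * (ENNReal.ofReal η * (∫⁻ s in Ioc 0 t ∩ Ioc (t - η) t,
        (C : ℝ≥0∞) ^ 2 * q s)) ≤ ENNReal.ofReal η * (ENNReal.ofReal η * (expE 1 * (C : ℝ≥0∞) ^ 2))
          * S := by
      rw [mul_left_comm, mul_assoc]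
      refine mul_le_mul_right ?_ _
      rw [← lintegral_const_mul' _ _ (expE_ne_top _)]
      calc ∫⁻ s in Ioc 0 t ∩ Ioc (t - η) t, expE (β * t) * ((C : ℝ≥0∞) ^ 2 * q s)
          ≤ ∫⁻ s in Ioc 0 t ∩ Ioc (t - η) t, expE 1 * (C : ℝ≥0∞) ^ 2 * S := by
            refine setLIntegral_mono' (measurableSet_Ioc.inter measurableSet_Ioc) fun s hs => ?_
            have hs' : s ∈ Icc 0 T := ⟨hs.1.1.le, hs.1.2.trans ht.2⟩
            have e : expE (β * t) * ((C : ℝ≥0∞) ^ 2 * q s) =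
                expE (β * (t - s)) * (C : ℝ≥0∞) ^ 2 * (expE (β * s) * q s) := by
              have : expE (β * t) = expE (β * (t - s)) * expE (β * s) := by
                rw [← expE_add]; congr 1; ring
              rw [this]; ring
            rw [e]
            refine mul_le_mul' (mul_le_mul_left (expE_mono ?_) _) (hqS s hs')
            have h3 : t - η < s := hs.2.1
            have h4 : s ≤ t := hs.1.2
            have h5 := hχ.1
            nlinarith
        _ = expE 1 * (C : ℝ≥0∞) ^ 2 * S * volume (Ioc 0 t ∩ Ioc (t - η) t) := by
            rw [lintegral_const, Measure.restrict_apply_univ]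
        _ ≤ expE 1 * (C : ℝ≥0∞) ^ 2 * S * ENNReal.ofReal η := by
            refine mul_le_mul_right ((measure_mono inter_subset_right).trans_eq ?_) _
            rw [Real.volume_Ioc]; congr 1; ring
        _ = _ := by ring
    have h3 : expE (β * t) * (ENNReal.ofReal (1 / (1 - χ)) * ∫⁻ s in Ioc 0 t,
        expE (-(1 - χ) * (t - s)) * (ENNReal.ofReal ((η ^ d)⁻¹) * (C * n s) ^ 2)) ≤ D * A := by
      rw [mul_left_comm]
      have hb := lintegral_expE_shift_le (c := 1 - χ) (β := β) (t := t) hβ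
        (g := fun s => ENNReal.ofReal ((η ^ d)⁻¹) * (C * n s) ^ 2)
        (A := ENNReal.ofReal ((η ^ d)⁻¹) * (C ^ 2 * A)) (fun s hs => by
          have := hA s ⟨hs.1.le, hs.2.trans ht.2⟩
          rw [mul_left_comm, mul_pow, mul_left_comm (expE _)]
          exact mul_le_mul_right (mul_le_mul_right this _) _)
      refine (mul_le_mul_right hb _).trans_eq ?_
      rw [hD]
      push_cast
      simp only [ENNReal.ofReal]
      ring
    calc expE (β * t) * q t ≤ expE (β * t) * (4 * (expE (-(1 - χ) * t) ^ 2 * J +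
          ENNReal.ofReal η * (∫⁻ s in Ioc 0 t ∩ Ioc (t - η) t, (C : ℝ≥0∞) ^ 2 * q s) +
          ENNReal.ofReal (1 / (1 - χ)) * ∫⁻ s in Ioc 0 t, expE (-(1 - χ) * (t - s)) *
            (ENNReal.ofReal ((η ^ d)⁻¹) * (C * n s) ^ 2))) :=
          mul_le_mul_right (lintegral_density_sq_le_add hV hχ hk hf ht.1 hη) _
      _ ≤ 4 * (J + ENNReal.ofReal η * (ENNReal.ofReal η * (expE 1 * (C : ℝ≥0∞) ^ 2)) * S +
          D * A) := by
          rw [mul_left_comm]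
          refine mul_le_mul_right ?_ _
          rw [mul_add, mul_add]
          exact add_le_add (add_le_add h1 h2) h3
      _ = 4 * (J + D * A) +
          4 * (ENNReal.ofReal η * (ENNReal.ofReal η * (expE 1 * (C : ℝ≥0∞) ^ 2))) * S := by ring
      _ ≤ 4 * (1 + D) * (J + A) + 2⁻¹ * S := by
          refine add_le_add ?_ (mul_le_mul_left hsmall _)
          rw [mul_assoc]
          refine mul_le_mul_right ?_ _
          calc J + D * A ≤ J + D * A + (D * J + A) := le_self_add
            _ = _ := by ring
  intro t ht
  refine (hqS t ht).trans ((le_two_mul_of_le_add_half hfinite (iSup₂_le hstep)).trans_eq ?_)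
  push_cast
  ring

/-- The `L²` norm of the majorant decays as soon as its `L¹` norm does. -/
theorem exists_majorant_sq_le (hV : volume (velocitySet d V₀) = 1) (hχ : χ ∈ Ioo (0 : ℝ) 1)
    (C : ℝ≥0) {β : ℝ} (hβ0 : 0 ≤ β) (hβ : β < 1 - χ) :
    ∃ M : ℝ≥0, ∀ (k : E d → E d → ℝ) (f : E d × E d → ℝ), IsBoundedKernel V₀ C k → Measurable f →
      ∫⁻ z, ‖f z‖ₑ ^ 2 ∂(phaseMeasure d V₀) ≠ ⊤ → ∀ (T : ℝ) (A : ℝ≥0∞),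
      (∀ t ∈ Icc 0 T, expE (β * t) *
        (∫⁻ z, majorant χ V₀ k f t z ∂(phaseMeasure d V₀)) ^ 2 ≤ A) →
      ∀ t ∈ Icc 0 T, expE (β * t) * ∫⁻ z, majorant χ V₀ k f t z ^ 2 ∂(phaseMeasure d V₀) ≤
        M * (∫⁻ z, ‖f z‖ₑ ^ 2 ∂(phaseMeasure d V₀) + A) := by
  obtain ⟨M, hM⟩ := exists_density_sq_le hV hχ C hβ0 hβ
  have hl : 0 < 1 - χ := by linarith [hχ.2]
  set D : ℝ≥0 := (Real.toNNReal (1 / (1 - χ))) * (Real.toNNReal (1 / (1 - χ - β))) * C ^ 2 * M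
    with hD
  refine ⟨2 * (1 + D), fun k f hk hf hf2 T A hA t ht => ?_⟩
  have hq := hM k f hk hf hf2 T A hA
  set J := ∫⁻ z, ‖f z‖ₑ ^ 2 ∂(phaseMeasure d V₀) with hJ
  set q : ℝ → ℝ≥0∞ := fun s => ∫⁻ x, density χ V₀ k f s x ^ 2 with hqdef
  set G : ℝ → E d × E d → ℝ≥0∞ := fun s z =>
    absGain V₀ k (majorant χ V₀ k f s) (shift (-(t - s)) z).1 with hG
  have hgm := measurable_absGain_majorant χ V₀ hk.measurable hf
  have hGm : Measurable (Function.uncurry G) := by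
    have ha : Measurable fun q : ℝ × (E d × E d) => -(t - q.1) := by fun_prop
    have hs : Measurable fun q : ℝ × (E d × E d) => (shift (-(t - q.1)) q.2).1 :=
      measurable_comp_shift measurable_fst ha measurable_snd
    exact hgm.comp (measurable_fst.prodMk hs)
  have hem : Measurable fun s => expE (-(1 - χ) * (t - s)) := measurable_expE.comp (by fun_prop)
  have hfsh : Measurable fun z => ‖f (shift (-t) z)‖ₑ := (hf.comp (measurable_shift (-t))).enorm
  have hgs : ∀ s, Measurable fun x => absGain V₀ k (majorant χ V₀ k f s) x ^ 2 := fun s =>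
    (hgm.comp (measurable_const.prodMk measurable_id)).pow_const 2
  have hDs : ∀ s, Measurable (density χ V₀ k f s) := fun s =>
    (measurable_density χ V₀ hk.measurable hf).comp (measurable_const.prodMk measurable_id)
  have hm1 : Measurable fun z => (expE (-(1 - χ) * t) * ‖f (shift (-t) z)‖ₑ) ^ 2 :=
    (hfsh.const_mul _).pow_const 2
  have hG2 : ∀ s, ∫⁻ z, G s z ^ 2 ∂(phaseMeasure d V₀) ≤ C ^ 2 * q s := fun s => by
    have hgz : Measurable fun z : E d × E d => absGain V₀ k (majorant χ V₀ k f s) z.1 ^ 2 :=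
      (hgs s).comp measurable_fst
    have e := lintegral_shift V₀ (-(t - s))
      (fun z => absGain V₀ k (majorant χ V₀ k f s) z.1 ^ 2) hgz
    rw [show (∫⁻ z, G s z ^ 2 ∂(phaseMeasure d V₀)) = _ from e,
      lintegral_phaseMeasure_fst hV (hgs s), hqdef]
    simp only
    rw [← lintegral_const_mul _ ((hDs s).pow_const 2)]
    refine lintegral_mono fun x => ?_
    rw [← mul_pow]
    exact pow_le_pow_left' (absGain_majorant_le hk hf s x) 2
  have hmain : ∫⁻ z, majorant χ V₀ k f t z ^ 2 ∂(phaseMeasure d V₀) ≤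
      2 * (expE (-(1 - χ) * t) ^ 2 * J + ENNReal.ofReal (1 / (1 - χ)) *
        ∫⁻ s in Ioc 0 t, expE (-(1 - χ) * (t - s)) * (C ^ 2 * q s)) := by
    calc ∫⁻ z, majorant χ V₀ k f t z ^ 2 ∂(phaseMeasure d V₀)
        ≤ ∫⁻ z, 2 * ((expE (-(1 - χ) * t) * ‖f (shift (-t) z)‖ₑ) ^ 2 +
          (∫⁻ s in Ioc 0 t, expE (-(1 - χ) * (t - s)) * G s z) ^ 2) ∂(phaseMeasure d V₀) :=
          lintegral_mono fun z => (pow_le_pow_left'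
            (majorant_le hχ.1.le hk.measurable hf ht.1 z) 2).trans (add_sq_le_two_mul _ _)
      _ = 2 * (expE (-(1 - χ) * t) ^ 2 * J + ∫⁻ z, (∫⁻ s in Ioc 0 t,
          expE (-(1 - χ) * (t - s)) * G s z) ^ 2 ∂(phaseMeasure d V₀)) := by
          rw [lintegral_const_mul' _ _ (by simp), lintegral_add_left hm1]
          simp only [mul_pow]
          rw [lintegral_const_mul _ (hfsh.pow_const 2),
            lintegral_shift V₀ (-t) (fun z => ‖f z‖ₑ ^ 2) (hf.enorm.pow_const 2)]
      _ ≤ _ := by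
          refine mul_le_mul_right (add_le_add_right ((lintegral_sq_lintegral_le hem hGm).trans
            (mul_le_mul' (lintegral_expE_le hl) ?_)) _) _
          exact lintegral_mono fun s => mul_le_mul_right (hG2 s) _
  have h1 : expE (β * t) * (expE (-(1 - χ) * t) ^ 2 * J) ≤ J := by
    rw [← mul_assoc, expE_pow_two, ← expE_add]
    refine (mul_le_mul_left (expE_le_one ?_) _).trans_eq (one_mul _)
    nlinarith [ht.1]
  have h3 : expE (β * t) * (ENNReal.ofReal (1 / (1 - χ)) * ∫⁻ s in Ioc 0 t,
      expE (-(1 - χ) * (t - s)) * (C ^ 2 * q s)) ≤ D * (J + A) := by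
    rw [mul_left_comm]
    have hb := lintegral_expE_shift_le (c := 1 - χ) (β := β) (t := t) hβ
      (g := fun s => C ^ 2 * q s) (A := C ^ 2 * (M * (J + A))) (fun s hs => by
        rw [mul_left_comm]
        exact mul_le_mul_right (hq s ⟨hs.1.le, hs.2.trans ht.2⟩) _)
    refine (mul_le_mul_right hb _).trans_eq ?_
    rw [hD]
    push_cast
    simp only [ENNReal.ofReal]
    ring
  calc expE (β * t) * ∫⁻ z, majorant χ V₀ k f t z ^ 2 ∂(phaseMeasure d V₀)
      ≤ _ := mul_le_mul_right hmain _
    _ ≤ 2 * (J + D * (J + A)) := by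
        rw [mul_left_comm]
        refine mul_le_mul_right ?_ _
        rw [mul_add]
        exact add_le_add h1 h3
    _ ≤ _ := by
        push_cast
        rw [mul_assoc]
        refine mul_le_mul_right ?_ _
        rw [add_mul, one_mul]
        exact add_le_add_left le_self_add _

/-- Decay of the majorant in `L¹` with the weight `ψ` and in `L²`, at the rate `b / 2`, when the
part `ρ` of the gain term that is not absorbed by `κ` is small in `L²`. -/
theorem exists_decay (hV : volume (velocitySet d V₀) = 1) (hχ : χ ∈ Ioo (0 : ℝ) 1)
    (C : ℝ≥0) {b : ℝ} (hb : b < 0) (hb' : -b < 1 - χ) :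
    ∃ ε : ℝ≥0∞, 0 < ε ∧ ∃ M : ℝ≥0, ∀ (ψ ψ' κ : E d × E d → ℝ) (ρ : E d × E d → ℝ≥0∞)
      (c : ℝ) (W : E d → ℝ≥0∞) (B : ℝ≥0) (k : E d → E d → ℝ) (f : E d × E d → ℝ),
      IsLyapunov χ V₀ b ψ ψ' κ → (∀ z, z.2 ∈ velocitySet d V₀ → 1 / 2 ≤ ψ z) →
      IsFlowWeight V₀ c W → (∀ z, z.2 ∈ velocitySet d V₀ → ENNReal.ofReal (ψ z) ≤ B * W z.1) →
      (∀ z, z.2 ∈ velocitySet d V₀ → ENNReal.ofReal (κ z) ≤ B * W z.1) →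
      IsBoundedKernel V₀ C k → Measurable ρ →
      (∀ x, ∀ v ∈ velocitySet d V₀, ‖k x v‖ₑ * ∫⁻ v' in velocitySet d V₀,
        ENNReal.ofReal (ψ (x, v')) ≤ ENNReal.ofReal (κ (x, v)) + ρ (x, v)) →
      ∫⁻ z, ρ z ^ 2 ∂(phaseMeasure d V₀) ≤ ε →
      Measurable f → ∫⁻ z, W z.1 * ‖f z‖ₑ ∂(phaseMeasure d V₀) ≠ ⊤ →
      ∫⁻ z, ‖f z‖ₑ ^ 2 ∂(phaseMeasure d V₀) ≠ ⊤ → ∀ t, 0 ≤ t →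
      expE (-b * t) * ((∫⁻ z, majorant χ V₀ k f t z ∂(phaseMeasure d V₀)) ^ 2 +
        ∫⁻ z, majorant χ V₀ k f t z ^ 2 ∂(phaseMeasure d V₀)) ≤
      M * ((∫⁻ z, ENNReal.ofReal (ψ z) * ‖f z‖ₑ ∂(phaseMeasure d V₀)) ^ 2 +
        ∫⁻ z, ‖f z‖ₑ ^ 2 ∂(phaseMeasure d V₀)) := by
  obtain ⟨M, hM⟩ := exists_majorant_sq_le hV hχ C (β := -b) (by linarith) hb'
  set D : ℝ≥0 := Real.toNNReal (1 / (-b / 2)) ^ 2 with hD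
  -- With this `ε` one has `16 D ε M ≤ 1`, so in `hstep` the supremum returns with coefficient `8 D
  -- ε M ≤ 1/2` and is absorbed. The constant 20 rounds up the coefficients `16` and `9` obtained at
  -- the end.
  refine ⟨((16 * D * (M + 1) : ℝ≥0) : ℝ≥0∞)⁻¹, ENNReal.inv_pos.2 ENNReal.coe_ne_top, 20 * (M + 1), ?_⟩
  intro ψ ψ' κ ρ c W B k f hL hψ hW hψW hκW hk hρ hgain hρε hf hf1 hf2
  set μ := phaseMeasure d V₀ with hμ
  set J := ∫⁻ z, ‖f z‖ₑ ^ 2 ∂μ with hJ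
  set N₀ := ∫⁻ z, ENNReal.ofReal (ψ z) * ‖f z‖ₑ ∂μ with hN₀
  set N : ℝ → ℝ≥0∞ := fun t => ∫⁻ z, ENNReal.ofReal (ψ z) * majorant χ V₀ k f t z ∂μ with hN
  have hPm := measurable_majorant χ V₀ hk.measurable hf
  have hPt : ∀ r, Measurable (majorant χ V₀ k f r) := fun r =>
    hPm.comp (measurable_const.prodMk measurable_id)
  -- finiteness on bounded time intervals
  have hfin : ∀ T, ∃ L : ℝ≥0∞, L ≠ ⊤ ∧ ∀ t ∈ Icc 0 T, N t ≤ L ∧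
      ∫⁻ z, ENNReal.ofReal (κ z) * majorant χ V₀ k f t z ∂μ ≤ L := by
    intro T
    obtain ⟨L, hL⟩ := exists_lintegral_majorant_le hV hχ hk hf (p := 1) (Or.inl rfl) hW T
    simp only [pow_one] at hL
    have hWP : ∀ t, Measurable fun z : E d × E d => W z.1 * majorant χ V₀ k f t z := fun t =>
      (hW.measurable.comp measurable_fst).mul (hPt t)
    have key : ∀ w : E d × E d → ℝ, (∀ z, z.2 ∈ velocitySet d V₀ →
        ENNReal.ofReal (w z) ≤ B * W z.1) → ∀ t ∈ Icc 0 T,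
        ∫⁻ z, ENNReal.ofReal (w z) * majorant χ V₀ k f t z ∂μ ≤
        B * (L * ∫⁻ z, W z.1 * ‖f z‖ₑ ∂μ) := fun w hw t ht => by
      refine le_trans ?_ (mul_le_mul_right (hL t ht) _)
      rw [← lintegral_const_mul _ (hWP t)]
      refine lintegral_mono_ae ?_
      filter_upwards [ae_velocity_mem V₀] with z hz
      rw [← mul_assoc]
      exact mul_le_mul_left (hw z hz) _
    exact ⟨B * (L * ∫⁻ z, W z.1 * ‖f z‖ₑ ∂μ), ENNReal.mul_ne_top ENNReal.coe_ne_top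
      (ENNReal.mul_ne_top ENNReal.coe_ne_top hf1), fun t ht => ⟨key ψ hψW t ht, key κ hκW t ht⟩⟩
  have hn : ∀ t, ∫⁻ z, majorant χ V₀ k f t z ∂μ ≤ 2 * N t := fun t => by
    have hm : Measurable fun z => ENNReal.ofReal (ψ z) * majorant χ V₀ k f t z :=
      hL.cont.measurable.ennreal_ofReal.mul (hPt t)
    rw [hN]
    simp only
    rw [← lintegral_const_mul _ hm]
    refine lintegral_mono_ae ?_
    filter_upwards [ae_velocity_mem V₀] with z hz
    rw [← mul_assoc]
    nth_rewrite 1 [← one_mul (majorant χ V₀ k f t z)]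
    refine mul_le_mul_left ?_ _
    have h2 : (2 : ℝ≥0∞) = ENNReal.ofReal 2 := by simp
    rw [h2, ← ENNReal.ofReal_mul zero_le_two]
    exact ENNReal.one_le_ofReal.2 (by linarith [hψ z hz])
  intro T hT
  obtain ⟨L, hLtop, hLle⟩ := hfin T
  set S : ℝ≥0∞ := ⨆ t ∈ Icc 0 T, expE (-b * t) * N t ^ 2 with hS
  have hNS : ∀ t ∈ Icc 0 T, expE (-b * t) * N t ^ 2 ≤ S := fun t ht =>
    le_iSup₂ (f := fun t (_ : t ∈ Icc 0 T) => expE (-b * t) * N t ^ 2) t ht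
  have hStop : S ≠ ⊤ := by
    refine ne_top_of_le_ne_top (b := expE (-b * T) * L ^ 2)
      (ENNReal.mul_ne_top (expE_ne_top _) (ENNReal.pow_ne_top hLtop))
      (iSup₂_le fun t ht => mul_le_mul' (expE_mono (by nlinarith [ht.2]))
        (pow_le_pow_left' (hLle t ht).1 2))
  have hn2 : ∀ t ∈ Icc 0 T, expE (-b * t) * (∫⁻ z, majorant χ V₀ k f t z ∂μ) ^ 2 ≤ 4 * S :=
    fun t ht => by
    calc _ ≤ expE (-b * t) * (2 * N t) ^ 2 := mul_le_mul_right (pow_le_pow_left' (hn t) 2) _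
      _ = 4 * (expE (-b * t) * N t ^ 2) := by ring
      _ ≤ _ := mul_le_mul_right (hNS t ht) _
  have hP2 := hM k f hk hf hf2 T (4 * S) hn2
  set r : ℝ → ℝ≥0∞ := fun s => ∫⁻ z, ρ z * majorant χ V₀ k f s z ∂μ with hr
  have hrm : Measurable r := Measurable.lintegral_prod_right' (f := fun q : ℝ × (E d × E d) =>
    ρ q.2 * majorant χ V₀ k f q.1 q.2) ((hρ.comp measurable_snd).mul hPm)
  set ε : ℝ≥0∞ := ((16 * D * (M + 1) : ℝ≥0) : ℝ≥0∞)⁻¹ with hε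
  have hr2 : ∀ t ∈ Icc 0 T, expE (-b * t) * r t ^ 2 ≤ ε * (M * (J + 4 * S)) := fun t ht => by
    calc expE (-b * t) * r t ^ 2 ≤ expE (-b * t) *
          ((∫⁻ z, ρ z ^ 2 ∂μ) * ∫⁻ z, majorant χ V₀ k f t z ^ 2 ∂μ) :=
          mul_le_mul_right (lintegral_mul_sq_le hρ.aemeasurable (hPt t).aemeasurable) _
      _ = (∫⁻ z, ρ z ^ 2 ∂μ) * (expE (-b * t) * ∫⁻ z, majorant χ V₀ k f t z ^ 2 ∂μ) := by ring
      _ ≤ _ := mul_le_mul' hρε (hP2 t ht)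
  have hstep : ∀ t ∈ Icc 0 T, expE (-b * t) * N t ^ 2 ≤
      2 * N₀ ^ 2 + 2 * (D * (ε * (M * (J + 4 * S)))) := by
    intro t ht
    have hmain := hL.lintegral_majorant_le hχ.1.le hk.measurable hf hρ hgain ht.1 (by
      refine ne_top_of_le_ne_top (b := ∫⁻ r in Ioc 0 t, expE (-b * t) * L) ?_
        (setLIntegral_mono' measurableSet_Ioc fun r hr => mul_le_mul' (expE_mono ?_)
          (hLle r ⟨hr.1.le, hr.2.trans ht.2⟩).2)
      · rw [lintegral_const, Measure.restrict_apply_univ, Real.volume_Ioc]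
        exact ENNReal.mul_ne_top (ENNReal.mul_ne_top (expE_ne_top _) hLtop) ENNReal.ofReal_ne_top
      · nlinarith [hr.2])
    -- Half of the rate is given up: the remaining `e^{b (t - s) / 2}` is an integrable kernel in
    -- time, against which the remainder is estimated in square mean. This is why the final rate of
    -- the norm is `b / 2`.
    have h1 : expE (-b / 2 * t) * N t ≤ N₀ +
        ∫⁻ s in Ioc 0 t, expE (-(-b / 2) * (t - s)) * (expE (-b / 2 * s) * r s) := by
      have h2 := mul_le_mul_right hmain (expE (b / 2 * t))
      rw [mul_add] at h2
      calc expE (-b / 2 * t) * N t = expE (b / 2 * t) * (expE (-b * t) * N t) := by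
            rw [← mul_assoc, ← expE_add]; congr 2; ring
        _ ≤ _ := h2
        _ ≤ _ := by
            refine add_le_add ?_ ?_
            · refine (mul_le_mul_left (expE_le_one ?_) _).trans_eq (one_mul _)
              nlinarith [ht.1]
            · rw [← lintegral_const_mul' _ _ (expE_ne_top _)]
              refine lintegral_mono fun s => le_of_eq ?_
              rw [← mul_assoc, ← mul_assoc, ← expE_add, ← expE_add]
              congr 2; ring
    have hem : Measurable fun s => expE (-(-b / 2) * (t - s)) := measurable_expE.comp (by fun_prop)
    have hem2 : Measurable fun s => expE (-b / 2 * s) * r s :=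
      (measurable_expE.comp (by fun_prop)).mul hrm
    have hsq : ∀ (s : ℝ) (y : ℝ≥0∞), (expE (-b / 2 * s) * y) ^ 2 = expE (-b * s) * y ^ 2 :=
      fun s y => by rw [mul_pow, expE_pow_two]; congr 2; ring
    have h3 : (∫⁻ s in Ioc 0 t, expE (-(-b / 2) * (t - s)) * (expE (-b / 2 * s) * r s)) ^ 2 ≤
        D * (ε * (M * (J + 4 * S))) := by
      refine (lintegral_weight_mul_sq_le hem.aemeasurable hem2.aemeasurable).trans ?_
      have hD2 : (D : ℝ≥0∞) = ENNReal.ofReal (1 / (-b / 2)) * ENNReal.ofReal (1 / (-b / 2)) := by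
        rw [hD, sq]; push_cast; rfl
      rw [hD2, mul_assoc]
      refine mul_le_mul' (lintegral_expE_le (by linarith)) ?_
      rw [← sub_zero (-b / 2)]
      have := lintegral_expE_shift_le (c := -b / 2) (β := 0) (t := t) (by linarith)
        (g := fun s => (expE (-b / 2 * s) * r s) ^ 2) (A := ε * (M * (J + 4 * S))) (fun s hs => by
          rw [zero_mul, expE_zero, one_mul, hsq]
          exact hr2 s ⟨hs.1.le, hs.2.trans ht.2⟩)
      rw [zero_mul, expE_zero, one_mul] at this
      simpa only [sub_zero] using this
    rw [← hsq]
    calc _ ≤ _ := pow_le_pow_left' h1 2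
      _ ≤ _ := add_sq_le_two_mul _ _
      _ ≤ 2 * (N₀ ^ 2 + D * (ε * (M * (J + 4 * S)))) :=
          mul_le_mul_right (add_le_add_right h3 _) _
      _ = _ := by ring
  have hDε : (D : ℝ≥0∞) * (ε * M) * 16 ≤ 1 := by
    have h1 : (D : ℝ≥0∞) * M * 16 ≤ ((16 * D * (M + 1) : ℝ≥0) : ℝ≥0∞) := by
      push_cast
      calc (D : ℝ≥0∞) * M * 16 ≤ D * M * 16 + D * 16 := le_self_add
        _ = _ := by ring
    calc (D : ℝ≥0∞) * (ε * M) * 16 = (D * M * 16) * ε := by ring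
      _ ≤ _ := mul_le_mul_left h1 _
      _ ≤ 1 := ENNReal.mul_inv_le_one _
  have hSle : S ≤ 2 * (2 * N₀ ^ 2 + J) := by
    refine le_two_mul_of_le_add_half hStop (iSup₂_le fun t ht => (hstep t ht).trans ?_)
    rw [add_assoc]
    refine add_le_add_right ?_ _
    have hx : ∀ y : ℝ≥0∞, D * (ε * M) * 16 * y ≤ y := fun y =>
      (mul_le_mul_left hDε _).trans_eq (one_mul _)
    have hhalf : (8 : ℝ≥0∞) = 16 * 2⁻¹ := by
      have : (16 : ℝ≥0∞) = 8 * 2 := by norm_num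
      rw [this, mul_assoc, ENNReal.mul_inv_cancel (by simp) (by simp), mul_one]
    calc 2 * (D * (ε * (M * (J + 4 * S)))) = D * (ε * M) * 2 * J + D * (ε * M) * 8 * S := by ring
      _ ≤ D * (ε * M) * 16 * J + D * (ε * M) * 16 * (2⁻¹ * S) := by
          refine add_le_add (mul_le_mul_left (mul_le_mul_right (by norm_num) _) _) (le_of_eq ?_)
          rw [hhalf]; ring
      _ ≤ _ := add_le_add (hx _) (hx _)
  have hTT : T ∈ Icc 0 T := ⟨hT, le_rfl⟩
  calc expE (-b * T) * ((∫⁻ z, majorant χ V₀ k f T z ∂μ) ^ 2 +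
        ∫⁻ z, majorant χ V₀ k f T z ^ 2 ∂μ)
      ≤ 4 * S + M * (J + 4 * S) := by
        rw [mul_add]
        exact add_le_add (hn2 T hTT) (hP2 T hTT)
    _ ≤ (M + 1) * (J + 4 * S) := by
        rw [add_mul, one_mul, add_comm]
        exact add_le_add_right le_add_self _
    _ ≤ (M + 1) * (J + 4 * (2 * (2 * N₀ ^ 2 + J))) :=
        mul_le_mul_right (add_le_add_right (mul_le_mul_right hSle _) _) _
    _ = (M + 1) * (16 * N₀ ^ 2 + 9 * J) := by ring
    _ ≤ (M + 1) * (20 * N₀ ^ 2 + 20 * J) := by gcongr <;> norm_num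
    _ = _ := by push_cast; ring

end SquareDecay

/-! ### Symmetries of the velocity set -/

theorem measurePreserving_velocity (V₀ : ℝ) (L : E d ≃ₗᵢ[ℝ] E d) :
    MeasurePreserving L (volume.restrict (velocitySet d V₀))
      (volume.restrict (velocitySet d V₀)) := by
  have h := L.measurePreserving.restrict_preimage (measurableSet_velocitySet (d := d) V₀)
  have : L ⁻¹' velocitySet d V₀ = velocitySet d V₀ := by
    ext v; simp [velocitySet]
  rwa [this] at h

theorem integral_velocity_isometry (V₀ : ℝ) (L : E d ≃ₗᵢ[ℝ] E d) (g : E d → ℝ) :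
    ∫ v in velocitySet d V₀, g (L v) = ∫ v in velocitySet d V₀, g v :=
  (measurePreserving_velocity V₀ L).integral_comp L.toHomeomorph.measurableEmbedding g

/-- The reflection in the hyperplane bisecting two vectors of equal norm exchanges them. -/
theorem exists_isometry_single [NeZero d] (x : E d) :
    ∃ L : E d ≃ₗᵢ[ℝ] E d, L x = ‖x‖ • EuclideanSpace.single (0 : Fin d) (1 : ℝ) := by
  refine ⟨(Submodule.span ℝ {x - ‖x‖ • EuclideanSpace.single (0 : Fin d) (1 : ℝ)})ᗮ.reflection,
    Submodule.reflection_sub ?_⟩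
  simp [norm_smul]

theorem exists_isometry_inner [NeZero d] (x : E d) :
    ∃ L : E d ≃ₗᵢ[ℝ] E d, ∀ v, inner ℝ x v = ‖x‖ * L v 0 := by
  obtain ⟨L, hL⟩ := exists_isometry_single x
  refine ⟨L, fun v => ?_⟩
  rw [← L.inner_map_map, hL, real_inner_smul_left, EuclideanSpace.inner_single_left]
  simp

theorem integral_velocity_inner (V₀ : ℝ) (x : E d) : ∫ v in velocitySet d V₀, inner ℝ x v = 0 := by
  have h := integral_velocity_isometry V₀ (LinearIsometryEquiv.neg ℝ) fun v : E d => inner ℝ x v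
  simp only [LinearIsometryEquiv.coe_neg, inner_neg_right, integral_neg] at h
  linarith

/-- The first absolute moment `∫_𝒱 |v₁| dv`. -/
def absMoment (d : ℕ) [NeZero d] (V₀ : ℝ) : ℝ := ∫ v in velocitySet d V₀, |v 0|

theorem continuousOn_integrable {V₀ : ℝ} {g : E d → ℝ} (hg : Continuous g) :
    IntegrableOn g (velocitySet d V₀) :=
  (hg.continuousOn.integrableOn_compact (isCompact_closedBall (0 : E d) V₀)).mono_set
    Metric.ball_subset_closedBall

theorem continuous_coord [NeZero d] : Continuous fun v : E d => v 0 := by fun_prop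

theorem absMoment_pos [NeZero d] {V₀ : ℝ} (hV₀ : 0 < V₀) : 0 < absMoment d V₀ := by
  refine (setIntegral_pos_iff_support_of_nonneg_ae (Eventually.of_forall fun v => abs_nonneg _)
    (continuousOn_integrable continuous_coord.abs)).2 ?_
  have ho : IsOpen (Function.support (fun v : E d => |v 0|) ∩ velocitySet d V₀) :=
    (isOpen_ne_fun (f := fun v : E d => |v 0|) (g := fun _ => (0 : ℝ)) continuous_coord.abs
      continuous_const).inter Metric.isOpen_ball
  refine ho.measure_pos volume ⟨EuclideanSpace.single 0 (V₀ / 2), ?_, ?_⟩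
  · simp [hV₀.ne']
  · simp [velocitySet, abs_of_pos hV₀, hV₀]

theorem integral_velocity_abs_inner [NeZero d] (V₀ : ℝ) (x : E d) :
    ∫ v in velocitySet d V₀, |inner ℝ x v| = ‖x‖ * absMoment d V₀ := by
  obtain ⟨L, hL⟩ := exists_isometry_inner x
  simp only [hL, abs_mul, abs_norm]
  rw [integral_const_mul, integral_velocity_isometry V₀ L fun v => |v 0|]
  rfl

/-! ### The Lyapunov weight -/

theorem one_le_bracket (x : E d) : 1 ≤ bracket x := by
  rw [bracket, Real.one_le_sqrt]
  nlinarith [sq_nonneg ‖x‖]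

theorem norm_le_bracket (x : E d) : ‖x‖ ≤ bracket x :=
  Real.le_sqrt_of_sq_le (by linarith)

theorem bracket_le (x : E d) : bracket x ≤ 1 + ‖x‖ :=
  Real.sqrt_le_iff.2 ⟨by positivity, by nlinarith [norm_nonneg x]⟩

theorem continuous_bracket : Continuous (bracket : E d → ℝ) := by
  unfold bracket; fun_prop

theorem continuous_weight (γ : ℝ) : Continuous (weight γ : E d → ℝ) :=
  Real.continuous_exp.comp (continuous_bracket.const_mul γ)

theorem weight_pos (γ : ℝ) (x : E d) : 0 < weight γ x := Real.exp_pos _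

theorem one_le_weight {γ : ℝ} (hγ : 0 ≤ γ) (x : E d) : 1 ≤ weight γ x :=
  Real.one_le_exp (mul_nonneg hγ (zero_le_one.trans (one_le_bracket x)))

/-- The correction `(s - β √(1 + s²)) / ⟨x⟩` of the weight, with `s = x · v`. -/
def tilt (β : ℝ) (z : E d × E d) : ℝ :=
  (inner ℝ z.1 z.2 - β * Real.sqrt (1 + inner ℝ z.1 z.2 ^ 2)) / bracket z.1

/-- The derivative of `tilt` along the free transport flow. -/
def tiltDeriv (β : ℝ) (z : E d × E d) : ℝ :=
  ((‖z.2‖ ^ 2 - β * (inner ℝ z.1 z.2 * ‖z.2‖ ^ 2 / Real.sqrt (1 + inner ℝ z.1 z.2 ^ 2))) *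
    bracket z.1 - (inner ℝ z.1 z.2 - β * Real.sqrt (1 + inner ℝ z.1 z.2 ^ 2)) *
    (inner ℝ z.1 z.2 / bracket z.1)) / bracket z.1 ^ 2

/-- The weight `m (1 + γ (s - β √(1 + s²)) / ⟨x⟩)`. -/
def lyapunov (γ β : ℝ) (z : E d × E d) : ℝ := weight γ z.1 * (1 + γ * tilt β z)

/-- The derivative of `lyapunov` along the free transport flow. -/
def lyapunovDeriv (γ β : ℝ) (z : E d × E d) : ℝ :=
  weight γ z.1 * (γ * (inner ℝ z.1 z.2 / bracket z.1)) * (1 + γ * tilt β z) +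
    weight γ z.1 * (γ * tiltDeriv β z)

theorem hasDerivAt_position (z : E d × E d) (t : ℝ) :
    HasDerivAt (fun t => (shift t z).1) z.2 t := by
  have := ((hasDerivAt_id t).smul_const z.2).const_add z.1
  simpa using this

theorem hasDerivAt_inner_shift (z : E d × E d) (t : ℝ) :
    HasDerivAt (fun t => (inner ℝ (shift t z).1 (shift t z).2 : ℝ)) (‖z.2‖ ^ 2) t := by
  have := (hasDerivAt_position z t).inner ℝ (hasDerivAt_const t z.2)
  simpa using this

theorem hasDerivAt_bracket_shift (z : E d × E d) (t : ℝ) :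
    HasDerivAt (fun t => bracket (shift t z).1)
      (inner ℝ (shift t z).1 (shift t z).2 / bracket (shift t z).1) t := by
  have := ((hasDerivAt_position z t).norm_sq.const_add 1).sqrt (by positivity)
  refine this.congr_deriv ?_
  rw [mul_div_mul_left _ _ two_ne_zero]
  rfl

theorem sqrt_one_add_sq_pos (s : ℝ) : 0 < Real.sqrt (1 + s ^ 2) := Real.sqrt_pos.2 (by positivity)

theorem hasDerivAt_tilt_shift (β : ℝ) (z : E d × E d) (t : ℝ) :
    HasDerivAt (fun t => tilt β (shift t z)) (tiltDeriv β (shift t z)) t := by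
  have hs := hasDerivAt_inner_shift z t
  have hs2 : HasDerivAt (fun t => (1 + inner ℝ (shift t z).1 (shift t z).2 ^ 2 : ℝ))
      (2 * (inner ℝ (shift t z).1 (shift t z).2 * ‖z.2‖ ^ 2)) t :=
    ((hs.fun_pow 2).const_add 1).congr_deriv (by push_cast; ring)
  have hw : HasDerivAt (fun t => Real.sqrt (1 + inner ℝ (shift t z).1 (shift t z).2 ^ 2))
      (inner ℝ (shift t z).1 (shift t z).2 * ‖z.2‖ ^ 2 /
        Real.sqrt (1 + inner ℝ (shift t z).1 (shift t z).2 ^ 2)) t :=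
    (hs2.sqrt (by positivity)).congr_deriv (mul_div_mul_left _ _ two_ne_zero)
  have hb0 : bracket (shift t z).1 ≠ 0 := (zero_lt_one.trans_le (one_le_bracket _)).ne'
  exact (hs.fun_sub (hw.const_mul β)).fun_div (hasDerivAt_bracket_shift z t) hb0

theorem hasDerivAt_lyapunov_shift (γ β : ℝ) (z : E d × E d) (t : ℝ) :
    HasDerivAt (fun t => lyapunov γ β (shift t z)) (lyapunovDeriv γ β (shift t z)) t :=
  (((hasDerivAt_bracket_shift z t).const_mul γ).exp).mul
    (((hasDerivAt_tilt_shift β z t).const_mul γ).const_add 1)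

theorem bracket_fst_ne_zero (z : E d × E d) : bracket z.1 ≠ 0 :=
  (zero_lt_one.trans_le (one_le_bracket _)).ne'

theorem continuous_bracket_fst : Continuous fun z : E d × E d => bracket z.1 :=
  continuous_bracket.comp continuous_fst

theorem continuous_tilt (β : ℝ) : Continuous (tilt β : E d × E d → ℝ) := by
  unfold tilt
  exact Continuous.div (by fun_prop) continuous_bracket_fst bracket_fst_ne_zero

theorem continuous_tiltDeriv (β : ℝ) : Continuous (tiltDeriv β : E d × E d → ℝ) := by
  unfold tiltDeriv
  have h1 : Continuous fun z : E d × E d => (inner ℝ z.1 z.2 * ‖z.2‖ ^ 2 /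
      Real.sqrt (1 + inner ℝ z.1 z.2 ^ 2) : ℝ) :=
    Continuous.div (by fun_prop) (by fun_prop) fun z => (sqrt_one_add_sq_pos _).ne'
  have h2 : Continuous fun z : E d × E d => (inner ℝ z.1 z.2 / bracket z.1 : ℝ) :=
    Continuous.div (by fun_prop) continuous_bracket_fst bracket_fst_ne_zero
  refine Continuous.div (Continuous.sub (Continuous.mul ?_ continuous_bracket_fst)
    (Continuous.mul (by fun_prop) h2)) (continuous_bracket_fst.pow 2)
    fun z => pow_ne_zero 2 (bracket_fst_ne_zero z)
  exact Continuous.sub (by fun_prop) (h1.const_mul β)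

theorem continuous_lyapunov (γ β : ℝ) : Continuous (lyapunov γ β : E d × E d → ℝ) :=
  ((continuous_weight γ).comp continuous_fst).mul
    (((continuous_tilt β).const_mul γ).const_add 1)

theorem continuous_lyapunovDeriv (γ β : ℝ) : Continuous (lyapunovDeriv γ β : E d × E d → ℝ) := by
  have h2 : Continuous fun z : E d × E d => (inner ℝ z.1 z.2 / bracket z.1 : ℝ) :=
    Continuous.div (by fun_prop) continuous_bracket_fst bracket_fst_ne_zero
  have hw := (continuous_weight (d := d) γ).comp (continuous_fst (Y := E d))
  exact ((hw.mul (h2.const_mul γ)).mul (((continuous_tilt β).const_mul γ).const_add 1)).add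
    (hw.mul ((continuous_tiltDeriv β).const_mul γ))

/-! ### Uniform bounds on the tilt and comparison of the Lyapunov weight with `m`. -/

section Bounds

variable {V₀ : ℝ} {z : E d × E d}

theorem norm_velocity_le (hz : z.2 ∈ velocitySet d V₀) : ‖z.2‖ ≤ V₀ := by
  simpa [velocitySet] using (mem_ball_zero_iff.1 hz).le

theorem abs_inner_div_bracket_le (hz : z.2 ∈ velocitySet d V₀) :
    |(inner ℝ z.1 z.2 : ℝ)| / bracket z.1 ≤ V₀ := by
  rw [div_le_iff₀ (zero_lt_one.trans_le (one_le_bracket _))]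
  refine (abs_real_inner_le_norm _ _).trans ?_
  rw [mul_comm]
  exact mul_le_mul (norm_velocity_le hz) (norm_le_bracket _) (norm_nonneg _)
    ((norm_nonneg _).trans (norm_velocity_le hz))

theorem sqrt_one_add_sq_le (s : ℝ) : Real.sqrt (1 + s ^ 2) ≤ 1 + |s| :=
  Real.sqrt_le_iff.2 ⟨by positivity, by nlinarith [abs_nonneg s, sq_abs s]⟩

theorem abs_le_sqrt_one_add_sq (s : ℝ) : |s| ≤ Real.sqrt (1 + s ^ 2) :=
  Real.le_sqrt_of_sq_le (by rw [sq_abs]; linarith)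

theorem abs_tilt_le {β : ℝ} (hβ : β ∈ Icc (0 : ℝ) 1) (hz : z.2 ∈ velocitySet d V₀) :
    |tilt β z| ≤ 1 + 2 * V₀ := by
  have hy := one_le_bracket z.1
  have hu := abs_inner_div_bracket_le hz
  set s : ℝ := inner ℝ z.1 z.2 with hs
  rw [div_le_iff₀ (by linarith)] at hu
  rw [tilt, abs_div, abs_of_pos (show 0 < bracket z.1 by linarith), div_le_iff₀ (by linarith)]
  have h1 := sqrt_one_add_sq_le s
  have h2 := Real.sqrt_nonneg (1 + s ^ 2)
  have h3 : |s - β * Real.sqrt (1 + s ^ 2)| ≤ |s| + Real.sqrt (1 + s ^ 2) := by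
    refine (abs_sub _ _).trans (add_le_add_right ?_ _)
    rw [abs_mul, abs_of_nonneg hβ.1, abs_of_nonneg h2]
    exact mul_le_of_le_one_left h2 hβ.2
  nlinarith

/-- The numerator of the tilt and the bracket both have bounded derivatives along the flow, so the
quotient rule gives `O(1 / ⟨x⟩)`, negligible far from the origin. -/
theorem abs_tiltDeriv_le {β : ℝ} (hβ : β ∈ Icc (0 : ℝ) 1) (hz : z.2 ∈ velocitySet d V₀) :
    |tiltDeriv β z| ≤ (2 * V₀ ^ 2 + (1 + 2 * V₀) * V₀) / bracket z.1 := by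
  have hy := one_le_bracket z.1
  have hy0 : 0 < bracket z.1 := by linarith
  have hu := abs_inner_div_bracket_le hz
  have hp := abs_tilt_le hβ hz
  have hv := norm_velocity_le hz
  have hV := (norm_nonneg _).trans hv
  have hsq := sqrt_one_add_sq_pos (inner ℝ z.1 z.2)
  have e : tiltDeriv β z = (‖z.2‖ ^ 2 - β * (inner ℝ z.1 z.2 * ‖z.2‖ ^ 2 /
      Real.sqrt (1 + inner ℝ z.1 z.2 ^ 2)) - tilt β z * (inner ℝ z.1 z.2 / bracket z.1)) /
      bracket z.1 := by
    unfold tiltDeriv tilt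
    field_simp
  rw [e, abs_div, abs_of_pos hy0]
  refine div_le_div_of_nonneg_right ?_ hy0.le
  have h1 : ‖z.2‖ ^ 2 ≤ V₀ ^ 2 := pow_le_pow_left₀ (norm_nonneg _) hv 2
  have h2 : |β * (inner ℝ z.1 z.2 * ‖z.2‖ ^ 2 / Real.sqrt (1 + inner ℝ z.1 z.2 ^ 2))| ≤ V₀ ^ 2 := by
    rw [abs_mul, abs_of_nonneg hβ.1, abs_div, abs_of_pos hsq, abs_mul, abs_of_nonneg (sq_nonneg ‖z.2‖)]
    have h3 : |(inner ℝ z.1 z.2 : ℝ)| * ‖z.2‖ ^ 2 / Real.sqrt (1 + inner ℝ z.1 z.2 ^ 2) ≤ V₀ ^ 2 := by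
      rw [div_le_iff₀ hsq, mul_comm]
      exact mul_le_mul h1 (abs_le_sqrt_one_add_sq _) (abs_nonneg _) (sq_nonneg _)
    exact (mul_le_of_le_one_left (by positivity) hβ.2).trans h3
  have h4 : |tilt β z * (inner ℝ z.1 z.2 / bracket z.1)| ≤ (1 + 2 * V₀) * V₀ := by
    rw [abs_mul, abs_div, abs_of_pos hy0]
    exact mul_le_mul hp hu (by positivity) (by linarith)
  calc _ ≤ |‖z.2‖ ^ 2 - β * (inner ℝ z.1 z.2 * ‖z.2‖ ^ 2 /
        Real.sqrt (1 + inner ℝ z.1 z.2 ^ 2))| + |tilt β z * (inner ℝ z.1 z.2 / bracket z.1)| :=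
        abs_sub _ _
    _ ≤ (|‖z.2‖ ^ 2| + |β * (inner ℝ z.1 z.2 * ‖z.2‖ ^ 2 /
        Real.sqrt (1 + inner ℝ z.1 z.2 ^ 2))|) + |tilt β z * (inner ℝ z.1 z.2 / bracket z.1)| :=
        add_le_add_left (abs_sub _ _) _
    _ ≤ (V₀ ^ 2 + V₀ ^ 2) + (1 + 2 * V₀) * V₀ := by
        rw [abs_of_nonneg (sq_nonneg ‖z.2‖)]
        exact add_le_add (add_le_add h1 h2) h4
    _ = _ := by ring

theorem tilt_factor_mem {γ β : ℝ} (hγ0 : 0 ≤ γ) (hγ : γ * (1 + 2 * V₀) ≤ 1 / 2)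
    (hβ : β ∈ Icc (0 : ℝ) 1) (hz : z.2 ∈ velocitySet d V₀) :
    1 + γ * tilt β z ∈ Icc (1 / 2 : ℝ) (3 / 2) := by
  have h := abs_le.1 (abs_tilt_le hβ hz)
  constructor <;> nlinarith

theorem lyapunov_mem {γ β : ℝ} (hγ0 : 0 ≤ γ) (hγ : γ * (1 + 2 * V₀) ≤ 1 / 2)
    (hβ : β ∈ Icc (0 : ℝ) 1) (hz : z.2 ∈ velocitySet d V₀) :
    lyapunov γ β z ∈ Icc (weight γ z.1 / 2) (3 / 2 * weight γ z.1) := by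
  have h := tilt_factor_mem hγ0 hγ hβ hz
  have hw := weight_pos γ z.1
  unfold lyapunov
  constructor <;> nlinarith [h.1, h.2]

end Bounds

/-- The average of the Lyapunov weight over the velocities. -/
def lyapunovMean (V₀ γ β : ℝ) (x : E d) : ℝ := ∫ v in velocitySet d V₀, lyapunov γ β (x, v)

/-! ### The velocity average of the Lyapunov weight. -/

section Mean

variable {V₀ γ β : ℝ}

theorem lintegral_lyapunov (hγ0 : 0 ≤ γ) (hγ : γ * (1 + 2 * V₀) ≤ 1 / 2)
    (hβ : β ∈ Icc (0 : ℝ) 1) (x : E d) :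
    ∫⁻ v in velocitySet d V₀, ENNReal.ofReal (lyapunov γ β (x, v)) =
      ENNReal.ofReal (lyapunovMean V₀ γ β x) := by
  refine (ofReal_integral_eq_lintegral_ofReal (continuousOn_integrable
    ((continuous_lyapunov γ β).comp (by fun_prop))) ?_).symm
  filter_upwards [ae_restrict_mem (measurableSet_velocitySet V₀)] with v hv
  have := (lyapunov_mem (z := (x, v)) hγ0 hγ hβ hv).1
  have hw := weight_pos γ x
  exact le_trans (by simp only; positivity) this

theorem lyapunovMean_nonneg (hγ0 : 0 ≤ γ) (hγ : γ * (1 + 2 * V₀) ≤ 1 / 2)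
    (hβ : β ∈ Icc (0 : ℝ) 1) (x : E d) : 0 ≤ lyapunovMean V₀ γ β x := by
  refine setIntegral_nonneg (measurableSet_velocitySet V₀) fun v hv => ?_
  have := (lyapunov_mem (z := (x, v)) hγ0 hγ hβ hv).1
  have hw := weight_pos γ x
  exact le_trans (by simp only; positivity) this

/-- The part linear in `v` averages to zero by symmetry, and `√(1 + s²) ≥ |s|` makes the rest at
least a first absolute moment. The deficit with respect to `m` is the source of decay at infinity.
-/
theorem lyapunovMean_le [NeZero d] (hV : volume (velocitySet d V₀) = 1) (hγ0 : 0 ≤ γ)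
    (hβ : 0 ≤ β) (x : E d) :
    lyapunovMean V₀ γ β x ≤
      weight γ x * (1 - γ * (β * (absMoment d V₀ * (‖x‖ / bracket x)))) := by
  have hy := zero_lt_one.trans_le (one_le_bracket x)
  have hs : Continuous fun v : E d => (inner ℝ x v : ℝ) := by fun_prop
  have hq : Continuous fun v : E d => Real.sqrt (1 + inner ℝ x v ^ 2) := by fun_prop
  have e : ∀ v : E d, lyapunov γ β (x, v) = weight γ x + weight γ x * (γ / bracket x) * inner ℝ x v -
      weight γ x * (γ / bracket x) * β * Real.sqrt (1 + inner ℝ x v ^ 2) := fun v => by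
    simp only [lyapunov, tilt]
    field_simp
    ring
  have hm : ‖x‖ * absMoment d V₀ ≤ ∫ v in velocitySet d V₀, Real.sqrt (1 + inner ℝ x v ^ 2) := by
    rw [← integral_velocity_abs_inner]
    exact setIntegral_mono (continuousOn_integrable hs.abs) (continuousOn_integrable hq)
      fun v => abs_le_sqrt_one_add_sq _
  unfold lyapunovMean
  simp only [e]
  have h1 : IntegrableOn (fun v : E d => weight γ x) (velocitySet d V₀) :=
    continuousOn_integrable continuous_const
  have h2 := (continuousOn_integrable (V₀ := V₀) hs).const_mul (weight γ x * (γ / bracket x))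
  have h3 := (continuousOn_integrable (V₀ := V₀) hq).const_mul (weight γ x * (γ / bracket x) * β)
  have h12 : IntegrableOn (fun v : E d => weight γ x +
      weight γ x * (γ / bracket x) * inner ℝ x v) (velocitySet d V₀) := h1.add h2
  rw [integral_sub h12 h3, integral_add h1 h2, integral_const_mul, integral_const_mul,
    integral_velocity_inner, setIntegral_const]
  simp only [measureReal_def, hV, ENNReal.toReal_one, one_smul, mul_zero, add_zero]
  have hw : 0 ≤ weight γ x * (γ / bracket x) * β :=
    mul_nonneg (mul_nonneg (weight_pos γ x).le (div_nonneg hγ0 hy.le)) hβ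
  have := mul_le_mul_of_nonneg_left hm hw
  refine (sub_le_sub_left this _).trans_eq ?_
  field_simp

theorem measurable_lyapunovMean : Measurable (lyapunovMean V₀ γ β : E d → ℝ) := by
  have hm : StronglyMeasurable (Function.uncurry fun (x v : E d) => lyapunov γ β (x, v)) :=
    (continuous_lyapunov γ β).stronglyMeasurable
  exact (hm.integral_prod_right (ν := volume.restrict (velocitySet d V₀))).measurable

end Mean

/-! ### Values of the cutoff functions. -/

section Cutoff

variable {φ : E d → ℝ}

theorem IsCutoff.mem_Icc (hφ : IsCutoff φ) (x : E d) : φ x ∈ Icc (0 : ℝ) 1 := by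
  constructor
  · exact (indicator_nonneg (fun _ _ => zero_le_one) x).trans (hφ.lower x)
  · refine (hφ.upper x).trans ?_
    exact indicator_le_self' (fun _ _ => zero_le_one) x

theorem IsCutoff.scaled_mem_Icc (hφ : IsCutoff φ) (r : ℝ) (x : E d) :
    scaled φ r x ∈ Icc (0 : ℝ) 1 := hφ.mem_Icc _

theorem IsCutoff.scaled_eq_one (hφ : IsCutoff φ) {r : ℝ} (hr : 0 < r) {x : E d} (hx : ‖x‖ < r) :
    scaled φ r x = 1 := by
  refine le_antisymm (hφ.mem_Icc _).2 (le_trans (le_of_eq ?_) (hφ.lower _))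
  rw [indicator_of_mem]
  rw [mem_ball_zero_iff, norm_smul, norm_inv, Real.norm_of_nonneg hr.le, inv_mul_lt_iff₀ hr]
  simpa using hx

theorem IsCutoff.scaled_eq_zero (hφ : IsCutoff φ) {r : ℝ} (hr : 0 < r) {x : E d}
    (hx : 2 * r ≤ ‖x‖) : scaled φ r x = 0 := by
  refine le_antisymm ((hφ.upper _).trans (le_of_eq ?_)) (hφ.mem_Icc _).1
  rw [indicator_of_notMem]
  rw [mem_ball_zero_iff, norm_smul, norm_inv, Real.norm_of_nonneg hr.le, inv_mul_lt_iff₀ hr,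
    not_lt, mul_comm]
  exact hx

theorem IsCutoff.continuous_scaled (hφ : IsCutoff φ) (r : ℝ) : Continuous (scaled φ r) :=
  hφ.smooth.continuous.comp (by fun_prop)

end Cutoff

/-! ### The Lyapunov inequality. -/

/-- The part of the gain term that is absorbed by the Lyapunov weight. -/
def absorbed (χ V₀ γ : ℝ) (φ : E d → ℝ) (R : ℝ) (z : E d × E d) : ℝ :=
  (1 - scaled φ R z.1) * turningKernel χ z.1 z.2 * lyapunovMean V₀ γ (χ / 2) z.1

/-- Here `y` stands for `⟨x⟩`, `u` and `w` for `s` and `√(1 + s²)` divided by `⟨x⟩`, `p` and `p'`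
for the tilt and its derivative. At first order in `γ`, `u - K u = -χ |u|` compensates `K β w`, and
the deficit `K β c / 2 ≥ κ₀` of the mean survives. The errors `γ u p` and `p' + 1 / y` take at most
a quarter of `κ₀` each. -/
theorem lyapunov_ineq_far {χ γ V₀ c κ₀ K β y u w p p' σ : ℝ} (hχ : χ ∈ Ioo (0 : ℝ) 1) (hγ : 0 < γ)
    (hβ : β = χ / 2) (hσ : K = 1 + χ * σ) (hσu : σ * u = |u|) (hK : K ∈ Icc (1 - χ) (1 + χ))
    (hp : p = u - β * w) (hw : w ≤ |u| + 1 / y) (hy : 0 < y)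
    (hκ₀ : κ₀ = β * (1 - χ) * c / 2) (hc : 0 ≤ c) (hu : |u| ≤ V₀) (hpb : |p| ≤ 1 + 2 * V₀)
    (hγκ : γ * (V₀ * (1 + 2 * V₀)) ≤ κ₀ / 4) {C' : ℝ} (hp' : |p'| ≤ C' / y)
    (hyκ : (C' + 1) / y ≤ κ₀ / 4) :
    γ * u * (1 + γ * p) + γ * p' - K * (1 + γ * p) + K * (1 - γ * (β * c / 2)) ≤
      -(γ * κ₀ / 2) := by
  have hV : 0 ≤ V₀ := (abs_nonneg u).trans hu
  have h1 : γ * (u * p) ≤ κ₀ / 4 := by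
    refine le_trans (mul_le_mul_of_nonneg_left ((le_abs_self _).trans ?_) hγ.le) hγκ
    rw [abs_mul]
    exact mul_le_mul hu hpb (abs_nonneg _) hV
  have h2 : p' + 1 / y ≤ κ₀ / 4 := by
    refine le_trans (add_le_add_left ((le_abs_self _).trans hp') _) ?_
    rwa [← add_div]
  have hβ0 : 0 ≤ β := by rw [hβ]; linarith [hχ.1]
  -- This fixes `β = χ / 2`: as `K ≤ 1 + χ ≤ 2`, the correction never costs more than the term `-χ
  -- |u|` provides.
  have hKβ : K * β ≤ χ := by
    rw [hβ]; nlinarith [hχ.1, hχ.2, hK.2]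
  have hK0 : 0 ≤ K := by linarith [hK.1, hχ.2]
  have h3 : K * β * w ≤ χ * |u| + 1 / y := by
    have hy1 : 0 ≤ 1 / y := by positivity
    calc K * β * w ≤ K * β * (|u| + 1 / y) := mul_le_mul_of_nonneg_left hw (mul_nonneg hK0 hβ0)
      _ ≤ χ * (|u| + 1 / y) := mul_le_mul_of_nonneg_right hKβ (by positivity)
      _ ≤ χ * |u| + 1 / y := by nlinarith [hχ.2]
  have h4 : u - K * u = -(χ * |u|) := by rw [hσ, ← hσu]; ring
  have h5 : κ₀ ≤ K * (β * c / 2) := by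
    rw [hκ₀]; nlinarith [mul_nonneg hβ0 hc, hK.1]
  have h6 : u + γ * (u * p) + p' - K * p - K * (β * c / 2) ≤ -(κ₀ / 2) := by
    have : K * p = K * u - K * β * w := by rw [hp]; ring
    linarith
  have := mul_le_mul_of_nonneg_left h6 hγ.le
  linarith

/-- Without the gain, the loss is bounded below by `(1 - χ) / 2`, and all other terms are `O(γ)`. -/
theorem lyapunov_ineq_near {χ γ V₀ κ₀ K y u p p' C' : ℝ} (hγ : 0 < γ)
    (hK : 1 - χ ≤ K) (hχ : χ < 1) (hy : 1 ≤ y) (hu : |u| ≤ V₀) (hpb : 1 + γ * p ∈ Icc (1 / 2 : ℝ) (3 / 2))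
    (hC' : 0 ≤ C') (hκ : 0 ≤ κ₀) (hp' : |p'| ≤ C' / y) (hγlam : γ * (2 * V₀ + C' + κ₀) ≤ (1 - χ) / 2) :
    γ * u * (1 + γ * p) + γ * p' - K * (1 + γ * p) ≤ -(γ * κ₀ / 2) := by
  have h1 : p' ≤ C' := (le_abs_self _).trans (hp'.trans (div_le_self hC' hy))
  have h2 : u * (1 + γ * p) ≤ V₀ * (3 / 2) := by
    have := (le_abs_self u).trans hu
    have h0 : 0 ≤ V₀ := (abs_nonneg u).trans hu
    nlinarith [hpb.1, hpb.2]
  have h3 : (1 - χ) / 2 ≤ K * (1 + γ * p) := by nlinarith [hpb.1]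
  have h0 : 0 ≤ V₀ := (abs_nonneg u).trans hu
  nlinarith [mul_le_mul_of_nonneg_left h1 hγ.le, mul_le_mul_of_nonneg_left h2 hγ.le,
    mul_nonneg hγ.le h0, mul_nonneg hγ.le hκ]

theorem sign_mul_self_div (s : ℝ) {y : ℝ} (hy : 0 < y) : Real.sign s * (s / y) = |s / y| := by
  rw [abs_div, abs_of_pos hy, mul_div_assoc']
  congr 1
  rcases lt_trichotomy s 0 with h | h | h
  · rw [Real.sign_of_neg h, abs_of_neg h]; ring
  · simp [h]
  · rw [Real.sign_of_pos h, abs_of_pos h]; ring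

/-- For `γ` small, `lyapunov` is a Lyapunov weight, with a rate independent of `R` large. -/
theorem exists_isLyapunov [NeZero d] {V₀ χ : ℝ} (hV₀ : 0 < V₀)
    (hV : volume (velocitySet d V₀) = 1) (hχ : χ ∈ Ioo (0 : ℝ) 1) {φ : E d → ℝ} (hφ : IsCutoff φ) :
    ∃ γstar : ℝ, 0 < γstar ∧ ∀ γ ∈ Ioo 0 γstar, γ * (1 + 2 * V₀) ≤ 1 / 2 ∧
      ∃ b < 0, -b < 1 - χ ∧ ∃ R₀ : ℝ, 1 < R₀ ∧ ∀ R, R₀ ≤ R →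
        IsLyapunov χ V₀ b (lyapunov γ (χ / 2) : E d × E d → ℝ) (lyapunovDeriv γ (χ / 2))
          (absorbed χ V₀ γ φ R) := by
  have hlam : 0 < 1 - χ := by linarith [hχ.2]
  set c := absMoment d V₀ with hc
  have hc0 : 0 < c := absMoment_pos hV₀
  set κ₀ := χ / 2 * (1 - χ) * c / 2 with hκ₀
  have hκ0 : 0 < κ₀ := by have := hχ.1; positivity
  set C' := 2 * V₀ ^ 2 + (1 + 2 * V₀) * V₀ with hC'
  have hC0 : 0 ≤ C' := by positivity
  -- The first threshold keeps `ψ / m` between `1/2` and `3/2`; the second makes the quadratic term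
  -- small in `lyapunov_ineq_far`; the third serves `lyapunov_ineq_near` and ensures `-b < 1 - χ`.
  set γ₁ := 1 / 2 / (1 + 2 * V₀) with hγ₁
  set γ₂ := κ₀ / 4 / (V₀ * (1 + 2 * V₀)) with hγ₂
  set γ₃ := (1 - χ) / 2 / (2 * V₀ + C' + κ₀) with hγ₃
  refine ⟨min γ₁ (min γ₂ γ₃), by positivity, fun γ hγ => ?_⟩
  have hγ0 : 0 < γ := hγ.1
  have h1 : γ * (1 + 2 * V₀) ≤ 1 / 2 :=
    (le_div_iff₀ (by positivity)).1 (hγ.2.le.trans (min_le_left _ _))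
  have h2 : γ * (V₀ * (1 + 2 * V₀)) ≤ κ₀ / 4 :=
    (le_div_iff₀ (by positivity)).1 (hγ.2.le.trans ((min_le_right _ _).trans (min_le_left _ _)))
  have h3 : γ * (2 * V₀ + C' + κ₀) ≤ (1 - χ) / 2 :=
    (le_div_iff₀ (by positivity)).1 (hγ.2.le.trans ((min_le_right _ _).trans (min_le_right _ _)))
  have hβ : χ / 2 ∈ Icc (0 : ℝ) 1 := ⟨by linarith [hχ.1], by linarith [hχ.2]⟩
  -- The pointwise inequality gives `-γ κ₀ / 2` times `m`, and `ψ ≤ (3/2) m` turns one half into one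
  -- third. The radius makes `(C' + 1) / ⟨x⟩ ≤ κ₀ / 4` and `|x| / ⟨x⟩ ≥ 1/2` outside the ball of
  -- radius `R`.
  refine ⟨h1, -(γ * κ₀ / 3), by have : 0 < γ * κ₀ := by positivity
                                linarith, ?_, 2 + 4 * (C' + 1) / κ₀, ?_, fun R hR => ?_⟩
  · have : γ * κ₀ ≤ γ * (2 * V₀ + C' + κ₀) := by
      refine mul_le_mul_of_nonneg_left ?_ hγ0.le
      linarith
    linarith
  · have : 0 ≤ 4 * (C' + 1) / κ₀ := by positivity
    linarith
  have hR1 : 2 ≤ R := by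
    have : 0 ≤ 4 * (C' + 1) / κ₀ := by positivity
    linarith
  have hmean := lyapunovMean_nonneg (d := d) hγ0.le h1 hβ
  refine ⟨continuous_lyapunov _ _, continuous_lyapunovDeriv _ _, ?_, fun z hz => ?_, fun z hz => ?_,
    hasDerivAt_lyapunov_shift _ _, fun z hz => ?_⟩
  · have hk : Measurable fun z : E d × E d => turningKernel χ z.1 z.2 := measurable_turningKernel χ
    exact ((measurable_const.sub ((hφ.continuous_scaled R).measurable.comp measurable_fst)).mul
      hk).mul (measurable_lyapunovMean.comp measurable_fst)
  · have := (lyapunov_mem hγ0.le h1 hβ hz).1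
    have hw := weight_pos γ z.1
    linarith
  · refine mul_nonneg (mul_nonneg ?_ ?_) (hmean _)
    · linarith [(hφ.scaled_mem_Icc R z.1).2]
    · linarith [(turningKernel_mem hχ.1.le z.1 z.2).1]
  have hK := turningKernel_mem hχ.1.le z.1 z.2
  have hy1 := one_le_bracket z.1
  have hy0 : 0 < bracket z.1 := by linarith
  have hw := weight_pos γ z.1
  have hfac := tilt_factor_mem hγ0.le h1 hβ hz
  have hu : |(inner ℝ z.1 z.2 : ℝ) / bracket z.1| ≤ V₀ := by
    rw [abs_div, abs_of_pos hy0]; exact abs_inner_div_bracket_le hz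
  have hp := abs_tilt_le hβ hz
  have hp' := abs_tiltDeriv_le hβ hz
  -- reduction to an inequality without the weight
  suffices h : γ * (inner ℝ z.1 z.2 / bracket z.1) * (1 + γ * tilt (χ / 2) z) +
      γ * tiltDeriv (χ / 2) z - turningKernel χ z.1 z.2 * (1 + γ * tilt (χ / 2) z) +
      absorbed χ V₀ γ φ R z / weight γ z.1 ≤ -(γ * κ₀ / 2) by
    have h4 := mul_le_mul_of_nonneg_left h hw.le
    have h5 : weight γ z.1 * (absorbed χ V₀ γ φ R z / weight γ z.1) = absorbed χ V₀ γ φ R z :=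
      mul_div_cancel₀ _ hw.ne'
    have h6 : weight γ z.1 * -(γ * κ₀ / 2) ≤ -(γ * κ₀ / 3) * lyapunov γ (χ / 2) z := by
      have h7 := (lyapunov_mem hγ0.le h1 hβ hz).2
      have h8 : 0 < γ * κ₀ := by positivity
      nlinarith
    refine le_trans (le_of_eq ?_) (h4.trans h6)
    rw [mul_add, h5]
    unfold lyapunovDeriv lyapunov
    ring
  by_cases hx : ‖z.1‖ < R
  · have : absorbed χ V₀ γ φ R z = 0 := by
      simp [absorbed, hφ.scaled_eq_one (by linarith) hx]
    rw [this, zero_div, add_zero]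
    exact lyapunov_ineq_near hγ0 hK.1 hχ.2 hy1 hu hfac hC0 hκ0.le hp' h3
  · rw [not_lt] at hx
    have hyR : 2 + 4 * (C' + 1) / κ₀ ≤ bracket z.1 := hR.trans (hx.trans (norm_le_bracket _))
    have hyκ : (C' + 1) / bracket z.1 ≤ κ₀ / 4 := by
      rw [div_le_iff₀ hy0]
      have : 4 * (C' + 1) / κ₀ ≤ bracket z.1 := by linarith
      rw [div_le_iff₀ hκ0] at this
      linarith
    have hhalf : 1 / 2 ≤ ‖z.1‖ / bracket z.1 := by
      rw [div_le_div_iff₀ two_pos hy0]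
      linarith [bracket_le z.1]
    have habs : absorbed χ V₀ γ φ R z / weight γ z.1 ≤
        turningKernel χ z.1 z.2 * (1 - γ * (χ / 2 * c / 2)) := by
      rw [div_le_iff₀ hw]
      have hK0 : 0 ≤ turningKernel χ z.1 z.2 := by linarith [hK.1]
      have hφ1 := hφ.scaled_mem_Icc R z.1
      calc absorbed χ V₀ γ φ R z ≤ turningKernel χ z.1 z.2 * lyapunovMean V₀ γ (χ / 2) z.1 := by
            unfold absorbed
            refine mul_le_mul_of_nonneg_right (mul_le_of_le_one_left hK0 ?_) (hmean _)
            linarith [hφ1.1]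
        _ ≤ turningKernel χ z.1 z.2 * (weight γ z.1 * (1 - γ * (χ / 2 * c / 2))) := by
            refine mul_le_mul_of_nonneg_left ((lyapunovMean_le hV hγ0.le hβ.1 z.1).trans
              (mul_le_mul_of_nonneg_left ?_ hw.le)) hK0
            have : γ * (χ / 2 * c / 2) ≤ γ * (χ / 2 * (c * (‖z.1‖ / bracket z.1))) := by
              refine mul_le_mul_of_nonneg_left ?_ hγ0.le
              rw [mul_div_assoc]
              refine mul_le_mul_of_nonneg_left ?_ hβ.1
              rw [div_eq_mul_one_div]
              exact mul_le_mul_of_nonneg_left hhalf hc0.le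
            linarith
        _ = _ := by ring
    refine (add_le_add_right habs _).trans ?_
    have hsq : Real.sqrt (1 + inner ℝ z.1 z.2 ^ 2) / bracket z.1 ≤
        |(inner ℝ z.1 z.2 : ℝ) / bracket z.1| + 1 / bracket z.1 := by
      rw [abs_div, abs_of_pos hy0, ← add_div]
      refine div_le_div_of_nonneg_right ?_ hy0.le
      linarith [sqrt_one_add_sq_le (inner ℝ z.1 z.2)]
    refine lyapunov_ineq_far (w := Real.sqrt (1 + inner ℝ z.1 z.2 ^ 2) / bracket z.1)
      (σ := Real.sign (inner ℝ z.1 z.2)) hχ hγ0 rfl rfl (sign_mul_self_div _ hy0) hK ?_ hsq hy0 rfl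
      hc0.le hu hp h2 hp' hyκ
    unfold tilt
    ring

/-! ### The kernels -/

section Kernels

variable {χ V₀ γ R δ₁ δ₂ δ₃ : ℝ} {φ : E d → ℝ} {ζ : ℝ → ℝ → ℝ}

/-- A nondecreasing function equal to `1` far to the right never exceeds `1`; oddness gives the
lower bound. -/
theorem IsRegularizedSign.abs_le_one {δ : ℝ} {g : ℝ → ℝ} (hg : IsRegularizedSign δ g) (s : ℝ) :
    |g s| ≤ 1 := by
  have key : ∀ s, g s ≤ 1 := fun s => by
    rw [← hg.eq_one (max s δ) (le_max_right _ _)]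
    exact hg.mono (le_max_left _ _)
  exact abs_le.2 ⟨by have := key (-s); rw [hg.odd] at this; linarith, key s⟩

theorem IsRegularizedSign.eq_sign {δ : ℝ} (hδ : 0 < δ) {g : ℝ → ℝ} (hg : IsRegularizedSign δ g)
    {s : ℝ} (hs : δ ≤ |s|) : g s = Real.sign s := by
  rcases le_or_gt 0 s with h | h
  · rw [abs_of_nonneg h] at hs
    rw [hg.eq_one s hs, Real.sign_of_pos (by linarith)]
  · rw [abs_of_neg h] at hs
    rw [Real.sign_of_neg h, ← neg_neg s, hg.odd, hg.eq_one _ hs]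

theorem abs_positionTruncation_le (hφ : IsCutoff φ) (x : E d) :
    |positionTruncation φ δ₂ R x| ≤ 1 := by
  have h1 := hφ.scaled_mem_Icc R x
  have h2 := hφ.scaled_mem_Icc δ₂ x
  rw [positionTruncation, abs_le]
  exact ⟨by linarith [h1.1, h2.2], by linarith [h1.2, h2.1]⟩

theorem positionTruncation_eq_zero (hφ : IsCutoff φ) (hR : 0 < R) (hδ : 0 < δ₂) (hδR : δ₂ ≤ R)
    {x : E d} (hx : 2 * R ≤ ‖x‖) : positionTruncation φ δ₂ R x = 0 := by
  rw [positionTruncation, hφ.scaled_eq_zero hR hx, hφ.scaled_eq_zero hδ (by linarith), sub_zero]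

theorem abs_velocityTruncation_le [NeZero d] (hφ : IsCutoff φ) (v : E d) :
    |velocityTruncation V₀ φ δ₁ v| ≤ 1 := by
  have h1 := hφ.scaled_mem_Icc δ₁ (EuclideanSpace.single 0 (V₀ - ‖v‖))
  have h2 := hφ.scaled_mem_Icc δ₁ v
  rw [velocityTruncation, scaledRadial, abs_le]
  exact ⟨by linarith [h1.2, h2.2], by linarith [h1.1, h2.1]⟩

theorem abs_regularKernel_le [NeZero d] (hχ : χ ∈ Ioo (0 : ℝ) 1) (hφ : IsCutoff φ)
    (hζ : IsRegularizedSign δ₃ (ζ δ₃)) (x v : E d) :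
    |regularKernel χ V₀ φ ζ R δ₁ δ₂ δ₃ x v| ≤ 2 := by
  have h3 : |1 + χ * ζ δ₃ (inner ℝ x v)| ≤ 2 := by
    have := abs_le.1 (hζ.abs_le_one (inner ℝ x v))
    rw [abs_le]
    constructor <;> nlinarith [hχ.1, hχ.2]
  rw [regularKernel, abs_mul, abs_mul]
  calc _ ≤ (1 : ℝ) * 1 * 2 := by
        refine mul_le_mul (mul_le_mul (abs_positionTruncation_le hφ x)
          (abs_velocityTruncation_le hφ v) (abs_nonneg _) zero_le_one) h3 (abs_nonneg _) (by norm_num)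
    _ = 2 := by norm_num

theorem continuous_regularKernel [NeZero d] (hφ : IsCutoff φ)
    (hζ : IsRegularizedSign δ₃ (ζ δ₃)) :
    Continuous (Function.uncurry (regularKernel χ V₀ φ ζ R δ₁ δ₂ δ₃)) := by
  have h1 : Continuous fun z : E d × E d => positionTruncation φ δ₂ R z.1 :=
    ((hφ.continuous_scaled R).comp continuous_fst).sub
      ((hφ.continuous_scaled δ₂).comp continuous_fst)
  have hs : Continuous fun z : E d × E d =>
      scaledRadial φ δ₁ (V₀ - ‖z.2‖) := by
    refine (hφ.continuous_scaled δ₁).comp ?_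
    have : Continuous fun s : ℝ => (EuclideanSpace.single (0 : Fin d) s : E d) := by
      have e : (fun s : ℝ => (EuclideanSpace.single (0 : Fin d) s : E d)) =
          fun s => s • EuclideanSpace.single (0 : Fin d) (1 : ℝ) := by
        funext s; ext i; simp
      rw [e]; fun_prop
    exact this.comp (by fun_prop)
  have h2 : Continuous fun z : E d × E d => velocityTruncation V₀ φ δ₁ z.2 :=
    (continuous_const.sub hs).sub ((hφ.continuous_scaled δ₁).comp continuous_snd)
  have h3 : Continuous fun z : E d × E d => 1 + χ * ζ δ₃ (inner ℝ z.1 z.2) :=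
    ((hζ.smooth.continuous.comp (by fun_prop)).const_mul χ).const_add 1
  exact (h1.mul h2).mul h3

theorem isBoundedKernel_kernelB1 (hχ : χ ∈ Ioo (0 : ℝ) 1) (hφ : IsCutoff φ) :
    IsBoundedKernel V₀ 4 (kernelB1 χ φ R) := by
  refine ⟨(measurable_const.sub ((hφ.continuous_scaled R).measurable.comp measurable_fst)).mul
    (measurable_turningKernel χ), fun x v _ => ?_⟩
  have hK := turningKernel_mem hχ.1.le x v
  have h1 := hφ.scaled_mem_Icc R x
  have h0 : 0 ≤ 1 - χ := by linarith [hχ.2]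
  have : |kernelB1 χ φ R x v| ≤ 4 := by
    rw [kernelB1, abs_mul]
    have h2 : |1 - scaled φ R x| ≤ 1 := abs_le.2 ⟨by linarith [h1.2], by linarith [h1.1]⟩
    have h3 : |turningKernel χ x v| ≤ 4 := abs_le.2 ⟨by linarith [hK.1], by linarith [hK.2, hχ.2]⟩
    calc _ ≤ 1 * (4 : ℝ) := mul_le_mul h2 h3 (abs_nonneg _) zero_le_one
      _ = 4 := one_mul _
  rw [Real.enorm_eq_ofReal_abs]
  exact (ENNReal.ofReal_le_ofReal this).trans_eq (by simp)

theorem isBoundedKernel_kernelB [NeZero d] (hχ : χ ∈ Ioo (0 : ℝ) 1) (hφ : IsCutoff φ)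
    (hζ : IsRegularizedSign δ₃ (ζ δ₃)) :
    IsBoundedKernel V₀ 4 (kernelB χ V₀ φ ζ R δ₁ δ₂ δ₃) := by
  refine ⟨(measurable_turningKernel χ).sub (continuous_regularKernel hφ hζ).measurable,
    fun x v _ => ?_⟩
  have hK := turningKernel_mem hχ.1.le x v
  have h1 := abs_le.1 (abs_regularKernel_le (V₀ := V₀) (R := R) (δ₁ := δ₁) (δ₂ := δ₂) hχ hφ hζ x v)
  have : |kernelB χ V₀ φ ζ R δ₁ δ₂ δ₃ x v| ≤ 4 :=
    abs_le.2 ⟨by unfold kernelB; linarith [hK.1, hχ.2], by unfold kernelB; linarith [hK.2, hχ.2]⟩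
  rw [Real.enorm_eq_ofReal_abs]
  exact (ENNReal.ofReal_le_ofReal this).trans_eq (by simp)

/-- The set where the kernels of `ℬ` and `ℬ₁` differ. -/
def exceptionalSet (d : ℕ) (V₀ R δ₁ δ₂ δ₃ : ℝ) : Set (E d × E d) :=
  {z | ‖z.1‖ < 2 * R ∧ (‖z.2‖ < 2 * δ₁ ∨ V₀ - ‖z.2‖ < 2 * δ₁)} ∪
    ({z | ‖z.1‖ < 2 * R ∧ ‖z.1‖ < 2 * δ₂} ∪
      {z | ‖z.1‖ < 2 * R ∧ |(inner ℝ z.1 z.2 : ℝ)| < δ₃})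

theorem measurableSet_exceptionalSet :
    MeasurableSet (exceptionalSet d V₀ R δ₁ δ₂ δ₃) := by
  have h1 : MeasurableSet {z : E d × E d | ‖z.1‖ < 2 * R} :=
    measurableSet_lt (by fun_prop) measurable_const
  have m1 : Measurable fun z : E d × E d => ‖z.1‖ := by fun_prop
  have m2 : Measurable fun z : E d × E d => ‖z.2‖ := by fun_prop
  have m3 : Measurable fun z : E d × E d => V₀ - ‖z.2‖ := by fun_prop
  have m4 : Measurable fun z : E d × E d => |(inner ℝ z.1 z.2 : ℝ)| :=
    continuous_abs.measurable.comp (by fun_prop)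
  exact (h1.inter ((measurableSet_lt m2 measurable_const).union
    (measurableSet_lt m3 measurable_const))).union
    ((h1.inter (measurableSet_lt m1 measurable_const)).union
      (h1.inter (measurableSet_lt m4 measurable_const)))

/-- Off the exceptional set with `|x| < 2R`, the cutoffs at scales `δ₁` and `δ₂` vanish and the
regularized sign is the sign, so the truncated kernel is `φ_R K`. For `|x| ≥ 2R` it vanishes, using
`δ₂ ≤ R`. -/
theorem kernelB_eq_kernelB1 [NeZero d] (hφ : IsCutoff φ) (hζ : IsRegularizedSign δ₃ (ζ δ₃))
    (hR : 0 < R) (hδ₁ : 0 < δ₁) (hδ₂ : 0 < δ₂) (hδ₃ : 0 < δ₃) (hδR : δ₂ ≤ R) {x v : E d}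
    (h : (x, v) ∉ exceptionalSet d V₀ R δ₁ δ₂ δ₃) :
    kernelB χ V₀ φ ζ R δ₁ δ₂ δ₃ x v = kernelB1 χ φ R x v := by
  rcases le_or_gt (2 * R) ‖x‖ with hx | hx
  · simp [kernelB, kernelB1, regularKernel, positionTruncation_eq_zero hφ hR hδ₂ hδR hx,
      hφ.scaled_eq_zero hR hx]
  · simp only [exceptionalSet, mem_union, Set.mem_ofPred_eq, hx, true_and, not_or, not_lt] at h
    obtain ⟨⟨h1, h2⟩, h3, h4⟩ := h
    have e1 : scaled φ δ₂ x = 0 := hφ.scaled_eq_zero hδ₂ h3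
    have e2 : scaled φ δ₁ v = 0 := hφ.scaled_eq_zero hδ₁ h1
    have e3 : scaledRadial φ δ₁ (V₀ - ‖v‖) = 0 := by
      refine hφ.scaled_eq_zero hδ₁ ?_
      simpa using h2.trans (le_abs_self _)
    rw [kernelB, kernelB1, regularKernel, positionTruncation, velocityTruncation, e1, e2, e3,
      hζ.eq_sign hδ₃ h4, turningKernel]
    ring

/-- The part of the gain term of `ℬ` that is not absorbed by the Lyapunov weight. -/
def remainder (V₀ γ R δ₁ δ₂ δ₃ : ℝ) (z : E d × E d) : ℝ≥0∞ :=
  (exceptionalSet d V₀ R δ₁ δ₂ δ₃).indicator (fun _ => ENNReal.ofReal (4 * Real.exp (γ * (1 + 2 * R)))) z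

theorem measurable_remainder : Measurable (remainder (d := d) V₀ γ R δ₁ δ₂ δ₃) :=
  measurable_const.indicator measurableSet_exceptionalSet

theorem lintegral_remainder_sq : ∫⁻ z, remainder V₀ γ R δ₁ δ₂ δ₃ z ^ 2 ∂(phaseMeasure d V₀) =
    ENNReal.ofReal (4 * Real.exp (γ * (1 + 2 * R))) ^ 2 *
      phaseMeasure d V₀ (exceptionalSet d V₀ R δ₁ δ₂ δ₃) := by
  have : ∀ z, remainder V₀ γ R δ₁ δ₂ δ₃ z ^ 2 = (exceptionalSet d V₀ R δ₁ δ₂ δ₃).indicator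
      (fun _ => ENNReal.ofReal (4 * Real.exp (γ * (1 + 2 * R))) ^ 2) z := fun z => by
    by_cases h : z ∈ exceptionalSet d V₀ R δ₁ δ₂ δ₃ <;> simp [remainder, h]
  simp only [this]
  rw [lintegral_indicator_const measurableSet_exceptionalSet]

theorem kernelB1_gain_le (hχ : χ ∈ Ioo (0 : ℝ) 1) (hφ : IsCutoff φ) (hγ0 : 0 ≤ γ)
    (hγ : γ * (1 + 2 * V₀) ≤ 1 / 2) (x v : E d) :
    ‖kernelB1 χ φ R x v‖ₑ * ∫⁻ v' in velocitySet d V₀, ENNReal.ofReal (lyapunov γ (χ / 2) (x, v')) =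
      ENNReal.ofReal (absorbed χ V₀ γ φ R (x, v)) := by
  have hβ : χ / 2 ∈ Icc (0 : ℝ) 1 := ⟨by linarith [hχ.1], by linarith [hχ.2]⟩
  have h0 : 0 ≤ kernelB1 χ φ R x v := by
    refine mul_nonneg ?_ ?_
    · linarith [(hφ.scaled_mem_Icc R x).2]
    · linarith [(turningKernel_mem hχ.1.le x v).1, hχ.2]
  rw [lintegral_lyapunov hγ0 hγ hβ, Real.enorm_of_nonneg h0, ← ENNReal.ofReal_mul h0]
  rfl

/-- Off the exceptional set the gain is the one of `ℬ₁`. On it `|x| < 2R`, so the kernel bound `4`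
and the bound of `m` by `e^{γ (1 + 2R)}` suffice. -/
theorem kernelB_gain_le [NeZero d] (hV : volume (velocitySet d V₀) = 1) (hχ : χ ∈ Ioo (0 : ℝ) 1)
    (hφ : IsCutoff φ) (hζ : IsRegularizedSign δ₃ (ζ δ₃)) (hγ0 : 0 ≤ γ)
    (hγ : γ * (1 + 2 * V₀) ≤ 1 / 2) (hR : 0 < R) (hδ₁ : 0 < δ₁) (hδ₂ : 0 < δ₂) (hδ₃ : 0 < δ₃)
    (hδR : δ₂ ≤ R) (hV₀ : 0 < V₀) {x v : E d} (hv : v ∈ velocitySet d V₀) :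
    ‖kernelB χ V₀ φ ζ R δ₁ δ₂ δ₃ x v‖ₑ *
        ∫⁻ v' in velocitySet d V₀, ENNReal.ofReal (lyapunov γ (χ / 2) (x, v')) ≤
      ENNReal.ofReal (absorbed χ V₀ γ φ R (x, v)) + remainder V₀ γ R δ₁ δ₂ δ₃ (x, v) := by
  by_cases h : (x, v) ∈ exceptionalSet d V₀ R δ₁ δ₂ δ₃
  · refine le_add_left ?_
    have hβ : χ / 2 ∈ Icc (0 : ℝ) 1 := ⟨by linarith [hχ.1], by linarith [hχ.2]⟩
    have hx : ‖x‖ < 2 * R := by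
      rcases h with h | h | h <;> exact h.1
    have hm : lyapunovMean V₀ γ (χ / 2) x ≤ Real.exp (γ * (1 + 2 * R)) := by
      have hb := zero_lt_one.trans_le (one_le_bracket x)
      calc lyapunovMean V₀ γ (χ / 2) x ≤ weight γ x *
            (1 - γ * (χ / 2 * (absMoment d V₀ * (‖x‖ / bracket x)))) :=
            lyapunovMean_le hV hγ0 hβ.1 x
        _ ≤ weight γ x := by
            refine mul_le_of_le_one_right (weight_pos γ x).le ?_
            have := (absMoment_pos (d := d) hV₀).le
            have h1 := hβ.1
            have : 0 ≤ γ * (χ / 2 * (absMoment d V₀ * (‖x‖ / bracket x))) := by positivity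
            linarith
        _ ≤ _ := Real.exp_le_exp.2 (mul_le_mul_of_nonneg_left
            ((bracket_le x).trans (by linarith)) hγ0)
    rw [remainder, indicator_of_mem h, lintegral_lyapunov hγ0 hγ hβ,
      ENNReal.ofReal_mul (by norm_num)]
    refine mul_le_mul' (((isBoundedKernel_kernelB hχ hφ hζ).bound x v hv).trans_eq (by simp))
      (ENNReal.ofReal_le_ofReal hm)
  · rw [kernelB_eq_kernelB1 hφ hζ hR hδ₁ hδ₂ hδ₃ hδR h, kernelB1_gain_le hχ hφ hγ0 hγ]
    exact le_self_add

end Kernels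

/-! ### The exceptional set is small -/

section Small

variable {V₀ : ℝ}

/-- Continuity from above of the measure along sets that shrink to a null set, starting from a set
of finite measure. -/
theorem exists_forall_measure_le {s : ℝ → Set (E d × E d)} (hs : ∀ δ, MeasurableSet (s δ))
    (hmono : ∀ i j, i ≤ j → s i ⊆ s j) (hfin : phaseMeasure d V₀ (s 1) ≠ ⊤)
    (hae : ∀ᵐ z ∂(phaseMeasure d V₀), ∃ δ > 0, z ∉ s δ) {ε : ℝ≥0∞} (hε : 0 < ε) :
    ∃ δstar ∈ Ioo (0 : ℝ) 1, ∀ δ ∈ Ioo 0 δstar, phaseMeasure d V₀ (s δ) ≤ ε := by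
  have h := tendsto_measure_biInter_gt (μ := phaseMeasure d V₀) (a := (0 : ℝ))
    (fun r _ => (hs r).nullMeasurableSet) (fun i j _ hij => hmono i j hij) ⟨1, one_pos, hfin⟩
  have h0 : phaseMeasure d V₀ (⋂ r, ⋂ (_ : r > 0), s r) = 0 := by
    refine measure_mono_null (fun z hz => ?_) hae
    rintro ⟨δ, hδ, hzδ⟩
    exact hzδ (mem_iInter₂.1 hz δ hδ)
  rw [h0] at h
  have hev : ∀ᶠ r in 𝓝[>] (0 : ℝ), phaseMeasure d V₀ (s r) ≤ ε :=
    (h.eventually (gt_mem_nhds hε)).mono fun r hr => le_of_lt hr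
  obtain ⟨u, hu, hsub⟩ := mem_nhdsGT_iff_exists_Ioo_subset.1 hev
  refine ⟨min u (1 / 2), ⟨lt_min hu (by norm_num), (min_le_right _ _).trans_lt (by norm_num)⟩,
    fun δ hδ => hsub ⟨hδ.1, hδ.2.trans_le (min_le_left _ _)⟩⟩

theorem ae_fst_ne_zero [NeZero d] (V₀ : ℝ) : ∀ᵐ z ∂(phaseMeasure d V₀), z.1 ≠ 0 := by
  have h : ∀ᵐ x ∂(volume : Measure (E d)), x ≠ 0 := Measure.ae_ne volume 0
  exact Measure.quasiMeasurePreserving_fst.ae h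

theorem ae_snd_ne_zero [NeZero d] (V₀ : ℝ) : ∀ᵐ z ∂(phaseMeasure d V₀), z.2 ≠ 0 := by
  have h : ∀ᵐ x ∂((volume : Measure (E d)).restrict (velocitySet d V₀)), x ≠ 0 :=
    ae_restrict_of_ae (Measure.ae_ne volume 0)
  exact Measure.quasiMeasurePreserving_snd.ae h

/-- For `x ≠ 0`, the velocities orthogonal to `x` form a proper subspace, hence a null set. -/
theorem ae_inner_ne_zero [NeZero d] (V₀ : ℝ) :
    ∀ᵐ z ∂(phaseMeasure d V₀), (inner ℝ z.1 z.2 : ℝ) ≠ 0 := by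
  have hm : MeasurableSet {z : E d × E d | (inner ℝ z.1 z.2 : ℝ) ≠ 0} :=
    (measurableSet_eq_fun (by fun_prop) measurable_const).compl
  refine (Measure.ae_prod_mem_iff_ae_ae_mem hm).2 ?_
  filter_upwards [Measure.ae_ne (volume : Measure (E d)) 0] with x hx
  refine ae_restrict_of_ae ?_
  have : (volume : Measure (E d)) ((Submodule.span ℝ {x})ᗮ : Submodule ℝ (E d)) = 0 := by
    refine Measure.addHaar_submodule _ _ fun htop => hx ?_
    have hxm : x ∈ (Submodule.span ℝ {x})ᗮ := by rw [htop]; trivial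
    have := Submodule.mem_orthogonal_singleton_iff_inner_right.1 hxm
    exact inner_self_eq_zero.1 this
  refine measure_mono_null (fun v hv => ?_) this
  have hv' : ¬ (inner ℝ x v : ℝ) ≠ 0 := hv
  exact Submodule.mem_orthogonal_singleton_iff_inner_right.2 (not_not.1 hv')

theorem phaseMeasure_slab_ne_top (hV : volume (velocitySet d V₀) = 1) (r : ℝ) :
    phaseMeasure d V₀ {z | ‖z.1‖ < r} ≠ ⊤ := by
  have : {z : E d × E d | ‖z.1‖ < r} = Metric.ball 0 r ×ˢ univ := by
    ext z; simp
  rw [this, phaseMeasure, Measure.prod_prod, Measure.restrict_apply_univ, hV, mul_one]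
  exact measure_ball_lt_top.ne

/-- The measure of the exceptional set is small when its parameters are. -/
theorem exists_exceptionalSet_le [NeZero d] (hV : volume (velocitySet d V₀) = 1) (R : ℝ)
    {ε : ℝ≥0∞} (hε : 0 < ε) :
    ∃ δ₁s ∈ Ioo (0 : ℝ) 1, ∃ δ₂s ∈ Ioo (0 : ℝ) 1, ∃ δ₃s ∈ Ioo (0 : ℝ) 1,
      ∀ δ₁ ∈ Ioo 0 δ₁s, ∀ δ₂ ∈ Ioo 0 δ₂s, ∀ δ₃ ∈ Ioo 0 δ₃s,
        phaseMeasure d V₀ (exceptionalSet d V₀ R δ₁ δ₂ δ₃) ≤ ε := by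
  have hε3 : 0 < ε / 3 := ENNReal.div_pos hε.ne' (by simp)
  have hfin := phaseMeasure_slab_ne_top hV (2 * R)
  have h1 : MeasurableSet {z : E d × E d | ‖z.1‖ < 2 * R} :=
    measurableSet_lt (by fun_prop) measurable_const
  have m1 : Measurable fun z : E d × E d => ‖z.1‖ := by fun_prop
  have m2 : Measurable fun z : E d × E d => ‖z.2‖ := by fun_prop
  have m3 : Measurable fun z : E d × E d => V₀ - ‖z.2‖ := by fun_prop
  have m4 : Measurable fun z : E d × E d => |(inner ℝ z.1 z.2 : ℝ)| :=
    continuous_abs.measurable.comp (by fun_prop)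
  obtain ⟨δ₁s, h1s, H1⟩ := exists_forall_measure_le (V₀ := V₀)
    (s := fun δ => {z : E d × E d | ‖z.1‖ < 2 * R ∧ (‖z.2‖ < 2 * δ ∨ V₀ - ‖z.2‖ < 2 * δ)})
    (fun δ => h1.inter ((measurableSet_lt m2 measurable_const).union
      (measurableSet_lt m3 measurable_const)))
    (fun i j hij z hz => ⟨hz.1, hz.2.imp (fun h => h.trans_le (by linarith))
      fun h => h.trans_le (by linarith)⟩)
    (ne_top_of_le_ne_top hfin (measure_mono fun z hz => hz.1)) (by
      filter_upwards [ae_velocity_mem V₀, ae_snd_ne_zero V₀] with z hz hz0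
      have hz1 : ‖z.2‖ < V₀ := mem_ball_zero_iff.1 hz
      have hz2 : 0 < ‖z.2‖ := norm_pos_iff.2 hz0
      refine ⟨min (‖z.2‖ / 2) ((V₀ - ‖z.2‖) / 2), lt_min (by linarith) (by linarith), fun h => ?_⟩
      rcases h.2 with h | h
      · linarith [min_le_left (‖z.2‖ / 2) ((V₀ - ‖z.2‖) / 2)]
      · linarith [min_le_right (‖z.2‖ / 2) ((V₀ - ‖z.2‖) / 2)]) hε3
  obtain ⟨δ₂s, h2s, H2⟩ := exists_forall_measure_le (V₀ := V₀)
    (s := fun δ => {z : E d × E d | ‖z.1‖ < 2 * R ∧ ‖z.1‖ < 2 * δ})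
    (fun δ => h1.inter (measurableSet_lt m1 measurable_const))
    (fun i j hij z hz => ⟨hz.1, hz.2.trans_le (by linarith)⟩)
    (ne_top_of_le_ne_top hfin (measure_mono fun z hz => hz.1)) (by
      filter_upwards [ae_fst_ne_zero V₀] with z hz0
      refine ⟨‖z.1‖ / 2, by have := norm_pos_iff.2 hz0; linarith, fun h => ?_⟩
      linarith [h.2]) hε3
  obtain ⟨δ₃s, h3s, H3⟩ := exists_forall_measure_le (V₀ := V₀)
    (s := fun δ => {z : E d × E d | ‖z.1‖ < 2 * R ∧ |(inner ℝ z.1 z.2 : ℝ)| < δ})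
    (fun δ => h1.inter (measurableSet_lt m4 measurable_const))
    (fun i j hij z hz => ⟨hz.1, hz.2.trans_le hij⟩)
    (ne_top_of_le_ne_top hfin (measure_mono fun z hz => hz.1)) (by
      filter_upwards [ae_inner_ne_zero V₀] with z hz0
      exact ⟨|inner ℝ z.1 z.2|, abs_pos.2 hz0, fun h => lt_irrefl _ h.2⟩) hε3
  refine ⟨δ₁s, h1s, δ₂s, h2s, δ₃s, h3s, fun δ₁ hd1 δ₂ hd2 δ₃ hd3 => ?_⟩
  calc _ ≤ _ := measure_union_le _ _
    _ ≤ ε / 3 + (ε / 3 + ε / 3) := add_le_add (H1 δ₁ hd1)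
        ((measure_union_le _ _).trans (add_le_add (H2 δ₂ hd2) (H3 δ₃ hd3)))
    _ = ε := by rw [← add_assoc, ENNReal.add_thirds]

end Small

/-! ### Plancherel's identity on `L¹ ∩ L²` -/

section Plancherel

open FourierTransform

theorem lintegral_enorm_sq_eq {α F : Type*} [MeasurableSpace α] [NormedAddCommGroup F]
    {μ : Measure α} (f : α → F) : ∫⁻ x, ‖f x‖ₑ ^ 2 ∂μ = eLpNorm f 2 μ ^ 2 := by
  have h := eLpNorm_nnreal_pow_eq_lintegral (μ := μ) (f := f) (p := 2) (by norm_num)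
  have e : ((2 : ℝ≥0) : ℝ) = ((2 : ℕ) : ℝ) := by norm_num
  simp only [e, ENNReal.rpow_natCast] at h
  rw [← h]
  rfl

theorem integral_smul_fourier_eq (s : SchwartzMap (E d) ℂ) {f : E d → ℂ} (hf : Integrable f) :
    ∫ x, (𝓕 s : SchwartzMap (E d) ℂ) x • f x = ∫ x, s x • 𝓕 f x := by
  have h := VectorFourier.integral_bilin_fourierIntegral_eq_flip (μ := (volume : Measure (E d)))
    (ν := (volume : Measure (E d))) (L := innerₗ (E d)) (f := (s : E d → ℂ)) (g := f)
    (ContinuousLinearMap.lsmul ℂ ℂ) Real.continuous_fourierChar continuous_inner s.integrable hf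
  rw [flip_innerₗ] at h
  exact h

/-- The `L²` Fourier transform and the Fourier integral define the same tempered distribution, since
both are transposes of the Fourier transform of Schwartz functions. Testing against smooth compactly
supported functions identifies them almost everywhere. -/
theorem fourier_toLp_ae_eq {f : E d → ℂ} (hf1 : Integrable f) (hf2 : MemLp f 2) :
    ((𝓕 (hf2.toLp f) : Lp (α := E d) ℂ 2) : E d → ℂ) =ᵐ[volume] 𝓕 f := by
  have hc : Continuous (𝓕 f) := VectorFourier.fourierIntegral_continuous
    Real.continuous_fourierChar continuous_inner hf1
  refine ae_eq_of_integral_contDiff_smul_eq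
    ((Lp.memLp _).locallyIntegrable (by norm_num)) hc.locallyIntegrable fun g hg hgc => ?_
  have hgC : HasCompactSupport (Complex.ofReal ∘ g) := hgc.comp_left rfl
  set s : SchwartzMap (E d) ℂ := hgC.toSchwartzMap (Complex.ofRealCLM.contDiff.comp hg) with hs
  have hsg : ∀ x, s x = (g x : ℂ) := fun x => rfl
  have h1 := congrArg (fun T : TemperedDistribution (E d) ℂ => T s)
    (MeasureTheory.Lp.fourier_toTemperedDistribution_eq (hf2.toLp f))
  simp only [TemperedDistribution.fourier_apply, Lp.toTemperedDistribution_apply] at h1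
  have h2 : ∫ x, (𝓕 s : SchwartzMap (E d) ℂ) x • (hf2.toLp f : E d → ℂ) x =
      ∫ x, (𝓕 s : SchwartzMap (E d) ℂ) x • f x :=
    integral_congr_ae (by filter_upwards [hf2.coeFn_toLp] with x hx; rw [hx])
  rw [h2, integral_smul_fourier_eq s hf1] at h1
  simp only [hsg, smul_eq_mul] at h1
  simp only [Complex.real_smul]
  exact h1.symm

/-- Plancherel's identity. -/
theorem lintegral_fourier_sq {f : E d → ℂ} (hf1 : Integrable f) (hf2 : MemLp f 2) :
    ∫⁻ ξ, ‖𝓕 f ξ‖ₑ ^ 2 = ∫⁻ x, ‖f x‖ₑ ^ 2 := by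
  rw [lintegral_enorm_sq_eq, lintegral_enorm_sq_eq, ← eLpNorm_congr_ae (fourier_toLp_ae_eq hf1 hf2),
    ← eLpNorm_congr_ae hf2.coeFn_toLp, ← Lp.enorm_def, ← Lp.enorm_def, ← ofReal_norm,
    ← ofReal_norm, Lp.norm_fourier_eq]

end Plancherel

/-! ### The oscillatory integral over the velocities -/

section Oscillatory

/-- The ball is contained in the set where all coordinates but the first lie in `[-V₀, V₀]`, over
which the integral factorizes into `d - 1` lengths and a one-dimensional integral. -/
theorem integral_coord_prod_le [NeZero d] {V₀ : ℝ} (hV₀ : 0 < V₀) {g : ℝ → ℝ} (hg0 : ∀ p, 0 ≤ g p)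
    (hgc : Continuous g) (hgi : Integrable g) :
    ∫ w in velocitySet d V₀, g (w 0) ≤ (2 * V₀) ^ (d - 1) * ∫ p, g p := by
  set f : Fin d → ℝ → ℝ := fun i => if i = 0 then g else (Icc (-V₀) V₀).indicator fun _ => 1 with hf
  have hfi : ∀ i, Integrable (f i) := fun i => by
    by_cases hi : i = 0
    · simp only [hf, hi, if_true]; exact hgi
    · simp only [hf, hi, if_false]
      exact (integrable_indicator_iff measurableSet_Icc).2 (by simp)
  have hf0 : ∀ i p, 0 ≤ f i p := fun i p => by
    by_cases hi : i = 0
    · simp only [hf, hi, if_true]; exact hg0 p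
    · simp only [hf, hi, if_false]; exact indicator_nonneg (fun _ _ => zero_le_one) p
  have hprod := integral_fintype_prod_volume_eq_prod (𝕜 := ℝ) (ι := Fin d) (E := fun _ => ℝ) f
  have hmp := PiLp.volume_preserving_ofLp (Fin d)
  have hemb : MeasurableEmbedding (WithLp.ofLp : E d → (Fin d → ℝ)) :=
    (MeasurableEquiv.toLp 2 (Fin d → ℝ)).symm.measurableEmbedding
  have hE : ∫ w : E d, ∏ i, f i (w i) = ∏ i, ∫ p, f i p := by
    rw [← hprod]
    exact hmp.integral_comp hemb fun x : Fin d → ℝ => ∏ i, f i (x i)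
  have hint : Integrable fun w : E d => ∏ i, f i (w i) :=
    (hmp.integrable_comp_emb hemb).2 (Integrable.fintype_prod hfi)
  have hval : ∏ i, ∫ p, f i p = (2 * V₀) ^ (d - 1) * ∫ p, g p := by
    rw [← Finset.mul_prod_erase Finset.univ _ (Finset.mem_univ (0 : Fin d)), mul_comm]
    congr 1
    · rw [Finset.prod_congr rfl (g := fun _ => 2 * V₀), Finset.prod_const, Finset.card_erase_of_mem
        (Finset.mem_univ _), Finset.card_univ, Fintype.card_fin]
      intro i hi
      have hi0 : i ≠ 0 := Finset.ne_of_mem_erase hi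
      simp only [hf, hi0, if_false]
      rw [integral_indicator measurableSet_Icc]
      simp [Real.volume_real_Icc_of_le (show -V₀ ≤ V₀ by linarith), two_mul]
  rw [← hval, ← hE]
  have hle : ∀ w ∈ velocitySet d V₀, g (w 0) ≤ ∏ i, f i (w i) := fun w hw => by
    rw [← Finset.mul_prod_erase Finset.univ _ (Finset.mem_univ (0 : Fin d))]
    rw [Finset.prod_eq_one]
    · simp [hf]
    · intro i hi
      have hi0 : i ≠ 0 := Finset.ne_of_mem_erase hi
      simp only [hf, hi0, if_false]
      rw [indicator_of_mem]
      have h1 : ‖w i‖ ≤ ‖w‖ := PiLp.norm_apply_le w i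
      have h2 : ‖w‖ < V₀ := mem_ball_zero_iff.1 hw
      exact abs_le.1 (h1.trans h2.le)
  calc ∫ w in velocitySet d V₀, g (w 0) ≤ ∫ w in velocitySet d V₀, ∏ i, f i (w i) :=
        setIntegral_mono_on (continuousOn_integrable (hgc.comp continuous_coord))
          hint.integrableOn (measurableSet_velocitySet V₀) hle
    _ ≤ ∫ w : E d, ∏ i, f i (w i) := setIntegral_le_integral hint
        (Eventually.of_forall fun w => Finset.prod_nonneg fun i _ => hf0 i _)

/-- A rotation aligns `ξ` with the first axis; the one-dimensional change of variable then provides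
the factor `1 / |ξ|`. -/
theorem setIntegral_inner_le [NeZero d] {V₀ : ℝ} (hV₀ : 0 < V₀) {g : ℝ → ℝ} (hg0 : ∀ p, 0 ≤ g p)
    (hgc : Continuous g) (hgi : Integrable g) {ξ : E d} (hξ : ξ ≠ 0) (c : ℝ) :
    ∫ w in velocitySet d V₀, g (c - inner ℝ ξ w) ≤ (2 * V₀) ^ (d - 1) / ‖ξ‖ * ∫ p, g p := by
  have hn : ‖ξ‖ ≠ 0 := norm_ne_zero_iff.2 hξ
  obtain ⟨L, hL⟩ := exists_isometry_inner ξ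
  simp only [hL]
  rw [integral_velocity_isometry V₀ L fun w => g (c - ‖ξ‖ * w 0)]
  have hi : Integrable fun p => g (c - ‖ξ‖ * p) :=
    (hgi.comp_sub_left c).comp_mul_left' hn
  refine (integral_coord_prod_le hV₀ (g := fun p => g (c - ‖ξ‖ * p)) (fun p => hg0 _)
    (hgc.comp (by fun_prop)) hi).trans_eq ?_
  have e : ∫ p, g (c - ‖ξ‖ * p) = ‖ξ‖⁻¹ * ∫ p, g p := by
    rw [Measure.integral_comp_mul_left (fun p => g (c - p)), integral_sub_left_eq_self g volume c,
      abs_of_nonneg (by positivity), smul_eq_mul]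
  rw [e]; ring

/-- The character `e^{- 2 π i t s}`. -/
def osc (t s : ℝ) : ℂ := Complex.exp (((-2 * Real.pi * (t * s) : ℝ) : ℂ) * Complex.I)

theorem norm_osc (t s : ℝ) : ‖osc t s‖ = 1 := Complex.norm_exp_ofReal_mul_I _

theorem continuous_osc : Continuous fun p : ℝ × ℝ => osc p.1 p.2 := by
  unfold osc; fun_prop

theorem osc_mul_conj (t r s : ℝ) : osc t r * (starRingEnd ℂ) (osc t s) = osc t (r - s) := by
  unfold osc
  rw [← Complex.exp_conj, ← Complex.exp_add]
  congr 1
  simp only [map_mul, Complex.conj_ofReal, Complex.conj_I]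
  push_cast
  ring

/-- The Fourier transform of the Gaussian `e^{- b t²}`. -/
def gaussKernel (b p : ℝ) : ℝ := Real.sqrt (Real.pi / b) * Real.exp (-(Real.pi ^ 2 / b) * p ^ 2)

theorem integral_gauss_osc {b : ℝ} (hb : 0 < b) (p : ℝ) :
    ∫ t : ℝ, (Real.exp (-b * t ^ 2) : ℂ) * osc t p = gaussKernel b p := by
  have h := fourierIntegral_gaussian (b := (b : ℂ)) (by simpa using hb) ((-2 * Real.pi * p : ℝ) : ℂ)
  have e : ∀ t : ℝ, (Real.exp (-b * t ^ 2) : ℂ) * osc t p =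
      Complex.exp (Complex.I * ((-2 * Real.pi * p : ℝ) : ℂ) * t) * Complex.exp (-(b : ℂ) * t ^ 2) :=
    fun t => by
      rw [osc, mul_comm]
      push_cast
      congr 2
      ring
  simp only [e]
  rw [h, gaussKernel]
  push_cast
  congr 1
  · rw [Real.sqrt_eq_rpow, Complex.ofReal_cpow (by positivity)]
    push_cast; rfl
  · congr 1
    have : (b : ℂ) ≠ 0 := by exact_mod_cast hb.ne'
    field_simp
    ring

theorem gaussKernel_nonneg (b p : ℝ) : 0 ≤ gaussKernel b p := by
  unfold gaussKernel; positivity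

theorem continuous_gaussKernel (b : ℝ) : Continuous (gaussKernel b) := by
  unfold gaussKernel; fun_prop

theorem gaussKernel_neg (b p : ℝ) : gaussKernel b (-p) = gaussKernel b p := by
  simp [gaussKernel]

theorem integrable_gaussKernel {b : ℝ} (hb : 0 < b) : Integrable (gaussKernel b) :=
  (integrable_exp_neg_mul_sq (by positivity)).const_mul _

theorem integral_gaussKernel {b : ℝ} (hb : 0 < b) : ∫ p, gaussKernel b p = 1 := by
  unfold gaussKernel
  rw [integral_const_mul, integral_gaussian, ← Real.sqrt_mul (by positivity)]
  rw [Real.sqrt_eq_one]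
  have := Real.pi_pos
  field_simp

variable {V₀ : ℝ} {g : E d → ℂ}

/-- The oscillatory integral `∫_𝒱 e^{- 2 π i t v·ξ} g(v) dv`. -/
def oscIntegral (V₀ : ℝ) (g : E d → ℂ) (ξ : E d) (t : ℝ) : ℂ :=
  ∫ v in velocitySet d V₀, osc t (inner ℝ ξ v) * g v

/-- The squared modulus is a double integral over pairs of velocities. The Gaussian in time makes
Fubini legitimate and integrates to an approximate identity at `ξ · (v - w)`. -/
theorem integral_gauss_oscIntegral {b : ℝ} (hb : 0 < b)
    (hg : Integrable g (volume.restrict (velocitySet d V₀))) (ξ : E d) :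
    ∫ t : ℝ, (Real.exp (-b * t ^ 2) : ℂ) *
        (oscIntegral V₀ g ξ t * (starRingEnd ℂ) (oscIntegral V₀ g ξ t)) =
      ∫ q, g q.1 * (starRingEnd ℂ) (g q.2) * gaussKernel b (inner ℝ ξ q.1 - inner ℝ ξ q.2)
        ∂((volume.restrict (velocitySet d V₀)).prod (volume.restrict (velocitySet d V₀))) := by
  set ν := (volume : Measure (E d)).restrict (velocitySet d V₀) with hν
  have hgc : Integrable (fun v => (starRingEnd ℂ) (g v)) ν :=
    hg.congr' (hg.1.star) (Eventually.of_forall fun v => by simp)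
  have hgg : Integrable (fun q : E d × E d => g q.1 * (starRingEnd ℂ) (g q.2)) (ν.prod ν) :=
    hg.mul_prod hgc
  have hga : Integrable (fun t : ℝ => (Real.exp (-b * t ^ 2) : ℂ)) :=
    (integrable_exp_neg_mul_sq hb).ofReal
  have h1 : ∀ t, oscIntegral V₀ g ξ t * (starRingEnd ℂ) (oscIntegral V₀ g ξ t) =
      ∫ q, osc t (inner ℝ ξ q.1 - inner ℝ ξ q.2) * (g q.1 * (starRingEnd ℂ) (g q.2)) ∂(ν.prod ν) := by
    intro t
    unfold oscIntegral
    rw [← integral_conj, ← integral_prod_mul]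
    refine integral_congr_ae (Eventually.of_forall fun q => ?_)
    simp only [map_mul]
    rw [← osc_mul_conj]
    ring
  have hmeas : Continuous fun p : ℝ × (E d × E d) => osc p.1 (inner ℝ ξ p.2.1 - inner ℝ ξ p.2.2) := by
    have : Continuous fun p : ℝ × (E d × E d) =>
        (p.1, (inner ℝ ξ p.2.1 - inner ℝ ξ p.2.2 : ℝ)) := by fun_prop
    exact continuous_osc.comp this
  have hbig : Integrable (Function.uncurry fun (t : ℝ) (q : E d × E d) =>
      (Real.exp (-b * t ^ 2) : ℂ) * (osc t (inner ℝ ξ q.1 - inner ℝ ξ q.2) *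
        (g q.1 * (starRingEnd ℂ) (g q.2)))) (volume.prod (ν.prod ν)) := by
    refine ((hga.mul_prod hgg).bdd_mul (c := 1) hmeas.aestronglyMeasurable
      (Eventually.of_forall fun p => (norm_osc _ _).le)).congr (Eventually.of_forall fun p => ?_)
    simp only [Function.uncurry]
    ring
  simp only [h1]
  simp only [← integral_const_mul]
  rw [integral_integral_swap hbig]
  refine integral_congr_ae (Eventually.of_forall fun q => ?_)
  simp only
  rw [← integral_gauss_osc hb, ← integral_const_mul]
  refine integral_congr_ae (Eventually.of_forall fun t => ?_)
  simp only
  ring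

theorem mul_le_sq_add_sq (a b : ℝ≥0∞) : a * b ≤ a ^ 2 + b ^ 2 := by
  rcases le_total a b with h | h
  · exact (mul_le_mul_left h b).trans (by rw [← sq]; exact le_add_self)
  · exact (mul_le_mul_right h a).trans (by rw [← sq]; exact le_self_add)

theorem lintegral_gaussKernel_le [NeZero d] (hV₀ : 0 < V₀) {b : ℝ} (hb : 0 < b) {ξ : E d}
    (hξ : ξ ≠ 0) (c : ℝ) :
    ∫⁻ w in velocitySet d V₀, ENNReal.ofReal (gaussKernel b (c - inner ℝ ξ w)) ≤
      ENNReal.ofReal ((2 * V₀) ^ (d - 1) / ‖ξ‖) := by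
  have hc : Continuous fun w : E d => gaussKernel b (c - inner ℝ ξ w) :=
    (continuous_gaussKernel b).comp (by fun_prop)
  rw [← ofReal_integral_eq_lintegral_ofReal (continuousOn_integrable hc)
    (Eventually.of_forall fun w => gaussKernel_nonneg _ _)]
  refine ENNReal.ofReal_le_ofReal ((setIntegral_inner_le hV₀ (gaussKernel_nonneg b)
    (continuous_gaussKernel b) (integrable_gaussKernel hb) hξ c).trans_eq ?_)
  rw [integral_gaussKernel hb, mul_one]

theorem continuous_oscIntegral (hg : Integrable g (volume.restrict (velocitySet d V₀))) (ξ : E d) :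
    Continuous (oscIntegral V₀ g ξ) := by
  refine continuous_of_dominated (bound := fun v => ‖g v‖) (fun t => ?_) (fun t => ?_) hg.norm ?_
  · have : Continuous fun v : E d => osc t (inner ℝ ξ v) :=
      continuous_osc.comp (continuous_const.prodMk (by fun_prop))
    exact this.aestronglyMeasurable.mul hg.1
  · exact Eventually.of_forall fun v => by rw [norm_mul, norm_osc, one_mul]
  · refine Eventually.of_forall fun v => ?_
    have : Continuous fun t : ℝ => osc t (inner ℝ ξ v) :=
      continuous_osc.comp (continuous_id.prodMk continuous_const)
    exact this.mul continuous_const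

theorem measurable_mul_gaussKernel (hgm : Measurable g) (b : ℝ) (ξ : E d) :
    Measurable fun q : E d × E d => ‖g q.1‖ₑ ^ 2 *
      ENNReal.ofReal (gaussKernel b (inner ℝ ξ q.1 - inner ℝ ξ q.2)) :=
  ((hgm.comp measurable_fst).enorm.pow_const 2).mul
    ((continuous_gaussKernel b).comp (by fun_prop)).measurable.ennreal_ofReal

theorem lintegral_mul_gaussKernel_le [NeZero d] (hV₀ : 0 < V₀) {b : ℝ} (hb : 0 < b)
    (hgm : Measurable g) {ξ : E d} (hξ : ξ ≠ 0) :
    ∫⁻ q, ‖g q.1‖ₑ ^ 2 * ENNReal.ofReal (gaussKernel b (inner ℝ ξ q.1 - inner ℝ ξ q.2))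
      ∂((volume.restrict (velocitySet d V₀)).prod (volume.restrict (velocitySet d V₀))) ≤
      ENNReal.ofReal ((2 * V₀) ^ (d - 1) / ‖ξ‖) * ∫⁻ v in velocitySet d V₀, ‖g v‖ₑ ^ 2 := by
  rw [lintegral_prod _ (measurable_mul_gaussKernel hgm b ξ).aemeasurable,
    ← lintegral_const_mul _ (hgm.enorm.pow_const 2)]
  refine lintegral_mono fun v => ?_
  have hκv : Measurable fun w : E d =>
      ENNReal.ofReal (gaussKernel b (inner ℝ ξ v - inner ℝ ξ w)) :=
    ((continuous_gaussKernel b).comp (by fun_prop)).measurable.ennreal_ofReal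
  simp only
  rw [lintegral_const_mul _ hκv, mul_comm]
  exact mul_le_mul_left (lintegral_gaussKernel_le hV₀ hb hξ _) _

theorem lintegral_mul_gaussKernel_le' [NeZero d] (hV₀ : 0 < V₀) {b : ℝ} (hb : 0 < b)
    (hgm : Measurable g) {ξ : E d} (hξ : ξ ≠ 0) :
    ∫⁻ q, ‖g q.2‖ₑ ^ 2 * ENNReal.ofReal (gaussKernel b (inner ℝ ξ q.1 - inner ℝ ξ q.2))
      ∂((volume.restrict (velocitySet d V₀)).prod (volume.restrict (velocitySet d V₀))) ≤
      ENNReal.ofReal ((2 * V₀) ^ (d - 1) / ‖ξ‖) * ∫⁻ v in velocitySet d V₀, ‖g v‖ₑ ^ 2 := by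
  refine le_trans (le_of_eq ?_) (lintegral_mul_gaussKernel_le hV₀ hb hgm hξ)
  rw [← lintegral_prod_swap]
  refine lintegral_congr fun q => ?_
  rw [Prod.fst_swap, Prod.snd_swap, ← gaussKernel_neg, neg_sub]

/-- Schur's test for the kernel of `integral_gauss_oscIntegral`. The Gaussian kernel has integral
one for every `b`, so the bound is uniform in `b`. -/
theorem lintegral_gauss_oscIntegral_le [NeZero d] (hV₀ : 0 < V₀) {b : ℝ} (hb : 0 < b)
    (hgm : Measurable g) (hg : Integrable g (volume.restrict (velocitySet d V₀))) {ξ : E d}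
    (hξ : ξ ≠ 0) :
    ∫⁻ t : ℝ, ENNReal.ofReal (Real.exp (-b * t ^ 2)) * ‖oscIntegral V₀ g ξ t‖ₑ ^ 2 ≤
      2 * ENNReal.ofReal ((2 * V₀) ^ (d - 1) / ‖ξ‖) * ∫⁻ v in velocitySet d V₀, ‖g v‖ₑ ^ 2 := by
  set ν := (volume : Measure (E d)).restrict (velocitySet d V₀) with hν
  have hF := continuous_oscIntegral hg ξ
  have hFb : ∀ t, ‖oscIntegral V₀ g ξ t‖ ≤ ∫ v, ‖g v‖ ∂ν := fun t => by
    refine (norm_integral_le_integral_norm _).trans_eq ?_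
    simp only [norm_mul, norm_osc, one_mul, hν]
  have hga := integrable_exp_neg_mul_sq hb
  have hFc : Continuous fun t : ℝ => ‖oscIntegral V₀ g ξ t‖ ^ 2 := hF.norm.pow 2
  have hint : Integrable fun t : ℝ => Real.exp (-b * t ^ 2) * ‖oscIntegral V₀ g ξ t‖ ^ 2 := by
    refine (hga.bdd_mul (c := (∫ v, ‖g v‖ ∂ν) ^ 2) hFc.aestronglyMeasurable
      (Eventually.of_forall fun t => ?_)).congr (Eventually.of_forall fun t => mul_comm _ _)
    rw [norm_pow, norm_norm]
    exact pow_le_pow_left₀ (norm_nonneg _) (hFb t) 2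
  have e1 : ∫⁻ t : ℝ, ENNReal.ofReal (Real.exp (-b * t ^ 2)) * ‖oscIntegral V₀ g ξ t‖ₑ ^ 2 =
      ENNReal.ofReal (∫ t : ℝ, Real.exp (-b * t ^ 2) * ‖oscIntegral V₀ g ξ t‖ ^ 2) := by
    rw [ofReal_integral_eq_lintegral_ofReal hint (Eventually.of_forall fun t => by positivity)]
    refine lintegral_congr fun t => ?_
    rw [ENNReal.ofReal_mul (Real.exp_pos _).le, ENNReal.ofReal_pow (norm_nonneg _), ofReal_norm]
  have e2 : ((∫ t : ℝ, Real.exp (-b * t ^ 2) * ‖oscIntegral V₀ g ξ t‖ ^ 2 : ℝ) : ℂ) =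
      ∫ q, g q.1 * (starRingEnd ℂ) (g q.2) * gaussKernel b (inner ℝ ξ q.1 - inner ℝ ξ q.2)
        ∂(ν.prod ν) := by
    rw [← integral_gauss_oscIntegral hb hg]
    refine (integral_ofReal (𝕜 := ℂ)).symm.trans ?_
    refine integral_congr_ae (Eventually.of_forall fun t => ?_)
    simp only
    rw [Complex.mul_conj, Complex.normSq_eq_norm_sq]
    exact Complex.ofReal_mul _ _
  have e3 : ENNReal.ofReal (∫ t : ℝ, Real.exp (-b * t ^ 2) * ‖oscIntegral V₀ g ξ t‖ ^ 2) =
      ‖∫ q, g q.1 * (starRingEnd ℂ) (g q.2) * gaussKernel b (inner ℝ ξ q.1 - inner ℝ ξ q.2)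
        ∂(ν.prod ν)‖ₑ := by
    rw [← e2, ← ofReal_norm, Complex.norm_real, Real.norm_of_nonneg
      (integral_nonneg fun t => by positivity)]
  rw [e1, e3]
  have hm1 := measurable_mul_gaussKernel hgm b ξ
  have hone := lintegral_mul_gaussKernel_le hV₀ hb hgm hξ
  have htwo := lintegral_mul_gaussKernel_le' hV₀ hb hgm hξ
  calc _ ≤ ∫⁻ q, ‖g q.1 * (starRingEnd ℂ) (g q.2) *
        gaussKernel b (inner ℝ ξ q.1 - inner ℝ ξ q.2)‖ₑ ∂(ν.prod ν) :=
        enorm_integral_le_lintegral_enorm _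
    _ ≤ ∫⁻ q, (‖g q.1‖ₑ ^ 2 * ENNReal.ofReal (gaussKernel b (inner ℝ ξ q.1 - inner ℝ ξ q.2)) +
        ‖g q.2‖ₑ ^ 2 * ENNReal.ofReal (gaussKernel b (inner ℝ ξ q.1 - inner ℝ ξ q.2)))
        ∂(ν.prod ν) := by
        refine lintegral_mono fun q => ?_
        have hk : ‖(gaussKernel b (inner ℝ ξ q.1 - inner ℝ ξ q.2) : ℂ)‖ₑ =
            ENNReal.ofReal (gaussKernel b (inner ℝ ξ q.1 - inner ℝ ξ q.2)) := by
          rw [← ofReal_norm, Complex.norm_real, Real.norm_of_nonneg (gaussKernel_nonneg _ _)]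
        have hcj : ‖(starRingEnd ℂ) (g q.2)‖ₑ = ‖g q.2‖ₑ := by
          rw [← ofReal_norm, RCLike.norm_conj, ofReal_norm]
        rw [enorm_mul, enorm_mul, hk, hcj, ← add_mul]
        exact mul_le_mul_left (mul_le_sq_add_sq _ _) _
    _ ≤ _ := by
        rw [lintegral_add_left hm1]
        refine (add_le_add hone htwo).trans_eq ?_
        ring

/-- The square of the oscillatory integral over the velocities is integrable in time, with the
gain of a factor `1 / |ξ|`. -/
theorem lintegral_oscIntegral_le [NeZero d] (hV₀ : 0 < V₀) (hgm : Measurable g)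
    (hg : Integrable g (volume.restrict (velocitySet d V₀))) {ξ : E d} (hξ : ξ ≠ 0) :
    ∫⁻ t : ℝ, ‖oscIntegral V₀ g ξ t‖ₑ ^ 2 ≤
      2 * ENNReal.ofReal ((2 * V₀) ^ (d - 1) / ‖ξ‖) * ∫⁻ v in velocitySet d V₀, ‖g v‖ₑ ^ 2 := by
  have hF := continuous_oscIntegral hg ξ
  -- The Gaussian is removed by letting its parameter tend to zero, with Fatou's lemma.
  set b : ℕ → ℝ := fun n => 1 / ((n : ℝ) + 1) with hb
  have hb0 : ∀ n, 0 < b n := fun n => by positivity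
  have hlim : ∀ t : ℝ, Tendsto (fun n => ENNReal.ofReal (Real.exp (-b n * t ^ 2)) *
      ‖oscIntegral V₀ g ξ t‖ₑ ^ 2) atTop (𝓝 (‖oscIntegral V₀ g ξ t‖ₑ ^ 2)) := fun t => by
    have h1 : Tendsto (fun n => Real.exp (-b n * t ^ 2)) atTop (𝓝 1) := by
      have h0 : Tendsto (fun n => -b n * t ^ 2) atTop (𝓝 (-0 * t ^ 2)) :=
        (tendsto_one_div_add_atTop_nhds_zero_nat.neg).mul_const _
      simpa [Function.comp_def] using (Real.continuous_exp.tendsto _).comp h0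
    have h2 := (ENNReal.continuous_ofReal.tendsto _).comp h1
    have h3 := ENNReal.Tendsto.mul_const (b := ‖oscIntegral V₀ g ξ t‖ₑ ^ 2) h2
      (Or.inr (ENNReal.pow_ne_top enorm_ne_top))
    simpa [Function.comp_def] using h3
  calc ∫⁻ t : ℝ, ‖oscIntegral V₀ g ξ t‖ₑ ^ 2
      = ∫⁻ t : ℝ, liminf (fun n => ENNReal.ofReal (Real.exp (-b n * t ^ 2)) *
        ‖oscIntegral V₀ g ξ t‖ₑ ^ 2) atTop := lintegral_congr fun t => (hlim t).liminf_eq.symm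
    _ ≤ liminf (fun n => ∫⁻ t : ℝ, ENNReal.ofReal (Real.exp (-b n * t ^ 2)) *
        ‖oscIntegral V₀ g ξ t‖ₑ ^ 2) atTop := by
        refine lintegral_liminf_le fun n => ?_
        have h1 : Measurable fun t : ℝ => Real.exp (-b n * t ^ 2) := by fun_prop
        exact h1.ennreal_ofReal.mul (hF.measurable.enorm.pow_const 2)
    _ ≤ liminf (fun _ : ℕ => 2 * ENNReal.ofReal ((2 * V₀) ^ (d - 1) / ‖ξ‖) *
        ∫⁻ v in velocitySet d V₀, ‖g v‖ₑ ^ 2) atTop :=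
        liminf_le_liminf (Eventually.of_forall fun n =>
          lintegral_gauss_oscIntegral_le hV₀ (hb0 n) hgm hg hξ)
    _ = _ := liminf_const _

end Oscillatory

/-! ### The symbol of the Slobodeckij seminorm -/

section Symbol

/-- The weight `|y|^{- (d + 1)}`. -/
def slobodeckij (y : E d) : ℝ≥0∞ := (ENNReal.ofReal (‖y‖ ^ (d + 1)))⁻¹

theorem measurable_slobodeckij : Measurable (slobodeckij (d := d)) := by
  unfold slobodeckij
  exact (Measurable.ennreal_ofReal (by fun_prop)).inv

/-- The constant bounding the symbol of the Slobodeckij seminorm. -/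
def symbolConst (d : ℕ) : ℝ≥0∞ :=
  ∫⁻ y : E d, ENNReal.ofReal (min 4 ((2 * Real.pi * ‖y‖) ^ 2)) * slobodeckij y

theorem norm_osc_sub_one_sq_le (t s : ℝ) : ‖osc t s - 1‖ ^ 2 ≤ min 4 ((2 * Real.pi * |t * s|) ^ 2) := by
  refine le_min ?_ (pow_le_pow_left₀ (norm_nonneg _) ?_ 2)
  · have : ‖osc t s - 1‖ ≤ 2 := (norm_sub_le _ _).trans (by rw [norm_osc]; norm_num)
    nlinarith [norm_nonneg (osc t s - 1)]
  · unfold osc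
    rw [mul_comm]
    refine (Real.norm_exp_I_mul_ofReal_sub_one_le).trans_eq ?_
    rw [Real.norm_eq_abs, abs_mul, abs_mul, abs_neg, abs_of_pos Real.pi_pos, abs_two]

theorem lintegral_comp_smul_eq {h : E d → ℝ≥0∞} (hh : Measurable h) {r : ℝ} (hr : 0 < r) :
    ∫⁻ y, h (r • y) = ENNReal.ofReal ((r ^ d)⁻¹) * ∫⁻ y, h y := by
  have h1 : ∫⁻ y : E d, h (r • y) = ∫⁻ y, h y ∂(Measure.map (fun y : E d => r • y) volume) :=
    (lintegral_map hh (by fun_prop)).symm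
  rw [h1, Measure.map_addHaar_smul _ hr.ne', lintegral_smul_measure, finrank_euclideanSpace_fin,
    abs_of_pos (by positivity), smul_eq_mul]

theorem slobodeckij_smul {r : ℝ} (hr : 0 < r) (y : E d) :
    slobodeckij y = ENNReal.ofReal (r ^ (d + 1)) * slobodeckij (r • y) := by
  unfold slobodeckij
  have h0 : ENNReal.ofReal (r ^ (d + 1)) ≠ 0 := by simpa using pow_pos hr (d + 1)
  rw [norm_smul, Real.norm_of_nonneg hr.le, mul_pow, ENNReal.ofReal_mul (by positivity),
    ENNReal.mul_inv (Or.inl h0) (Or.inl ENNReal.ofReal_ne_top), ← mul_assoc,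
    ENNReal.mul_inv_cancel h0 ENNReal.ofReal_ne_top, one_mul]

/-- Rescaling `y` by `|ξ|`: the weight is homogeneous of degree `-(d + 1)` and Lebesgue measure of
degree `d`, which leaves one power of `|ξ|`. -/
theorem lintegral_symbol_le (ξ : E d) :
    ∫⁻ y : E d, slobodeckij y * ‖osc 1 (inner ℝ ξ y) - 1‖ₑ ^ 2 ≤ symbolConst d * ‖ξ‖ₑ := by
  by_cases hξ : ξ = 0
  · simp [hξ, osc]
  have hr : 0 < ‖ξ‖ := norm_pos_iff.2 hξ
  set h : E d → ℝ≥0∞ := fun y => ENNReal.ofReal (min 4 ((2 * Real.pi * ‖y‖) ^ 2)) * slobodeckij y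
    with hh
  have hm : Measurable h := (Measurable.ennreal_ofReal (by fun_prop)).mul measurable_slobodeckij
  calc ∫⁻ y : E d, slobodeckij y * ‖osc 1 (inner ℝ ξ y) - 1‖ₑ ^ 2
      ≤ ∫⁻ y : E d, ENNReal.ofReal (‖ξ‖ ^ (d + 1)) * h (‖ξ‖ • y) := by
        refine lintegral_mono fun y => ?_
        rw [slobodeckij_smul hr y, mul_assoc, hh]
        refine mul_le_mul_right ?_ _
        rw [mul_comm]
        refine mul_le_mul_left ?_ _
        rw [← ofReal_norm, ← ENNReal.ofReal_pow (norm_nonneg _)]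
        refine ENNReal.ofReal_le_ofReal ((norm_osc_sub_one_sq_le _ _).trans
          (min_le_min_left _ (pow_le_pow_left₀ (by positivity) ?_ 2)))
        refine mul_le_mul_of_nonneg_left ?_ (by positivity)
        rw [one_mul, norm_smul, norm_norm]
        exact abs_real_inner_le_norm _ _
    _ = ENNReal.ofReal (‖ξ‖ ^ (d + 1)) * (ENNReal.ofReal ((‖ξ‖ ^ d)⁻¹) * symbolConst d) := by
        have hms : Measurable fun y : E d => h (‖ξ‖ • y) := hm.comp (by fun_prop)
        rw [lintegral_const_mul _ hms, lintegral_comp_smul_eq hm hr]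
        rfl
    _ = symbolConst d * ‖ξ‖ₑ := by
        rw [← mul_assoc, ← ENNReal.ofReal_mul (by positivity), mul_comm, ← ofReal_norm]
        congr 2
        rw [pow_succ]
        field_simp

/-- Near the origin the integrand is of order `|y|^{1 - d}`, and at infinity of order `|y|^{-(d +
1)}`; both are integrable. -/
theorem symbolConst_ne_top [NeZero d] : symbolConst d ≠ ⊤ := by
  have hd : 1 ≤ Module.finrank ℝ (E d) := by
    rw [finrank_euclideanSpace_fin]; exact NeZero.one_le
  set f : E d → ℝ := fun y => min 4 ((2 * Real.pi * ‖y‖) ^ 2) / ‖y‖ ^ (d + 1) with hf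
  have hfm : Measurable f := by
    have h1 : Measurable fun y : E d => min 4 ((2 * Real.pi * ‖y‖) ^ 2) := by fun_prop
    exact h1.div (by fun_prop)
  have hf0 : ∀ y, 0 ≤ f y := fun y => by simp only [hf]; positivity
  have hball : IntegrableOn f (Metric.ball 0 1) := by
    refine integrableOn_ball_of_norm_le_rpow hd (C := (2 * Real.pi) ^ 2) (α := (d : ℝ) - 1)
      (by rw [finrank_euclideanSpace_fin]; linarith)
      (Eventually.of_forall fun y => ?_) hfm.aestronglyMeasurable
    rw [Real.norm_of_nonneg (hf0 y)]
    by_cases hy : y = 0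
    · simp only [hf, hy, norm_zero]
      rw [zero_pow (by omega), div_zero]
      positivity
    have hy0 : 0 < ‖y‖ := norm_pos_iff.2 hy
    have e : ‖y‖ ^ (-((d : ℝ) - 1)) = ‖y‖ ^ 2 / ‖y‖ ^ (d + 1) := by
      rw [eq_div_iff (by positivity), ← Real.rpow_natCast, ← Real.rpow_add hy0, ← Real.rpow_natCast]
      congr 1; push_cast; ring
    rw [e, mul_div_assoc', ← mul_pow]
    exact div_le_div_of_nonneg_right (min_le_right _ _) (by positivity)
  have hI1 : ∫⁻ y in Metric.ball (0 : E d) 1, ENNReal.ofReal (f y) ≠ ⊤ := by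
    have := hball.hasFiniteIntegral
    rw [hasFiniteIntegral_iff_ofReal (Eventually.of_forall hf0)] at this
    exact this.ne
  have hI2 : ∫⁻ y in (Metric.ball (0 : E d) 1)ᶜ, ENNReal.ofReal (f y) ≠ ⊤ := by
    have hfin := finite_integral_one_add_norm (μ := (volume : Measure (E d))) (r := (d : ℝ) + 1)
      (by rw [finrank_euclideanSpace_fin]; linarith)
    refine ne_top_of_le_ne_top (b := ENNReal.ofReal (4 * 2 ^ (d + 1)) *
      ∫⁻ y : E d, ENNReal.ofReal ((1 + ‖y‖) ^ (-((d : ℝ) + 1))))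
      (ENNReal.mul_ne_top ENNReal.ofReal_ne_top hfin.ne) ?_
    rw [← lintegral_const_mul' _ _ ENNReal.ofReal_ne_top]
    refine (setLIntegral_mono' measurableSet_ball.compl fun y hy => ?_).trans
      (setLIntegral_le_lintegral _ _)
    have hy1 : 1 ≤ ‖y‖ := by simpa using hy
    rw [← ENNReal.ofReal_mul (by positivity)]
    refine ENNReal.ofReal_le_ofReal ?_
    have e : (1 + ‖y‖) ^ (-((d : ℝ) + 1)) = ((1 + ‖y‖) ^ (d + 1))⁻¹ := by
      rw [Real.rpow_neg (by positivity)]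
      congr 1
      exact_mod_cast Real.rpow_natCast (1 + ‖y‖) (d + 1)
    rw [e, ← div_eq_mul_inv, div_le_div_iff₀ (by positivity) (by positivity)]
    calc min 4 ((2 * Real.pi * ‖y‖) ^ 2) * (1 + ‖y‖) ^ (d + 1) ≤ 4 * (2 * ‖y‖) ^ (d + 1) :=
          mul_le_mul (min_le_left _ _) (pow_le_pow_left₀ (by positivity) (by linarith) _)
            (by positivity) (by norm_num)
      _ = 4 * 2 ^ (d + 1) * ‖y‖ ^ (d + 1) := by rw [mul_pow, mul_assoc]
  have hae : ∀ᵐ y ∂(volume : Measure (E d)), ENNReal.ofReal (min 4 ((2 * Real.pi * ‖y‖) ^ 2)) *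
      slobodeckij y = ENNReal.ofReal (f y) := by
    filter_upwards [Measure.ae_ne volume 0] with y hy
    have hy0 : 0 < ‖y‖ := norm_pos_iff.2 hy
    simp only [hf, slobodeckij]
    rw [ENNReal.ofReal_div_of_pos (by positivity), ENNReal.div_eq_inv_mul, mul_comm]
  rw [symbolConst, lintegral_congr_ae hae, ← lintegral_add_compl _ measurableSet_ball]
  exact ENNReal.add_ne_top.2 ⟨hI1, hI2⟩

end Symbol

/-! ### Regularity of velocity averages under free transport -/

section Averaging

open FourierTransform

/-- The square of the Slobodeckij seminorm of order `1/2` on `ℝ^d`. -/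
def halfSemi {F : Type*} [NormedAddCommGroup F] (h : E d → F) : ℝ≥0∞ :=
  ∫⁻ y, slobodeckij y * ∫⁻ x, ‖h (x + y) - h x‖ₑ ^ 2

/-- The velocity average of `G` transported freely during the time `τ`. -/
def velAvg {F : Type*} [NormedAddCommGroup F] [NormedSpace ℝ F] (V₀ τ : ℝ)
    (G : E d × E d → F) (x : E d) : F :=
  ∫ v in velocitySet d V₀, G (shift (-τ) (x, v))

theorem fourier_eq_osc (f : E d → ℂ) (ξ : E d) : 𝓕 f ξ = ∫ x, osc 1 (inner ℝ ξ x) * f x := by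
  rw [Real.fourier_eq']
  refine integral_congr_ae (Eventually.of_forall fun x => ?_)
  simp only [smul_eq_mul, osc]
  rw [one_mul, real_inner_comm]

theorem osc_add (t r s : ℝ) : osc t (r + s) = osc t r * osc t s := by
  unfold osc
  rw [← Complex.exp_add]
  congr 1
  push_cast
  ring

theorem osc_mul (t s : ℝ) : osc 1 (t * s) = osc t s := by
  unfold osc
  rw [one_mul]

theorem continuous_osc_inner (t : ℝ) (ξ : E d) : Continuous fun x : E d => osc t (inner ℝ ξ x) :=
  continuous_osc.comp (continuous_const.prodMk (by fun_prop))

theorem fourier_translate (f : E d → ℂ) (ξ y : E d) :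
    osc 1 (inner ℝ ξ y) * 𝓕 (fun x => f (x + y)) ξ = 𝓕 f ξ := by
  rw [fourier_eq_osc, fourier_eq_osc, ← integral_const_mul,
    ← integral_add_right_eq_self (fun x => osc 1 (inner ℝ ξ x) * f x) y]
  refine integral_congr_ae (Eventually.of_forall fun x => ?_)
  simp only
  rw [inner_add_right, osc_add]
  ring

theorem enorm_fourier_difference {f : E d → ℂ} (hf : Integrable f) (ξ y : E d) :
    ‖𝓕 (fun x => f (x + y) - f x) ξ‖ₑ = ‖osc 1 (inner ℝ ξ y) - 1‖ₑ * ‖𝓕 f ξ‖ₑ := by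
  have h1 : 𝓕 (fun x => f (x + y) - f x) ξ = 𝓕 (fun x => f (x + y)) ξ - 𝓕 f ξ := by
    simp only [fourier_eq_osc, mul_sub]
    refine integral_sub ?_ ?_
    · exact (hf.comp_add_right y).bdd_mul (c := 1) (continuous_osc_inner 1 ξ).aestronglyMeasurable
        (Eventually.of_forall fun x => (norm_osc _ _).le)
    · exact hf.bdd_mul (c := 1) (continuous_osc_inner 1 ξ).aestronglyMeasurable
        (Eventually.of_forall fun x => (norm_osc _ _).le)
  have h2 : ‖osc 1 (inner ℝ ξ y)‖ₑ = 1 := by rw [← ofReal_norm, norm_osc, ENNReal.ofReal_one]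
  rw [← one_mul ‖𝓕 (fun x => f (x + y) - f x) ξ‖ₑ, ← h2, ← enorm_mul, h1, mul_sub,
    fourier_translate, ← enorm_mul, ← enorm_neg]
  congr 1
  ring

theorem continuous_fourier {f : E d → ℂ} (hf : Integrable f) : Continuous (𝓕 f) :=
  VectorFourier.fourierIntegral_continuous Real.continuous_fourierChar continuous_inner hf

theorem lintegral_mul_lintegral_mul_swap {α β : Type*} [MeasurableSpace α] [MeasurableSpace β]
    {μ : Measure α} {ν : Measure β} [SFinite μ] [SFinite ν] {a : α → ℝ≥0∞} (ha : Measurable a)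
    {b : α → β → ℝ≥0∞} (hb : Measurable (Function.uncurry b)) {c : β → ℝ≥0∞}
    (hc : Measurable c) :
    ∫⁻ y, a y * ∫⁻ x, b y x * c x ∂ν ∂μ = ∫⁻ x, (∫⁻ y, a y * b y x ∂μ) * c x ∂ν := by
  have hm : Measurable fun p : α × β => a p.1 * b p.1 p.2 * c p.2 :=
    ((ha.comp measurable_fst).mul hb).mul (hc.comp measurable_snd)
  have h1 : ∀ y, a y * ∫⁻ x, b y x * c x ∂ν = ∫⁻ x, a y * b y x * c x ∂ν := fun y => by
    have hby : Measurable fun x => b y x * c x :=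
      (hb.comp (measurable_const.prodMk measurable_id)).mul hc
    rw [← lintegral_const_mul _ hby]
    simp only [mul_assoc]
  have h2 : ∀ x, (∫⁻ y, a y * b y x ∂μ) * c x = ∫⁻ y, a y * b y x * c x ∂μ := fun x => by
    have hbx : Measurable fun y => a y * b y x :=
      ha.mul (hb.comp (measurable_id.prodMk measurable_const))
    rw [lintegral_mul_const _ hbx]
  simp only [h1, h2]
  exact lintegral_lintegral_swap hm.aemeasurable

theorem measurable_enorm_osc_sub_one :
    Measurable (Function.uncurry fun y ξ : E d => ‖osc 1 (inner ℝ ξ y) - 1‖ₑ ^ 2) := by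
  have : Continuous fun p : E d × E d => osc 1 (inner ℝ p.2 p.1) :=
    continuous_osc.comp (continuous_const.prodMk (by fun_prop))
  exact (this.sub continuous_const).measurable.enorm.pow_const 2

/-- Translation by `y` multiplies the Fourier transform by a phase. Plancherel's identity for each
difference, followed by integration in `y`, brings out the symbol, bounded by a multiple of `|ξ|`.
-/
theorem halfSemi_le {f : E d → ℂ} (hf1 : Integrable f) (hf2 : MemLp f 2) :
    halfSemi f ≤ symbolConst d * ∫⁻ ξ, ‖ξ‖ₑ * ‖𝓕 f ξ‖ₑ ^ 2 := by
  have hc := continuous_fourier hf1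
  have hy : ∀ y : E d, ∫⁻ x, ‖f (x + y) - f x‖ₑ ^ 2 =
      ∫⁻ ξ, ‖osc 1 (inner ℝ ξ y) - 1‖ₑ ^ 2 * ‖𝓕 f ξ‖ₑ ^ 2 := fun y => by
    have h2 : MemLp (fun x => f (x + y)) 2 :=
      hf2.comp_measurePreserving (measurePreserving_add_right volume y)
    have hd1 : Integrable fun x => f (x + y) - f x := (hf1.comp_add_right y).sub hf1
    have hd2 : MemLp (fun x => f (x + y) - f x) 2 := h2.sub hf2
    rw [← lintegral_fourier_sq hd1 hd2]
    refine lintegral_congr fun ξ => ?_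
    rw [← mul_pow, ← enorm_fourier_difference hf1]
  have hf : Measurable fun ξ => ‖𝓕 f ξ‖ₑ ^ 2 := hc.measurable.enorm.pow_const 2
  have hf' : Measurable fun ξ : E d => ‖ξ‖ₑ * ‖𝓕 f ξ‖ₑ ^ 2 := measurable_enorm.mul hf
  unfold halfSemi
  simp only [hy]
  rw [lintegral_mul_lintegral_mul_swap measurable_slobodeckij measurable_enorm_osc_sub_one hf,
    ← lintegral_const_mul _ hf']
  refine lintegral_mono fun ξ => ?_
  rw [← mul_assoc]
  exact mul_le_mul_left (lintegral_symbol_le ξ) _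

variable {V₀ : ℝ} {G : E d × E d → ℂ}

/-- The Fourier transform in the position variable. -/
def partialFourier (G : E d × E d → ℂ) (ξ v : E d) : ℂ := 𝓕 (fun x => G (x, v)) ξ

theorem measurable_partialFourier (hG : Measurable G) :
    Measurable (Function.uncurry (partialFourier G)) := by
  have h : Function.uncurry (partialFourier G) =
      fun p : E d × E d => ∫ x, osc 1 (inner ℝ p.1 x) * G (x, p.2) := by
    funext p
    exact fourier_eq_osc _ _
  have hc : Continuous fun q : (E d × E d) × E d => osc 1 (inner ℝ q.1.1 q.2) :=
    continuous_osc.comp (continuous_const.prodMk (by fun_prop))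
  have hm : Measurable fun q : (E d × E d) × E d =>
      osc 1 (inner ℝ q.1.1 q.2) * G (q.2, q.1.2) :=
    hc.measurable.mul (hG.comp (measurable_snd.prodMk (measurable_snd.comp measurable_fst)))
  rw [h]
  exact (hm.stronglyMeasurable.integral_prod_right (ν := volume)).measurable

theorem integrable_phase (hG : Measurable G) (hG1 : ∫⁻ z, ‖G z‖ₑ ∂(phaseMeasure d V₀) ≠ ⊤) :
    Integrable G (phaseMeasure d V₀) :=
  ⟨hG.aestronglyMeasurable, lt_of_le_of_ne le_top hG1⟩

theorem integrable_partialFourier (hG : Measurable G) (hG1 : Integrable G (phaseMeasure d V₀))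
    (ξ : E d) : Integrable (partialFourier G ξ) (volume.restrict (velocitySet d V₀)) := by
  have hn : Integrable (fun v => ∫ x, ‖G (x, v)‖) (volume.restrict (velocitySet d V₀)) :=
    hG1.norm.integral_prod_right
  refine hn.mono' ((measurable_partialFourier hG).comp
    (measurable_const.prodMk measurable_id)).aestronglyMeasurable
    (Eventually.of_forall fun v => ?_)
  unfold partialFourier
  rw [fourier_eq_osc]
  refine (norm_integral_le_integral_norm _).trans_eq ?_
  simp only [norm_mul, norm_osc, one_mul]

/-- The substitution `x ↦ x + τ v` turns free transport into the phase `e^{-2πi τ ξ·v}`: the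
transform of the average is an oscillatory integral in which `τ` plays the role of time. -/
theorem fourier_velAvg (hG1 : Integrable G (phaseMeasure d V₀)) (τ : ℝ) (ξ : E d) :
    𝓕 (velAvg V₀ τ G) ξ = oscIntegral V₀ (partialFourier G ξ) ξ τ := by
  have hsh : Integrable (fun z => G (shift (-τ) z)) (phaseMeasure d V₀) :=
    (measurePreserving_shift V₀ (-τ)).integrable_comp_emb (measurableEmbedding_shift (-τ)) |>.2 hG1
  have hos : Continuous fun z : E d × E d => osc 1 (inner ℝ ξ z.1) :=
    (continuous_osc_inner 1 ξ).comp continuous_fst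
  have hbig : Integrable (Function.uncurry fun x v => osc 1 (inner ℝ ξ x) * G (shift (-τ) (x, v)))
      (volume.prod (volume.restrict (velocitySet d V₀))) :=
    Integrable.bdd_mul (c := 1) hsh hos.aestronglyMeasurable
      (Eventually.of_forall fun x => (norm_osc _ _).le)
  rw [fourier_eq_osc]
  unfold velAvg oscIntegral
  simp only [← integral_const_mul]
  rw [integral_integral_swap hbig]
  refine integral_congr_ae (Eventually.of_forall fun v => ?_)
  simp only
  unfold partialFourier
  rw [fourier_eq_osc, ← integral_add_right_eq_self _ (τ • v), ← integral_const_mul]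
  refine integral_congr_ae (Eventually.of_forall fun x => ?_)
  have e : shift (-τ) (x + τ • v, v) = (x, v) := by
    ext1 <;> simp [shift]
  simp only
  rw [e, inner_add_right, real_inner_smul_right, osc_add, osc_mul]
  ring

theorem integrable_velAvg (hG1 : Integrable G (phaseMeasure d V₀)) (τ : ℝ) :
    Integrable (velAvg V₀ τ G) := by
  have hsh : Integrable (fun z => G (shift (-τ) z)) (phaseMeasure d V₀) :=
    (measurePreserving_shift V₀ (-τ)).integrable_comp_emb (measurableEmbedding_shift (-τ)) |>.2 hG1
  exact hsh.integral_prod_left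

theorem enorm_velAvg_sq_le (hV : volume (velocitySet d V₀) = 1) (hG : Measurable G) (τ : ℝ)
    (x : E d) :
    ‖velAvg V₀ τ G x‖ₑ ^ 2 ≤ ∫⁻ v in velocitySet d V₀, ‖G (shift (-τ) (x, v))‖ₑ ^ 2 := by
  have hm : Measurable fun v : E d => ‖G (shift (-τ) (x, v))‖ₑ :=
    (measurable_comp_shift hG measurable_const (measurable_const.prodMk measurable_id)).enorm
  refine (pow_le_pow_left' (enorm_integral_le_lintegral_enorm _) 2).trans
    ((lintegral_sq_le_measure_mul hm.aemeasurable).trans_eq ?_)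
  rw [Measure.restrict_apply_univ, hV, one_mul]

theorem lintegral_velAvg_sq_le (hV : volume (velocitySet d V₀) = 1) (hG : Measurable G) (τ : ℝ) :
    ∫⁻ x, ‖velAvg V₀ τ G x‖ₑ ^ 2 ≤ ∫⁻ z, ‖G z‖ₑ ^ 2 ∂(phaseMeasure d V₀) := by
  have hm : Measurable fun z : E d × E d => ‖G z‖ₑ ^ 2 := hG.enorm.pow_const 2
  have hms : Measurable fun z : E d × E d => ‖G (shift (-τ) z)‖ₑ ^ 2 :=
    hm.comp (measurable_shift (-τ))
  rw [← lintegral_shift V₀ (-τ) _ hm, lintegral_phaseMeasure V₀ hms]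
  exact lintegral_mono fun x => enorm_velAvg_sq_le hV hG τ x

theorem memLp_velAvg (hV : volume (velocitySet d V₀) = 1) (hG : Measurable G)
    (hG1 : Integrable G (phaseMeasure d V₀)) (hG2 : ∫⁻ z, ‖G z‖ₑ ^ 2 ∂(phaseMeasure d V₀) ≠ ⊤)
    (τ : ℝ) : MemLp (velAvg V₀ τ G) 2 := by
  refine ⟨(integrable_velAvg hG1 τ).1, ?_⟩
  have h := ne_top_of_le_ne_top hG2 (lintegral_velAvg_sq_le hV hG τ)
  rw [lintegral_enorm_sq_eq] at h
  refine lt_of_le_of_ne le_top fun htop => h ?_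
  rw [htop]
  simp

/-- Plancherel's identity in `x` for almost every velocity, on the sections that are integrable and
square integrable. -/
theorem lintegral_partialFourier_sq (hG : Measurable G) (hG1 : Integrable G (phaseMeasure d V₀))
    (hG2 : ∫⁻ z, ‖G z‖ₑ ^ 2 ∂(phaseMeasure d V₀) ≠ ⊤) :
    ∫⁻ ξ, ∫⁻ v in velocitySet d V₀, ‖partialFourier G ξ v‖ₑ ^ 2 =
      ∫⁻ z, ‖G z‖ₑ ^ 2 ∂(phaseMeasure d V₀) := by
  have hm : Measurable fun z : E d × E d => ‖G z‖ₑ ^ 2 := hG.enorm.pow_const 2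
  have e : ∫⁻ z, ‖G z‖ₑ ^ 2 ∂(phaseMeasure d V₀) =
      ∫⁻ v in velocitySet d V₀, ∫⁻ x, ‖G (x, v)‖ₑ ^ 2 := by
    unfold phaseMeasure
    exact lintegral_prod_symm _ hm.aemeasurable
  have hmx : Measurable fun v : E d => ∫⁻ x, ‖G (x, v)‖ₑ ^ 2 := hm.lintegral_prod_left'
  rw [lintegral_lintegral_swap ((measurable_partialFourier hG).enorm.pow_const 2).aemeasurable, e]
  rw [e] at hG2
  have hae1 : ∀ᵐ v ∂(volume.restrict (velocitySet d V₀)), Integrable fun x => G (x, v) :=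
    hG1.prod_left_ae
  refine lintegral_congr_ae ?_
  filter_upwards [hae1, ae_lt_top hmx hG2] with v hv1 hv2
  refine lintegral_fourier_sq hv1 ⟨hv1.1, ?_⟩
  rw [lintegral_enorm_sq_eq] at hv2
  refine lt_of_le_of_ne le_top fun htop => hv2.ne ?_
  rw [htop]
  simp

theorem measurable_oscIntegral_partialFourier (hG : Measurable G) :
    Measurable fun p : ℝ × E d => oscIntegral V₀ (partialFourier G p.2) p.2 p.1 := by
  have hc : Continuous fun q : (ℝ × E d) × E d => osc q.1.1 (inner ℝ q.1.2 q.2) := by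
    have : Continuous fun q : (ℝ × E d) × E d => (q.1.1, (inner ℝ q.1.2 q.2 : ℝ)) := by fun_prop
    exact continuous_osc.comp this
  have hp : Measurable fun q : (ℝ × E d) × E d => partialFourier G q.1.2 q.2 :=
    (measurable_partialFourier hG).comp
      (g := Function.uncurry (partialFourier G)) (f := fun q : (ℝ × E d) × E d => (q.1.2, q.2))
      ((measurable_snd.comp measurable_fst).prodMk measurable_snd)
  have hm : Measurable fun q : (ℝ × E d) × E d =>
      osc q.1.1 (inner ℝ q.1.2 q.2) * partialFourier G q.1.2 q.2 := hc.measurable.mul hp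
  exact (hm.stronglyMeasurable.integral_prod_right
    (ν := volume.restrict (velocitySet d V₀))).measurable

/-- The constant of the averaging lemma. -/
def averagingConst (d : ℕ) (V₀ : ℝ) : ℝ≥0∞ :=
  symbolConst d * (2 * ENNReal.ofReal ((2 * V₀) ^ (d - 1)))

theorem averagingConst_ne_top [NeZero d] : averagingConst d V₀ ≠ ⊤ :=
  ENNReal.mul_ne_top symbolConst_ne_top (ENNReal.mul_ne_top (by simp) ENNReal.ofReal_ne_top)

/-- At each frequency, the factor `1 / |ξ|` from the time integral of the oscillatory integral
exactly compensates the weight `|ξ|` of the seminorm. -/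
theorem lintegral_halfSemi_velAvg_complex_le [NeZero d] (hV₀ : 0 < V₀)
    (hV : volume (velocitySet d V₀) = 1) (hG : Measurable G)
    (hG1 : Integrable G (phaseMeasure d V₀)) (hG2 : ∫⁻ z, ‖G z‖ₑ ^ 2 ∂(phaseMeasure d V₀) ≠ ⊤) :
    ∫⁻ τ : ℝ, halfSemi (velAvg V₀ τ G) ≤
      averagingConst d V₀ * ∫⁻ z, ‖G z‖ₑ ^ 2 ∂(phaseMeasure d V₀) := by
  have hpm := measurable_partialFourier hG
  have hom := measurable_oscIntegral_partialFourier (V₀ := V₀) hG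
  have hm : Measurable fun p : ℝ × E d =>
      ‖p.2‖ₑ * ‖oscIntegral V₀ (partialFourier G p.2) p.2 p.1‖ₑ ^ 2 :=
    measurable_snd.enorm.mul (hom.enorm.pow_const 2)
  have hsq : Measurable fun ξ : E d => ∫⁻ v in velocitySet d V₀, ‖partialFourier G ξ v‖ₑ ^ 2 :=
    (hpm.enorm.pow_const 2).lintegral_prod_right'
  have hτ : ∀ ξ : E d, ∫⁻ τ : ℝ, ‖ξ‖ₑ * ‖oscIntegral V₀ (partialFourier G ξ) ξ τ‖ₑ ^ 2 ≤
      2 * ENNReal.ofReal ((2 * V₀) ^ (d - 1)) *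
        ∫⁻ v in velocitySet d V₀, ‖partialFourier G ξ v‖ₑ ^ 2 := fun ξ => by
    by_cases hξ : ξ = 0
    · simp [hξ]
    have hmξ : Measurable fun τ : ℝ => ‖oscIntegral V₀ (partialFourier G ξ) ξ τ‖ₑ ^ 2 :=
      (hom.comp (measurable_id.prodMk measurable_const)).enorm.pow_const 2
    rw [lintegral_const_mul _ hmξ]
    refine (mul_le_mul_right (lintegral_oscIntegral_le hV₀
      (hpm.comp (measurable_const.prodMk measurable_id)) (integrable_partialFourier hG hG1 ξ) hξ)
      _).trans_eq ?_
    have hn : ‖ξ‖ₑ * ENNReal.ofReal ((2 * V₀) ^ (d - 1) / ‖ξ‖) =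
        ENNReal.ofReal ((2 * V₀) ^ (d - 1)) := by
      rw [← ofReal_norm, ← ENNReal.ofReal_mul (norm_nonneg _),
        mul_div_cancel₀ _ (norm_ne_zero_iff.2 hξ)]
    rw [← hn]
    simp only [Function.comp_def, Function.uncurry, id]
    ring
  calc ∫⁻ τ : ℝ, halfSemi (velAvg V₀ τ G)
      ≤ ∫⁻ τ : ℝ, symbolConst d * ∫⁻ ξ : E d,
        ‖ξ‖ₑ * ‖oscIntegral V₀ (partialFourier G ξ) ξ τ‖ₑ ^ 2 := by
        refine lintegral_mono fun τ => ?_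
        refine (halfSemi_le (integrable_velAvg hG1 τ) (memLp_velAvg hV hG hG1 hG2 τ)).trans_eq ?_
        simp only [fourier_velAvg hG1]
    _ = symbolConst d * ∫⁻ ξ : E d, ∫⁻ τ : ℝ,
        ‖ξ‖ₑ * ‖oscIntegral V₀ (partialFourier G ξ) ξ τ‖ₑ ^ 2 := by
        rw [lintegral_const_mul _ hm.lintegral_prod_right',
          lintegral_lintegral_swap hm.aemeasurable]
    _ ≤ symbolConst d * ∫⁻ ξ : E d, 2 * ENNReal.ofReal ((2 * V₀) ^ (d - 1)) *
        ∫⁻ v in velocitySet d V₀, ‖partialFourier G ξ v‖ₑ ^ 2 :=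
        mul_le_mul_right (lintegral_mono hτ) _
    _ = _ := by
        rw [lintegral_const_mul _ hsq, lintegral_partialFourier_sq hG hG1 hG2, averagingConst]
        ring

/-- The averaging lemma: the velocity averages of a freely transported density gain half a
derivative, in mean square over the time. -/
theorem lintegral_halfSemi_velAvg_le [NeZero d] (hV₀ : 0 < V₀)
    (hV : volume (velocitySet d V₀) = 1) {G : E d × E d → ℝ} (hG : Measurable G)
    (hG1 : ∫⁻ z, ‖G z‖ₑ ∂(phaseMeasure d V₀) ≠ ⊤)
    (hG2 : ∫⁻ z, ‖G z‖ₑ ^ 2 ∂(phaseMeasure d V₀) ≠ ⊤) :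
    ∫⁻ τ : ℝ, halfSemi (velAvg V₀ τ G) ≤
      averagingConst d V₀ * ∫⁻ z, ‖G z‖ₑ ^ 2 ∂(phaseMeasure d V₀) := by
  have he : ∀ a : ℝ, ‖(a : ℂ)‖ₑ = ‖a‖ₑ := fun a => by
    rw [← ofReal_norm, ← ofReal_norm, Complex.norm_real]
  have hc : Measurable fun z => (G z : ℂ) := Complex.measurable_ofReal.comp hG
  have h := lintegral_halfSemi_velAvg_complex_le (V₀ := V₀) hV₀ hV hc
    (integrable_phase hc (by simpa only [he] using hG1)) (by simpa only [he] using hG2)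
  have hv : ∀ τ x, velAvg V₀ τ (fun z => (G z : ℂ)) x = ((velAvg V₀ τ G x : ℝ) : ℂ) := fun τ x =>
    integral_ofReal
  simpa only [halfSemi, hv, ← Complex.ofReal_sub, he] using h

end Averaging

/-! ### Duhamel's formula and the averaging lemma -/

section Duhamel

variable {V₀ : ℝ}

theorem lintegral_expE_Ioi {c : ℝ} (hc : 0 < c) :
    ∫⁻ s in Ioi (0 : ℝ), expE (-c * s) = ENNReal.ofReal (1 / c) := by
  unfold expE
  rw [← ofReal_integral_eq_lintegral_ofReal (integrableOn_exp_mul_Ioi (neg_lt_zero.2 hc) 0)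
    (Eventually.of_forall fun s => (Real.exp_pos _).le), integral_exp_mul_Ioi (neg_lt_zero.2 hc)]
  simp

theorem measurable_velAvg {Φ : ℝ → E d × E d → ℝ} (hΦ : Measurable (Function.uncurry Φ))
    {α : Type*} [MeasurableSpace α] {a b : α → ℝ} {x : α → E d} (ha : Measurable a)
    (hb : Measurable b) (hx : Measurable x) :
    Measurable fun p => velAvg V₀ (a p) (Φ (b p)) (x p) := by
  unfold velAvg
  have hs : Measurable fun q : α × E d => shift (-(a q.1)) (x q.1, q.2) :=
    measurable_shift_uncurry.comp ((ha.comp measurable_fst).neg.prodMk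
      ((hx.comp measurable_fst).prodMk measurable_snd))
  have hm : Measurable fun q : α × E d => Φ (b q.1) (shift (-(a q.1)) (x q.1, q.2)) :=
    hΦ.comp (g := Function.uncurry Φ)
      (f := fun q : α × E d => (b q.1, shift (-(a q.1)) (x q.1, q.2)))
      ((hb.comp measurable_fst).prodMk hs)
  exact (hm.stronglyMeasurable.integral_prod_right
    (ν := volume.restrict (velocitySet d V₀))).measurable

theorem measurable_enorm_difference {H : ℝ × ℝ → E d → ℝ} (hH : Measurable (Function.uncurry H)) :
    Measurable fun q : ((ℝ × ℝ) × E d) × E d =>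
      ‖H q.1.1 (q.2 + q.1.2) - H q.1.1 q.2‖ₑ ^ 2 := by
  have h1 : Measurable fun q : ((ℝ × ℝ) × E d) × E d => H q.1.1 (q.2 + q.1.2) :=
    hH.comp (g := Function.uncurry H)
      (f := fun q : ((ℝ × ℝ) × E d) × E d => (q.1.1, q.2 + q.1.2)) (by fun_prop)
  have h2 : Measurable fun q : ((ℝ × ℝ) × E d) × E d => H q.1.1 q.2 :=
    hH.comp (g := Function.uncurry H)
      (f := fun q : ((ℝ × ℝ) × E d) × E d => (q.1.1, q.2)) (by fun_prop)
  exact (h1.sub h2).enorm.pow_const 2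

theorem measurable_halfSemi {H : ℝ × ℝ → E d → ℝ} (hH : Measurable (Function.uncurry H)) :
    Measurable fun p => halfSemi (H p) := by
  unfold halfSemi
  have h1 : Measurable fun q : (ℝ × ℝ) × E d =>
      ∫⁻ x, ‖H q.1 (x + q.2) - H q.1 x‖ₑ ^ 2 :=
    (measurable_enorm_difference hH).lintegral_prod_right'
  have h2 : Measurable fun q : (ℝ × ℝ) × E d => slobodeckij q.2 *
      ∫⁻ x, ‖H q.1 (x + q.2) - H q.1 x‖ₑ ^ 2 :=
    (measurable_slobodeckij.comp measurable_snd).mul h1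
  exact h2.lintegral_prod_right'

theorem measurable_halfSemi_velAvg {Φ : ℝ → E d × E d → ℝ} (hΦ : Measurable (Function.uncurry Φ)) :
    Measurable (Function.uncurry fun s τ : ℝ => halfSemi (velAvg V₀ τ (Φ s))) :=
  measurable_halfSemi (H := fun p => velAvg V₀ p.2 (Φ p.1))
    (measurable_velAvg (V₀ := V₀) hΦ (a := fun q : (ℝ × ℝ) × E d => q.1.2)
      (b := fun q => q.1.1) (x := fun q => q.2) (by fun_prop) (by fun_prop) (by fun_prop))

theorem measurable_halfSemi_velAvg_time {G : E d × E d → ℝ} (hG : Measurable G) :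
    Measurable fun τ : ℝ => halfSemi (velAvg V₀ τ G) :=
  (measurable_halfSemi_velAvg (V₀ := V₀) (Φ := fun _ => G) (hG.comp measurable_snd)).of_uncurry_left
    (x := 0)

/-- At fixed emission time the observation time is a translate of the flow time. Enlarging the
domain to `s > t` is harmless, since the averaging bound covers negative flow times too. -/
theorem lintegral_convolution_le {g : ℝ → ℝ → ℝ≥0∞} (hg : Measurable (Function.uncurry g))
    {w B : ℝ → ℝ≥0∞} (hw : Measurable w) (hB : ∀ s, 0 < s → ∫⁻ τ, g s τ ≤ B s) :
    ∫⁻ t in Ioi (0 : ℝ), ∫⁻ s in Ioi (0 : ℝ), w s * g s (t - s) ≤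
      ∫⁻ s in Ioi (0 : ℝ), w s * B s := by
  have hm : Measurable fun p : ℝ × ℝ => w p.2 * g p.2 (p.1 - p.2) :=
    (hw.comp measurable_snd).mul
      (hg.comp (f := fun p : ℝ × ℝ => (p.2, p.1 - p.2)) (by fun_prop))
  rw [lintegral_lintegral_swap hm.aemeasurable]
  refine setLIntegral_mono' measurableSet_Ioi fun s hs => ?_
  refine (setLIntegral_le_lintegral _ _).trans ?_
  have hms : Measurable fun t : ℝ => g s (t - s) :=
    hg.comp (f := fun t : ℝ => (s, t - s)) (by fun_prop)
  rw [lintegral_const_mul _ hms, lintegral_sub_right_eq_self (g s) s]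
  exact mul_le_mul_right (hB s hs) _

theorem enorm_difference_sq_le {μ : Measure ℝ} {a b c e : ℝ} {g g' : ℝ → ℝ}
    (hg : Integrable g μ) (hg' : Integrable g' μ) (ha : a = b + ∫ s, g s ∂μ)
    (hc : c = e + ∫ s, g' s ∂μ) :
    ‖a - c‖ₑ ^ 2 ≤ 2 * (‖b - e‖ₑ ^ 2 + (∫⁻ s, ‖g s - g' s‖ₑ ∂μ) ^ 2) := by
  have h : a - c = (b - e) + ∫ s, (g s - g' s) ∂μ := by
    rw [integral_sub hg hg', ha, hc]; ring
  rw [h]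
  exact (pow_le_pow_left' ((enorm_add_le _ _).trans
    (add_le_add_right (enorm_integral_le_lintegral_enorm _) _)) 2).trans (add_sq_le_two_mul _ _)

/-- The Slobodeckij seminorm of a function given by a Duhamel formula. -/
theorem halfSemi_duhamel_le {Φ : ℝ → E d × E d → ℝ} (hΦ : Measurable (Function.uncurry Φ))
    {G : E d × E d → ℝ} (hG : Measurable G) {h : E d → ℝ} {t ε : ℝ} (hε : 0 < ε)
    (hh : ∀ᵐ x, IntegrableOn (fun s => velAvg V₀ (t - s) (Φ s) x) (Ioc 0 t) ∧
      h x = velAvg V₀ t G x + ∫ s in Ioc 0 t, velAvg V₀ (t - s) (Φ s) x) :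
    halfSemi h ≤ 2 * (halfSemi (velAvg V₀ t G) + ENNReal.ofReal (1 / ε) *
      ∫⁻ s in Ioc 0 t, expE (ε * s) * halfSemi (velAvg V₀ (t - s) (Φ s))) := by
  set A : ℝ → E d → ℝ := fun s => velAvg V₀ (t - s) (Φ s) with hA
  have hAm : Measurable (Function.uncurry A) :=
    measurable_velAvg (V₀ := V₀) hΦ (a := fun q : ℝ × E d => t - q.1)
      (b := fun q => q.1) (x := fun q => q.2) (by fun_prop) (by fun_prop) (by fun_prop)
  have hAG : Measurable (velAvg V₀ t G) :=
    measurable_velAvg (V₀ := V₀) (Φ := fun _ => G) (hG.comp measurable_snd)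
      (a := fun _ : E d => t) (b := fun _ => 0) (x := fun q => q) (by fun_prop) (by fun_prop)
      (by fun_prop)
  have hD : Measurable fun q : (ℝ × E d) × E d => ‖A q.1.1 (q.2 + q.1.2) - A q.1.1 q.2‖ₑ := by
    have h1 : Measurable fun q : (ℝ × E d) × E d => A q.1.1 (q.2 + q.1.2) :=
      hAm.comp (g := Function.uncurry A)
        (f := fun q : (ℝ × E d) × E d => (q.1.1, q.2 + q.1.2)) (by fun_prop)
    have h2 : Measurable fun q : (ℝ × E d) × E d => A q.1.1 q.2 :=
      hAm.comp (g := Function.uncurry A)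
        (f := fun q : (ℝ × E d) × E d => (q.1.1, q.2)) (by fun_prop)
    exact (h1.sub h2).enorm
  have hDy : ∀ y, Measurable (Function.uncurry fun (s : ℝ) (x : E d) =>
      ‖A s (x + y) - A s x‖ₑ) := fun y =>
    hD.comp (f := fun q : ℝ × E d => ((q.1, y), q.2)) (by fun_prop)
  have hE : Measurable fun s : ℝ => expE (ε * s) := by fun_prop
  have hwt : ∫⁻ s in Ioc 0 t, expE (-ε * s) ≤ ENNReal.ofReal (1 / ε) :=
    (lintegral_mono_set Ioc_subset_Ioi_self).trans_eq (lintegral_expE_Ioi hε)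
  have hy : ∀ y, ∫⁻ x, ‖h (x + y) - h x‖ₑ ^ 2 ≤
      2 * ((∫⁻ x, ‖velAvg V₀ t G (x + y) - velAvg V₀ t G x‖ₑ ^ 2) + ENNReal.ofReal (1 / ε) *
        ∫⁻ s in Ioc 0 t, expE (ε * s) * ∫⁻ x, ‖A s (x + y) - A s x‖ₑ ^ 2) := by
    intro y
    have hb : Measurable fun x => ‖velAvg V₀ t G (x + y) - velAvg V₀ t G x‖ₑ ^ 2 :=
      ((hAG.comp (measurable_add_const y)).sub hAG).enorm.pow_const 2
    have hIm : Measurable fun x => (∫⁻ s in Ioc 0 t, ‖A s (x + y) - A s x‖ₑ) ^ 2 :=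
      ((hDy y).lintegral_prod_left' (μ := volume.restrict (Ioc 0 t))).pow_const 2
    have hCS : ∫⁻ x, (∫⁻ s in Ioc 0 t, ‖A s (x + y) - A s x‖ₑ) ^ 2 ≤
        ENNReal.ofReal (1 / ε) *
          ∫⁻ s in Ioc 0 t, expE (ε * s) * ∫⁻ x, ‖A s (x + y) - A s x‖ₑ ^ 2 := by
      have hE' : Measurable fun s : ℝ => expE (-ε * s) := by fun_prop
      -- Writing the integrand as `e^{-εs} · e^{εs} · (…)` makes the mass of the time kernel bounded
      -- uniformly in `t`, at the price of the weight `e^{εs}` on the source.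
      have key := lintegral_sq_lintegral_le (μ := volume.restrict (Ioc 0 t)) (ν := volume)
        hE' (G := fun s x => expE (ε * s) * ‖A s (x + y) - A s x‖ₑ)
        ((hE.comp measurable_fst).mul (hDy y))
      have hinv : ∀ s, expE (-ε * s) * expE (ε * s) = 1 := fun s => by
        rw [← expE_add]; simp
      have hDs : ∀ s, Measurable fun x => ‖A s (x + y) - A s x‖ₑ ^ 2 := fun s =>
        ((hDy y).comp (measurable_const.prodMk measurable_id)).pow_const 2
      have h2 : ∀ s, expE (-ε * s) * ∫⁻ x, (expE (ε * s) * ‖A s (x + y) - A s x‖ₑ) ^ 2 =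
          expE (ε * s) * ∫⁻ x, ‖A s (x + y) - A s x‖ₑ ^ 2 := fun s => by
        simp only [mul_pow]
        rw [lintegral_const_mul _ (hDs s), sq, ← mul_assoc, ← mul_assoc, hinv, one_mul]
      simp only [← mul_assoc, hinv, one_mul] at key
      simp only [h2] at key
      exact key.trans (mul_le_mul_left hwt _)
    have hshift := (measurePreserving_add_right (volume : Measure (E d)) y).quasiMeasurePreserving.ae
      hh
    calc ∫⁻ x, ‖h (x + y) - h x‖ₑ ^ 2
        ≤ ∫⁻ x, 2 * (‖velAvg V₀ t G (x + y) - velAvg V₀ t G x‖ₑ ^ 2 +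
          (∫⁻ s in Ioc 0 t, ‖A s (x + y) - A s x‖ₑ) ^ 2) := by
          refine lintegral_mono_ae ?_
          filter_upwards [hh, hshift] with x h1 h2
          exact enorm_difference_sq_le h2.1 h1.1 h2.2 h1.2
      _ ≤ _ := by
          rw [lintegral_const_mul' _ _ (by simp), lintegral_add_left hb]
          exact mul_le_mul_right (add_le_add_right hCS _) _
  have hDint : Measurable (Function.uncurry fun (y : E d) (s : ℝ) =>
      ∫⁻ x, ‖A s (x + y) - A s x‖ₑ ^ 2) := by
    have : Measurable fun q : (E d × ℝ) × E d => ‖A q.1.2 (q.2 + q.1.1) - A q.1.2 q.2‖ₑ ^ 2 :=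
      (hD.comp (f := fun q : (E d × ℝ) × E d => ((q.1.2, q.1.1), q.2)) (by fun_prop)).pow_const 2
    exact this.lintegral_prod_right'
  have hGint : Measurable fun y : E d => ∫⁻ x, ‖velAvg V₀ t G (x + y) - velAvg V₀ t G x‖ₑ ^ 2 := by
    have : Measurable fun q : E d × E d =>
        ‖velAvg V₀ t G (q.2 + q.1) - velAvg V₀ t G q.2‖ₑ ^ 2 :=
      ((hAG.comp (measurable_snd.add measurable_fst)).sub
        (hAG.comp measurable_snd)).enorm.pow_const 2
    exact this.lintegral_prod_right'
  have hswap : ∫⁻ y : E d, slobodeckij y * ∫⁻ s in Ioc 0 t, expE (ε * s) *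
      ∫⁻ x, ‖A s (x + y) - A s x‖ₑ ^ 2 = ∫⁻ s in Ioc 0 t, expE (ε * s) * halfSemi (A s) := by
    have h := lintegral_mul_lintegral_mul_swap (μ := (volume : Measure (E d)))
      (ν := volume.restrict (Ioc 0 t)) measurable_slobodeckij hDint hE
    simp only [mul_comm (expE _)]
    exact h
  have hSy : Measurable fun y : E d => slobodeckij y *
      ∫⁻ x, ‖velAvg V₀ t G (x + y) - velAvg V₀ t G x‖ₑ ^ 2 := measurable_slobodeckij.mul hGint
  have hTy : Measurable fun y : E d => slobodeckij y * ∫⁻ s in Ioc 0 t, expE (ε * s) *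
      ∫⁻ x, ‖A s (x + y) - A s x‖ₑ ^ 2 := by
    have : Measurable (Function.uncurry fun (y : E d) (s : ℝ) => expE (ε * s) *
      ∫⁻ x, ‖A s (x + y) - A s x‖ₑ ^ 2) := (hE.comp measurable_snd).mul hDint
    exact measurable_slobodeckij.mul (this.lintegral_prod_right' (ν := volume.restrict (Ioc 0 t)))
  calc halfSemi h ≤ ∫⁻ y : E d, 2 * (slobodeckij y *
          (∫⁻ x, ‖velAvg V₀ t G (x + y) - velAvg V₀ t G x‖ₑ ^ 2) + ENNReal.ofReal (1 / ε) *
          (slobodeckij y * ∫⁻ s in Ioc 0 t, expE (ε * s) *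
            ∫⁻ x, ‖A s (x + y) - A s x‖ₑ ^ 2)) := by
        refine lintegral_mono fun y => (mul_le_mul_right (hy y) _).trans_eq ?_
        ring
    _ = _ := by
        rw [lintegral_const_mul' _ _ (by simp), lintegral_add_left hSy,
          lintegral_const_mul _ hTy, hswap]
        rfl

/-- The averaging lemma for densities given by a Duhamel formula. -/
theorem lintegral_halfSemi_duhamel_le [NeZero d] (hV₀ : 0 < V₀)
    (hV : volume (velocitySet d V₀) = 1) {Φ : ℝ → E d × E d → ℝ}
    (hΦ : Measurable (Function.uncurry Φ)) {G : E d × E d → ℝ} (hG : Measurable G)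
    (hG1 : ∫⁻ z, ‖G z‖ₑ ∂(phaseMeasure d V₀) ≠ ⊤)
    (hG2 : ∫⁻ z, ‖G z‖ₑ ^ 2 ∂(phaseMeasure d V₀) ≠ ⊤)
    (hΦ1 : ∀ s, 0 < s → ∫⁻ z, ‖Φ s z‖ₑ ∂(phaseMeasure d V₀) ≠ ⊤)
    (hΦ2 : ∀ s, 0 < s → ∫⁻ z, ‖Φ s z‖ₑ ^ 2 ∂(phaseMeasure d V₀) ≠ ⊤)
    {h : ℝ → E d → ℝ} {ε : ℝ} (hε : 0 < ε)
    (hh : ∀ t, 0 < t → ∀ᵐ x, IntegrableOn (fun s => velAvg V₀ (t - s) (Φ s) x) (Ioc 0 t) ∧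
      h t x = velAvg V₀ t G x + ∫ s in Ioc 0 t, velAvg V₀ (t - s) (Φ s) x) :
    ∫⁻ t in Ioi (0 : ℝ), halfSemi (h t) ≤ 2 * averagingConst d V₀ *
      ((∫⁻ z, ‖G z‖ₑ ^ 2 ∂(phaseMeasure d V₀)) + ENNReal.ofReal (1 / ε) *
        ∫⁻ s in Ioi (0 : ℝ), expE (ε * s) * ∫⁻ z, ‖Φ s z‖ₑ ^ 2 ∂(phaseMeasure d V₀)) := by
  have hsq : Measurable fun s : ℝ => ∫⁻ z, ‖Φ s z‖ₑ ^ 2 ∂(phaseMeasure d V₀) :=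
    (hΦ.enorm.pow_const 2).lintegral_prod_right'
  have hE : Measurable fun s : ℝ => expE (ε * s) := by fun_prop
  have hES : Measurable fun s : ℝ => expE (ε * s) *
      ∫⁻ z, ‖Φ s z‖ₑ ^ 2 ∂(phaseMeasure d V₀) := hE.mul hsq
  have hgain := lintegral_convolution_le (measurable_halfSemi_velAvg (V₀ := V₀) hΦ) hE
    (B := fun s => averagingConst d V₀ * ∫⁻ z, ‖Φ s z‖ₑ ^ 2 ∂(phaseMeasure d V₀)) fun s hs =>
    lintegral_halfSemi_velAvg_le hV₀ hV (hΦ.comp (measurable_const.prodMk measurable_id))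
      (hΦ1 s hs) (hΦ2 s hs)
  simp only [mul_left_comm (expE _) (averagingConst d V₀)] at hgain
  rw [lintegral_const_mul _ hES] at hgain
  have hfirst : ∫⁻ t in Ioi (0 : ℝ), halfSemi (velAvg V₀ t G) ≤
      averagingConst d V₀ * ∫⁻ z, ‖G z‖ₑ ^ 2 ∂(phaseMeasure d V₀) :=
    (setLIntegral_le_lintegral _ _).trans (lintegral_halfSemi_velAvg_le hV₀ hV hG hG1 hG2)
  have hstep : ∫⁻ t in Ioi (0 : ℝ), halfSemi (h t) ≤ ∫⁻ t in Ioi (0 : ℝ),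
      2 * (halfSemi (velAvg V₀ t G) + ENNReal.ofReal (1 / ε) *
        ∫⁻ s in Ioi (0 : ℝ), expE (ε * s) * halfSemi (velAvg V₀ (t - s) (Φ s))) :=
    setLIntegral_mono' measurableSet_Ioi fun t ht =>
      (halfSemi_duhamel_le hΦ hG hε (hh t ht)).trans (mul_le_mul_right
        (add_le_add_right (mul_le_mul_right (lintegral_mono_set Ioc_subset_Ioi_self) _) _) _)
  refine hstep.trans ?_
  rw [lintegral_const_mul' _ _ (by simp),
    lintegral_add_left (measurable_halfSemi_velAvg_time hG),
    lintegral_const_mul' _ _ ENNReal.ofReal_ne_top, mul_assoc]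
  refine mul_le_mul_right ?_ _
  rw [mul_add, mul_left_comm]
  exact add_le_add hfirst (mul_le_mul_right hgain _)

/-- The velocity average of a density satisfying Duhamel's formula along the characteristics. -/
theorem ae_velAvg_duhamel {Φ : ℝ → E d × E d → ℝ} (hΦ : Measurable (Function.uncurry Φ))
    {G U : E d × E d → ℝ} (hG : Measurable G) {t : ℝ}
    (hG1 : ∫⁻ z, ‖G z‖ₑ ∂(phaseMeasure d V₀) ≠ ⊤)
    (hΦ1 : ∫⁻ s in Ioc 0 t, ∫⁻ z, ‖Φ s z‖ₑ ∂(phaseMeasure d V₀) ≠ ⊤)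
    (hU : ∀ᵐ z ∂(phaseMeasure d V₀), U z = G (shift (-t) z) +
      ∫ s in Ioc 0 t, Φ s (shift (-(t - s)) z)) :
    ∀ᵐ x, IntegrableOn (fun s => velAvg V₀ (t - s) (Φ s) x) (Ioc 0 t) ∧
      ∫ v in velocitySet d V₀, U (x, v) =
        velAvg V₀ t G x + ∫ s in Ioc 0 t, velAvg V₀ (t - s) (Φ s) x := by
  have hΦsm : Measurable fun p : (E d × E d) × ℝ => Φ p.2 (shift (-(t - p.2)) p.1) :=
    hΦ.comp (g := Function.uncurry Φ)
      (f := fun p : (E d × E d) × ℝ => (p.2, shift (-(t - p.2)) p.1))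
      (measurable_snd.prodMk (measurable_shift_uncurry.comp
        ((measurable_const.sub measurable_snd).neg.prodMk measurable_fst)))
  have hI : ∫⁻ p, ‖Φ p.2 (shift (-(t - p.2)) p.1)‖ₑ
      ∂((phaseMeasure d V₀).prod (volume.restrict (Ioc 0 t))) ≠ ⊤ := by
    rw [lintegral_prod_symm _ hΦsm.enorm.aemeasurable]
    refine ne_of_eq_of_ne (lintegral_congr fun s => ?_) hΦ1
    have hs : Measurable fun z => ‖Φ s z‖ₑ :=
      (hΦ.comp (measurable_const.prodMk measurable_id)).enorm
    exact lintegral_shift V₀ (-(t - s)) (fun z => ‖Φ s z‖ₑ) hs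
  have hInt : Integrable (fun p : (E d × E d) × ℝ => Φ p.2 (shift (-(t - p.2)) p.1))
      ((phaseMeasure d V₀).prod (volume.restrict (Ioc 0 t))) :=
    ⟨hΦsm.aestronglyMeasurable, lt_of_le_of_ne le_top hI⟩
  have hJm : Measurable fun z : E d × E d => ∫⁻ s in Ioc 0 t, ‖Φ s (shift (-(t - s)) z)‖ₑ :=
    hΦsm.enorm.lintegral_prod_right' (ν := volume.restrict (Ioc 0 t))
  have hJ : ∫⁻ x, ∫⁻ v in velocitySet d V₀, ∫⁻ s in Ioc 0 t,
      ‖Φ s (shift (-(t - s)) (x, v))‖ₑ ≠ ⊤ := by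
    rw [lintegral_prod _ hΦsm.enorm.aemeasurable, lintegral_phaseMeasure V₀ hJm] at hI
    exact hI
  have hJm' : Measurable fun x : E d => ∫⁻ v in velocitySet d V₀, ∫⁻ s in Ioc 0 t,
      ‖Φ s (shift (-(t - s)) (x, v))‖ₑ := hJm.lintegral_prod_right'
  have hGs : Integrable (fun z => G (shift (-t) z)) (phaseMeasure d V₀) :=
    ((measurePreserving_shift V₀ (-t)).integrable_comp_emb (measurableEmbedding_shift (-t))).2
      ⟨hG.aestronglyMeasurable, lt_of_le_of_ne le_top hG1⟩
  have hUx : ∀ᵐ x : E d, ∀ᵐ v ∂(volume.restrict (velocitySet d V₀)), U (x, v) =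
      G (shift (-t) (x, v)) + ∫ s in Ioc 0 t, Φ s (shift (-(t - s)) (x, v)) :=
    Measure.ae_ae_of_ae_prod hU
  have hGx : ∀ᵐ x : E d, Integrable (fun v => G (shift (-t) (x, v)))
      (volume.restrict (velocitySet d V₀)) := hGs.prod_right_ae
  filter_upwards [hUx, hGx, ae_lt_top hJm' hJ] with x hx1 hx2 hx3
  have hxm : Measurable fun q : E d × ℝ => Φ q.2 (shift (-(t - q.2)) (x, q.1)) :=
    hΦsm.comp (f := fun q : E d × ℝ => ((x, q.1), q.2)) (by fun_prop)
  have hxI : Integrable (fun q : E d × ℝ => Φ q.2 (shift (-(t - q.2)) (x, q.1)))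
      ((volume.restrict (velocitySet d V₀)).prod (volume.restrict (Ioc 0 t))) := by
    refine ⟨hxm.aestronglyMeasurable, ?_⟩
    rw [HasFiniteIntegral, lintegral_prod _ hxm.enorm.aemeasurable]
    exact hx3
  refine ⟨hxI.integral_prod_right, ?_⟩
  rw [integral_congr_ae hx1, integral_add hx2 hxI.integral_prod_left]
  congr 1
  exact integral_integral_swap hxI

end Duhamel

/-! ### The truncated solution along the characteristics -/

section Truncated

variable {χ V₀ α : ℝ} {k : E d → E d → ℝ} {f : E d × E d → ℝ} {F : E d × E d → ℝ} {ψ : E d → ℝ}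

/-- The source term of the equation satisfied by `e^{-αt} ψ(v) F(x, v) u(t, x, v)`. -/
def truncatedSource (χ V₀ α : ℝ) (k : E d → E d → ℝ) (f F : E d × E d → ℝ) (ψ : E d → ℝ) (s : ℝ)
    (z : E d × E d) : ℝ :=
  Real.exp (-α * s) * (ψ z.2 *
    ((-α * F z + fderiv ℝ F z (z.2, 0) - F z * turningKernel χ z.1 z.2) * mildSol χ V₀ k f s z +
      F z * gain V₀ k (mildSol χ V₀ k f s) z))

theorem hasDerivAt_shift (z : E d × E d) (s : ℝ) :
    HasDerivAt (fun s => shift s z) (z.2, 0) s := by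
  unfold shift
  have h : HasDerivAt (fun s : ℝ => z.1 + s • z.2) z.2 s := by
    simpa using ((hasDerivAt_id s).smul_const z.2).const_add z.1
  exact h.prodMk (hasDerivAt_const s z.2)

theorem continuous_flowDeriv (hF : ContDiff ℝ 1 F) :
    Continuous fun z : E d × E d => fderiv ℝ F z (z.2, 0) :=
  (hF.continuous_fderiv one_ne_zero).clm_apply (by fun_prop)

theorem measurable_truncatedSource (hF : ContDiff ℝ 1 F) (hψ : Measurable ψ)
    (hk : Measurable (Function.uncurry k)) (hf : Measurable f) :
    Measurable (Function.uncurry (truncatedSource χ V₀ α k f F ψ)) := by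
  have h1 : Measurable fun p : ℝ × (E d × E d) => Real.exp (-α * p.1) := by fun_prop
  have h2 : Measurable fun p : ℝ × (E d × E d) => ψ p.2.2 :=
    hψ.comp (measurable_snd.comp measurable_snd)
  have h3 : Measurable fun p : ℝ × (E d × E d) => F p.2 :=
    hF.continuous.measurable.comp measurable_snd
  have h4 : Measurable fun p : ℝ × (E d × E d) => fderiv ℝ F p.2 (p.2.2, 0) :=
    (continuous_flowDeriv hF).measurable.comp measurable_snd
  have h5 : Measurable fun p : ℝ × (E d × E d) => turningKernel χ p.2.1 p.2.2 :=
    (measurable_turningKernel χ).comp measurable_snd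
  have h6 : Measurable fun p : ℝ × (E d × E d) => mildSol χ V₀ k f p.1 p.2 :=
    measurable_mildSol χ V₀ hk hf
  have h7 : Measurable fun p : ℝ × (E d × E d) => gain V₀ k (mildSol χ V₀ k f p.1) p.2 :=
    measurable_gain V₀ hk (P := fun p : ℝ × (E d × E d) => mildSol χ V₀ k f p.1)
      ((measurable_mildSol χ V₀ hk hf).comp
      (f := fun q : (ℝ × (E d × E d)) × (E d × E d) => (q.1.1, q.2)) (by fun_prop)) measurable_snd
  exact h1.mul (h2.mul ((((h3.const_mul (-α)).add h4).sub (h3.mul h5)).mul h6 |>.add (h3.mul h7)))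

/-- The product rule along the characteristic. The loss term, the exponential rate and the
derivative of `F` are all put into the source, so that only free transport remains. The factor `ψ`
depends on the conserved velocity and needs no regularity. -/
theorem truncated_duhamel (hχ : 0 ≤ χ) (hF : ContDiff ℝ 1 F)
    (hk : Measurable (Function.uncurry k)) (hf : Measurable f) {t : ℝ} (ht : 0 ≤ t)
    {z : E d × E d} (hz : majorant χ V₀ k f t z ≠ ⊤) :
    Real.exp (-α * t) * (ψ z.2 * F z * mildSol χ V₀ k f t z) =
      ψ (shift (-t) z).2 * F (shift (-t) z) * f (shift (-t) z) +
        ∫ s in Ioc 0 t, truncatedSource χ V₀ α k f F ψ s (shift (-(t - s)) z) := by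
  obtain ⟨w, rfl⟩ : ∃ w, z = shift t w := ⟨shift (-t) z, (shift_shift_neg t z).symm⟩
  have hderiv : ∀ s, HasDerivAt (fun s => Real.exp (-α * s) * F (shift s w))
      (Real.exp (-α * s) * (-α) * F (shift s w) +
        Real.exp (-α * s) * fderiv ℝ F (shift s w) (w.2, 0)) s := fun s => by
    have h1 : HasDerivAt (fun s => Real.exp (-α * s)) (Real.exp (-α * s) * (-α)) s := by
      simpa using ((hasDerivAt_id s).const_mul (-α)).exp
    have h2 : HasDerivAt (fun s => F (shift s w)) (fderiv ℝ F (shift s w) (w.2, 0)) s :=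
      ((hF.differentiable one_ne_zero) _).hasFDerivAt.comp_hasDerivAt s (hasDerivAt_shift w s)
    exact h1.mul h2
  have hsc : Continuous fun s : ℝ => shift s w :=
    continuous_shift_uncurry.comp (by fun_prop : Continuous fun s : ℝ => (s, w))
  have hFc : Continuous fun s => F (shift s w) := hF.continuous.comp hsc
  have hF'c : Continuous fun s => fderiv ℝ F (shift s w) (w.2, 0) :=
    (continuous_flowDeriv hF).comp hsc
  have ha : IsPrimitiveOn t (fun s => Real.exp (-α * s) * F (shift s w)) _ :=
    IsPrimitiveOn.of_hasDerivAt countable_empty (by fun_prop) (fun s _ => hderiv s)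
      (Continuous.intervalIntegrable (by fun_prop) _ _)
  have h := (ha.mul ht (mildSol_isPrimitiveOn hχ hk hf ht hz)).eq t ⟨ht, le_rfl⟩
  simp only [mildSol_zero, shift_zero] at h
  rw [intervalIntegral.integral_of_le ht] at h
  rw [shift_neg_shift]
  have hint : ∫ s in Ioc 0 t, truncatedSource χ V₀ α k f F ψ s (shift (-(t - s)) (shift t w)) =
      ψ w.2 * ∫ s in Ioc 0 t, ((Real.exp (-α * s) * (-α) * F (shift s w) +
        Real.exp (-α * s) * fderiv ℝ F (shift s w) (w.2, 0)) * mildSol χ V₀ k f s (shift s w) +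
        Real.exp (-α * s) * F (shift s w) *
          (-turningKernel χ (shift s w).1 (shift s w).2 * mildSol χ V₀ k f s (shift s w) +
            gain V₀ k (mildSol χ V₀ k f s) (shift s w))) := by
    rw [← integral_const_mul]
    refine integral_congr_ae (Eventually.of_forall fun s => ?_)
    have e : shift (-(t - s)) (shift t w) = shift s w := by
      rw [shift_shift]; congr 1; ring
    simp only [truncatedSource]
    rw [e]
    simp only [shift_snd, shift_fst]
    ring
  rw [hint]
  have h' := congrArg (fun r => ψ w.2 * r) h
  simp only [shift_snd] at h' ⊢
  rw [mul_add] at h'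
  have e0 : Real.exp (-α * 0) = 1 := by simp
  rw [e0] at h'
  linear_combination h'

variable {C D : ℝ≥0}

theorem enorm_truncatedSource_le (hk : IsBoundedKernel V₀ C k) (hf : Measurable f)
    (hψ : ∀ v, |ψ v| ≤ 1) {s : ℝ} {z : E d × E d}
    (h1 : ‖-α * F z + fderiv ℝ F z (z.2, 0) - F z * turningKernel χ z.1 z.2‖ₑ ≤ D)
    (h2 : ‖F z‖ₑ ≤ D) :
    ‖truncatedSource χ V₀ α k f F ψ s z‖ₑ ≤ expE (-α * s) *
      (D * (majorant χ V₀ k f s z + C * density χ V₀ k f s z.1)) := by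
  have hψ' : ‖ψ z.2‖ₑ ≤ 1 := by
    rw [Real.enorm_eq_ofReal_abs]
    exact (ENNReal.ofReal_le_ofReal (hψ _)).trans_eq ENNReal.ofReal_one
  have hexp : ‖Real.exp (-α * s)‖ₑ = expE (-α * s) := Real.enorm_of_nonneg (Real.exp_pos _).le
  unfold truncatedSource
  rw [enorm_mul, enorm_mul, hexp]
  refine mul_le_mul_right ?_ _
  refine (mul_le_mul_left hψ' _).trans ?_
  rw [one_mul, mul_add]
  refine (enorm_add_le _ _).trans (add_le_add ?_ ?_)
  · rw [enorm_mul]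
    exact mul_le_mul' h1 (enorm_mildSol_le χ V₀ k f s z)
  · rw [enorm_mul]
    exact mul_le_mul' h2 ((enorm_gain_le V₀ k (enorm_mildSol_le χ V₀ k f s) z).trans
      (absGain_majorant_le hk hf s z.1))

theorem lintegral_truncatedSource_le (hV : volume (velocitySet d V₀) = 1)
    (hk : IsBoundedKernel V₀ C k) (hf : Measurable f) (hψ : ∀ v, |ψ v| ≤ 1)
    (h1 : ∀ z : E d × E d, z.2 ∈ velocitySet d V₀ →
      ‖-α * F z + fderiv ℝ F z (z.2, 0) - F z * turningKernel χ z.1 z.2‖ₑ ≤ D)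
    (h2 : ∀ z : E d × E d, z.2 ∈ velocitySet d V₀ → ‖F z‖ₑ ≤ D) (s : ℝ) :
    ∫⁻ z, ‖truncatedSource χ V₀ α k f F ψ s z‖ₑ ∂(phaseMeasure d V₀) ≤
      expE (-α * s) * (D * (1 + C)) * ∫⁻ z, majorant χ V₀ k f s z ∂(phaseMeasure d V₀) := by
  have hP : Measurable (majorant χ V₀ k f s) :=
    (measurable_majorant χ V₀ hk.measurable hf).comp (measurable_const.prodMk measurable_id)
  have hρ : Measurable (density χ V₀ k f s) :=
    (measurable_density χ V₀ hk.measurable hf).comp (measurable_const.prodMk measurable_id)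
  have hρ1 : Measurable fun z : E d × E d => density χ V₀ k f s z.1 := hρ.comp measurable_fst
  calc _ ≤ ∫⁻ z, expE (-α * s) *
        (D * (majorant χ V₀ k f s z + C * density χ V₀ k f s z.1)) ∂(phaseMeasure d V₀) := by
        refine lintegral_mono_ae ?_
        filter_upwards [ae_velocity_mem V₀] with z hz
        exact enorm_truncatedSource_le hk hf hψ (h1 z hz) (h2 z hz)
    _ = _ := by
        rw [lintegral_const_mul' _ _ (expE_ne_top _), lintegral_const_mul' _ _ ENNReal.coe_ne_top,
          lintegral_add_left hP, lintegral_const_mul' _ _ ENNReal.coe_ne_top,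
          lintegral_phaseMeasure_fst hV hρ, lintegral_density hk.measurable hf]
        ring

theorem lintegral_truncatedSource_sq_le (hV : volume (velocitySet d V₀) = 1)
    (hk : IsBoundedKernel V₀ C k) (hf : Measurable f) (hψ : ∀ v, |ψ v| ≤ 1)
    (h1 : ∀ z : E d × E d, z.2 ∈ velocitySet d V₀ →
      ‖-α * F z + fderiv ℝ F z (z.2, 0) - F z * turningKernel χ z.1 z.2‖ₑ ≤ D)
    (h2 : ∀ z : E d × E d, z.2 ∈ velocitySet d V₀ → ‖F z‖ₑ ≤ D) (s : ℝ) :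
    ∫⁻ z, ‖truncatedSource χ V₀ α k f F ψ s z‖ₑ ^ 2 ∂(phaseMeasure d V₀) ≤
      expE (2 * (-α * s)) * (2 * D ^ 2 * (1 + C ^ 2)) *
        ∫⁻ z, majorant χ V₀ k f s z ^ 2 ∂(phaseMeasure d V₀) := by
  have hP : Measurable (majorant χ V₀ k f s) :=
    (measurable_majorant χ V₀ hk.measurable hf).comp (measurable_const.prodMk measurable_id)
  have hρ : Measurable (density χ V₀ k f s) :=
    (measurable_density χ V₀ hk.measurable hf).comp (measurable_const.prodMk measurable_id)
  have hρ1 : Measurable fun z : E d × E d => density χ V₀ k f s z.1 := hρ.comp measurable_fst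
  have hC2 : (C : ℝ≥0∞) ^ 2 ≠ ⊤ := ENNReal.pow_ne_top ENNReal.coe_ne_top
  have hD2 : 2 * (D : ℝ≥0∞) ^ 2 ≠ ⊤ :=
    ENNReal.mul_ne_top (by simp) (ENNReal.pow_ne_top ENNReal.coe_ne_top)
  calc _ ≤ ∫⁻ z, expE (2 * (-α * s)) * (2 * D ^ 2 * (majorant χ V₀ k f s z ^ 2 +
        C ^ 2 * density χ V₀ k f s z.1 ^ 2)) ∂(phaseMeasure d V₀) := by
        refine lintegral_mono_ae ?_
        filter_upwards [ae_velocity_mem V₀] with z hz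
        refine (pow_le_pow_left' (enorm_truncatedSource_le hk hf hψ (h1 z hz) (h2 z hz)) 2).trans ?_
        rw [mul_pow, mul_pow, expE_pow_two]
        refine mul_le_mul_right ((mul_le_mul_right (add_sq_le_two_mul _ _) _).trans_eq ?_) _
        ring
    _ = expE (2 * (-α * s)) * (2 * D ^ 2 *
        ((∫⁻ z, majorant χ V₀ k f s z ^ 2 ∂(phaseMeasure d V₀)) +
        C ^ 2 * ∫⁻ x, density χ V₀ k f s x ^ 2)) := by
        rw [lintegral_const_mul' _ _ (expE_ne_top _), lintegral_const_mul' _ _ hD2,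
          lintegral_add_left (hP.pow_const 2), lintegral_const_mul' _ _ hC2,
          lintegral_phaseMeasure_fst hV (F := fun x => density χ V₀ k f s x ^ 2) (hρ.pow_const 2)]
    _ ≤ expE (2 * (-α * s)) * (2 * D ^ 2 *
        ((∫⁻ z, majorant χ V₀ k f s z ^ 2 ∂(phaseMeasure d V₀)) +
        C ^ 2 * ∫⁻ z, majorant χ V₀ k f s z ^ 2 ∂(phaseMeasure d V₀))) := by
        gcongr
        exact lintegral_density_sq_le hV hk.measurable hf s
    _ = _ := by ring

theorem halfSemi_const_mul (c : ℝ) (h : E d → ℝ) :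
    halfSemi (fun x => c * h x) = ‖c‖ₑ ^ 2 * halfSemi h := by
  have hc : ‖c‖ₑ ^ 2 ≠ ⊤ := ENNReal.pow_ne_top enorm_ne_top
  unfold halfSemi
  simp only [← mul_sub, enorm_mul, mul_pow]
  rw [← lintegral_const_mul' _ _ hc]
  refine lintegral_congr fun y => ?_
  rw [lintegral_const_mul' _ _ hc]
  ring

/-- The weighted space-time regularity of the velocity averages of the truncated solution. -/
theorem exists_lintegral_halfSemi_le [NeZero d] (hV₀ : 0 < V₀)
    (hV : volume (velocitySet d V₀) = 1) (hχ : χ ∈ Ioo (0 : ℝ) 1)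
    (hF : ContDiff ℝ 1 F) (hψm : Measurable ψ) (hψ : ∀ v, |ψ v| ≤ 1)
    (h1 : ∀ z : E d × E d, z.2 ∈ velocitySet d V₀ →
      ‖-α * F z + fderiv ℝ F z (z.2, 0) - F z * turningKernel χ z.1 z.2‖ₑ ≤ D)
    (h2 : ∀ z : E d × E d, z.2 ∈ velocitySet d V₀ → ‖F z‖ₑ ≤ D) {b : ℝ} (hb : b < 2 * α)
    (C : ℝ≥0) :
    ∃ M : ℝ≥0, ∀ (k : E d → E d → ℝ) (f : E d × E d → ℝ) (N : ℝ≥0∞), IsBoundedKernel V₀ C k →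
      Measurable f → ∫⁻ z, ‖f z‖ₑ ∂(phaseMeasure d V₀) ≠ ⊤ →
      ∫⁻ z, ‖f z‖ₑ ^ 2 ∂(phaseMeasure d V₀) ≤ N → N ≠ ⊤ →
      (∀ t, 0 ≤ t → expE (-b * t) * ∫⁻ z, majorant χ V₀ k f t z ^ 2 ∂(phaseMeasure d V₀) ≤ N) →
      ∫⁻ t in Ioi (0 : ℝ), expE (-2 * α * t) *
        halfSemi (fun x => ∫ v in velocitySet d V₀, ψ v * F (x, v) * mildSol χ V₀ k f t (x, v)) ≤
      M * N := by
  -- The squared source decays like `e^{(b - 2α) s} = e^{-2εs}`. Half of this rate pays for the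
  -- weight `e^{εs}` of the Duhamel estimate, and the other half makes the integral converge.
  set ε : ℝ := (2 * α - b) / 2 with hε
  have hε0 : 0 < ε := by rw [hε]; linarith
  set M : ℝ≥0∞ := 2 * averagingConst d V₀ * (D ^ 2 + ENNReal.ofReal (1 / ε) *
    ((2 * D ^ 2 * (1 + C ^ 2)) * ENNReal.ofReal (1 / ε))) with hM
  have hMt : M ≠ ⊤ := by
    have hC2 : (C : ℝ≥0∞) ^ 2 ≠ ⊤ := ENNReal.pow_ne_top ENNReal.coe_ne_top
    have hD2 : (D : ℝ≥0∞) ^ 2 ≠ ⊤ := ENNReal.pow_ne_top ENNReal.coe_ne_top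
    exact ENNReal.mul_ne_top (ENNReal.mul_ne_top (by simp) averagingConst_ne_top)
      (ENNReal.add_ne_top.2 ⟨hD2, ENNReal.mul_ne_top ENNReal.ofReal_ne_top (ENNReal.mul_ne_top
        (ENNReal.mul_ne_top (ENNReal.mul_ne_top (by simp) hD2)
        (ENNReal.add_ne_top.2 ⟨by simp, hC2⟩)) ENNReal.ofReal_ne_top)⟩)
  refine ⟨M.toNNReal, fun k f N hk hf hf1 hf2 hN hdec => ?_⟩
  rw [ENNReal.coe_toNNReal hMt]
  set μ := phaseMeasure d V₀ with hμ
  have hP2 : ∀ s, 0 ≤ s → ∫⁻ z, majorant χ V₀ k f s z ^ 2 ∂μ ≤ expE (b * s) * N := fun s hs => by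
    have h := mul_le_mul_right (hdec s hs) (expE (b * s))
    rw [← mul_assoc, ← expE_add] at h
    simpa using h
  have hΦ := measurable_truncatedSource (χ := χ) (V₀ := V₀) (α := α) hF hψm hk.measurable hf
  have hGm : Measurable fun z : E d × E d => ψ z.2 * F z * f z :=
    ((hψm.comp measurable_snd).mul hF.continuous.measurable).mul hf
  have hGle : ∀ᵐ z ∂μ, ‖ψ z.2 * F z * f z‖ₑ ≤ D * ‖f z‖ₑ := by
    filter_upwards [ae_velocity_mem V₀] with z hz
    rw [enorm_mul, enorm_mul]
    refine mul_le_mul_left ?_ _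
    have hψ' : ‖ψ z.2‖ₑ ≤ 1 := by
      rw [Real.enorm_eq_ofReal_abs]
      exact (ENNReal.ofReal_le_ofReal (hψ _)).trans_eq ENNReal.ofReal_one
    exact (mul_le_mul' hψ' (h2 z hz)).trans_eq (one_mul _)
  have hG1 : ∫⁻ z, ‖ψ z.2 * F z * f z‖ₑ ∂μ ≠ ⊤ := by
    refine ne_top_of_le_ne_top ?_ (lintegral_mono_ae hGle)
    rw [lintegral_const_mul' _ _ ENNReal.coe_ne_top]
    exact ENNReal.mul_ne_top ENNReal.coe_ne_top hf1
  have hG2le : ∫⁻ z, ‖ψ z.2 * F z * f z‖ₑ ^ 2 ∂μ ≤ D ^ 2 * N := by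
    refine (lintegral_mono_ae (hGle.mono fun z hz => pow_le_pow_left' hz 2)).trans ?_
    simp only [mul_pow]
    rw [lintegral_const_mul' _ _ (ENNReal.pow_ne_top ENNReal.coe_ne_top)]
    exact mul_le_mul_right hf2 _
  have hG2 : ∫⁻ z, ‖ψ z.2 * F z * f z‖ₑ ^ 2 ∂μ ≠ ⊤ := ne_top_of_le_ne_top
    (ENNReal.mul_ne_top (ENNReal.pow_ne_top ENNReal.coe_ne_top) hN) hG2le
  have hΦ1b : ∀ T, ∃ M : ℝ≥0, ∀ s ∈ Icc 0 T,
      ∫⁻ z, ‖truncatedSource χ V₀ α k f F ψ s z‖ₑ ∂μ ≤ M := fun T => by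
    obtain ⟨M, hM⟩ := exists_lintegral_majorant_one_le hV hχ hk hf hf1 T
    set c : ℝ≥0∞ := expE (|α| * T) * (D * (1 + C)) * M with hc
    have hct : c ≠ ⊤ := ENNReal.mul_ne_top (ENNReal.mul_ne_top (expE_ne_top _)
      (ENNReal.mul_ne_top ENNReal.coe_ne_top (ENNReal.add_ne_top.2 ⟨by simp, by simp⟩)))
      ENNReal.coe_ne_top
    refine ⟨c.toNNReal, fun s hs => ?_⟩
    rw [ENNReal.coe_toNNReal hct]
    refine (lintegral_truncatedSource_le hV hk hf hψ h1 h2 s).trans (mul_le_mul' (mul_le_mul_left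
      (expE_mono ?_) _) (hM s hs))
    have := neg_abs_le α
    calc -α * s ≤ |α| * s := mul_le_mul_of_nonneg_right (by linarith) hs.1
      _ ≤ |α| * T := mul_le_mul_of_nonneg_left hs.2 (abs_nonneg _)
  have hΦ1 : ∀ s, 0 < s → ∫⁻ z, ‖truncatedSource χ V₀ α k f F ψ s z‖ₑ ∂μ ≠ ⊤ := fun s hs => by
    obtain ⟨M, hM⟩ := hΦ1b s
    exact ne_top_of_le_ne_top ENNReal.coe_ne_top (hM s ⟨hs.le, le_rfl⟩)
  have hΦ2le : ∀ s, 0 < s → ∫⁻ z, ‖truncatedSource χ V₀ α k f F ψ s z‖ₑ ^ 2 ∂μ ≤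
      expE (2 * (-α * s)) * (2 * D ^ 2 * (1 + C ^ 2)) * (expE (b * s) * N) := fun s hs =>
    (lintegral_truncatedSource_sq_le hV hk hf hψ h1 h2 s).trans
      (mul_le_mul_right (hP2 s hs.le) _)
  have hΦ2 : ∀ s, 0 < s → ∫⁻ z, ‖truncatedSource χ V₀ α k f F ψ s z‖ₑ ^ 2 ∂μ ≠ ⊤ := fun s hs => by
    refine ne_top_of_le_ne_top ?_ (hΦ2le s hs)
    exact ENNReal.mul_ne_top (ENNReal.mul_ne_top (expE_ne_top _) (ENNReal.mul_ne_top
      (ENNReal.mul_ne_top (by simp) (ENNReal.pow_ne_top ENNReal.coe_ne_top))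
      (ENNReal.add_ne_top.2 ⟨by simp, ENNReal.pow_ne_top ENNReal.coe_ne_top⟩)))
      (ENNReal.mul_ne_top (expE_ne_top _) hN)
  have hh : ∀ t, 0 < t → ∀ᵐ x, IntegrableOn (fun s => velAvg V₀ (t - s)
      (truncatedSource χ V₀ α k f F ψ s) x) (Ioc 0 t) ∧
      (∫ v in velocitySet d V₀, Real.exp (-α * t) *
        (ψ v * F (x, v) * mildSol χ V₀ k f t (x, v))) =
      velAvg V₀ t (fun z => ψ z.2 * F z * f z) x +
        ∫ s in Ioc 0 t, velAvg V₀ (t - s) (truncatedSource χ V₀ α k f F ψ s) x := by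
    intro t ht
    refine ae_velAvg_duhamel (U := fun z => Real.exp (-α * t) *
      (ψ z.2 * F z * mildSol χ V₀ k f t z)) hΦ hGm hG1 ?_ ?_
    · obtain ⟨M, hM⟩ := hΦ1b t
      refine ne_top_of_le_ne_top ?_ (setLIntegral_mono' measurableSet_Ioc
        fun s hs => hM s (Ioc_subset_Icc_self hs))
      rw [setLIntegral_const]
      exact ENNReal.mul_ne_top ENNReal.coe_ne_top (by simp)
    · obtain ⟨M, hM⟩ := exists_lintegral_majorant_one_le hV hχ hk hf hf1 t
      have hm : Measurable (majorant χ V₀ k f t) :=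
        (measurable_majorant χ V₀ hk.measurable hf).comp (measurable_const.prodMk measurable_id)
      filter_upwards [ae_lt_top hm (ne_top_of_le_ne_top ENNReal.coe_ne_top
        (hM t ⟨ht.le, le_rfl⟩))] with z hz
      exact truncated_duhamel hχ.1.le hF hk.measurable hf ht.le hz.ne
  have key := lintegral_halfSemi_duhamel_le hV₀ hV hΦ hGm hG1 hG2 hΦ1 hΦ2 hε0 hh
  have hexp : ∀ t, ‖Real.exp (-α * t)‖ₑ ^ 2 = expE (-2 * α * t) := fun t => by
    rw [Real.enorm_of_nonneg (Real.exp_pos _).le]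
    change expE _ ^ 2 = _
    rw [expE_pow_two]; congr 1; ring
  simp only [integral_const_mul, halfSemi_const_mul, hexp] at key
  refine key.trans ?_
  have hsrc : ∫⁻ s in Ioi (0 : ℝ), expE (ε * s) *
      ∫⁻ z, ‖truncatedSource χ V₀ α k f F ψ s z‖ₑ ^ 2 ∂μ ≤
      (2 * D ^ 2 * (1 + C ^ 2)) * ENNReal.ofReal (1 / ε) * N := by
    calc _ ≤ ∫⁻ s in Ioi (0 : ℝ), expE (-ε * s) * ((2 * D ^ 2 * (1 + C ^ 2)) * N) := by
          refine setLIntegral_mono' measurableSet_Ioi fun s hs => ?_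
          refine (mul_le_mul_right (hΦ2le s hs) _).trans_eq ?_
          have e : expE (-ε * s) = expE (ε * s) * expE (2 * (-α * s)) * expE (b * s) := by
            rw [← expE_add, ← expE_add]; congr 1; rw [hε]; ring
          rw [e]; ring
      _ = _ := by
          rw [lintegral_mul_const _ (by fun_prop), lintegral_expE_Ioi hε0]
          ring
  calc _ ≤ 2 * averagingConst d V₀ * (D ^ 2 * N + ENNReal.ofReal (1 / ε) *
        ((2 * D ^ 2 * (1 + C ^ 2)) * ENNReal.ofReal (1 / ε) * N)) :=
        mul_le_mul_right (add_le_add hG2le (mul_le_mul_right hsrc _)) _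
    _ = M * N := by rw [hM]; ring

end Truncated

/-! ### The norm of `Y` of the functions of the position -/

section PositionFunctions

/-- The integral over the velocities of the kernel of the Slobodeckij seminorm on the phase
space, at unit distance. -/
def sliceConst (d : ℕ) : ℝ≥0∞ :=
  ∫⁻ w : E d, (ENNReal.ofReal (Real.sqrt (1 + ‖w‖ ^ 2) ^ (2 * d + 1)))⁻¹

theorem sliceConst_ne_top [NeZero d] : sliceConst d ≠ ⊤ := by
  have hd : (1 : ℝ) ≤ d := by exact_mod_cast NeZero.one_le
  have hfin := finite_integral_one_add_norm (μ := (volume : Measure (E d))) (r := 2 * (d : ℝ) + 1)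
    (by rw [finrank_euclideanSpace_fin]; linarith)
  refine ne_top_of_le_ne_top (b := ENNReal.ofReal (2 ^ (2 * d + 1)) *
    ∫⁻ y : E d, ENNReal.ofReal ((1 + ‖y‖) ^ (-(2 * (d : ℝ) + 1))))
    (ENNReal.mul_ne_top ENNReal.ofReal_ne_top hfin.ne) ?_
  rw [← lintegral_const_mul' _ _ ENNReal.ofReal_ne_top]
  refine lintegral_mono fun w => ?_
  have h0 : 0 < Real.sqrt (1 + ‖w‖ ^ 2) := Real.sqrt_pos.2 (by positivity)
  have hle : 1 + ‖w‖ ≤ 2 * Real.sqrt (1 + ‖w‖ ^ 2) := by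
    have h1 : (1 + ‖w‖) / 2 ≤ Real.sqrt (1 + ‖w‖ ^ 2) :=
      Real.le_sqrt_of_sq_le (by nlinarith [sq_nonneg (1 - ‖w‖), norm_nonneg w])
    linarith
  have e : (1 + ‖w‖) ^ (-(2 * (d : ℝ) + 1)) = ((1 + ‖w‖) ^ (2 * d + 1))⁻¹ := by
    rw [Real.rpow_neg (by positivity)]
    congr 1
    exact_mod_cast Real.rpow_natCast (1 + ‖w‖) (2 * d + 1)
  rw [← ENNReal.ofReal_inv_of_pos (by positivity), ← ENNReal.ofReal_mul (by positivity), e]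
  refine ENNReal.ofReal_le_ofReal ?_
  rw [← div_eq_mul_inv, ← one_div, div_le_div_iff₀ (by positivity) (by positivity), one_mul,
    ← mul_pow]
  exact pow_le_pow_left₀ (by positivity) hle _

/-- Rescaling `v' - v` by `r` gives `r^d r^{-(2d+1)} = r^{-(d+1)}`: integrating one velocity out of
the kernel of order `1/2` in dimension `2d` leaves the kernel of order `1/2` in dimension `d`. -/
theorem lintegral_slice (v : E d) {r : ℝ} (hr : 0 < r) :
    ∫⁻ v' : E d, (ENNReal.ofReal (Real.sqrt (r ^ 2 + ‖v - v'‖ ^ 2) ^ (2 * d + 1)))⁻¹ =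
      sliceConst d * (ENNReal.ofReal (r ^ (d + 1)))⁻¹ := by
  set H : E d → ℝ≥0∞ := fun w => (ENNReal.ofReal (Real.sqrt (1 + ‖w‖ ^ 2) ^ (2 * d + 1)))⁻¹ with hH
  have hHm : Measurable H := by
    have h1 : Measurable fun w : E d => Real.sqrt (1 + ‖w‖ ^ 2) ^ (2 * d + 1) := by fun_prop
    exact h1.ennreal_ofReal.inv
  have hpt : ∀ w : E d, (ENNReal.ofReal (Real.sqrt (r ^ 2 + ‖w‖ ^ 2) ^ (2 * d + 1)))⁻¹ =
      (ENNReal.ofReal (r ^ (2 * d + 1)))⁻¹ * H (r⁻¹ • w) := fun w => by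
    have e : r ^ 2 + ‖w‖ ^ 2 = r ^ 2 * (1 + ‖r⁻¹ • w‖ ^ 2) := by
      rw [norm_smul, Real.norm_of_nonneg (inv_nonneg.2 hr.le)]
      field_simp
    have h0 : ENNReal.ofReal (r ^ (2 * d + 1)) ≠ 0 := by simpa using pow_pos hr (2 * d + 1)
    rw [e, Real.sqrt_mul (sq_nonneg r), Real.sqrt_sq hr.le, mul_pow,
      ENNReal.ofReal_mul (by positivity), ENNReal.mul_inv (Or.inl h0) (Or.inl ENNReal.ofReal_ne_top)]
  have hsm : Measurable fun w : E d => H (r⁻¹ • w) := hHm.comp (by fun_prop)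
  rw [lintegral_sub_left_eq_self (fun w : E d =>
    (ENNReal.ofReal (Real.sqrt (r ^ 2 + ‖w‖ ^ 2) ^ (2 * d + 1)))⁻¹) v]
  simp only [hpt]
  rw [lintegral_const_mul _ hsm, lintegral_comp_smul_eq hHm (inv_pos.2 hr), ← mul_assoc, mul_comm]
  change sliceConst d * _ = _
  congr 1
  rw [← ENNReal.ofReal_inv_of_pos (by positivity), ← ENNReal.ofReal_inv_of_pos (by positivity),
    ← ENNReal.ofReal_mul (by positivity)]
  congr 1
  rw [inv_pow, inv_inv, show 2 * d + 1 = d + (d + 1) by ring, pow_add]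
  field_simp

theorem lintegral_slice_le (V₀ : ℝ) {h : E d → ℝ} (x x' v : E d) :
    ∫⁻ v' in velocitySet d V₀, ENNReal.ofReal ((h x - h x') ^ 2) /
      ENNReal.ofReal (Real.sqrt (‖x - x'‖ ^ 2 + ‖v - v'‖ ^ 2) ^ (2 * d + 1)) ≤
    sliceConst d * (slobodeckij (x' - x) * ‖h x' - h x‖ₑ ^ 2) := by
  by_cases hx : x = x'
  · simp [hx]
  have hr : 0 < ‖x - x'‖ := norm_pos_iff.2 (sub_ne_zero.2 hx)
  have e : ENNReal.ofReal ((h x - h x') ^ 2) = ‖h x' - h x‖ₑ ^ 2 := by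
    rw [Real.enorm_eq_ofReal_abs, ← ENNReal.ofReal_pow (abs_nonneg _), sq_abs]
    congr 1; ring
  simp only [div_eq_mul_inv, e]
  rw [lintegral_const_mul' _ _ (ENNReal.pow_ne_top enorm_ne_top)]
  refine (mul_le_mul_right (setLIntegral_le_lintegral _ _) _).trans_eq ?_
  rw [lintegral_slice v hr, slobodeckij, norm_sub_rev x' x]
  ring

theorem lintegral_slobodeckij_difference {h : E d → ℝ} (hh : Measurable h) :
    ∫⁻ x, ∫⁻ y, slobodeckij y * ‖h (x + y) - h x‖ₑ ^ 2 = halfSemi h := by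
  have hdm : Measurable (Function.uncurry fun y x : E d => ‖h (x + y) - h x‖ₑ ^ 2) :=
    ((hh.comp (measurable_snd.add measurable_fst)).sub (hh.comp measurable_snd)).enorm.pow_const 2
  have key := lintegral_mul_lintegral_mul_swap (μ := (volume : Measure (E d)))
    (ν := (volume : Measure (E d))) measurable_slobodeckij hdm (c := fun _ => 1) measurable_const
  simp only [mul_one] at key
  exact key.symm

theorem measurable_slobodeckij_difference {h : E d → ℝ} (hh : Measurable h) :
    Measurable fun x => ∫⁻ y, slobodeckij y * ‖h (x + y) - h x‖ₑ ^ 2 := by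
  have hd : Measurable fun p : E d × E d => ‖h (p.1 + p.2) - h p.1‖ₑ ^ 2 :=
    ((hh.comp (measurable_fst.add measurable_snd)).sub (hh.comp measurable_fst)).enorm.pow_const 2
  have hF : Measurable fun p : E d × E d => slobodeckij p.2 * ‖h (p.1 + p.2) - h p.1‖ₑ ^ 2 :=
    (measurable_slobodeckij.comp measurable_snd).mul hd
  exact hF.lintegral_prod_right'

theorem lintegral_phase_difference_le (V₀ : ℝ) {h : E d → ℝ} (hh : Measurable h) (z : E d × E d) :
    ∫⁻ z', ENNReal.ofReal ((h z.1 - h z'.1) ^ 2) /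
        ENNReal.ofReal (Real.sqrt (‖z.1 - z'.1‖ ^ 2 + ‖z.2 - z'.2‖ ^ 2) ^ (2 * d + 1))
        ∂(phaseMeasure d V₀) ≤
      sliceConst d * ∫⁻ y, slobodeckij y * ‖h (z.1 + y) - h z.1‖ₑ ^ 2 := by
  have h1 : Measurable fun z' : E d × E d => (h z.1 - h z'.1) ^ 2 :=
    (measurable_const.sub (hh.comp measurable_fst)).pow_const 2
  have h2 : Measurable fun z' : E d × E d =>
      Real.sqrt (‖z.1 - z'.1‖ ^ 2 + ‖z.2 - z'.2‖ ^ 2) ^ (2 * d + 1) := by fun_prop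
  have hm : Measurable fun z' : E d × E d => ENNReal.ofReal ((h z.1 - h z'.1) ^ 2) /
      ENNReal.ofReal (Real.sqrt (‖z.1 - z'.1‖ ^ 2 + ‖z.2 - z'.2‖ ^ 2) ^ (2 * d + 1)) :=
    h1.ennreal_ofReal.div h2.ennreal_ofReal
  have hdy : Measurable fun y : E d => slobodeckij y * ‖h (z.1 + y) - h z.1‖ₑ ^ 2 :=
    measurable_slobodeckij.mul
      (((hh.comp (measurable_const_add z.1)).sub measurable_const).enorm.pow_const 2)
  rw [lintegral_phaseMeasure V₀ hm, ← lintegral_const_mul _ hdy]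
  refine (lintegral_mono fun x' => lintegral_slice_le V₀ z.1 x' z.2).trans_eq ?_
  rw [← lintegral_add_left_eq_self _ z.1]
  simp only [add_sub_cancel_left]

/-- The outer velocity integral costs nothing, because `|𝒱| = 1`, and the inner one is enlarged to
all of `ℝ^d` to use the scaling of `lintegral_slice`. -/
theorem eNormHHalfSq_le {V₀ : ℝ} (hV : volume (velocitySet d V₀) = 1) {h : E d → ℝ}
    (hh : Measurable h) :
    eNormHHalfSq V₀ (fun z : E d × E d => h z.1) ≤
      (∫⁻ x, ‖h x‖ₑ ^ 2) + sliceConst d * halfSemi h := by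
  have hsq : Measurable fun x => ‖h x‖ₑ ^ 2 := hh.enorm.pow_const 2
  have hdm := measurable_slobodeckij_difference hh
  unfold eNormHHalfSq
  refine add_le_add ?_ ?_
  · rw [← lintegral_enorm_sq_eq, lintegral_phaseMeasure_fst hV (F := fun x => ‖h x‖ₑ ^ 2) hsq]
  · refine (lintegral_mono (lintegral_phase_difference_le V₀ hh)).trans_eq ?_
    rw [lintegral_phaseMeasure_fst hV (hdm.const_mul (sliceConst d)), lintegral_const_mul _ hdm,
      lintegral_slobodeckij_difference hh]

end PositionFunctions

/-! ### The regularity of `𝒜 u` -/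

section Regularity

variable {χ V₀ R δ₁ δ₂ δ₃ : ℝ} {φ : E d → ℝ} {ζ : ℝ → ℝ → ℝ}

/-- The factor of the regularized kernel that varies along the characteristics. -/
def positionFactor (χ : ℝ) (φ : E d → ℝ) (ζ : ℝ → ℝ → ℝ) (R δ₂ δ₃ : ℝ) (z : E d × E d) : ℝ :=
  positionTruncation φ δ₂ R z.1 * (1 + χ * ζ δ₃ (inner ℝ z.1 z.2))

theorem contDiff_positionFactor (hφ : IsCutoff φ) (hζ : IsRegularizedSign δ₃ (ζ δ₃)) :
    ContDiff ℝ 1 (positionFactor χ φ ζ R δ₂ δ₃) := by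
  have h1 : ContDiff ℝ 1 φ := hφ.smooth.of_le (by exact_mod_cast le_top)
  have h2 : ContDiff ℝ 1 (ζ δ₃) := hζ.smooth.of_le (by exact_mod_cast le_top)
  have hs : ∀ r : ℝ, ContDiff ℝ 1 fun z : E d × E d => scaled φ r z.1 := fun r =>
    h1.comp (contDiff_fst.const_smul r⁻¹)
  have hi : ContDiff ℝ 1 fun z : E d × E d => ζ δ₃ (inner ℝ z.1 z.2) :=
    h2.comp (contDiff_fst.inner ℝ contDiff_snd)
  exact ((hs R).sub (hs δ₂)).mul (contDiff_const.add (contDiff_const.mul hi))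

theorem abs_positionFactor_le (hχ : χ ∈ Ioo (0 : ℝ) 1) (hφ : IsCutoff φ)
    (hζ : IsRegularizedSign δ₃ (ζ δ₃)) (z : E d × E d) :
    |positionFactor χ φ ζ R δ₂ δ₃ z| ≤ 2 := by
  have h3 : |1 + χ * ζ δ₃ (inner ℝ z.1 z.2)| ≤ 2 := by
    have := abs_le.1 (hζ.abs_le_one (inner ℝ z.1 z.2))
    rw [abs_le]
    constructor <;> nlinarith [hχ.1, hχ.2]
  rw [positionFactor, abs_mul]
  calc _ ≤ (1 : ℝ) * 2 :=
        mul_le_mul (abs_positionTruncation_le hφ z.1) h3 (abs_nonneg _) zero_le_one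
    _ = 2 := by norm_num

/-- The derivative is continuous, hence bounded over the compact set `|x| ≤ 2R`, `|v| ≤ V₀`; beyond
it `F` vanishes near the point. -/
theorem exists_flowDeriv_positionFactor_le (hφ : IsCutoff φ) (hζ : IsRegularizedSign δ₃ (ζ δ₃))
    (hR : 0 < R) (hδ : 0 < δ₂) (hδR : δ₂ ≤ R) :
    ∃ c : ℝ, ∀ z : E d × E d, z.2 ∈ velocitySet d V₀ →
      |fderiv ℝ (positionFactor χ φ ζ R δ₂ δ₃) z (z.2, 0)| ≤ c := by
  have hc := continuous_flowDeriv (contDiff_positionFactor (χ := χ) (R := R) (δ₂ := δ₂) hφ hζ)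
  obtain ⟨c, hcb⟩ := ((isCompact_closedBall (0 : E d) (2 * R)).prod
    (isCompact_closedBall (0 : E d) V₀)).exists_bound_of_continuousOn hc.continuousOn
  refine ⟨max c 0, fun z hz => ?_⟩
  rcases le_or_gt ‖z.1‖ (2 * R) with hx | hx
  · refine (hcb z ⟨by simpa using hx, ?_⟩).trans (le_max_left _ _)
    simpa using norm_velocity_le hz
  · have hev : positionFactor χ φ ζ R δ₂ δ₃ =ᶠ[𝓝 z] fun _ => 0 := by
      have hopen : ∀ᶠ w : E d × E d in 𝓝 z, 2 * R < ‖w.1‖ :=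
        (continuous_fst.norm.continuousAt (x := z)).eventually (lt_mem_nhds hx)
      filter_upwards [hopen] with w hw
      rw [positionFactor, positionTruncation_eq_zero hφ hR hδ hδR hw.le, zero_mul]
    rw [hev.fderiv_eq]
    simp

theorem regularKernel_eq [NeZero d] (x v : E d) : regularKernel χ V₀ φ ζ R δ₁ δ₂ δ₃ x v =
    velocityTruncation V₀ φ δ₁ v * positionFactor χ φ ζ R δ₂ δ₃ (x, v) := by
  unfold regularKernel positionFactor
  ring

theorem measurable_velocityTruncation [NeZero d] (hφ : IsCutoff φ) :
    Measurable (velocityTruncation V₀ φ δ₁) := by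
  have h : Measurable fun s : ℝ => (EuclideanSpace.single (0 : Fin d) s : E d) := by
    have e : (fun s : ℝ => (EuclideanSpace.single (0 : Fin d) s : E d)) =
        fun s => s • EuclideanSpace.single (0 : Fin d) (1 : ℝ) := by
      funext s; ext i; simp
    rw [e]; fun_prop
  have hn : Measurable fun v : E d => V₀ - ‖v‖ := by fun_prop
  exact (measurable_const.sub ((hφ.continuous_scaled δ₁).measurable.comp (h.comp hn))).sub
    (hφ.continuous_scaled δ₁).measurable

theorem eNormYSq_opA [NeZero d] (hφ : IsCutoff φ) (hζ : IsRegularizedSign δ₃ (ζ δ₃))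
    (hR : 0 < R) (hδ : 0 < δ₂) (hδR : δ₂ ≤ R) {u : E d × E d → ℝ} (hu : Measurable u) :
    eNormYSq V₀ (2 * R) (opA χ V₀ φ ζ R δ₁ δ₂ δ₃ u) =
      eNormHHalfSq V₀ (opA χ V₀ φ ζ R δ₁ δ₂ δ₃ u) := by
  rw [eNormYSq, if_pos]
  refine ⟨?_, Eventually.of_forall fun z hz => ?_⟩
  · have h : Measurable fun z : E d × E d =>
        gain V₀ (regularKernel χ V₀ φ ζ R δ₁ δ₂ δ₃) ((fun _ : E d × E d => u) z) z :=
      measurable_gain V₀ (continuous_regularKernel hφ hζ).measurable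
        (P := fun _ : E d × E d => u) (hu.comp measurable_snd) measurable_id
    exact h.aestronglyMeasurable
  · have hx : 2 * R ≤ ‖z.1‖ := by simpa using hz
    simp [opA, gain, regularKernel, positionTruncation_eq_zero hφ hR hδ hδR hx]

/-- The weighted space-time bound of `𝒜 u` in `Y`, for the mild solutions `u` decaying at the
rate `b / 2`. -/
theorem exists_lintegral_eNormYSq_le [NeZero d] (hV₀ : 0 < V₀)
    (hV : volume (velocitySet d V₀) = 1) (hχ : χ ∈ Ioo (0 : ℝ) 1) (hφ : IsCutoff φ)
    (hζ : IsRegularizedSign δ₃ (ζ δ₃)) (hR : 0 < R) (hδ : 0 < δ₂) (hδR : δ₂ ≤ R) {α b : ℝ}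
    (hb : b < 2 * α) (C : ℝ≥0) :
    ∃ M : ℝ≥0, ∀ (k : E d → E d → ℝ) (f : E d × E d → ℝ) (N : ℝ≥0∞), IsBoundedKernel V₀ C k →
      Measurable f → ∫⁻ z, ‖f z‖ₑ ∂(phaseMeasure d V₀) ≠ ⊤ →
      ∫⁻ z, ‖f z‖ₑ ^ 2 ∂(phaseMeasure d V₀) ≤ N → N ≠ ⊤ →
      (∀ t, 0 ≤ t → expE (-b * t) * ∫⁻ z, majorant χ V₀ k f t z ^ 2 ∂(phaseMeasure d V₀) ≤ N) →
      ∫⁻ t in Ioi (0 : ℝ),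
        eNormYSq V₀ (2 * R) (opA χ V₀ φ ζ R δ₁ δ₂ δ₃ (mildSol χ V₀ k f t)) * expE (-2 * α * t) ≤
      M * N := by
  set F := positionFactor χ φ ζ R δ₂ δ₃ with hFdef
  set ψ := velocityTruncation V₀ φ δ₁ with hψdef
  have hF : ContDiff ℝ 1 F := contDiff_positionFactor hφ hζ
  obtain ⟨c, hc⟩ := exists_flowDeriv_positionFactor_le (χ := χ) (V₀ := V₀) hφ hζ hR hδ hδR
  have hψ : ∀ v, |ψ v| ≤ 1 := abs_velocityTruncation_le hφ
  have hF2 : ∀ z, |F z| ≤ 2 := abs_positionFactor_le hχ hφ hζ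
  -- From `|F| ≤ 2` and `|K| ≤ 2`: the rate, the flow derivative of `F` and the loss give the first
  -- three terms; the last is a bound on `F` alone.
  set D : ℝ≥0 := (|α| * 2 + |c| + 4 + 2).toNNReal with hD
  have hD0 : 0 ≤ |α| * 2 + |c| + 4 + 2 := by positivity
  have h2 : ∀ z : E d × E d, z.2 ∈ velocitySet d V₀ → ‖F z‖ₑ ≤ D := fun z _ => by
    rw [Real.enorm_eq_ofReal_abs]
    refine ENNReal.ofReal_le_ofReal ((hF2 z).trans ?_)
    linarith [abs_nonneg α, abs_nonneg c]
  have h1 : ∀ z : E d × E d, z.2 ∈ velocitySet d V₀ →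
      ‖-α * F z + fderiv ℝ F z (z.2, 0) - F z * turningKernel χ z.1 z.2‖ₑ ≤ D := fun z hz => by
    rw [Real.enorm_eq_ofReal_abs]
    refine ENNReal.ofReal_le_ofReal ?_
    have hK := turningKernel_mem hχ.1.le z.1 z.2
    have hKa : |turningKernel χ z.1 z.2| ≤ 2 :=
      abs_le.2 ⟨by linarith [hK.1, hχ.2], by linarith [hK.2, hχ.2]⟩
    have e1 : |-α * F z| ≤ |α| * 2 := by
      rw [abs_mul, abs_neg]
      exact mul_le_mul_of_nonneg_left (hF2 z) (abs_nonneg _)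
    have e2 : |F z * turningKernel χ z.1 z.2| ≤ 4 := by
      rw [abs_mul]
      calc _ ≤ (2 : ℝ) * 2 := mul_le_mul (hF2 z) hKa (abs_nonneg _) (by norm_num)
        _ = 4 := by norm_num
    have e3 : |fderiv ℝ F z (z.2, 0)| ≤ |c| := (hc z hz).trans (le_abs_self c)
    calc _ ≤ |-α * F z + fderiv ℝ F z (z.2, 0)| + |F z * turningKernel χ z.1 z.2| := abs_sub _ _
      _ ≤ |-α * F z| + |fderiv ℝ F z (z.2, 0)| + |F z * turningKernel χ z.1 z.2| :=
        add_le_add_left (abs_add_le _ _) _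
      _ ≤ _ := by linarith
  obtain ⟨M, hM⟩ := exists_lintegral_halfSemi_le hV₀ hV hχ hF
    (measurable_velocityTruncation (V₀ := V₀) (δ₁ := δ₁) hφ) hψ h1 h2 hb C
  set c' : ℝ≥0∞ := 4 * ENNReal.ofReal (1 / (2 * α - b)) + sliceConst d * M with hc'
  have hct : c' ≠ ⊤ := ENNReal.add_ne_top.2 ⟨ENNReal.mul_ne_top (by simp) ENNReal.ofReal_ne_top,
    ENNReal.mul_ne_top sliceConst_ne_top ENNReal.coe_ne_top⟩
  refine ⟨c'.toNNReal, fun k f N hk hf hf1 hf2 hN hdec => ?_⟩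
  rw [ENNReal.coe_toNNReal hct]
  set h : ℝ → E d → ℝ := fun t x =>
    ∫ v in velocitySet d V₀, ψ v * F (x, v) * mildSol χ V₀ k f t (x, v) with hh
  have hum : ∀ t, Measurable (mildSol χ V₀ k f t) := fun t =>
    (measurable_mildSol χ V₀ hk.measurable hf).comp (measurable_const.prodMk measurable_id)
  have hA : ∀ t, opA χ V₀ φ ζ R δ₁ δ₂ δ₃ (mildSol χ V₀ k f t) = fun z => h t z.1 := fun t => by
    funext z
    simp only [opA, gain, regularKernel_eq, hh, hFdef, hψdef]
  have hhm : ∀ t, Measurable (h t) := fun t => by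
    have hm : Measurable fun q : E d × E d => ψ q.2 * F q * mildSol χ V₀ k f t q :=
      (((measurable_velocityTruncation hφ).comp measurable_snd).mul hF.continuous.measurable).mul
        (hum t)
    exact (hm.stronglyMeasurable.integral_prod_right
      (ν := volume.restrict (velocitySet d V₀))).measurable
  have hle : ∀ t x, ‖h t x‖ₑ ≤ 2 * density χ V₀ k f t x := fun t x => by
    refine (enorm_integral_le_lintegral_enorm _).trans ?_
    unfold density
    rw [← lintegral_const_mul' _ _ (by simp)]
    refine lintegral_mono fun v => ?_
    rw [enorm_mul]
    refine mul_le_mul' ?_ (enorm_mildSol_le χ V₀ k f t (x, v))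
    rw [Real.enorm_eq_ofReal_abs, abs_mul]
    refine (ENNReal.ofReal_le_ofReal (mul_le_mul (hψ v) (hF2 (x, v)) (abs_nonneg _)
      zero_le_one)).trans_eq (by norm_num)
  have hL2 : ∀ t, 0 ≤ t → (∫⁻ x, ‖h t x‖ₑ ^ 2) * expE (-2 * α * t) ≤
      expE (-(2 * α - b) * t) * (4 * N) := fun t ht => by
    have e1 : ∫⁻ x, ‖h t x‖ₑ ^ 2 ≤
        4 * ∫⁻ z, majorant χ V₀ k f t z ^ 2 ∂(phaseMeasure d V₀) := by
      refine (lintegral_mono fun x => pow_le_pow_left' (hle t x) 2).trans ?_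
      simp only [mul_pow]
      rw [lintegral_const_mul' _ _ (by simp)]
      refine (mul_le_mul_right (lintegral_density_sq_le hV hk.measurable hf t) _).trans_eq ?_
      norm_num
    have e2 : expE (-2 * α * t) = expE (-(2 * α - b) * t) * expE (-b * t) := by
      rw [← expE_add]; congr 1; ring
    calc _ ≤ (4 * ∫⁻ z, majorant χ V₀ k f t z ^ 2 ∂(phaseMeasure d V₀)) * expE (-2 * α * t) :=
          mul_le_mul_left e1 _
      _ = expE (-(2 * α - b) * t) * (4 * (expE (-b * t) *
          ∫⁻ z, majorant χ V₀ k f t z ^ 2 ∂(phaseMeasure d V₀))) := by rw [e2]; ring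
      _ ≤ _ := mul_le_mul_right (mul_le_mul_right (hdec t ht) _) _
  have hE : Measurable fun t : ℝ => expE (-(2 * α - b) * t) * (4 * N) := by fun_prop
  calc _ ≤ ∫⁻ t in Ioi (0 : ℝ), (expE (-(2 * α - b) * t) * (4 * N) +
        sliceConst d * (expE (-2 * α * t) * halfSemi (h t))) := by
        refine setLIntegral_mono' measurableSet_Ioi fun t ht => ?_
        rw [eNormYSq_opA hφ hζ hR hδ hδR (hum t), hA t]
        refine (mul_le_mul_left (eNormHHalfSq_le hV (hhm t)) _).trans ?_
        rw [add_mul]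
        refine add_le_add (hL2 t (le_of_lt ht)) (le_of_eq ?_)
        ring
    _ ≤ ENNReal.ofReal (1 / (2 * α - b)) * (4 * N) + sliceConst d * (M * N) := by
        rw [lintegral_add_left hE, lintegral_const_mul' _ _ sliceConst_ne_top]
        refine add_le_add (le_of_eq ?_)
          (mul_le_mul_right (hM k f N hk hf hf1 hf2 hN hdec) _)
        rw [lintegral_mul_const _ (by fun_prop), lintegral_expE_Ioi (by linarith)]
    _ = c' * N := by rw [hc']; ring

end Regularity

/-! ### The weighted norms -/

section Norms

variable {V₀ γ : ℝ}

/-- The weight `m`, with values in `[0, ∞]`. -/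
def weightE (γ : ℝ) (x : E d) : ℝ≥0∞ := ENNReal.ofReal (weight γ x)

theorem measurable_weightE : Measurable (weightE γ : E d → ℝ≥0∞) :=
  (continuous_weight γ).measurable.ennreal_ofReal

theorem one_le_weightE (hγ : 0 ≤ γ) (x : E d) : 1 ≤ weightE γ x := by
  rw [← ENNReal.ofReal_one]
  exact ENNReal.ofReal_le_ofReal (one_le_weight hγ x)

theorem weightE_sq (x : E d) : weightE γ x ^ 2 = weightE (2 * γ) x := by
  unfold weightE weight
  rw [← ENNReal.ofReal_pow (Real.exp_pos _).le, ← Real.exp_nat_mul]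
  congr 2
  push_cast
  ring

theorem bracket_add_le (x y : E d) : bracket (x + y) ≤ bracket x + ‖y‖ := by
  have hb : 0 ≤ bracket x := Real.sqrt_nonneg _
  have hsq : bracket x ^ 2 = 1 + ‖x‖ ^ 2 := Real.sq_sqrt (by positivity)
  refine Real.sqrt_le_iff.2 ⟨by positivity, ?_⟩
  have h1 := pow_le_pow_left₀ (norm_nonneg _) (norm_add_le x y) 2
  nlinarith [mul_le_mul_of_nonneg_right (norm_le_bracket x) (norm_nonneg y)]

/-- `⟨x⟩` is 1-Lipschitz and the speeds are at most `V₀`. -/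
theorem isFlowWeight_weightE (hV₀ : 0 ≤ V₀) (hγ : 0 ≤ γ) :
    IsFlowWeight V₀ (γ * V₀) (weightE γ : E d → ℝ≥0∞) := by
  refine ⟨measurable_weightE, mul_nonneg hγ hV₀, fun x v hv t ht => ?_⟩
  unfold weightE weight
  rw [← ENNReal.ofReal_mul (Real.exp_pos _).le, ← Real.exp_add]
  refine ENNReal.ofReal_le_ofReal (Real.exp_le_exp.2 ?_)
  have h1 := bracket_add_le x (t • v)
  rw [norm_smul, Real.norm_of_nonneg ht] at h1
  have h2 : t * ‖v‖ ≤ t * V₀ := mul_le_mul_of_nonneg_left (norm_velocity_le (z := (x, v)) hv) ht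
  nlinarith [mul_le_mul_of_nonneg_left (h1.trans (add_le_add_right h2 _)) hγ]

theorem eNormL1_eq (f : E d × E d → ℝ) :
    eNormL1 V₀ γ f = ∫⁻ z, weightE γ z.1 * ‖f z‖ₑ ∂(phaseMeasure d V₀) := by
  unfold eNormL1 eNormLpWeight
  rw [eLpNorm_one_eq_lintegral_enorm]
  refine lintegral_congr fun z => ?_
  rw [enorm_mul, Real.enorm_of_nonneg (weight_pos γ z.1).le, weightE]

theorem eNormXSq_eq (f : E d × E d → ℝ) :
    eNormXSq V₀ γ f = (∫⁻ z, weightE γ z.1 * ‖f z‖ₑ ∂(phaseMeasure d V₀)) ^ 2 +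
      ∫⁻ z, weightE (2 * γ) z.1 * ‖f z‖ₑ ^ 2 ∂(phaseMeasure d V₀) := by
  unfold eNormXSq
  rw [← eNormL1_eq, eNormL1]
  congr 1
  unfold eNormLpWeight
  rw [← lintegral_enorm_sq_eq]
  refine lintegral_congr fun z => ?_
  rw [enorm_mul, mul_pow, Real.enorm_of_nonneg (weight_pos γ z.1).le, ← weightE_sq, weightE]

theorem lintegral_enorm_le_eNormL1 (hγ : 0 ≤ γ) (f : E d × E d → ℝ) :
    ∫⁻ z, ‖f z‖ₑ ∂(phaseMeasure d V₀) ≤ eNormL1 V₀ γ f := by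
  rw [eNormL1_eq]
  refine lintegral_mono fun z => ?_
  rw [← one_mul ‖f z‖ₑ, ← mul_assoc, mul_one]
  exact mul_le_mul_left (one_le_weightE hγ _) _

theorem eNormL1_sq_le (f : E d × E d → ℝ) : eNormL1 V₀ γ f ^ 2 ≤ eNormXSq V₀ γ f := le_self_add

theorem eNormL1_ne_top_of_eNormXSq {f : E d × E d → ℝ} (h : eNormXSq V₀ γ f ≠ ⊤) :
    eNormL1 V₀ γ f ≠ ⊤ := fun htop => h (by
  have := eNormL1_sq_le (V₀ := V₀) (γ := γ) f
  rw [htop] at this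
  simpa using this)

theorem lintegral_enorm_sq_le_eNormXSq (hγ : 0 ≤ γ) (f : E d × E d → ℝ) :
    ∫⁻ z, ‖f z‖ₑ ^ 2 ∂(phaseMeasure d V₀) ≤ eNormXSq V₀ γ f := by
  rw [eNormXSq_eq]
  refine le_add_left (lintegral_mono fun z => ?_)
  rw [← one_mul (‖f z‖ₑ ^ 2), ← mul_assoc, mul_one]
  exact mul_le_mul_left (one_le_weightE (by linarith) _) _

theorem eNormL1_congr_ae {f g : E d × E d → ℝ} (h : f =ᵐ[phaseMeasure d V₀] g) :
    eNormL1 V₀ γ f = eNormL1 V₀ γ g :=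
  eLpNorm_congr_ae (h.mono fun z hz => by simp only [hz])

theorem eNormXSq_congr_ae {f g : E d × E d → ℝ} (h : f =ᵐ[phaseMeasure d V₀] g) :
    eNormXSq V₀ γ f = eNormXSq V₀ γ g := by
  have hm : (fun z => weight γ z.1 * f z) =ᵐ[phaseMeasure d V₀] fun z => weight γ z.1 * g z :=
    h.mono fun z hz => by simp only [hz]
  unfold eNormXSq eNormLpWeight
  rw [eLpNorm_congr_ae hm, eLpNorm_congr_ae hm]

theorem eNormHHalfSq_congr_ae {f g : E d × E d → ℝ} (h : f =ᵐ[phaseMeasure d V₀] g) :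
    eNormHHalfSq V₀ f = eNormHHalfSq V₀ g := by
  unfold eNormHHalfSq
  rw [eLpNorm_congr_ae h]
  congr 1
  refine lintegral_congr_ae ?_
  filter_upwards [h] with z hz
  refine lintegral_congr_ae ?_
  filter_upwards [h] with z' hz'
  rw [hz, hz']

theorem eNormYSq_congr_ae {r : ℝ} {f g : E d × E d → ℝ} (h : f =ᵐ[phaseMeasure d V₀] g) :
    eNormYSq V₀ r f = eNormYSq V₀ r g := by
  have h1 : AEStronglyMeasurable f (phaseMeasure d V₀) ↔
      AEStronglyMeasurable g (phaseMeasure d V₀) := aestronglyMeasurable_congr h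
  have h2 : (∀ᵐ z ∂(phaseMeasure d V₀), z.1 ∉ Metric.ball (0 : E d) r → f z = 0) ↔
      ∀ᵐ z ∂(phaseMeasure d V₀), z.1 ∉ Metric.ball (0 : E d) r → g z = 0 :=
    eventually_congr (h.mono fun z hz => by rw [hz])
  unfold eNormYSq
  rw [h1, h2, eNormHHalfSq_congr_ae h]

end Norms

/-! ### Well-posedness -/

section WellPosed

variable {χ V₀ γ : ℝ} {C : ℝ≥0} {k : E d → E d → ℝ} {N : (E d × E d → ℝ) → ℝ≥0∞}

theorem IsTrajectory.congr_initial {f g : E d × E d → ℝ} {u : ℝ → E d × E d → ℝ}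
    (h : IsTrajectory χ V₀ k N f u) (hfg : f =ᵐ[phaseMeasure d V₀] g) :
    IsTrajectory χ V₀ k N g u := by
  refine ⟨h.measurable, h.bounded, h.continuous, h.initial.trans hfg, fun φ hφ t ht => ?_⟩
  rw [h.weak φ hφ t ht]
  congr 1
  exact integral_congr_ae (hfg.mono fun z hz => by simp only [hz])

/-- Boundedness of the norm `N` only serves to put both solutions in the `L¹` class, where
uniqueness holds. The two well-posedness statements thus share one proof. -/
theorem isTrajectory_ae_eq_mildSol (hV : volume (velocitySet d V₀) = 1)
    (hχ : χ ∈ Ioo (0 : ℝ) 1) (hk : IsBoundedKernel V₀ C k)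
    (hN : ∀ M : ℝ≥0, ∃ M' : ℝ≥0, ∀ g, AEStronglyMeasurable g (phaseMeasure d V₀) → N g ≤ M →
      ∫⁻ z, ‖g z‖ₑ ∂(phaseMeasure d V₀) ≤ M')
    (hNb : ∀ f, Measurable f → N f ≠ ⊤ → ∀ T, ∃ M : ℝ≥0, ∀ t ∈ Icc 0 T,
      N (mildSol χ V₀ k f t) ≤ M) {f : E d × E d → ℝ} (hf : Measurable f) (hfN : N f ≠ ⊤)
    {u : ℝ → E d × E d → ℝ} (hu : IsTrajectory χ V₀ k N f u) {t : ℝ} (ht : 0 ≤ t) :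
    u t =ᵐ[phaseMeasure d V₀] mildSol χ V₀ k f t := by
  obtain ⟨M, hM⟩ := hN (N f).toNNReal
  have hf1 : ∫⁻ z, ‖f z‖ₑ ∂(phaseMeasure d V₀) ≠ ⊤ := ne_top_of_le_ne_top ENNReal.coe_ne_top
    (hM f hf.aestronglyMeasurable (by rw [ENNReal.coe_toNNReal hfN]))
  have hm := mildSol_isTrajectory hV hχ hk hf hf1 (hNb f hf hfN)
  obtain ⟨w, hw, hwu⟩ := hu.exists_isL1Trajectory hN
  obtain ⟨w', hw', hwm⟩ := hm.exists_isL1Trajectory hN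
  exact (hwu t ht).trans ((hw.ae_eq hV hχ hk hw' ht).trans (hwm t ht).symm)

/-- The datum is measurable only up to a null set, so the series is built on a measurable
representative. -/
theorem isWellPosed (hV : volume (velocitySet d V₀) = 1)
    (hχ : χ ∈ Ioo (0 : ℝ) 1) (hk : IsBoundedKernel V₀ C k)
    (hN : ∀ M : ℝ≥0, ∃ M' : ℝ≥0, ∀ g, AEStronglyMeasurable g (phaseMeasure d V₀) → N g ≤ M →
      ∫⁻ z, ‖g z‖ₑ ∂(phaseMeasure d V₀) ≤ M')
    (hNc : ∀ f g, f =ᵐ[phaseMeasure d V₀] g → N f = N g)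
    (hNb : ∀ f, Measurable f → N f ≠ ⊤ → ∀ T, ∃ M : ℝ≥0, ∀ t ∈ Icc 0 T,
      N (mildSol χ V₀ k f t) ≤ M) : IsWellPosed χ V₀ k N := by
  intro f hf
  have hae := hf.1.ae_eq_mk
  have hgm : Measurable (hf.1.mk f) := hf.1.measurable_mk
  have hgN : N (hf.1.mk f) ≠ ⊤ := by
    rw [← hNc _ _ hae]
    exact hf.2.ne
  obtain ⟨M, hM⟩ := hN (N (hf.1.mk f)).toNNReal
  have hg1 : ∫⁻ z, ‖hf.1.mk f z‖ₑ ∂(phaseMeasure d V₀) ≠ ⊤ :=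
    ne_top_of_le_ne_top ENNReal.coe_ne_top
      (hM _ hgm.aestronglyMeasurable (by rw [ENNReal.coe_toNNReal hgN]))
  exact ⟨mildSol χ V₀ k (hf.1.mk f), (mildSol_isTrajectory hV hχ hk hgm hg1
    (hNb _ hgm hgN)).congr_initial hae.symm, fun w hw t ht =>
    isTrajectory_ae_eq_mildSol hV hχ hk hN hNb hgm hgN (hw.congr_initial hae) ht⟩

theorem eNormL1_controls (hγ : 0 ≤ γ) (M : ℝ≥0) : ∃ M' : ℝ≥0, ∀ g : E d × E d → ℝ,
    AEStronglyMeasurable g (phaseMeasure d V₀) → eNormL1 V₀ γ g ≤ M →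
      ∫⁻ z, ‖g z‖ₑ ∂(phaseMeasure d V₀) ≤ M' :=
  ⟨M, fun g _ hg => (lintegral_enorm_le_eNormL1 hγ g).trans hg⟩

theorem le_one_add_sq (x : ℝ≥0∞) : x ≤ 1 + x ^ 2 := by
  rcases le_total x 1 with h | h
  · exact h.trans le_self_add
  · refine le_add_left ?_
    rw [sq]
    exact le_mul_of_one_le_left' h

theorem eNormXSq_controls (hγ : 0 ≤ γ) (M : ℝ≥0) : ∃ M' : ℝ≥0, ∀ g : E d × E d → ℝ,
    AEStronglyMeasurable g (phaseMeasure d V₀) → eNormXSq V₀ γ g ≤ M →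
      ∫⁻ z, ‖g z‖ₑ ∂(phaseMeasure d V₀) ≤ M' := by
  refine ⟨1 + M, fun g _ hg => (lintegral_enorm_le_eNormL1 hγ g).trans ?_⟩
  push_cast
  exact (le_one_add_sq _).trans (add_le_add_right ((eNormL1_sq_le g).trans hg) _)

theorem exists_eNormL1_mildSol_le (hV₀ : 0 ≤ V₀) (hV : volume (velocitySet d V₀) = 1)
    (hχ : χ ∈ Ioo (0 : ℝ) 1) (hk : IsBoundedKernel V₀ C k) (hγ : 0 ≤ γ) {f : E d × E d → ℝ}
    (hf : Measurable f) (hfN : eNormL1 V₀ γ f ≠ ⊤) (T : ℝ) :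
    ∃ M : ℝ≥0, ∀ t ∈ Icc 0 T, eNormL1 V₀ γ (mildSol χ V₀ k f t) ≤ M := by
  obtain ⟨M, hM⟩ := exists_lintegral_majorant_le hV hχ hk hf (p := 1) (Or.inl rfl)
    (isFlowWeight_weightE hV₀ hγ) T
  simp only [pow_one, ← eNormL1_eq] at hM
  refine ⟨M * (eNormL1 V₀ γ f).toNNReal, fun t ht => ?_⟩
  push_cast
  rw [ENNReal.coe_toNNReal hfN, eNormL1_eq]
  exact (lintegral_mono fun z => mul_le_mul_right (enorm_mildSol_le χ V₀ k f t z) _).trans (hM t ht)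

theorem exists_eNormXSq_mildSol_le (hV₀ : 0 ≤ V₀) (hV : volume (velocitySet d V₀) = 1)
    (hχ : χ ∈ Ioo (0 : ℝ) 1) (hk : IsBoundedKernel V₀ C k) (hγ : 0 ≤ γ) {f : E d × E d → ℝ}
    (hf : Measurable f) (hfN : eNormXSq V₀ γ f ≠ ⊤) (T : ℝ) :
    ∃ M : ℝ≥0, ∀ t ∈ Icc 0 T, eNormXSq V₀ γ (mildSol χ V₀ k f t) ≤ M := by
  obtain ⟨M₁, hM₁⟩ := exists_eNormL1_mildSol_le hV₀ hV hχ hk hγ hf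
    (eNormL1_ne_top_of_eNormXSq hfN) T
  obtain ⟨M₂, hM₂⟩ := exists_lintegral_majorant_le hV hχ hk hf (p := 2) (Or.inr rfl)
    (isFlowWeight_weightE hV₀ (γ := 2 * γ) (by linarith)) T
  refine ⟨M₁ ^ 2 + M₂ * (eNormXSq V₀ γ f).toNNReal, fun t ht => ?_⟩
  push_cast
  rw [ENNReal.coe_toNNReal hfN, eNormXSq_eq, ← eNormL1_eq]
  refine add_le_add (pow_le_pow_left' (hM₁ t ht) 2) ?_
  refine (lintegral_mono fun z => mul_le_mul_right
    (pow_le_pow_left' (enorm_mildSol_le χ V₀ k f t z) 2) _).trans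
    ((hM₂ t ht).trans (mul_le_mul_right ?_ _))
  rw [eNormXSq_eq]
  exact le_add_self

end WellPosed

/-! ### Decay of the solutions -/

section DecayEstimates

variable {χ V₀ γ b R : ℝ} {φ : E d → ℝ}

theorem lyapunovMean_le_weight [NeZero d] (hV₀ : 0 < V₀) (hV : volume (velocitySet d V₀) = 1)
    {β : ℝ} (hγ : 0 ≤ γ) (hβ : 0 ≤ β) (x : E d) : lyapunovMean V₀ γ β x ≤ weight γ x := by
  refine (lyapunovMean_le hV hγ hβ x).trans (mul_le_of_le_one_right (weight_pos γ x).le ?_)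
  have h1 := (absMoment_pos (d := d) hV₀).le
  have h2 := zero_lt_one.trans_le (one_le_bracket x)
  have : 0 ≤ γ * (β * (absMoment d V₀ * (‖x‖ / bracket x))) := by positivity
  linarith

theorem ofReal_absorbed_le [NeZero d] (hV₀ : 0 < V₀) (hV : volume (velocitySet d V₀) = 1)
    (hχ : χ ∈ Ioo (0 : ℝ) 1) (hφ : IsCutoff φ) (hγ0 : 0 ≤ γ) (hγ : γ * (1 + 2 * V₀) ≤ 1 / 2)
    (z : E d × E d) :
    ENNReal.ofReal (absorbed χ V₀ γ φ R z) ≤ (2 : ℝ≥0) * weightE γ z.1 := by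
  have hβ : χ / 2 ∈ Icc (0 : ℝ) 1 := ⟨by linarith [hχ.1], by linarith [hχ.2]⟩
  have h1 := hφ.scaled_mem_Icc R z.1
  have hK := turningKernel_mem hχ.1.le z.1 z.2
  have hm0 := lyapunovMean_nonneg hγ0 hγ hβ z.1
  have hm := lyapunovMean_le_weight hV₀ hV hγ0 hβ.1 z.1
  have hw := weight_pos γ z.1
  have h2 : ((2 : ℝ≥0) : ℝ≥0∞) = ENNReal.ofReal 2 := by simp
  rw [h2, weightE, ← ENNReal.ofReal_mul (by norm_num)]
  refine ENNReal.ofReal_le_ofReal ?_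
  unfold absorbed
  refine mul_le_mul ?_ hm hm0 (by norm_num)
  nlinarith [h1.1, h1.2, hK.1, hK.2, hχ.1, hχ.2]

theorem ofReal_lyapunov_le (hχ : χ ∈ Ioo (0 : ℝ) 1) (hγ0 : 0 ≤ γ)
    (hγ : γ * (1 + 2 * V₀) ≤ 1 / 2) {z : E d × E d} (hz : z.2 ∈ velocitySet d V₀) :
    ENNReal.ofReal (lyapunov γ (χ / 2) z) ≤ ENNReal.ofReal (3 / 2) * weightE γ z.1 := by
  have hβ : χ / 2 ∈ Icc (0 : ℝ) 1 := ⟨by linarith [hχ.1], by linarith [hχ.2]⟩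
  rw [weightE, ← ENNReal.ofReal_mul (by norm_num)]
  exact ENNReal.ofReal_le_ofReal (lyapunov_mem hγ0 hγ hβ hz).2

theorem weightE_le_ofReal_lyapunov (hχ : χ ∈ Ioo (0 : ℝ) 1) (hγ0 : 0 ≤ γ)
    (hγ : γ * (1 + 2 * V₀) ≤ 1 / 2) {z : E d × E d} (hz : z.2 ∈ velocitySet d V₀) :
    weightE γ z.1 ≤ ENNReal.ofReal 2 * ENNReal.ofReal (lyapunov γ (χ / 2) z) := by
  have hβ : χ / 2 ∈ Icc (0 : ℝ) 1 := ⟨by linarith [hχ.1], by linarith [hχ.2]⟩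
  rw [weightE, ← ENNReal.ofReal_mul (by norm_num)]
  exact ENNReal.ofReal_le_ofReal (by linarith [(lyapunov_mem hγ0 hγ hβ hz).1])

theorem lintegral_ofReal_lyapunov_le (hχ : χ ∈ Ioo (0 : ℝ) 1) (hγ0 : 0 ≤ γ)
    (hγ : γ * (1 + 2 * V₀) ≤ 1 / 2) (f : E d × E d → ℝ) :
    ∫⁻ z, ENNReal.ofReal (lyapunov γ (χ / 2) z) * ‖f z‖ₑ ∂(phaseMeasure d V₀) ≤
      ENNReal.ofReal (3 / 2) * eNormL1 V₀ γ f := by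
  rw [eNormL1_eq, ← lintegral_const_mul' _ _ ENNReal.ofReal_ne_top]
  refine lintegral_mono_ae ?_
  filter_upwards [ae_velocity_mem V₀] with z hz
  rw [← mul_assoc]
  exact mul_le_mul_left (ofReal_lyapunov_le hχ hγ0 hγ hz) _

/-- For `ℬ₁` the gain is exactly what the Lyapunov weight absorbs, so the remainder is zero. The
constant is `3 = 2 · (3/2)`, from the comparison of `ψ` with `m` at both ends. -/
theorem eNormL1_mildSol_kernelB1_le [NeZero d] (hV₀ : 0 < V₀)
    (hV : volume (velocitySet d V₀) = 1) (hχ : χ ∈ Ioo (0 : ℝ) 1) (hφ : IsCutoff φ)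
    (hγ0 : 0 ≤ γ) (hγ : γ * (1 + 2 * V₀) ≤ 1 / 2) (hb : b < 0)
    (hL : IsLyapunov χ V₀ b (lyapunov γ (χ / 2) : E d × E d → ℝ) (lyapunovDeriv γ (χ / 2))
      (absorbed χ V₀ γ φ R)) {f : E d × E d → ℝ} (hf : Measurable f)
    (hfN : eNormL1 V₀ γ f ≠ ⊤) {t : ℝ} (ht : 0 ≤ t) :
    eNormL1 V₀ γ (mildSol χ V₀ (kernelB1 χ φ R) f t) ≤
      ENNReal.ofReal (3 * Real.exp (b * t)) * eNormL1 V₀ γ f := by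
  have hk := isBoundedKernel_kernelB1 (V₀ := V₀) (R := R) hχ hφ
  obtain ⟨M, hM⟩ := exists_lintegral_majorant_le hV hχ hk hf (p := 1) (Or.inl rfl)
    (isFlowWeight_weightE hV₀.le hγ0) t
  simp only [pow_one, ← eNormL1_eq] at hM
  set P := majorant χ V₀ (kernelB1 χ φ R) f with hP
  set μ := phaseMeasure d V₀ with hμ
  have hfin : ∫⁻ r in Ioc 0 t, expE (-b * r) *
      ∫⁻ z, ENNReal.ofReal (absorbed χ V₀ γ φ R z) * P r z ∂μ ≠ ⊤ := by
    have hle : ∀ r ∈ Ioc 0 t, expE (-b * r) *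
        ∫⁻ z, ENNReal.ofReal (absorbed χ V₀ γ φ R z) * P r z ∂μ ≤
        expE (-b * t) * ((2 : ℝ≥0) * (M * eNormL1 V₀ γ f)) := fun r hr => by
      refine mul_le_mul' (expE_mono (mul_le_mul_of_nonneg_left hr.2 (by linarith))) ?_
      refine (lintegral_mono fun z => mul_le_mul_left
        (ofReal_absorbed_le hV₀ hV hχ hφ hγ0 hγ z) _).trans ?_
      simp only [mul_assoc]
      rw [lintegral_const_mul' _ _ ENNReal.coe_ne_top]
      exact mul_le_mul_right (hM r (Ioc_subset_Icc_self hr)) _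
    refine ne_top_of_le_ne_top ?_ (setLIntegral_mono' measurableSet_Ioc hle)
    rw [setLIntegral_const]
    exact ENNReal.mul_ne_top (ENNReal.mul_ne_top (expE_ne_top _) (ENNReal.mul_ne_top
      ENNReal.coe_ne_top (ENNReal.mul_ne_top ENNReal.coe_ne_top hfN))) (by simp)
  have key := hL.lintegral_majorant_le hχ.1.le hk.measurable hf (ρ := fun _ => 0) measurable_const
    (fun x v _ => by rw [kernelB1_gain_le hχ hφ hγ0 hγ, add_zero]) ht hfin
  simp only [zero_mul, lintegral_zero, mul_zero, add_zero] at key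
  have hψP : ∫⁻ z, ENNReal.ofReal (lyapunov γ (χ / 2) z) * P t z ∂μ ≤
      expE (b * t) * (ENNReal.ofReal (3 / 2) * eNormL1 V₀ γ f) := by
    have h := mul_le_mul_right (key.trans (lintegral_ofReal_lyapunov_le hχ hγ0 hγ f))
      (expE (b * t))
    rw [← mul_assoc, ← expE_add] at h
    simpa using h
  calc eNormL1 V₀ γ (mildSol χ V₀ (kernelB1 χ φ R) f t)
      ≤ ∫⁻ z, ENNReal.ofReal 2 * (ENNReal.ofReal (lyapunov γ (χ / 2) z) * P t z) ∂μ := by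
        rw [eNormL1_eq]
        refine lintegral_mono_ae ?_
        filter_upwards [ae_velocity_mem V₀] with z hz
        rw [← mul_assoc]
        exact mul_le_mul' (weightE_le_ofReal_lyapunov hχ hγ0 hγ hz) (enorm_mildSol_le _ _ _ _ _ _)
    _ ≤ ENNReal.ofReal 2 * (expE (b * t) * (ENNReal.ofReal (3 / 2) * eNormL1 V₀ γ f)) := by
        rw [lintegral_const_mul' _ _ ENNReal.ofReal_ne_top]
        exact mul_le_mul_right hψP _
    _ = ENNReal.ofReal (3 * Real.exp (b * t)) * eNormL1 V₀ γ f := by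
        have e : ENNReal.ofReal (3 * Real.exp (b * t)) =
            ENNReal.ofReal 2 * (expE (b * t) * ENNReal.ofReal (3 / 2)) := by
          unfold expE
          rw [← ENNReal.ofReal_mul (Real.exp_pos _).le, ← ENNReal.ofReal_mul (by norm_num)]
          congr 1; ring
        rw [e]; ring

variable {ζ : ℝ → ℝ → ℝ}

/-- The mild solutions of the equation of `ℬ` decay in `L²`, once the parameters of the
regularization are small. -/
theorem exists_lintegral_majorant_kernelB_sq_le [NeZero d] (hV₀ : 0 < V₀)
    (hV : volume (velocitySet d V₀) = 1) (hχ : χ ∈ Ioo (0 : ℝ) 1) (hφ : IsCutoff φ)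
    (hζ : ∀ δ ∈ Ioo (0 : ℝ) 1, IsRegularizedSign δ (ζ δ))
    (hγ0 : 0 ≤ γ) (hγ : γ * (1 + 2 * V₀) ≤ 1 / 2) (hb : b < 0) (hb' : -b < 1 - χ) (hR : 1 ≤ R)
    (hL : IsLyapunov χ V₀ b (lyapunov γ (χ / 2) : E d × E d → ℝ) (lyapunovDeriv γ (χ / 2))
      (absorbed χ V₀ γ φ R)) :
    ∃ δ₁s ∈ Ioo (0 : ℝ) 1, ∃ δ₂s ∈ Ioo (0 : ℝ) 1, ∃ δ₃s ∈ Ioo (0 : ℝ) 1, ∃ M : ℝ≥0,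
      ∀ δ₁ ∈ Ioo 0 δ₁s, ∀ δ₂ ∈ Ioo 0 δ₂s, ∀ δ₃ ∈ Ioo 0 δ₃s, ∀ f : E d × E d → ℝ, Measurable f →
        eNormXSq V₀ γ f ≠ ⊤ → ∀ t, 0 ≤ t → expE (-b * t) *
          ∫⁻ z, majorant χ V₀ (kernelB χ V₀ φ ζ R δ₁ δ₂ δ₃) f t z ^ 2 ∂(phaseMeasure d V₀) ≤
          M * eNormXSq V₀ γ f := by
  obtain ⟨ε, hε, M, hM⟩ := exists_decay (d := d) hV hχ 4 hb hb'
  set c : ℝ≥0∞ := ENNReal.ofReal (4 * Real.exp (γ * (1 + 2 * R))) ^ 2 with hc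
  have hct : c ≠ ⊤ := ENNReal.pow_ne_top ENNReal.ofReal_ne_top
  -- The squared `L²` norm of the remainder is `c` times the measure of the exceptional set. As `c`
  -- depends on `γ` and `R` but not on the `δ`'s, it can be compensated by shrinking the set.
  obtain ⟨δ₁s, h1s, δ₂s, h2s, δ₃s, h3s, hS⟩ := exists_exceptionalSet_le (d := d) hV R
    (ε := ε / c) (ENNReal.div_pos hε.ne' hct)
  refine ⟨δ₁s, h1s, δ₂s, h2s, δ₃s, h3s, 4 * M, fun δ₁ hd1 δ₂ hd2 δ₃ hd3 f hf hfN t ht => ?_⟩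
  have hζ3 := hζ δ₃ ⟨hd3.1, hd3.2.trans h3s.2⟩
  have hβ : χ / 2 ∈ Icc (0 : ℝ) 1 := ⟨by linarith [hχ.1], by linarith [hχ.2]⟩
  have hrem : ∫⁻ z, remainder V₀ γ R δ₁ δ₂ δ₃ z ^ 2 ∂(phaseMeasure d V₀) ≤ ε := by
    rw [lintegral_remainder_sq]
    exact (mul_le_mul_right (hS δ₁ hd1 δ₂ hd2 δ₃ hd3) _).trans ENNReal.mul_div_le
  have hf1 := eNormL1_ne_top_of_eNormXSq hfN
  have key := hM (lyapunov γ (χ / 2)) (lyapunovDeriv γ (χ / 2)) (absorbed χ V₀ γ φ R)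
    (remainder V₀ γ R δ₁ δ₂ δ₃) (γ * V₀) (weightE γ) 2 (kernelB χ V₀ φ ζ R δ₁ δ₂ δ₃) f hL
    (fun z hz => by linarith [(lyapunov_mem hγ0 hγ hβ hz).1, one_le_weight hγ0 z.1])
    (isFlowWeight_weightE hV₀.le hγ0)
    (fun z hz => (ofReal_lyapunov_le hχ hγ0 hγ hz).trans (mul_le_mul_left
      ((ENNReal.ofReal_le_ofReal (by norm_num : (3 / 2 : ℝ) ≤ 2)).trans_eq (by simp)) _))
    (fun z _ => ofReal_absorbed_le hV₀ hV hχ hφ hγ0 hγ z)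
    (isBoundedKernel_kernelB hχ hφ hζ3) measurable_remainder
    (fun x v hv => kernelB_gain_le hV hχ hφ hζ3 hγ0 hγ (by linarith) hd1.1 hd2.1 hd3.1
      (by linarith [hd2.2, h2s.2]) hV₀ hv) hrem hf (by rwa [← eNormL1_eq])
    (ne_top_of_le_ne_top hfN (lintegral_enorm_sq_le_eNormXSq hγ0 f)) t ht
  refine (mul_le_mul_right le_add_self _).trans (key.trans ?_)
  have h1 : (∫⁻ z, ENNReal.ofReal (lyapunov γ (χ / 2) z) * ‖f z‖ₑ ∂(phaseMeasure d V₀)) ^ 2 ≤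
      3 * eNormXSq V₀ γ f := by
    refine (pow_le_pow_left' (lintegral_ofReal_lyapunov_le hχ hγ0 hγ f) 2).trans ?_
    rw [mul_pow]
    refine mul_le_mul' ?_ (eNormL1_sq_le f)
    rw [← ENNReal.ofReal_pow (by norm_num)]
    exact (ENNReal.ofReal_le_ofReal (by norm_num : ((3 : ℝ) / 2) ^ 2 ≤ 3)).trans_eq (by simp)
  calc _ ≤ M * (3 * eNormXSq V₀ γ f + eNormXSq V₀ γ f) :=
        mul_le_mul_right (add_le_add h1 (lintegral_enorm_sq_le_eNormXSq hγ0 f)) _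
    _ = _ := by push_cast; ring

end DecayEstimates

end RunTumble

end

/-! ### The proposition. -/

theorem proposition4p2 (d : ℕ) [NeZero d] (V₀ : ℝ) (hV₀ : 0 < V₀)
    (hvol : volume (RunTumble.velocitySet d V₀) = 1)
    (χ : ℝ) (hχ : χ ∈ Ioo (0 : ℝ) 1)
    (φ : RunTumble.E d → ℝ) (hφ : RunTumble.IsCutoff φ)
    (ζ : ℝ → ℝ → ℝ) (hζ : ∀ δ ∈ Ioo (0 : ℝ) 1, RunTumble.IsRegularizedSign δ (ζ δ)) :
    ∃ γstar : ℝ, 0 < γstar ∧ ∀ γ ∈ Ioo 0 γstar,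
    ∃ astar : ℝ, astar < 0 ∧ ∃ C : ℝ, 1 ≤ C ∧ ∃ R₀ : ℝ, 1 < R₀ ∧ ∀ R : ℝ, R₀ ≤ R →
      -- the decay of `S_{ℬ₁}` in `L¹(m)` at the rate `a*`
      (RunTumble.IsWellPosed χ V₀ (RunTumble.kernelB1 χ φ R) (RunTumble.eNormL1 V₀ γ) ∧
        ∀ f u, RunTumble.Mem V₀ (RunTumble.eNormL1 V₀ γ) f →
          RunTumble.IsTrajectory χ V₀ (RunTumble.kernelB1 χ φ R) (RunTumble.eNormL1 V₀ γ) f u →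
          ∀ t : ℝ, 0 ≤ t → RunTumble.eNormL1 V₀ γ (u t) ≤
            ENNReal.ofReal (C * Real.exp (astar * t)) * RunTumble.eNormL1 V₀ γ f) ∧
      -- the regularity of `𝒜 S_ℬ` for the same `a*`
      ∃ δ₁star ∈ Ioo (0 : ℝ) 1, ∀ δ₁ ∈ Ioo 0 δ₁star,
      ∃ δ₂star ∈ Ioo (0 : ℝ) 1, ∀ δ₂ ∈ Ioo 0 δ₂star,
      ∃ δ₃star ∈ Ioo (0 : ℝ) 1, ∀ δ₃ ∈ Ioo 0 δ₃star,
        RunTumble.IsWellPosed χ V₀ (RunTumble.kernelB χ V₀ φ ζ R δ₁ δ₂ δ₃)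
          (RunTumble.eNormXSq V₀ γ) ∧
        ∀ a : ℝ, astar < a → ∃ Ca : ℝ, 0 < Ca ∧
          ∀ f u, RunTumble.Mem V₀ (RunTumble.eNormXSq V₀ γ) f →
            RunTumble.IsTrajectory χ V₀ (RunTumble.kernelB χ V₀ φ ζ R δ₁ δ₂ δ₃)
              (RunTumble.eNormXSq V₀ γ) f u →
            ∫⁻ t in Ioi (0 : ℝ),
                RunTumble.eNormYSq V₀ (2 * R) (RunTumble.opA χ V₀ φ ζ R δ₁ δ₂ δ₃ (u t)) *
                  ENNReal.ofReal (Real.exp (-2 * a * t))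
              ≤ ENNReal.ofReal Ca * RunTumble.eNormXSq V₀ γ f := by
  obtain ⟨γstar, hγs, hγall⟩ := RunTumble.exists_isLyapunov hV₀ hvol hχ hφ
  refine ⟨γstar, hγs, fun γ hγ => ?_⟩
  obtain ⟨hγ1, b, hb, hb', R₀, hR₀, hL⟩ := hγall γ hγ
  have hγ0 : 0 ≤ γ := hγ.1.le
  -- The rate `b / 2` is dictated by `ℬ`, whose squared norms decay like `e^{bt}`. For `ℬ₁` the
  -- better rate `b` is available and is weakened.
  refine ⟨b / 2, by linarith, 3, by norm_num, R₀, hR₀, fun R hR => ⟨⟨?_, ?_⟩, ?_⟩⟩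
  · exact RunTumble.isWellPosed hvol hχ (RunTumble.isBoundedKernel_kernelB1 hχ hφ)
      (RunTumble.eNormL1_controls hγ0) (fun f g h => RunTumble.eNormL1_congr_ae h)
      fun f hf hfN T => RunTumble.exists_eNormL1_mildSol_le hV₀.le hvol hχ
        (RunTumble.isBoundedKernel_kernelB1 hχ hφ) hγ0 hf hfN T
  · intro f u hf hu t ht
    have hk := RunTumble.isBoundedKernel_kernelB1 (V₀ := V₀) (R := R) hχ hφ
    obtain ⟨hfm, hfN⟩ := hf
    obtain ⟨g, hgm, hae⟩ := hfm.aemeasurable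
    have hgN : RunTumble.eNormL1 V₀ γ g ≠ ⊤ := by
      rw [← RunTumble.eNormL1_congr_ae hae]
      exact hfN.ne
    have hut := RunTumble.isTrajectory_ae_eq_mildSol hvol hχ hk (RunTumble.eNormL1_controls hγ0)
      (fun g hg hgN T => RunTumble.exists_eNormL1_mildSol_le hV₀.le hvol hχ hk hγ0 hg hgN T)
      hgm hgN (hu.congr_initial hae) ht
    rw [RunTumble.eNormL1_congr_ae hut, RunTumble.eNormL1_congr_ae hae]
    refine (RunTumble.eNormL1_mildSol_kernelB1_le hV₀ hvol hχ hφ hγ0 hγ1 hb (hL R hR)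
      hgm hgN ht).trans (mul_le_mul_left (ENNReal.ofReal_le_ofReal ?_) _)
    refine mul_le_mul_of_nonneg_left (Real.exp_le_exp.2 ?_) (by norm_num)
    nlinarith
  · have hR1 : 1 ≤ R := by linarith
    obtain ⟨δ₁s, h1s, δ₂s, h2s, δ₃s, h3s, M, hM⟩ :=
      RunTumble.exists_lintegral_majorant_kernelB_sq_le hV₀ hvol hχ hφ hζ hγ0 hγ1 hb hb' hR1 (hL R hR)
    -- The thresholds come from three separate bounds, one for each piece of the exceptional set, so
    -- the later ones do not depend on the earlier parameters.
    refine ⟨δ₁s, h1s, fun δ₁ hd1 => ⟨δ₂s, h2s, fun δ₂ hd2 => ⟨δ₃s, h3s, fun δ₃ hd3 => ?_⟩⟩⟩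
    have hζ3 := hζ δ₃ ⟨hd3.1, hd3.2.trans h3s.2⟩
    have hk := RunTumble.isBoundedKernel_kernelB (V₀ := V₀) (R := R) (δ₁ := δ₁) (δ₂ := δ₂)
      hχ hφ hζ3
    have hNb := fun g (hg : Measurable g) hgN T =>
      RunTumble.exists_eNormXSq_mildSol_le (γ := γ) hV₀.le hvol hχ hk hγ0 hg hgN T
    refine ⟨RunTumble.isWellPosed hvol hχ hk (RunTumble.eNormXSq_controls hγ0)
      (fun f g h => RunTumble.eNormXSq_congr_ae h) hNb, fun a ha => ?_⟩
    obtain ⟨M', hM'⟩ := RunTumble.exists_lintegral_eNormYSq_le (δ₁ := δ₁) hV₀ hvol hχ hφ hζ3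
      (by linarith : 0 < R) hd2.1 (by linarith [hd2.2, h2s.2]) (by linarith : b < 2 * a) 4
    -- The factor `M + 1` dominates both the decay constant `M` and the coefficient one of the
    -- datum; the final `+ 1` only ensures positivity.
    refine ⟨M' * (M + 1) + 1, by positivity, fun f u hf hu => ?_⟩
    obtain ⟨hfm, hfN⟩ := hf
    obtain ⟨g, hgm, hae⟩ := hfm.aemeasurable
    have hgN : RunTumble.eNormXSq V₀ γ g ≠ ⊤ := by
      rw [← RunTumble.eNormXSq_congr_ae hae]
      exact hfN.ne
    have hut : ∀ t, 0 ≤ t → u t =ᵐ[RunTumble.phaseMeasure d V₀] _ := fun t ht =>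
      RunTumble.isTrajectory_ae_eq_mildSol hvol hχ hk (RunTumble.eNormXSq_controls hγ0) hNb
        hgm hgN (hu.congr_initial hae) ht
    have hN : (M + 1 : ℝ≥0) * RunTumble.eNormXSq V₀ γ g ≠ ⊤ :=
      ENNReal.mul_ne_top ENNReal.coe_ne_top hgN
    have hle : RunTumble.eNormXSq V₀ γ g ≤ (M + 1 : ℝ≥0) * RunTumble.eNormXSq V₀ γ g :=
      le_mul_of_one_le_left' (by push_cast; exact le_add_self)
    have key := hM' _ g _ hk hgm
      (ne_top_of_le_ne_top (RunTumble.eNormL1_ne_top_of_eNormXSq hgN)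
        (RunTumble.lintegral_enorm_le_eNormL1 hγ0 g))
      ((RunTumble.lintegral_enorm_sq_le_eNormXSq hγ0 g).trans hle) hN fun t ht =>
        (hM δ₁ hd1 δ₂ hd2 δ₃ hd3 g hgm hgN t ht).trans
          (mul_le_mul_left (by push_cast; exact le_self_add) _)
    calc _ = ∫⁻ t in Ioi (0 : ℝ), RunTumble.eNormYSq V₀ (2 * R)
          (RunTumble.opA χ V₀ φ ζ R δ₁ δ₂ δ₃ (RunTumble.mildSol χ V₀
            (RunTumble.kernelB χ V₀ φ ζ R δ₁ δ₂ δ₃) g t)) * RunTumble.expE (-2 * a * t) := by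
          refine setLIntegral_congr_fun measurableSet_Ioi fun t ht => ?_
          have h := RunTumble.gain_congr_ae (RunTumble.regularKernel χ V₀ φ ζ R δ₁ δ₂ δ₃)
            (hut t (le_of_lt ht))
          exact congrArg (fun r => r * RunTumble.expE (-2 * a * t)) (RunTumble.eNormYSq_congr_ae h)
      _ ≤ _ := key
      _ ≤ ENNReal.ofReal (M' * (M + 1) + 1) * RunTumble.eNormXSq V₀ γ f := by
          rw [RunTumble.eNormXSq_congr_ae hae, ← mul_assoc, ← ENNReal.coe_mul]
          refine mul_le_mul_left ?_ _
          rw [← ENNReal.ofReal_coe_nnreal]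
          refine ENNReal.ofReal_le_ofReal ?_
          push_cast
          linarith
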